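/- Let $R$ be a complete discrete valuation ring with uniformizer $\pi$, fraction field $K$ and algebraically closed residue field $k$ of characteristic $p\ge 0$. Let $\mathcal X\to S=\mathrm{Spec}(R)$ be an SNC-model of a smooth, proper, geometrically connected curve over $K$: $\mathcal X$ is a regular integral scheme, proper and flat over $S$, with that curve as generic fiber, such that the irreducible components of the special fiber $\mathcal X_k$ are smooth and $(\mathcal X_k)_{\mathrm{red}}$ is a strict normal crossings divisor. Let $n\ge 1$ be an integer not divisible by $p$, let $K'=K[\pi']/(\pi'^n-\pi)$, let $R'$ be the integral closure of $R$ in $K'$, $S'=\mathrm{Spec}(R')$, let $\mathcal X'$ be the normalization of $\mathcal X\times_S S'$, and let $f:\mathcal X'\to\mathcal X$ be the induced morphism. Let $x\in\mathcal X_k$ be a closed point and $x'\in\mathcal X'$ a point with $f(x')=x$. Completions are taken with respect to the maximal ideals, and isomorphisms are isomorphisms of $R$-algebras, respectively $R'$-algebras. (1) If two distinct irreducible components of $\mathcal X_k$ of multiplicities $a$ and $b$, not both divisible by $p$, meet at $x$, then $a,b\geq 1$ and $\widehat{\mathcal O}_{\mathcal X,x}\cong R[[u,v]]/(\pi-u^av^b)$.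 (2) If $\widehat{\mathcal O}_{\mathcal X,x}\cong R[[u,v]]/(\pi-u^av^b)$ with $a,b\ge 1$, put $$a''=\frac{a}{\gcd(a,n)},\qquad b''=\frac{b}{\gcd(b,n)},\qquad n''=\frac{n\cdot\gcd(a,b,n)}{\gcd(a,n)\cdot\gcd(b,n)}.$$ Then there is an integer $r$, prime to $n''$, with $rb''+a''\equiv 0 \pmod{n''}$, and for every integer $r\ge 0$ satisfying this congruence $$\widehat{\mathcal O}_{\mathcal X',x'}\cong\bigl\{R'[[z,w]]/(\pi'-z^{a''}w^{b''})\bigr\}^{\boldsymbol\mu_{n''}},$$ where $\xi\in\boldsymbol\mu_{n''}$ acts by $[\xi](z)=\xi z$ and $[\xi](w)=\xi^r w$. If $n''>1$, then $x'$ is a tame cyclic quotient singularity of $\mathcal X'$; that is, there are an integer $m>1$ not divisible by $p$, a unit $r\in(\mathbb Z/m)^*$, integers $m_1>0$, $m_2\ge 0$ with $m_1\equiv -rm_2\pmod m$ and a uniformizer $\varpi$ of $R'$ such that $\widehat{\mathcal O}_{\mathcal X',x'}$ is isomorphic to the algebra of $\boldsymbol\mu_m$-invariants of $R'[[t_1,t_2]]/(t_1^{m_1}t_2^{m_2}-\varpi)$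 for the action $[\xi](t_1)=\xi t_1$, $[\xi](t_2)=\xi^r t_2$. If $n''=1$, then $\mathcal X'$ is regular at $x'$. (3) If $x$ lies on exactly one irreducible component of $\mathcal X_k$, of multiplicity $b$, then $b\geq 1$ and $\widehat{\mathcal O}_{\mathcal X,x}\cong R[[u,v]]/(\pi-c_0v^b)$ for some unit $c_0\in R[[u,v]]$. (4) If $\widehat{\mathcal O}_{\mathcal X,x}\cong R[[u,v]]/(\pi-c_0v^b)$ with $b\ge 1$ and a unit $c_0\in R[[u,v]]$, put $b'=b/\gcd(b,n)$ and $n'=n/\gcd(b,n)$. Then there is a unit $c\in R[[u,v]]$ with $c^n=c_0$ such that the ring $R'[[s,t]]/(\pi'-c(s,t^{n'})\,t^{b'})$ is regular and $$\widehat{\mathcal O}_{\mathcal X',x'}\cong R'[[s,t]]/(\pi'-c(s,t^{n'})\,t^{b'}).$$ -/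

import Mathlib

open CategoryTheory CategoryTheory.Limits AlgebraicGeometry IsLocalRing

universe u

noncomputable section

namespace TameBaseChange

/-! ### The tamely ramified extension `R'/R` -/

section Extension

variable (R : Type u) [CommRing R] (π : R) (n : ℕ)

/-- `K' = K[π'] / (π' ^ n - π)`, where `K` is the fraction field of `R`. -/
abbrev TameField : Type u :=
  AdjoinRoot (Polynomial.X ^ n - Polynomial.C (algebraMap R (FractionRing R) π) :
    Polynomial (FractionRing R))

/-- `R'`, the integral closure of `R` in `K'`. -/
abbrev TameRing : Type u := integralClosure R (TameField R π n)

theorem isIntegral_root [NeZero n] :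
    IsIntegral R (AdjoinRoot.root
      (Polynomial.X ^ n - Polynomial.C (algebraMap R (FractionRing R) π) :
        Polynomial (FractionRing R))) := by
  refine IsIntegral.of_pow (Nat.pos_of_ne_zero (NeZero.ne n)) ?_
  have h := AdjoinRoot.eval₂_root
    (Polynomial.X ^ n - Polynomial.C (algebraMap R (FractionRing R) π) :
        Polynomial (FractionRing R))
  simp only [Polynomial.eval₂_sub, Polynomial.eval₂_X_pow, Polynomial.eval₂_C, sub_eq_zero] at h
  rw [h]
  exact (isIntegral_algebraMap (R := R) (A := FractionRing R) (x := π)).map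
    (IsScalarTower.toAlgHom R (FractionRing R) (TameField R π n))

/-- The element `π'` of `R'`, with `π' ^ n = π`. -/
def tameRoot [NeZero n] : TameRing R π n :=
  ⟨AdjoinRoot.root _, isIntegral_root R π n⟩

end Extension

/-! ### Power series in two variables and the action of roots of unity -/

section PowerSeries

variable {A : Type u} [CommRing A]

/-- `A[[z,w]] / (F)`; the variables are `z = X 0` and `w = X 1`. -/
abbrev PowerSeriesQuotient (F : MvPowerSeries (Fin 2) A) : Type u :=
  MvPowerSeries (Fin 2) A ⧸ Ideal.span {F}

/-- The power series `ϖ - z ^ a * w ^ b`. -/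
def crossing (ϖ : A) (a b : ℕ) : MvPowerSeries (Fin 2) A :=
  MvPowerSeries.C ϖ - MvPowerSeries.X 0 ^ a * MvPowerSeries.X 1 ^ b

/-- The power series `ϖ - c * w ^ b`. -/
def oneBranch (ϖ : A) (c : MvPowerSeries (Fin 2) A) (b : ℕ) : MvPowerSeries (Fin 2) A :=
  MvPowerSeries.C ϖ - c * MvPowerSeries.X 1 ^ b

theorem rescale_X (c : Fin 2 → A) (i : Fin 2) :
    MvPowerSeries.rescale c (MvPowerSeries.X i) =
      MvPowerSeries.C (c i) * MvPowerSeries.X i := by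
  classical
  ext m
  simp only [MvPowerSeries.coeff_rescale, MvPowerSeries.coeff_C_mul, MvPowerSeries.coeff_X]
  split_ifs with h
  · subst h
    simp
  · simp

theorem rescale_C (c : Fin 2 → A) (x : A) :
    MvPowerSeries.rescale c (MvPowerSeries.C x) = MvPowerSeries.C x := by
  classical
  ext m
  simp only [MvPowerSeries.coeff_rescale, MvPowerSeries.coeff_C]
  split_ifs with h
  · subst h
    simp
  · simp

theorem rescale_crossing (ϖ : A) {a b m r : ℕ} (h : m ∣ r * b + a) (ξ : rootsOfUnity m A) :
    MvPowerSeries.rescale ![((ξ : Aˣ) : A), ((ξ : Aˣ) : A) ^ r] (crossing ϖ a b) =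
      crossing ϖ a b := by
  have hξ : ((ξ : Aˣ) : A) ^ (r * b + a) = 1 := by
    obtain ⟨k, hk⟩ := h
    have h1 : ((ξ : Aˣ) : A) ^ m = 1 := by
      have := (mem_rootsOfUnity m (ξ : Aˣ)).1 ξ.2
      rw [← Units.val_pow_eq_pow_val, this, Units.val_one]
    rw [hk, pow_mul, h1, one_pow]
  simp only [crossing, map_sub, map_mul, map_pow, rescale_X, rescale_C, mul_pow]
  have h2 : (MvPowerSeries.C ((ξ : Aˣ) : A) : MvPowerSeries (Fin 2) A) ^ (r * b + a) = 1 := by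
    rw [← map_pow, hξ, map_one]
  congr 1
  simp only [Matrix.cons_val_zero, Matrix.cons_val_one, map_pow]
  calc _ = (MvPowerSeries.C ((ξ : Aˣ) : A) : MvPowerSeries (Fin 2) A) ^ (r * b + a) *
        (MvPowerSeries.X 0 ^ a * MvPowerSeries.X 1 ^ b) := by ring
    _ = _ := by rw [h2, one_mul]

/-- The automorphism `[ξ]` of `A[[z,w]] / (ϖ - z ^ a * w ^ b)` given by `z ↦ ξ z`, `w ↦ ξ ^ r w`,
for an `m`-th root of unity `ξ`; it is well defined because `m` divides `r * b + a`. -/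
def rootAction (ϖ : A) {a b m r : ℕ} (h : m ∣ r * b + a) (ξ : rootsOfUnity m A) :
    PowerSeriesQuotient (crossing ϖ a b) →ₐ[A] PowerSeriesQuotient (crossing ϖ a b) :=
  Ideal.quotientMapₐ _
    (MvPowerSeries.rescaleAlgHom ![((ξ : Aˣ) : A), ((ξ : Aˣ) : A) ^ r]) (by
      rw [Ideal.span_singleton_le_iff_mem, Ideal.mem_comap]
      change MvPowerSeries.rescaleAlgHom _ (crossing ϖ a b) ∈ _
      rw [MvPowerSeries.rescaleAlgHom_apply, rescale_crossing ϖ h ξ]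
      exact Ideal.mem_span_singleton_self _)

/-- The subalgebra of `μ_m`-invariants in `A[[z,w]] / (ϖ - z ^ a * w ^ b)`, for the action
`[ξ](z) = ξ z`, `[ξ](w) = ξ ^ r w`. -/
def rootInvariants (ϖ : A) {a b m r : ℕ} (h : m ∣ r * b + a) :
    Subalgebra A (PowerSeriesQuotient (crossing ϖ a b)) :=
  ⨅ ξ : rootsOfUnity m A, AlgHom.equalizer (rootAction ϖ h ξ) (AlgHom.id A _)

end PowerSeries

/-! ### Local rings of schemes over an affine base -/

section Stalks

variable {D : Type u} [CommRing D] {Y : Scheme.{u}} (g : Y ⟶ Spec (CommRingCat.of D))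

/-- The structure map `D → 𝒪_{Y,y}` of a `D`-scheme `g : Y ⟶ Spec D`. -/
def toStalk (y : Y) : D →+* Y.presheaf.stalk y :=
  ((Scheme.ΓSpecIso (CommRingCat.of D)).inv ≫ g.appTop ≫ Y.presheaf.germ ⊤ y trivial).hom

set_option linter.unusedVariables false in
/-- The completion of `𝒪_{Y,y}` with respect to its maximal ideal (it depends on `g` only through
its `D`-algebra structure). -/
def CompletedStalk (g : Y ⟶ Spec (CommRingCat.of D)) (y : Y) : Type u :=
  AdicCompletion (maximalIdeal (Y.presheaf.stalk y)) (Y.presheaf.stalk y)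

instance (y : Y) : CommRing (CompletedStalk g y) :=
  inferInstanceAs (CommRing (AdicCompletion (maximalIdeal (Y.presheaf.stalk y))
    (Y.presheaf.stalk y)))

instance (y : Y) : Algebra D (CompletedStalk g y) :=
  ((algebraMap (Y.presheaf.stalk y) (AdicCompletion (maximalIdeal (Y.presheaf.stalk y))
    (Y.presheaf.stalk y))).comp (toStalk g y)).toAlgebra

/-- `y` is a tame cyclic quotient singularity of the `D`-scheme `Y`, where `D` is a complete
discrete valuation ring with algebraically closed residue field. That `m` is not divisible by the
residue characteristic is expressed by `m` being a unit of `D`; reduction identifies the `m`-th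
roots of unity of `D` with those of the residue field. -/
def IsTameCyclicQuotientSingularity (y : Y) : Prop :=
  ∃ (m r m₁ m₂ : ℕ) (ϖ : D) (h : m ∣ r * m₂ + m₁),
    1 < m ∧ IsUnit (m : D) ∧ r.Coprime m ∧ 0 < m₁ ∧ Irreducible ϖ ∧
      Nonempty (CompletedStalk g y ≃ₐ[D] rootInvariants ϖ h)

end Stalks

/-! ### Strict normal crossings models and normalization -/

section Models

variable {R : Type u} [CommRing R] [IsDomain R] [IsDiscreteValuationRing R]
  {X : Scheme.{u}} (f : X ⟶ Spec (CommRingCat.of R))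

/-- The ideal of the special fiber in the local ring `𝒪_{X,x}`. -/
def specialIdeal (x : X) : Ideal (X.presheaf.stalk x) := (maximalIdeal R).map (toStalk f x)

/-- The generic fiber `X_K ⟶ Spec K`. -/
abbrev genericFiberHom :
    pullback f (Spec.map (CommRingCat.ofHom (algebraMap R (FractionRing R)))) ⟶
      Spec (CommRingCat.of (FractionRing R)) :=
  pullback.snd _ _

/-- `f : X ⟶ Spec R` is an SNC-model of its generic fiber: `X` is a regular integral scheme,
proper and flat over `R`, whose generic fiber is a smooth and geometrically connected curve, the
irreducible components of the special fiber are smooth, and the reduced special fiber is a strict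
normal crossings divisor. -/
structure IsSNCModel : Prop where
  isIntegral : IsIntegral X
  isProper : IsProper f
  flat : Flat f
  smooth_genericFiber : SmoothOfRelativeDimension 1 (genericFiberHom f)
  geometricallyConnected_genericFiber : GeometricallyConnected (genericFiberHom f)
  regular : ∀ x : X, IsRegularLocalRing (X.presheaf.stalk x)
  /-- The minimal primes `P` of the special fiber in `𝒪_{X,x}` correspond to the irreducible
  components of the special fiber through `x`, and `𝒪_{X,x} / P` is the local ring at `x` of such a
  component with its reduced structure. Over an algebraically closed field, regular components are
  the same as smooth components. -/
  regular_components : ∀ x : X, f x = closedPoint R →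
    ∀ P ∈ (specialIdeal f x).minimalPrimes, IsRegularLocalRing (X.presheaf.stalk x ⧸ P)
  /-- At every point `x` of the special fiber there is a regular system of parameters `t` of
  `𝒪_{X,x}` such that the ideal of the reduced special fiber is generated by a product of distinct
  members of `t`. -/
  normal_crossings : ∀ x : X, f x = closedPoint R →
    ∃ (d : ℕ) (t : Fin d → X.presheaf.stalk x) (s : Finset (Fin d)),
      ringKrullDim (X.presheaf.stalk x) = d ∧
      Ideal.span (Set.range t) = maximalIdeal (X.presheaf.stalk x) ∧
      (specialIdeal f x).radical = Ideal.span {∏ i ∈ s, t i}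

/-- `ξ` is the generic point of an irreducible component of the special fiber. The component
passes through `x` if and only if `ξ ⤳ x`. -/
def IsComponentPoint (ξ : X) : Prop :=
  f ξ = closedPoint R ∧ ∀ η : X, η ⤳ ξ → f η = closedPoint R → η = ξ

/-- The multiplicity in the special fiber of the component with generic point `ξ`, i.e. the length
of the local ring of the special fiber at `ξ`. -/
def multiplicity (ξ : X) : ℕ∞ :=
  Module.length (X.presheaf.stalk ξ) (X.presheaf.stalk ξ ⧸ specialIdeal f ξ)

/-- Two distinct irreducible components of the special fiber, of multiplicities `a` and `b`,
meet at `x`. -/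
def IsCrossingPoint (x : X) (a b : ℕ) : Prop :=
  ∃ ξ₁ ξ₂ : X, ξ₁ ≠ ξ₂ ∧ IsComponentPoint f ξ₁ ∧ IsComponentPoint f ξ₂ ∧ ξ₁ ⤳ x ∧ ξ₂ ⤳ x ∧
    multiplicity f ξ₁ = a ∧ multiplicity f ξ₂ = b

/-- Exactly one irreducible component of the special fiber passes through `x`, and it has
multiplicity `b`. -/
def IsOneBranchPoint (x : X) (b : ℕ) : Prop :=
  ∃ ξ : X, IsComponentPoint f ξ ∧ ξ ⤳ x ∧ multiplicity f ξ = b ∧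
    ∀ η : X, IsComponentPoint f η → η ⤳ x → η = ξ

/-- `ν : Y ⟶ Z` is the normalization of the integral scheme `Z`: the scheme `Y` is integral and
normal, and `ν` is an integral and birational morphism. -/
structure IsNormalization {Y Z : Scheme.{u}} (ν : Y ⟶ Z) : Prop where
  isIntegral : IsIntegral Y
  normal : ∀ y : Y, IsIntegrallyClosed (Y.presheaf.stalk y)
  isIntegralHom : IsIntegralHom ν
  birational : ∃ U : Z.Opens, Dense (U : Set Z) ∧ IsIso (ν ∣_ U)

/-- The base change `X_{S'} = X ×_S S'`, for `S' = Spec R'`. -/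
abbrev baseChange (π : R) (n : ℕ) : Scheme.{u} :=
  pullback f (Spec.map (CommRingCat.ofHom (algebraMap R (TameRing R π n))))

end Models

end TameBaseChange

end

/-! Write A for the local ring of X at x and O for that of X' at x'. At a normal crossings point, A
is regular of dimension two with parameters t₁, t₂ such that π = c t₁^a t₂^b for a unit c.

Structure of X. The smooth generic fibre gives A transcendence degree one over R, and a height
inequality bounds dim A by two. If the dimension were smaller, the maximal ideal of A would be
principal and A would be finite over the complete ring R, contradicting the transcendence degree
(`ringKrullDim_eq_two_of_trdeg_eq_one`). The residue field of A is that of R, so evaluating power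
series at the parameters maps R[[u,v]] onto the completion of A. The map kills π - c₀ u^a v^b; the
quotient by this series is already a domain of dimension two, so nothing else is killed
(`exists_completion_equiv_branchRing`). If a or b is invertible, the unit c is absorbed into a
parameter by a root taken in the completion. The components through x are the primes t₁, t₂ that
occur in π, and their multiplicities are the exponents.

Structure of X'. Put a' = a/gcd(a,n), n₁ = n/gcd(a,n), b' = b/gcd(b,n), n₂ = n/gcd(b,n), d =
gcd(n₁,n₂) = n'' and N = lcm(n₁,n₂). For c with c^n = c₀ let c' = c(z^n₁, w^n₂) and E =
R'[[z,w]]/(π' - c' z^a' w^b'). The substitution u = z^n₁, v = w^n₂ maps the completion of A to E,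
because the n-th power of the equation of E is the equation of A. As n is invertible and R contains
the n-th roots of unity, the elements of O integral over A are combinations of e_i = π'^i /
(t₁^⌊ia/n⌋ t₂^⌊ib/n⌋) for i < n (`exists_eq_sum_of_isIntegral`). These explicit generators replace
any general finiteness theorem for normalizations.

The map A → E extends to O with π' ↦ π', and e_i goes to a unit times z^(i a' mod n₁) w^(i b' mod
n₂) (`exists_extension`). By the Chinese remainder theorem, as i runs modulo N, these exponents are
exactly the pairs (i, j) in the box [0,n₁) × [0,n₂) with d ∣ i + r j. So the image lies in the part
D of E of degree zero modulo d, where z has weight 1 and w weight r. The element e_N is a unit; its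
residue depends on x' and has to match a residue prescribed for c, and this is where the choice of
n-th root c enters.

Modulo (t₁, t₂), the map O → D is surjective by `exists_sub_extension_mem` and injective by
`mem_span_of_extension_mem`. Since D is a D-linear retract of E, it is complete and t₁, t₂ is a
regular pair in it; quasi-regularity then passes from the first power of (t₁, t₂) to all powers, and
D is the completion of O (`exists_completion_equiv_of_retract`). Averaging over the d-th roots of
unity identifies D with the ring of invariants at a crossing. At a point on one branch, a' = 0 and
n₁ = 1, so d = 1 and D = E.

Finally, O is a localization of the normalization of A[T]/(T^n - π), and T^n - π is irreducible over
the fraction field of A because the integral scheme X' maps onto the base change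
(`irreducible_of_irreducible_baseChange`). -/

namespace TameBaseChange

/-! ### Regular pairs and quasi-regularity -/

section RegularPairs

/-- In a domain this says that `s, t` is a regular sequence, in a form symmetric in `s` and `t`. -/
def RegPair {D : Type*} [CommRing D] (s t : D) : Prop :=
  ∀ x y, s * x = t * y → ∃ z, x = t * z ∧ y = s * z

variable {D : Type*} [CommRing D]

theorem RegPair.symm {s t : D} (h : RegPair s t) : RegPair t s := fun x y e =>
  let ⟨z, h1, h2⟩ := h y x e.symm
  ⟨z, h2, h1⟩

theorem RegPair.pow_right {s t : D} (h : RegPair s t) (m : ℕ) : RegPair s (t ^ m) := by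
  induction m with
  | zero => intro x y e; exact ⟨x, by simp, by simpa using e.symm⟩
  | succ m ih =>
    intro x y e
    obtain ⟨z, h1, h2⟩ := h x (t ^ m * y) (by rw [e]; ring)
    obtain ⟨w, h3, h4⟩ := ih z y h2.symm
    exact ⟨w, by rw [h1, h3]; ring, h4⟩

theorem RegPair.pow {s t : D} (h : RegPair s t) (l m : ℕ) : RegPair (s ^ l) (t ^ m) :=
  (h.pow_right m).symm.pow_right l |>.symm

theorem RegPair.unit_mul_right {s t g : D} (h : RegPair s t) (hg : IsUnit g) :
    RegPair s (g * t) := by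
  obtain ⟨g, rfl⟩ := hg
  intro x y e
  obtain ⟨z, h1, h2⟩ := h x (g * y) (by rw [e]; ring)
  refine ⟨(↑g⁻¹ : D) * z, ?_, ?_⟩
  · rw [h1]
    calc t * z = ((↑g : D) * ↑g⁻¹) * (t * z) := by simp
      _ = _ := by ring
  · calc y = ((↑g⁻¹ : D) * ↑g) * y := by simp
      _ = ↑g⁻¹ * (↑g * y) := by ring
      _ = _ := by rw [h2]; ring

theorem RegPair.add_mul_left {s t : D} (h : RegPair s t) (r : D) : RegPair (s + r * t) t := by
  intro x y e
  obtain ⟨z, h1, h2⟩ := h x (y - r * x) (by linear_combination e)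
  exact ⟨z, h1, by rw [← sub_add_cancel y (r * x), h2, h1]; ring⟩

/-- The only monomial of degree k + 1 in s and t without a factor s is t ^ (k + 1). This asymmetric
splitting lets inductions on the power of the ideal use one lower power and one explicit term. -/
theorem mem_span_pair_pow_succ {s t : D} {k : ℕ} {x : D} :
    x ∈ Ideal.span {s, t} ^ (k + 1) ↔
      ∃ y ∈ Ideal.span {s, t} ^ k, ∃ z, x = s * y + t ^ (k + 1) * z := by
  have hs : s ∈ Ideal.span {s, t} := Ideal.subset_span (by simp)
  have ht : t ∈ Ideal.span {s, t} := Ideal.subset_span (by simp)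
  constructor
  · induction k generalizing x with
    | zero =>
      intro h
      rw [zero_add, pow_one, Ideal.mem_span_pair] at h
      obtain ⟨a, b, rfl⟩ := h
      exact ⟨a, by simp, b, by ring⟩
    | succ k ih =>
      intro h
      rw [pow_succ'] at h
      refine Submodule.mul_induction_on h ?_ ?_
      · intro m hm y hy
        obtain ⟨a, b, rfl⟩ := Ideal.mem_span_pair.1 hm
        obtain ⟨y', hy', z, hyz⟩ := ih hy
        refine ⟨a * y + b * (t * y'), ?_, b * z, ?_⟩
        · refine add_mem (Ideal.mul_mem_left _ _ hy) (Ideal.mul_mem_left _ _ ?_)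
          rw [pow_succ']
          exact Ideal.mul_mem_mul ht hy'
        · linear_combination b * t * hyz
      · rintro x y ⟨y1, h1, z1, e1⟩ ⟨y2, h2, z2, e2⟩
        exact ⟨y1 + y2, add_mem h1 h2, z1 + z2, by rw [e1, e2]; ring⟩
  · rintro ⟨y, hy, z, rfl⟩
    refine add_mem ?_ (Ideal.mul_mem_right _ _ (Ideal.pow_mem_pow ht _))
    rw [pow_succ']
    exact Ideal.mul_mem_mul hs hy

/-- Quasi-regularity of a regular pair `s', t'` of `D`, transported to a ring `O` which maps to a
ring `E` in which `D` is dense. -/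
theorem mem_span_pow_of_map_mem {O E : Type*} [CommRing O] [CommRing E] (φ : O →+* E)
    (ι : D →+* E) {s t : O} {s' t' : D} (hs : φ s = ι s') (ht : φ t = ι t') (hreg : RegPair s' t')
    (hdense : ∀ (k : ℕ) (e : E), ∃ d, e - ι d ∈ Ideal.span {ι s', ι t'} ^ k)
    (hcomap : ∀ (k : ℕ) (d : D), ι d ∈ Ideal.span {ι s', ι t'} ^ k → d ∈ Ideal.span {s', t'} ^ k)
    (h1 : ∀ o, φ o ∈ Ideal.span {ι s', ι t'} → o ∈ Ideal.span {s, t}) (k : ℕ) (o : O)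
    (ho : φ o ∈ Ideal.span {ι s', ι t'} ^ k) : o ∈ Ideal.span {s, t} ^ k := by
  set J := Ideal.span {ι s', ι t'} with hJ
  have hsJ : ι s' ∈ J := Ideal.subset_span (by simp)
  have htJ : ι t' ∈ J := Ideal.subset_span (by simp)
  have hmap : ∀ (k : ℕ) (d : D), d ∈ Ideal.span {s', t'} ^ k → ι d ∈ J ^ k := by
    intro k d hd
    have := Ideal.mem_map_of_mem ι hd
    rwa [Ideal.map_pow, Ideal.map_span, Set.image_pair] at this
  have step : ∀ (k : ℕ) (o : O), o ∈ Ideal.span {s, t} ^ k → φ o ∈ J ^ (k + 1) →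
      o ∈ Ideal.span {s, t} ^ (k + 1) := by
    intro k
    induction k with
    | zero => intro o _ h; simpa using h1 o (by simpa using h)
    | succ k ih =>
      intro o ho h
      obtain ⟨y, hy, z, rfl⟩ := mem_span_pair_pow_succ.1 ho
      obtain ⟨y', hy'⟩ := hdense (k + 1) (φ y)
      obtain ⟨z', hz'⟩ := hdense 1 (φ z)
      have hmem : ι (s' * y' + t' ^ (k + 1) * z') ∈ J ^ (k + 1 + 1) := by
        have e : ι (s' * y' + t' ^ (k + 1) * z') = φ (s * y + t ^ (k + 1) * z) -
            (ι s' * (φ y - ι y') + ι t' ^ (k + 1) * (φ z - ι z')) := by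
          simp only [map_add, map_mul, map_pow, hs, ht]; ring
        rw [e]
        refine sub_mem h (add_mem ?_ ?_)
        · rw [pow_succ']; exact Ideal.mul_mem_mul hsJ hy'
        · rw [pow_succ]
          exact Ideal.mul_mem_mul (Ideal.pow_mem_pow htJ _) (by simpa using hz')
      obtain ⟨j, hj, d, hd⟩ := mem_span_pair_pow_succ.1 (hcomap _ _ hmem)
      -- Two expansions of one element give s' (y' - j) = t' ^ (k + 1) (t' d - z'). Regularity makes
      -- y' - j a multiple of t' ^ (k + 1) and puts z' in the ideal, so y and z both gain one order.
      obtain ⟨e, he1, he2⟩ := hreg.pow_right (k + 1) (y' - j) (t' * d - z')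
        (by linear_combination hd)
      have htD : t' ∈ Ideal.span {s', t'} := Ideal.subset_span (by simp)
      have hsD : s' ∈ Ideal.span {s', t'} := Ideal.subset_span (by simp)
      have hyJ : φ y ∈ J ^ (k + 1) := by
        rw [← sub_add_cancel (φ y) (ι y')]
        refine add_mem hy' (hmap _ _ ?_)
        rw [← sub_add_cancel y' j, he1]
        exact add_mem (Ideal.mul_mem_right _ _ (Ideal.pow_mem_pow htD _)) hj
      have hzJ : φ z ∈ J := by
        rw [← sub_add_cancel (φ z) (ι z')]
        refine add_mem (by simpa using hz') ?_
        have : z' ∈ Ideal.span {s', t'} ^ 1 := by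
          rw [pow_one, show z' = t' * d - s' * e by rw [← he2]; ring]
          exact sub_mem (Ideal.mul_mem_right _ _ htD) (Ideal.mul_mem_right _ _ hsD)
        simpa using hmap 1 z' this
      refine add_mem ?_ ?_
      · rw [pow_succ']
        exact Ideal.mul_mem_mul (Ideal.subset_span (by simp)) (ih y hy hyJ)
      · rw [pow_succ]
        exact Ideal.mul_mem_mul (Ideal.pow_mem_pow (Ideal.subset_span (by simp)) _) (h1 z hzJ)
  have : ∀ l ≤ k, o ∈ Ideal.span {s, t} ^ l := by
    intro l
    induction l with
    | zero => simp
    | succ l ih => exact fun hl => step l o (ih (by omega)) (Ideal.pow_le_pow_right hl ho)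
  exact this k le_rfl

end RegularPairs

/-! ### Recognition of an adic completion -/

section CompletionCriterion

variable {O D : Type*} [CommRing O] [CommRing D]

/-- A ring homomorphism `φ : O → D` to a `J`-adically complete ring identifies `D` with the
`M`-adic completion of `O` as soon as it has dense image and the topologies match. -/
theorem exists_adicCompletion_equiv (M : Ideal O) (J : Ideal D) [IsAdicComplete J D] (φ : O →+* D)
    (l : ℕ) (hl : 0 < l) (h1 : M ^ l ≤ J.comap φ)
    (h2 : ∀ (k : ℕ) (o : O), φ o ∈ J ^ k → o ∈ M ^ k)
    (h3 : ∀ (k : ℕ) (d : D), ∃ o, d - φ o ∈ J ^ k) :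
    ∃ e : AdicCompletion M O ≃+* D, ∀ o, e (algebraMap O (AdicCompletion M O) o) = φ o := by
  have hle : ∀ k, M ^ (l * k) ≤ RingHom.ker ((Ideal.Quotient.mk (J ^ k)).comp φ) := by
    intro k x hx
    rw [RingHom.mem_ker, RingHom.comp_apply, Ideal.Quotient.eq_zero_iff_mem]
    rw [pow_mul] at hx
    have := Ideal.pow_right_mono h1 k hx
    exact Ideal.le_comap_pow φ k this
  -- Only M ^ l is known to land in J, so the component modulo J ^ k reads the argument modulo M ^
  -- (l * k).
  let f : ∀ k, AdicCompletion M O →+* D ⧸ J ^ k := fun k =>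
    (Ideal.Quotient.lift (M ^ (l * k)) ((Ideal.Quotient.mk (J ^ k)).comp φ)
      (fun a ha => hle k ha)).comp (AdicCompletion.evalₐ M (l * k)).toRingHom
  have hf : ∀ (k : ℕ) (a : AdicCompletion.AdicCauchySequence M O),
      f k (AdicCompletion.mk M O a) = Ideal.Quotient.mk (J ^ k) (φ (a (l * k))) := by
    intro k a
    simp only [f, RingHom.comp_apply, AlgHom.toRingHom_eq_coe, RingHom.coe_coe,
      AdicCompletion.evalₐ_mk]
    rfl
  have hcompat : ∀ {m n : ℕ} (h : m ≤ n), (Ideal.Quotient.factorPow J h).comp (f n) = f m := by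
    intro m n h
    ext x
    induction x using AdicCompletion.induction_on with
    | h a =>
      rw [RingHom.comp_apply, hf, hf]
      change Ideal.Quotient.mk (J ^ m) (φ (a (l * n))) = _
      rw [Ideal.Quotient.eq, ← map_sub]
      have : a (l * n) - a (l * m) ∈ M ^ (l * m) := by
        have := a.2 (Nat.mul_le_mul_left l h)
        rw [SModEq.comm, SModEq.sub_mem] at this
        simpa using this
      have h4 := hle m this
      rwa [RingHom.mem_ker, RingHom.comp_apply, Ideal.Quotient.eq_zero_iff_mem] at h4
  let F : AdicCompletion M O →+* D := IsAdicComplete.liftRingHom J f hcompat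
  have hF : ∀ k x, Ideal.Quotient.mk (J ^ k) (F x) = f k x := fun k x =>
    IsAdicComplete.mk_liftRingHom J f hcompat k x
  have hsep : ∀ x y : D, (∀ k, Ideal.Quotient.mk (J ^ k) x = Ideal.Quotient.mk (J ^ k) y) →
      x = y := by
    intro x y h
    refine (IsHausdorff.eq_iff_smodEq (I := J)).2 fun k => ?_
    rw [SModEq.sub_mem]
    simpa using Ideal.Quotient.eq.1 (h k)
  have hFo : ∀ o, F (algebraMap O _ o) = φ o := by
    intro o
    refine hsep _ _ fun k => ?_
    rw [hF]
    have : algebraMap O (AdicCompletion M O) o = AdicCompletion.of M O o := rfl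
    simp only [f, RingHom.comp_apply, AlgHom.toRingHom_eq_coe, RingHom.coe_coe, this,
      AdicCompletion.evalₐ_of]
    rfl
  have hinj : Function.Injective F := by
    rw [injective_iff_map_eq_zero]
    intro x hx
    induction x using AdicCompletion.induction_on with
    | h a =>
      -- The term controlled modulo J ^ n has index l * n, and `h2` then places it in M ^ n.
      refine AdicCompletion.mk_zero_of _ _ _ ⟨0, fun n _ => ⟨l * n, Nat.le_mul_of_pos_left n hl,
        n, le_rfl, ?_⟩⟩
      have := hF n (AdicCompletion.mk M O a)
      rw [hx, hf, map_zero] at this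
      simpa using h2 n _ (Ideal.Quotient.eq_zero_iff_mem.1 this.symm)
  have hsurj : Function.Surjective F := by
    intro d
    choose a ha using fun k => h3 k d
    have hc : ∀ k, a k ≡ a (k + 1) [SMOD (M ^ k • ⊤ : Submodule O O)] := by
      intro k
      rw [SModEq.sub_mem]
      have : a k - a (k + 1) ∈ M ^ k := by
        refine h2 k _ ?_
        have := sub_mem (Ideal.pow_le_pow_right (Nat.le_succ k) (ha (k + 1))) (ha k)
        simpa using this
      simpa using this
    refine ⟨AdicCompletion.mk M O (AdicCompletion.AdicCauchySequence.mk M O a hc), ?_⟩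
    refine hsep _ _ fun k => ?_
    rw [hF, hf]
    refine (Ideal.Quotient.eq.2 ?_).symm
    exact Ideal.pow_le_pow_right (Nat.le_mul_of_pos_left k hl) (ha (l * k))
  exact ⟨RingEquiv.ofBijective F ⟨hinj, hsurj⟩, hFo⟩

end CompletionCriterion


/-! ### Truncation and divisibility by a variable in power series -/

section Restrict

variable {S : Type*} [CommRing S]

open MvPowerSeries in
open Classical in
/-- The part of a power series supported on the monomials satisfying `P`. -/
noncomputable def restrictSupport (P : (Fin 2 →₀ ℕ) → Prop) :
    MvPowerSeries (Fin 2) S →ₗ[S] MvPowerSeries (Fin 2) S where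
  toFun f := fun m => if P m then coeff m f else 0
  map_add' f g := by
    ext m
    simp only [map_add]
    change ite _ _ _ = (ite _ _ _ : S) + ite _ _ _
    split_ifs <;> simp
  map_smul' r f := by
    ext m
    change ite _ _ _ = r * (ite _ _ _ : S)
    split_ifs <;> simp

open Classical in
theorem coeff_restrictSupport (P : (Fin 2 →₀ ℕ) → Prop) (f : MvPowerSeries (Fin 2) S)
    (m : Fin 2 →₀ ℕ) : MvPowerSeries.coeff m (restrictSupport P f) =
      if P m then MvPowerSeries.coeff m f else 0 := rfl

theorem exists_eq_X_pow_mul_add_restrictSupport (s : Fin 2) (N : ℕ)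
    (f : MvPowerSeries (Fin 2) S) :
    ∃ g, f = MvPowerSeries.X s ^ N * g + restrictSupport (fun m => m s < N) f := by
  have : MvPowerSeries.X s ^ N ∣ f - restrictSupport (fun m => m s < N) f := by
    rw [MvPowerSeries.X_pow_dvd_iff]
    intro m hm
    rw [map_sub, coeff_restrictSupport, if_pos hm, sub_self]
  obtain ⟨g, hg⟩ := this
  exact ⟨g, by rw [← hg]; ring⟩

theorem mem_span_X_iff (f : MvPowerSeries (Fin 2) S) :
    f ∈ Ideal.span {(MvPowerSeries.X 0 : MvPowerSeries (Fin 2) S), MvPowerSeries.X 1} ↔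
      MvPowerSeries.constantCoeff f = 0 := by
  constructor
  · intro h
    obtain ⟨a, b, rfl⟩ := Ideal.mem_span_pair.1 h
    simp
  · intro h
    obtain ⟨g, hg⟩ := exists_eq_X_pow_mul_add_restrictSupport 0 1 f
    have : MvPowerSeries.X 1 ∣ restrictSupport (fun m : Fin 2 →₀ ℕ => m 0 < 1) f := by
      rw [MvPowerSeries.X_dvd_iff]
      intro m hm
      rw [coeff_restrictSupport]
      split_ifs with h0
      · have : m = 0 := by
          ext i
          fin_cases i
          · simpa using h0
          · simpa using hm
        rw [this, MvPowerSeries.coeff_zero_eq_constantCoeff_apply, h]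
      · rfl
    obtain ⟨k, hk⟩ := this
    rw [hg, hk, pow_one]
    exact add_mem (Ideal.mul_mem_right _ _ (Ideal.subset_span (by simp)))
      (Ideal.mul_mem_right _ _ (Ideal.subset_span (by simp)))

theorem coeff_single_mul (f g : MvPowerSeries (Fin 2) S) (k : ℕ) :
    MvPowerSeries.coeff (Finsupp.single 0 k) (f * g) =
      ∑ p ∈ Finset.HasAntidiagonal.antidiagonal k, MvPowerSeries.coeff (Finsupp.single 0 p.1) f *
        MvPowerSeries.coeff (Finsupp.single 0 p.2) g := by
  classical
  rw [MvPowerSeries.coeff_mul, Finsupp.antidiagonal_single, Finset.sum_map]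
  rfl

theorem X_one_dvd_iff {f : MvPowerSeries (Fin 2) S} : MvPowerSeries.X 1 ∣ f ↔
    PowerSeries.mk (fun k => MvPowerSeries.coeff (Finsupp.single 0 k) f) = 0 := by
  rw [MvPowerSeries.X_dvd_iff]
  constructor
  · intro h
    ext k
    rw [PowerSeries.coeff_mk, h _ (by simp)]
    simp
  · intro h m hm
    have := congrArg (PowerSeries.coeff (m 0)) h
    rw [PowerSeries.coeff_mk] at this
    have h2 : m = Finsupp.single 0 (m 0) := by
      ext i
      fin_cases i
      · simp
      · simpa using hm
    rw [h2, this]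
    rfl

/-- Setting `X 1` to zero leaves power series in one variable over a domain, which have no zero
divisors. -/
theorem X_one_dvd_or_dvd [IsDomain S] {f g : MvPowerSeries (Fin 2) S}
    (h : MvPowerSeries.X 1 ∣ f * g) : MvPowerSeries.X 1 ∣ f ∨ MvPowerSeries.X 1 ∣ g := by
  rw [X_one_dvd_iff] at h ⊢
  rw [X_one_dvd_iff, ← mul_eq_zero, ← h]
  ext k
  rw [PowerSeries.coeff_mul, PowerSeries.coeff_mk, coeff_single_mul]
  simp

end Restrict

/-! ### A dimension bound and a regularity criterion in dimension two -/

section TwoDimensional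

variable {Q : Type*} [CommRing Q] [IsDomain Q] [IsLocalRing Q]

omit [IsLocalRing Q] in
theorem one_le_ringKrullDim_of_not_isUnit {z : Q} (h0 : z ≠ 0) (hz : ¬ IsUnit z) :
    1 ≤ ringKrullDim Q := by
  have h := ringKrullDim_quotient_succ_le_of_nonZeroDivisor (mem_nonZeroDivisors_of_ne_zero h0)
  have : Nontrivial (Q ⧸ Ideal.span {z}) := by
    rw [Ideal.Quotient.nontrivial_iff, Ne, Ideal.span_singleton_eq_top]
    exact hz
  exact le_trans (le_add_of_nonneg_left ringKrullDim_nonneg_of_nontrivial) h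

/-- The dimension drops on dividing by w, and in the domain Q / (w) the class of z is a nonzero
nonunit, which accounts for a second step. -/
theorem two_le_ringKrullDim_of_prime {z w : Q} (hz : ¬ IsUnit z) (hw : Prime w)
    (hwz : ¬ w ∣ z) : 2 ≤ ringKrullDim Q := by
  have h3 := ringKrullDim_quotient_succ_le_of_nonZeroDivisor
    (mem_nonZeroDivisors_of_ne_zero hw.ne_zero)
  have hP : (Ideal.span {w}).IsPrime := (Ideal.span_singleton_prime hw.ne_zero).2 hw
  have hloc : IsLocalRing (Q ⧸ Ideal.span {w}) :=
    IsLocalRing.of_surjective' (Ideal.Quotient.mk _) Ideal.Quotient.mk_surjective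
  have h4 : 1 ≤ ringKrullDim (Q ⧸ Ideal.span {w}) := by
    refine one_le_ringKrullDim_of_not_isUnit (z := Ideal.Quotient.mk _ z) ?_ ?_
    · rwa [Ne, Ideal.Quotient.eq_zero_iff_mem, Ideal.mem_span_singleton]
    · intro h
      have : IsLocalHom (Ideal.Quotient.mk (Ideal.span {w})) :=
        IsLocalHom.of_surjective _ Ideal.Quotient.mk_surjective
      exact hz (isUnit_of_map_unit _ _ h)
  calc (2 : WithBot ℕ∞) = 1 + 1 := by norm_num
    _ ≤ _ := (add_le_add_left h4 1).trans h3

theorem isRegularLocalRing_of_prime [IsNoetherianRing Q] {z w : Q}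
    (hm : maximalIdeal Q = Ideal.span {z, w}) (hw : Prime w) (hwz : ¬ w ∣ z) :
    IsRegularLocalRing Q := by
  refine IsRegularLocalRing.of_spanFinrank_maximalIdeal_le Q ?_
  have h1 : (maximalIdeal Q).spanFinrank ≤ 2 := by
    rw [hm]
    refine (Submodule.spanFinrank_span_le_ncard_of_finite (by simp)).trans ?_
    exact (Set.ncard_insert_le _ _).trans (by simp)
  have hz : ¬ IsUnit z := by
    rw [← mem_nonunits_iff, ← mem_maximalIdeal, hm]
    exact Ideal.subset_span (by simp)
  exact le_trans (by exact_mod_cast h1) (two_le_ringKrullDim_of_prime hz hw hwz)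

end TwoDimensional

/-! ### The rings A[[z,w]] / (ϖ - c z^a w^b), covering crossings (c = 1) and single branches (a = 0)
-/

section Branch

/-- The power series `ϖ - c * z ^ a * w ^ b`. -/
noncomputable def branch {S : Type u} [CommRing S] (ϖ : S) (c : MvPowerSeries (Fin 2) S)
    (a b : ℕ) : MvPowerSeries (Fin 2) S :=
  MvPowerSeries.C ϖ - c * (MvPowerSeries.X 0 ^ a * MvPowerSeries.X 1 ^ b)

theorem crossing_eq_branch {S : Type u} [CommRing S] (ϖ : S) (a b : ℕ) :
    crossing ϖ a b = branch ϖ 1 a b := by simp [crossing, branch]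

theorem oneBranch_eq_branch {S : Type u} [CommRing S] (ϖ : S) (c : MvPowerSeries (Fin 2) S)
    (b : ℕ) : oneBranch ϖ c b = branch ϖ c 0 b := by simp [oneBranch, branch]

variable {S : Type u} [CommRing S] (ϖ : S) (c : MvPowerSeries (Fin 2) S) (a b : ℕ)

/-- `A[[z,w]] / (ϖ - c * z ^ a * w ^ b)`. -/
abbrev BranchRing : Type u := PowerSeriesQuotient (branch ϖ c a b)

/-- The quotient map. -/
noncomputable abbrev BranchRing.mk : MvPowerSeries (Fin 2) S →ₐ[S] BranchRing ϖ c a b :=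
  Ideal.Quotient.mkₐ S _

theorem BranchRing.mk_surjective : Function.Surjective (BranchRing.mk ϖ c a b) :=
  Ideal.Quotient.mkₐ_surjective _ _

theorem BranchRing.mk_eq_zero_iff {f : MvPowerSeries (Fin 2) S} :
    BranchRing.mk ϖ c a b f = 0 ↔ ∃ g, f = branch ϖ c a b * g := by
  rw [Ideal.Quotient.mkₐ_eq_mk, Ideal.Quotient.eq_zero_iff_mem, Ideal.mem_span_singleton]
  rfl

/-- The class of the first variable. -/
noncomputable abbrev BranchRing.z : BranchRing ϖ c a b := BranchRing.mk ϖ c a b (.X 0)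

/-- The class of the second variable. -/
noncomputable abbrev BranchRing.w : BranchRing ϖ c a b := BranchRing.mk ϖ c a b (.X 1)

theorem BranchRing.algebraMap_eq : algebraMap S (BranchRing ϖ c a b) ϖ =
    BranchRing.mk ϖ c a b c * (BranchRing.z ϖ c a b ^ a * BranchRing.w ϖ c a b ^ b) := by
  have h : BranchRing.mk ϖ c a b (branch ϖ c a b) = 0 :=
    (BranchRing.mk_eq_zero_iff ϖ c a b).2 ⟨1, by simp⟩
  have h2 : BranchRing.mk ϖ c a b (.C ϖ) = algebraMap S (BranchRing ϖ c a b) ϖ :=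
    (BranchRing.mk ϖ c a b).commutes ϖ
  have h3 : BranchRing.mk ϖ c a b (.C ϖ - c * (.X 0 ^ a * .X 1 ^ b)) = 0 := h
  rw [map_sub, sub_eq_zero, h2] at h3
  rw [h3]
  simp only [map_mul, map_pow]

variable {ϖ c a b}

section Local

variable [IsLocalRing S] (hϖ : maximalIdeal S = Ideal.span {ϖ}) (hb : 0 < b)

include hϖ in
theorem not_isUnit_uniformizer : ¬ IsUnit ϖ := by
  rw [← mem_nonunits_iff, ← mem_maximalIdeal, hϖ]
  exact Ideal.mem_span_singleton_self _

omit [IsLocalRing S] in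
theorem constantCoeff_branch (hb : 0 < b) :
    MvPowerSeries.constantCoeff (branch ϖ c a b) = ϖ := by
  simp [branch, zero_pow hb.ne']

include hϖ hb

theorem BranchRing.nontrivial : Nontrivial (BranchRing ϖ c a b) := by
  refine Ideal.Quotient.nontrivial_iff.2 ?_
  rw [Ne, Ideal.span_singleton_eq_top, MvPowerSeries.isUnit_iff_constantCoeff,
    constantCoeff_branch hb]
  exact not_isUnit_uniformizer hϖ

theorem BranchRing.isLocalRing : IsLocalRing (BranchRing ϖ c a b) := by
  have := BranchRing.nontrivial (c := c) (a := a) hϖ hb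
  exact IsLocalRing.of_surjective' (BranchRing.mk ϖ c a b).toRingHom
    (BranchRing.mk_surjective ϖ c a b)

theorem BranchRing.isUnit_mk_iff {f : MvPowerSeries (Fin 2) S} :
    IsUnit (BranchRing.mk ϖ c a b f) ↔ IsUnit (MvPowerSeries.constantCoeff f) := by
  constructor
  · intro h
    obtain ⟨y, hy⟩ := h.exists_right_inv
    obtain ⟨g, rfl⟩ := BranchRing.mk_surjective ϖ c a b y
    rw [← map_mul, ← map_one (BranchRing.mk ϖ c a b), ← sub_eq_zero, ← map_sub,
      BranchRing.mk_eq_zero_iff] at hy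
    obtain ⟨k, hk⟩ := hy
    have h1 := congrArg MvPowerSeries.constantCoeff hk
    simp only [map_sub, map_mul, map_one, constantCoeff_branch hb] at h1
    by_contra h2
    have h3 : (1 : S) ∈ maximalIdeal S := by
      rw [show (1 : S) = MvPowerSeries.constantCoeff f * MvPowerSeries.constantCoeff g -
        ϖ * MvPowerSeries.constantCoeff k by rw [← h1]; ring]
      refine sub_mem (Ideal.mul_mem_right _ _ h2) (Ideal.mul_mem_right _ _ ?_)
      rw [hϖ]
      exact Ideal.mem_span_singleton_self _
    exact h3 isUnit_one
  · intro h
    exact (MvPowerSeries.isUnit_iff_constantCoeff.2 h).map _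

theorem BranchRing.mk_mem_span_iff {f : MvPowerSeries (Fin 2) S} :
    BranchRing.mk ϖ c a b f ∈ Ideal.span {BranchRing.z ϖ c a b, BranchRing.w ϖ c a b} ↔
      ¬ IsUnit (MvPowerSeries.constantCoeff f) := by
  constructor
  · intro h hu
    obtain ⟨x, y, hxy⟩ := Ideal.mem_span_pair.1 h
    obtain ⟨x, rfl⟩ := BranchRing.mk_surjective ϖ c a b x
    obtain ⟨y, rfl⟩ := BranchRing.mk_surjective ϖ c a b y
    have h1 := (BranchRing.isUnit_mk_iff (c := c) (a := a) hϖ hb).2 hu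
    rw [← hxy, ← map_mul, ← map_mul, ← map_add, BranchRing.isUnit_mk_iff hϖ hb] at h1
    simp at h1
  · intro h
    have h0 : MvPowerSeries.constantCoeff f ∈ maximalIdeal S := h
    rw [hϖ, Ideal.mem_span_singleton] at h0
    obtain ⟨r, hr⟩ := h0
    have h1 : f - MvPowerSeries.C (MvPowerSeries.constantCoeff f) ∈
        Ideal.span {(MvPowerSeries.X 0 : MvPowerSeries (Fin 2) S), MvPowerSeries.X 1} := by
      rw [mem_span_X_iff]; simp
    have h2 := Ideal.mem_map_of_mem (BranchRing.mk ϖ c a b) h1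
    rw [Ideal.map_span, Set.image_pair] at h2
    rw [← sub_add_cancel f (MvPowerSeries.C (MvPowerSeries.constantCoeff f)), map_add]
    refine add_mem h2 ?_
    have h3 : BranchRing.mk ϖ c a b (MvPowerSeries.C (MvPowerSeries.constantCoeff f)) =
      algebraMap S _ (MvPowerSeries.constantCoeff f) := (BranchRing.mk ϖ c a b).commutes _
    rw [h3, hr, map_mul, BranchRing.algebraMap_eq]
    refine Ideal.mul_mem_right _ _ (Ideal.mul_mem_left _ _ (Ideal.mul_mem_left _ _ ?_))
    exact Ideal.pow_mem_of_mem _ (Ideal.subset_span (by simp)) _ hb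

theorem BranchRing.maximalIdeal_eq [IsLocalRing (BranchRing ϖ c a b)] :
    maximalIdeal (BranchRing ϖ c a b) =
      Ideal.span {BranchRing.z ϖ c a b, BranchRing.w ϖ c a b} := by
  ext x
  obtain ⟨f, rfl⟩ := BranchRing.mk_surjective ϖ c a b x
  rw [BranchRing.mk_mem_span_iff hϖ hb, ← BranchRing.isUnit_mk_iff (c := c) (a := a) hϖ hb]
  rfl

variable [IsDomain S] (hϖ0 : ϖ ≠ 0)

omit [IsLocalRing S] hϖ in
include hϖ0 in
-- Since b > 0, the equation reduces modulo `X 1` to the nonzero constant ϖ, which is not a zero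
-- divisor.
theorem X_dvd_of_dvd_branch_mul {y : MvPowerSeries (Fin 2) S}
    (h : MvPowerSeries.X 1 ∣ branch ϖ c a b * y) : MvPowerSeries.X 1 ∣ y := by
  have h1 : MvPowerSeries.X 1 ∣ MvPowerSeries.C ϖ * y := by
    have : MvPowerSeries.C ϖ * y =
      branch ϖ c a b * y + c * (MvPowerSeries.X 0 ^ a * MvPowerSeries.X 1 ^ b) * y := by
      rw [branch]; ring
    rw [this]
    refine dvd_add h (Dvd.dvd.mul_right (Dvd.dvd.mul_left (Dvd.dvd.mul_left ?_ _) _) _)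
    exact dvd_pow_self _ hb.ne'
  rw [MvPowerSeries.X_dvd_iff] at h1 ⊢
  intro m hm
  have := h1 m hm
  rw [MvPowerSeries.coeff_C_mul] at this
  exact (mul_eq_zero.1 this).resolve_left hϖ0

omit [IsLocalRing S] hϖ in
include hϖ0 in
theorem BranchRing.w_mul_eq_zero {x : BranchRing ϖ c a b}
    (h : BranchRing.w ϖ c a b * x = 0) : x = 0 := by
  obtain ⟨f, rfl⟩ := BranchRing.mk_surjective ϖ c a b x
  rw [← map_mul, BranchRing.mk_eq_zero_iff] at h
  obtain ⟨g, hg⟩ := h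
  obtain ⟨k, rfl⟩ := X_dvd_of_dvd_branch_mul (c := c) (a := a) hb hϖ0 ⟨f, hg.symm⟩
  rw [BranchRing.mk_eq_zero_iff]
  refine ⟨k, ?_⟩
  have h0 : (MvPowerSeries.X 1 : MvPowerSeries (Fin 2) S) ∈ nonZeroDivisors _ :=
    MvPowerSeries.X_mem_nonzeroDivisors
  refine (mul_cancel_left_mem_nonZeroDivisors h0).1 ?_
  rw [hg]; ring

omit [IsDomain S] in
/-- Membership in the ideal `(w)` can be tested in `k[[z,w]]`. -/
theorem BranchRing.w_dvd_mk_iff {f : MvPowerSeries (Fin 2) S} :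
    BranchRing.w ϖ c a b ∣ BranchRing.mk ϖ c a b f ↔
      MvPowerSeries.X 1 ∣ MvPowerSeries.map (residue S) f := by
  have hres : residue S ϖ = 0 := by
    rw [residue_eq_zero_iff, hϖ]
    exact Ideal.mem_span_singleton_self _
  constructor
  · rintro ⟨y, hy⟩
    obtain ⟨g, rfl⟩ := BranchRing.mk_surjective ϖ c a b y
    rw [← map_mul, ← sub_eq_zero, ← map_sub, BranchRing.mk_eq_zero_iff] at hy
    obtain ⟨k, hk⟩ := hy
    rw [sub_eq_iff_eq_add] at hk
    rw [hk, map_add, map_mul, map_mul, branch, map_sub, MvPowerSeries.map_C, hres, map_zero,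
      MvPowerSeries.map_X]
    refine dvd_add (Dvd.dvd.mul_right ?_ _) (dvd_mul_right _ _)
    rw [zero_sub, dvd_neg]
    simp only [map_mul, map_pow, MvPowerSeries.map_X]
    exact Dvd.dvd.mul_left (Dvd.dvd.mul_left (dvd_pow_self _ hb.ne') _) _
  · intro h
    rw [MvPowerSeries.X_dvd_iff] at h
    -- The part of f free of `X 1` has all coefficients divisible by ϖ, and ϖ itself is a multiple
    -- of w in the quotient.
    obtain ⟨g, hg⟩ := exists_eq_X_pow_mul_add_restrictSupport 1 1 f
    have h1 : ∀ m, ∃ s, MvPowerSeries.coeff m (restrictSupport (fun m => m 1 < 1) f) = ϖ * s := by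
      intro m
      rw [coeff_restrictSupport]
      split_ifs with h2
      · have := h m (by simpa using h2)
        rw [MvPowerSeries.coeff_map, residue_eq_zero_iff, hϖ, Ideal.mem_span_singleton] at this
        exact this
      · exact ⟨0, by simp⟩
    choose s hs using h1
    have h3 : restrictSupport (fun m => m 1 < 1) f = MvPowerSeries.C ϖ *
        (show MvPowerSeries (Fin 2) S from fun m => s m) := by
      ext m
      rw [MvPowerSeries.coeff_C_mul, hs]
      rfl
    rw [hg, h3, map_add, map_mul, map_mul, pow_one]
    refine dvd_add (dvd_mul_right _ _) (Dvd.dvd.mul_right ?_ _)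
    have h4 : BranchRing.mk ϖ c a b (.C ϖ) = algebraMap S (BranchRing ϖ c a b) ϖ :=
      (BranchRing.mk ϖ c a b).commutes ϖ
    rw [h4, BranchRing.algebraMap_eq]
    exact Dvd.dvd.mul_left (Dvd.dvd.mul_left (dvd_pow_self _ hb.ne') _) _

omit [IsDomain S] in
-- The quotient by w is the power series ring k[[z]] over the residue field, because ϖ dies with w.
theorem BranchRing.w_dvd_or_dvd {x y : BranchRing ϖ c a b} (h : BranchRing.w ϖ c a b ∣ x * y) :
    BranchRing.w ϖ c a b ∣ x ∨ BranchRing.w ϖ c a b ∣ y := by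
  obtain ⟨f, rfl⟩ := BranchRing.mk_surjective ϖ c a b x
  obtain ⟨g, rfl⟩ := BranchRing.mk_surjective ϖ c a b y
  rw [← map_mul] at h
  rw [BranchRing.w_dvd_mk_iff hϖ hb] at h ⊢
  rw [BranchRing.w_dvd_mk_iff hϖ hb]
  rw [map_mul] at h
  exact X_one_dvd_or_dvd h

omit [IsDomain S] in
theorem BranchRing.not_w_dvd_z : ¬ BranchRing.w ϖ c a b ∣ BranchRing.z ϖ c a b := by
  rw [BranchRing.w_dvd_mk_iff hϖ hb, MvPowerSeries.map_X, MvPowerSeries.X_dvd_iff]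
  intro h
  have := h (Finsupp.single 0 1) (by simp)
  rw [MvPowerSeries.coeff_index_single_self_X] at this
  exact one_ne_zero this

include hϖ0 in
theorem BranchRing.regPair : RegPair (BranchRing.z ϖ c a b) (BranchRing.w ϖ c a b) := by
  intro x y h
  obtain ⟨t, rfl⟩ := (BranchRing.w_dvd_or_dvd hϖ hb ⟨y, h⟩).resolve_left
    (BranchRing.not_w_dvd_z hϖ hb)
  refine ⟨t, rfl, ?_⟩
  rw [← sub_eq_zero]
  refine BranchRing.w_mul_eq_zero hb hϖ0 ?_
  rw [mul_sub, ← h]; ring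

variable [IsNoetherianRing S]

include hϖ0 in
-- By Krull's intersection theorem a nonzero element is a power of w times an element not divisible
-- by w. As w has the prime property and is not a zero divisor, a product of two such elements is
-- nonzero.
theorem BranchRing.isDomain : IsDomain (BranchRing ϖ c a b) := by
  have hl := BranchRing.isLocalRing (c := c) (a := a) hϖ hb
  have hmem : BranchRing.w ϖ c a b ∈ maximalIdeal (BranchRing ϖ c a b) := by
    rw [BranchRing.maximalIdeal_eq hϖ hb]
    exact Ideal.subset_span (by simp)
  have hH : IsHausdorff (Ideal.span {BranchRing.w ϖ c a b}) (BranchRing ϖ c a b) := by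
    refine IsHausdorff.of_isLocalRing _ _ (ne_top_of_le_ne_top (Ideal.IsPrime.ne_top' (I :=
      maximalIdeal (BranchRing ϖ c a b))) ?_)
    rwa [Ideal.span_singleton_le_iff_mem]
  have key : ∀ x : BranchRing ϖ c a b, x ≠ 0 → ∃ (i : ℕ) (x' : BranchRing ϖ c a b),
      x = BranchRing.w ϖ c a b ^ i * x' ∧ ¬ BranchRing.w ϖ c a b ∣ x' := by
    intro x hx
    have : ∃ i, ¬ BranchRing.w ϖ c a b ^ i ∣ x := by
      by_contra hcon
      push Not at hcon
      refine hx (hH.haus x fun i => ?_)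
      rw [SModEq.zero, smul_eq_mul, Ideal.mul_top, Ideal.span_singleton_pow,
        Ideal.mem_span_singleton]
      exact hcon i
    classical
    obtain ⟨j, hj⟩ : ∃ j, Nat.find this = j + 1 := by
      refine Nat.exists_eq_succ_of_ne_zero fun h0 => ?_
      have := Nat.find_spec this
      rw [h0] at this
      exact this (by simp)
    have h1 : BranchRing.w ϖ c a b ^ j ∣ x := by
      by_contra h2
      have := Nat.find_min' this h2
      omega
    obtain ⟨x', hx'⟩ := h1
    refine ⟨j, x', hx', ?_⟩
    rintro ⟨x'', rfl⟩
    have h3 := Nat.find_spec this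
    rw [hj] at h3
    exact h3 ⟨x'', by rw [hx']; ring⟩
  have hpow : ∀ (i : ℕ) (x : BranchRing ϖ c a b), BranchRing.w ϖ c a b ^ i * x = 0 → x = 0 := by
    intro i
    induction i with
    | zero => intro x hx; simpa using hx
    | succ i ih =>
      intro x hx
      exact ih x (BranchRing.w_mul_eq_zero hb hϖ0 (by rw [← hx]; ring))
  have : NoZeroDivisors (BranchRing ϖ c a b) := by
    refine ⟨fun {x y} hxy => ?_⟩
    by_contra! hcon
    obtain ⟨i, x', rfl, hx'⟩ := key x hcon.1
    obtain ⟨j, y', rfl, hy'⟩ := key y hcon.2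
    have h0 : x' * y' = 0 := hpow (i + j) _ (by rw [← hxy]; ring)
    rcases BranchRing.w_dvd_or_dvd hϖ hb (h0 ▸ dvd_zero (BranchRing.w ϖ c a b)) with h | h
    · exact hx' h
    · exact hy' h
  exact NoZeroDivisors.to_isDomain _

omit [IsDomain S] in
-- Separation is Krull's theorem. For limits, the successive differences of a Cauchy sequence are
-- lifted to the matching powers of (X 0, X 1), the lifts are summed in the complete power series
-- ring, and the sum is pushed down.
theorem BranchRing.isAdicComplete :
    IsAdicComplete (Ideal.span {BranchRing.z ϖ c a b, BranchRing.w ϖ c a b})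
      (BranchRing ϖ c a b) := by
  have hl := BranchRing.isLocalRing (c := c) (a := a) hϖ hb
  have hH : IsHausdorff (Ideal.span {BranchRing.z ϖ c a b, BranchRing.w ϖ c a b})
      (BranchRing ϖ c a b) := by
    rw [← BranchRing.maximalIdeal_eq hϖ hb]; infer_instance
  have hI : Ideal.span {BranchRing.z ϖ c a b, BranchRing.w ϖ c a b} =
      (Ideal.span (Set.range MvPowerSeries.X)).map (BranchRing.mk ϖ c a b) := by
    rw [Ideal.map_span]
    congr 1
    rw [show Set.range (MvPowerSeries.X (R := S) (σ := Fin 2)) = {.X 0, .X 1} by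
      ext x; simp [eq_comm], Set.image_pair]
  refine { hH with prec' := fun f hf => ?_ }
  have hstep : ∀ k, ∃ g ∈ (Ideal.span (Set.range (MvPowerSeries.X (R := S) (σ := Fin 2)))) ^ k,
      BranchRing.mk ϖ c a b g = f (k + 1) - f k := by
    intro k
    have := hf (Nat.le_succ k)
    rw [SModEq.comm, SModEq.sub_mem, smul_eq_mul, Ideal.mul_top, hI, ← Ideal.map_pow,
      Ideal.mem_map_iff_of_surjective _ (BranchRing.mk_surjective ϖ c a b)] at this
    exact this
  choose g hg hgf using hstep
  obtain ⟨g0, hg0⟩ := BranchRing.mk_surjective ϖ c a b (f 0)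
  let F : ℕ → MvPowerSeries (Fin 2) S := fun k => g0 + ∑ i ∈ Finset.range k, g i
  have hF : ∀ k, BranchRing.mk ϖ c a b (F k) = f k := by
    intro k
    simp only [F, map_add, map_sum, hg0, hgf, Finset.sum_range_sub]
    ring
  obtain ⟨L, hL⟩ := IsPrecomplete.prec
    (inferInstance : IsPrecomplete (Ideal.span (Set.range MvPowerSeries.X))
      (MvPowerSeries (Fin 2) S)) (f := F) (by
      intro m n hmn
      have := (AdicCompletion.isAdicCauchy_iff
        (Ideal.span (Set.range (MvPowerSeries.X (R := S) (σ := Fin 2))))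
        (MvPowerSeries (Fin 2) S) F).2 (fun k => by
          rw [SModEq.comm, SModEq.sub_mem, smul_eq_mul, Ideal.mul_top]
          simpa [F, Finset.sum_range_succ] using hg k) hmn
      exact this)
  refine ⟨BranchRing.mk ϖ c a b L, fun k => ?_⟩
  have := hL k
  rw [SModEq.sub_mem, smul_eq_mul, Ideal.mul_top] at this ⊢
  rw [hI, ← Ideal.map_pow, ← hF, ← map_sub]
  exact Ideal.mem_map_of_mem _ this

include hϖ0 in
theorem BranchRing.isRegularLocalRing : IsRegularLocalRing (BranchRing ϖ c a b) := by
  have hl := BranchRing.isLocalRing (c := c) (a := a) hϖ hb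
  have hd := BranchRing.isDomain (c := c) (a := a) hϖ hb hϖ0
  refine isRegularLocalRing_of_prime (BranchRing.maximalIdeal_eq hϖ hb) ⟨?_, ?_, ?_⟩
    (BranchRing.not_w_dvd_z hϖ hb)
  · exact fun h =>
      one_ne_zero (BranchRing.w_mul_eq_zero (c := c) (a := a) hb hϖ0 (x := 1) (by rw [h]; simp))
  · rw [← mem_nonunits_iff, ← mem_maximalIdeal, BranchRing.maximalIdeal_eq hϖ hb]
    exact Ideal.subset_span (by simp)
  · exact fun x y h => BranchRing.w_dvd_or_dvd hϖ hb h

end Local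

end Branch


/-! ### Descent of completeness and regularity to a retract -/

section Retract

variable {S E : Type*} [CommRing S] [CommRing E] [Algebra S E] (D : Subalgebra S E)

/-- A retraction of `E` onto the subalgebra `D` which is `D`-linear. -/
structure IsRetraction (ρ : E →+ E) : Prop where
  mem : ∀ x, ρ x ∈ D
  apply_mul : ∀ x ∈ D, ∀ y, ρ (x * y) = x * ρ y
  apply_one : ρ 1 = 1

variable {D} {ρ : E →+ E} (hρ : IsRetraction D ρ)

include hρ

theorem IsRetraction.apply_of_mem {x : E} (hx : x ∈ D) : ρ x = x := by
  have := hρ.apply_mul x hx 1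
  rwa [mul_one, hρ.apply_one, mul_one] at this

/-- A D-linear map sends i y to i ρ(y), hence the extension of I to E back into I. It follows that
extension followed by contraction returns I, which is what moves ideal membership from E down to D.
-/
theorem IsRetraction.apply_mem_of_mem_map {I : Ideal D} {y : E}
    (hy : y ∈ I.map (algebraMap D E)) : (⟨ρ y, hρ.mem y⟩ : D) ∈ I := by
  -- The extra multiplier a is needed for the induction on the span: ρ is linear over D only, so
  -- scalars from E have to stay inside its argument.
  have key : ∀ a : E, (⟨ρ (a * y), hρ.mem _⟩ : D) ∈ I := by
    refine Submodule.span_induction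
      (p := fun y _ => ∀ a : E, (⟨ρ (a * y), hρ.mem _⟩ : D) ∈ I) ?_ ?_ ?_ ?_ hy
    · rintro _ ⟨i, hi, rfl⟩ a
      convert I.mul_mem_right (⟨ρ a, hρ.mem a⟩ : D) hi
      change ρ (a * i) = i * ρ a
      rw [mul_comm, hρ.apply_mul i i.2]
    · intro a
      convert I.zero_mem
      simp
    · intro x y _ _ hx hy a
      convert I.add_mem (hx a) (hy a)
      change ρ (a * (x + y)) = ρ (a * x) + ρ (a * y)
      rw [mul_add, map_add]
    · intro b y _ ih a
      convert ih (a * b) using 2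
      rw [smul_eq_mul, mul_assoc]
  convert key 1
  rw [one_mul]

theorem IsRetraction.mem_of_mem_map {I : Ideal D} {x : D}
    (hx : (x : E) ∈ I.map (algebraMap D E)) : x ∈ I := by
  convert hρ.apply_mem_of_mem_map hx
  exact (hρ.apply_of_mem x.2).symm

theorem IsRetraction.regPair {s t : D} (h : RegPair (s : E) (t : E)) : RegPair s t := by
  intro x y e
  obtain ⟨z, h1, h2⟩ := h x y (by exact_mod_cast congrArg (algebraMap D E) e)
  refine ⟨⟨ρ z, hρ.mem z⟩, ?_, ?_⟩
  · ext
    change (x : E) = t * ρ z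
    rw [← hρ.apply_mul _ t.2, ← h1, hρ.apply_of_mem x.2]
  · ext
    change (y : E) = s * ρ z
    rw [← hρ.apply_mul _ s.2, ← h2, hρ.apply_of_mem y.2]

/-- The limit is formed in E and projected by ρ, which does not move the terms of the sequence. -/
theorem IsRetraction.isAdicComplete (I : Ideal D) [IsAdicComplete (I.map (algebraMap D E)) E] :
    IsAdicComplete I D where
  haus' x hx := by
    have : IsHausdorff (I.map (algebraMap D E)) E := inferInstance
    ext
    refine this.haus (x : E) fun n => ?_
    have := hx n
    rw [SModEq.zero, smul_eq_mul, Ideal.mul_top] at this ⊢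
    rw [← Ideal.map_pow]
    exact Ideal.mem_map_of_mem (algebraMap D E) this
  prec' f hf := by
    obtain ⟨L, hL⟩ := IsPrecomplete.prec
      (inferInstance : IsPrecomplete (I.map (algebraMap D E)) E) (f := fun n => (f n : E)) (by
        intro m n hmn
        have := hf hmn
        rw [SModEq.sub_mem, smul_eq_mul, Ideal.mul_top] at this ⊢
        rw [← Ideal.map_pow]
        exact Ideal.mem_map_of_mem (algebraMap D E) this)
    refine ⟨⟨ρ L, hρ.mem L⟩, fun n => ?_⟩
    have := hL n
    rw [SModEq.sub_mem, smul_eq_mul, Ideal.mul_top] at this ⊢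
    rw [← Ideal.map_pow] at this
    convert hρ.apply_mem_of_mem_map this
    change (f n : E) - ρ L = ρ (f n - L)
    rw [map_sub, hρ.apply_of_mem (f n).2]

end Retract

/-- The ideals J and N define the same topology, so the limit for N also serves for J. It is
compared with the n-th term through a term of index at least l n. -/
theorem isAdicComplete_of_pow_le {E : Type*} [CommRing E] {N J : Ideal E} (hJN : J ≤ N) {l : ℕ}
    (hl : N ^ l ≤ J) [IsAdicComplete N E] : IsAdicComplete J E where
  haus' x hx := by
    refine IsHausdorff.haus (inferInstance : IsHausdorff N E) x fun n => ?_
    have := hx n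
    rw [SModEq.zero, smul_eq_mul, Ideal.mul_top] at this ⊢
    exact Ideal.pow_right_mono hJN n this
  prec' f hf := by
    obtain ⟨L, hL⟩ := IsPrecomplete.prec (inferInstance : IsPrecomplete N E) (f := f) (by
        intro m n hmn
        have := hf hmn
        rw [SModEq.sub_mem, smul_eq_mul, Ideal.mul_top] at this ⊢
        exact Ideal.pow_right_mono hJN m this)
    refine ⟨L, fun n => ?_⟩
    have h1 := hf (show n ≤ max n (l * n) from le_max_left _ _)
    have h2 := hL (max n (l * n))
    rw [SModEq.sub_mem, smul_eq_mul, Ideal.mul_top] at h1 h2 ⊢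
    have h3 : N ^ (max n (l * n)) ≤ J ^ n :=
      (Ideal.pow_le_pow_right (le_max_right _ _)).trans
        (by rw [pow_mul]; exact Ideal.pow_right_mono hl n)
    have := add_mem h1 (h3 h2)
    rwa [sub_add_sub_cancel] at this

theorem span_pair_pow_le {E : Type*} [CommRing E] (z w : E) (n₁ n₂ : ℕ) :
    Ideal.span {z, w} ^ (n₁ + n₂) ≤ Ideal.span {z ^ n₁, w ^ n₂} := by
  rw [Ideal.span_insert, Ideal.span_insert, ← Ideal.span_singleton_pow,
    ← Ideal.span_singleton_pow]
  exact Ideal.sup_pow_add_le_pow_sup_pow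

/-- Recognition of the completion of a local ring `O` as a retract `D` of a two-dimensional
complete local ring `E`. -/
theorem exists_completion_equiv_of_retract {S E O : Type*} [CommRing S] [CommRing E] [Algebra S E]
    [CommRing O] [IsLocalRing O] [IsLocalRing E]
    {D : Subalgebra S E} {ρ : E →+ E} (hρ : IsRetraction D ρ)
    {z w : E} (hmax : maximalIdeal E = Ideal.span {z, w}) [IsAdicComplete (Ideal.span {z, w}) E]
    (φ : O →+* E) (hφ : ∀ o, φ o ∈ D) {s t : O} {n₁ n₂ : ℕ} (hn : 0 < n₁ + n₂)
    (hspan : Ideal.span {φ s, φ t} = Ideal.span {z ^ n₁, w ^ n₂})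
    (hreg : RegPair (φ s) (φ t)) (hs : s ∈ maximalIdeal O) (ht : t ∈ maximalIdeal O)
    (hM : ∀ o ∈ maximalIdeal O, φ o ∈ maximalIdeal E)
    (hinj : ∀ o, φ o ∈ Ideal.span {φ s, φ t} → o ∈ Ideal.span {s, t})
    (hsurj : ∀ d ∈ D, ∃ o, d - φ o ∈ Ideal.span {φ s, φ t}) :
    ∃ e : AdicCompletion (maximalIdeal O) O ≃+* D,
      ∀ o, (e (algebraMap O _ o) : E) = φ o := by
  let φD : O →+* D := φ.codRestrict D hφ
  set J : Ideal D := Ideal.span {φD s, φD t} with hJ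
  have hJmap : J.map (algebraMap D E) = Ideal.span {φ s, φ t} := by
    rw [hJ, Ideal.map_span, Set.image_pair]
    rfl
  have hsM : φ s ∈ maximalIdeal E := hM s hs
  have htM : φ t ∈ maximalIdeal E := hM t ht
  have hle : maximalIdeal E ^ (n₁ + n₂) ≤ J.map (algebraMap D E) := by
    rw [hJmap, hspan, hmax]
    exact span_pair_pow_le z w n₁ n₂
  have hc0 : IsAdicComplete (maximalIdeal E) E := by rwa [hmax]
  have hc1 : IsAdicComplete (J.map (algebraMap D E)) E := by
    refine isAdicComplete_of_pow_le (N := maximalIdeal E) ?_ hle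
    rw [hJmap, Ideal.span_le]
    rintro _ (rfl | rfl) <;> assumption
  have hc := hρ.isAdicComplete J
  have hreg' : RegPair (φD s) (φD t) := hρ.regPair hreg
  have hsJ : φD s ∈ J := Ideal.subset_span (by simp)
  have htJ : φD t ∈ J := Ideal.subset_span (by simp)
  have hst : Ideal.span {s, t} ≤ maximalIdeal O := by
    rw [Ideal.span_le]
    rintro _ (rfl | rfl) <;> assumption
  have h1 : ∀ o, φD o ∈ J → o ∈ Ideal.span {s, t} := by
    intro o ho
    refine hinj o ?_
    rw [← hJmap]
    exact Ideal.mem_map_of_mem (algebraMap D E) ho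
  have h0 : ∀ d : D, ∃ o, d - φD o ∈ J := by
    intro d
    obtain ⟨o, ho⟩ := hsurj d d.2
    refine ⟨o, hρ.mem_of_mem_map ?_⟩
    rw [hJmap]
    exact ho
  -- Density modulo J is promoted to each graded piece by approximating the coefficients of the
  -- monomials in s and t, which themselves come from O.
  have hstep : ∀ (k : ℕ), ∀ j ∈ J ^ k, ∃ o, j - φD o ∈ J ^ (k + 1) := by
    intro k
    induction k with
    | zero => intro j _; simpa using h0 j
    | succ k ih =>
      intro j hj
      obtain ⟨y, hy, x, rfl⟩ := mem_span_pair_pow_succ.1 hj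
      obtain ⟨o1, ho1⟩ := ih y hy
      obtain ⟨o2, ho2⟩ := h0 x
      refine ⟨s * o1 + t ^ (k + 1) * o2, ?_⟩
      have e : φD s * y + φD t ^ (k + 1) * x - φD (s * o1 + t ^ (k + 1) * o2) =
          φD s * (y - φD o1) + φD t ^ (k + 1) * (x - φD o2) := by
        simp only [map_add, map_mul, map_pow]; ring
      rw [e]
      refine add_mem ?_ ?_
      · rw [pow_succ' J]; exact Ideal.mul_mem_mul hsJ ho1
      · rw [pow_succ J]; exact Ideal.mul_mem_mul (Ideal.pow_mem_pow htJ _) ho2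
  have hdense : ∀ (k : ℕ) (d : D), ∃ o, d - φD o ∈ J ^ k := by
    intro k
    induction k with
    | zero => intro d; exact ⟨0, by simp⟩
    | succ k ih =>
      intro d
      obtain ⟨o, ho⟩ := ih d
      obtain ⟨o', ho'⟩ := hstep k _ ho
      exact ⟨o + o', by rwa [map_add, ← sub_sub]⟩
  obtain ⟨e, he⟩ := exists_adicCompletion_equiv (maximalIdeal O) J φD (n₁ + n₂) hn
    (by
      intro o ho
      refine hρ.mem_of_mem_map (hle ?_)
      have : maximalIdeal O ≤ (maximalIdeal E).comap φ := fun o ho => hM o ho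
      exact Ideal.le_comap_pow φ _ (Ideal.pow_right_mono this _ ho))
    (by
      intro k o ho
      refine Ideal.pow_right_mono hst k ?_
      -- Quasi-regularity of the pair in D upgrades injectivity modulo the first power of the ideal
      -- to every power; here the dense ring is D itself.
      refine mem_span_pow_of_map_mem φD (RingHom.id D) rfl rfl hreg' (fun k e => ⟨e, by simp⟩)
        (fun k d hd => hd) h1 k o ho) hdense
  exact ⟨e, fun o => congrArg Subtype.val (he o)⟩

/-! ### The grading modulo d with weights 1 and r -/

section Graded

variable {S : Type u} [CommRing S]

/-- The part of a power series supported on monomials `z ^ i * w ^ j` with `d ∣ i + r * j`. -/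
noncomputable abbrev degreeZero (d r : ℕ) :
    MvPowerSeries (Fin 2) S →ₗ[S] MvPowerSeries (Fin 2) S :=
  restrictSupport fun m => d ∣ m 0 + r * m 1

theorem degreeZero_eq_self_iff {d r : ℕ} {f : MvPowerSeries (Fin 2) S} :
    degreeZero d r f = f ↔ ∀ m, MvPowerSeries.coeff m f ≠ 0 → d ∣ m 0 + r * m 1 := by
  constructor
  · intro h m hm
    by_contra hd
    rw [← h, coeff_restrictSupport, if_neg hd] at hm
    exact hm rfl
  · intro h
    ext m
    rw [coeff_restrictSupport]
    split_ifs with hd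
    · rfl
    · by_contra h0
      exact hd (h m (Ne.symm h0))

theorem degreeZero_idem (d r : ℕ) (f : MvPowerSeries (Fin 2) S) :
    degreeZero d r (degreeZero d r f) = degreeZero d r f := by
  rw [degreeZero_eq_self_iff]
  intro m hm
  by_contra hd
  rw [coeff_restrictSupport, if_neg hd] at hm
  exact hm rfl

/-- Degrees add, so multiplying by a series of degree zero does not mix the residue classes modulo
d. -/
theorem degreeZero_mul {d r : ℕ} {f : MvPowerSeries (Fin 2) S} (hf : degreeZero d r f = f)
    (g : MvPowerSeries (Fin 2) S) : degreeZero d r (f * g) = f * degreeZero d r g := by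
  classical
  rw [degreeZero_eq_self_iff] at hf
  ext m
  have key : ∀ p ∈ Finset.HasAntidiagonal.antidiagonal m, MvPowerSeries.coeff p.1 f ≠ 0 →
      (d ∣ p.2 0 + r * p.2 1 ↔ d ∣ m 0 + r * m 1) := by
    intro p hp h
    rw [Finset.HasAntidiagonal.mem_antidiagonal] at hp
    have e : m 0 + r * m 1 = (p.1 0 + r * p.1 1) + (p.2 0 + r * p.2 1) := by
      rw [← hp]; simp only [Finsupp.add_apply]; ring
    rw [e, ← Nat.dvd_add_right (hf p.1 h)]
  rw [coeff_restrictSupport, MvPowerSeries.coeff_mul, MvPowerSeries.coeff_mul]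
  split_ifs with hd
  · refine Finset.sum_congr rfl fun p hp => ?_
    by_cases h : MvPowerSeries.coeff p.1 f = 0
    · rw [h, zero_mul, zero_mul]
    · rw [coeff_restrictSupport, if_pos ((key p hp h).2 hd)]
  · refine (Finset.sum_eq_zero fun p hp => ?_).symm
    by_cases h : MvPowerSeries.coeff p.1 f = 0
    · rw [h, zero_mul]
    · rw [coeff_restrictSupport, if_neg (fun h' => hd ((key p hp h).1 h')), mul_zero]

end Graded


/-- Applying ρ to x y = 1 gives x ρ(y) = 1, and inverses are unique. -/
theorem IsRetraction.inv_mem {S E : Type*} [CommRing S] [CommRing E] [Algebra S E]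
    {D : Subalgebra S E} {ρ : E →+ E} (hρ : IsRetraction D ρ) {x y : E} (hx : x ∈ D)
    (hxy : x * y = 1) : y ∈ D := by
  have h := hρ.apply_mul x hx y
  rw [hxy, hρ.apply_one] at h
  have : y = ρ y := by
    calc y = y * (x * ρ y) := by rw [← h, mul_one]
      _ = (x * y) * ρ y := by ring
      _ = ρ y := by rw [hxy, one_mul]
  rw [this]
  exact hρ.mem y

/-! ### The graded part as a ring of invariants -/

section Graded

variable {S : Type u} [CommRing S]

theorem degreeZero_C (d r : ℕ) (x : S) :
    degreeZero d r (MvPowerSeries.C x : MvPowerSeries (Fin 2) S) = MvPowerSeries.C x := by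
  classical
  rw [degreeZero_eq_self_iff]
  intro m hm
  rw [MvPowerSeries.coeff_C] at hm
  have : m = 0 := by
    by_contra h
    exact hm (if_neg h)
  simp [this]

theorem degreeZero_monomial {d r i j : ℕ} (h : d ∣ i + r * j) :
    degreeZero d r (MvPowerSeries.X 0 ^ i * MvPowerSeries.X 1 ^ j : MvPowerSeries (Fin 2) S) =
      MvPowerSeries.X 0 ^ i * MvPowerSeries.X 1 ^ j := by
  classical
  rw [degreeZero_eq_self_iff]
  intro m hm
  rw [MvPowerSeries.X_pow_eq, MvPowerSeries.X_pow_eq, MvPowerSeries.monomial_mul_monomial,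
    MvPowerSeries.coeff_monomial] at hm
  have : m = Finsupp.single 0 i + Finsupp.single 1 j := by
    by_contra h
    exact hm (if_neg h)
  subst this
  simpa using h

theorem degreeZero_mul_self {d r : ℕ} {f g : MvPowerSeries (Fin 2) S}
    (hf : degreeZero d r f = f) (hg : degreeZero d r g = g) :
    degreeZero d r (f * g) = f * g := by
  rw [degreeZero_mul hf, hg]

variable (S) in
/-- The power series supported on monomials `z ^ i * w ^ j` with `d ∣ i + r * j`. -/
noncomputable def gradedSeries (d r : ℕ) : Subalgebra S (MvPowerSeries (Fin 2) S) where
  carrier := {f | degreeZero d r f = f}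
  mul_mem' hf hg := degreeZero_mul_self hf hg
  add_mem' {f g} hf hg := by
    change degreeZero d r (f + g) = f + g
    rw [map_add, hf, hg]
  algebraMap_mem' x := degreeZero_C d r x

theorem mem_gradedSeries {d r : ℕ} {f : MvPowerSeries (Fin 2) S} :
    f ∈ gradedSeries S d r ↔ degreeZero d r f = f := Iff.rfl

theorem branch_mem_gradedSeries {ϖ : S} {c : MvPowerSeries (Fin 2) S} {a b d r : ℕ}
    (hc : c ∈ gradedSeries S d r) (hd : d ∣ a + r * b) : branch ϖ c a b ∈ gradedSeries S d r :=
  sub_mem (degreeZero_C d r ϖ) (mul_mem hc (degreeZero_monomial hd))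

/-- The image of the power series supported on monomials `z ^ i * w ^ j` with `d ∣ i + r * j`. -/
noncomputable def gradedPart (ϖ : S) (c : MvPowerSeries (Fin 2) S) (a b d r : ℕ) :
    Subalgebra S (BranchRing ϖ c a b) :=
  (gradedSeries S d r).map (BranchRing.mk ϖ c a b)

theorem mk_mem_gradedPart {ϖ : S} {c : MvPowerSeries (Fin 2) S} {a b d r : ℕ}
    {f : MvPowerSeries (Fin 2) S} (hf : f ∈ gradedSeries S d r) :
    BranchRing.mk ϖ c a b f ∈ gradedPart ϖ c a b d r := ⟨f, hf, rfl⟩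

theorem gradedPart_one {ϖ : S} {c : MvPowerSeries (Fin 2) S} {a b r : ℕ} :
    gradedPart ϖ c a b 1 r = ⊤ := by
  rw [eq_top_iff]
  rintro x -
  obtain ⟨f, rfl⟩ := BranchRing.mk_surjective ϖ c a b x
  refine mk_mem_gradedPart ?_
  rw [mem_gradedSeries, degreeZero_eq_self_iff]
  intro m _
  exact one_dvd _

/-- The equation is homogeneous of degree zero, so the projection to degree zero preserves the ideal
it generates and descends to the quotient. -/
theorem exists_isRetraction_gradedPart {ϖ : S} {c : MvPowerSeries (Fin 2) S} {a b d r : ℕ}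
    (hc : c ∈ gradedSeries S d r) (hd : d ∣ a + r * b) :
    ∃ ρ : BranchRing ϖ c a b →+ BranchRing ϖ c a b, IsRetraction (gradedPart ϖ c a b d r) ρ ∧
      ∀ f, ρ (BranchRing.mk ϖ c a b f) = BranchRing.mk ϖ c a b (degreeZero d r f) := by
  have hF := branch_mem_gradedSeries (ϖ := ϖ) hc hd
  let q : MvPowerSeries (Fin 2) S →+ BranchRing ϖ c a b :=
    (BranchRing.mk ϖ c a b : _ →+* BranchRing ϖ c a b).toAddMonoidHom
  let g : MvPowerSeries (Fin 2) S →+ BranchRing ϖ c a b := q.comp (degreeZero d r).toAddMonoidHom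
  have hinv : Function.RightInverse (Function.surjInv (BranchRing.mk_surjective ϖ c a b)) q :=
    Function.rightInverse_surjInv (BranchRing.mk_surjective ϖ c a b)
  have hker : q.ker ≤ g.ker := by
    intro f hf
    obtain ⟨h, hh⟩ := (BranchRing.mk_eq_zero_iff ϖ c a b).1 hf
    refine (BranchRing.mk_eq_zero_iff ϖ c a b).2 ⟨degreeZero d r h, ?_⟩
    change degreeZero d r f = _
    rw [hh, degreeZero_mul hF]
  let ρ := q.liftOfRightInverse _ hinv ⟨g, hker⟩
  have hρ : ∀ f, ρ (BranchRing.mk ϖ c a b f) = BranchRing.mk ϖ c a b (degreeZero d r f) :=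
    fun f => AddMonoidHom.liftOfRightInverse_comp_apply q _ hinv ⟨g, hker⟩ f
  refine ⟨ρ, ⟨?_, ?_, ?_⟩, hρ⟩
  · intro x
    obtain ⟨f, rfl⟩ := BranchRing.mk_surjective ϖ c a b x
    rw [hρ]
    exact mk_mem_gradedPart (degreeZero_idem d r f)
  · rintro _ ⟨f, hf, rfl⟩ y
    obtain ⟨g, rfl⟩ := BranchRing.mk_surjective ϖ c a b y
    change ρ (BranchRing.mk ϖ c a b f * _) = BranchRing.mk ϖ c a b f * _
    rw [← map_mul, hρ, hρ, ← map_mul, degreeZero_mul hf]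
  · rw [← map_one (BranchRing.mk ϖ c a b), hρ]
    congr 1
    exact degreeZero_C d r (1 : S)

theorem sum_primitiveRoot_pow {S : Type*} [CommRing S] [IsDomain S] {d : ℕ} {ζ : S}
    (hζ : IsPrimitiveRoot ζ d) (m : ℕ) :
    ∑ j ∈ Finset.range d, (ζ ^ m) ^ j = if d ∣ m then (d : S) else 0 := by
  split_ifs with hd
  · obtain ⟨k, rfl⟩ := hd
    rw [pow_mul, hζ.pow_eq_one]
    simp
  · have h1 : ζ ^ m ≠ 1 := fun h => hd ((hζ.pow_eq_one_iff_dvd _).1 h)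
    have h2 := mul_geom_sum (ζ ^ m) d
    rw [← pow_mul, mul_comm _ d, pow_mul, hζ.pow_eq_one, one_pow, sub_self] at h2
    exact (mul_eq_zero.1 h2).resolve_left (sub_ne_zero.2 h1)

/-- Orthogonality of characters: on a monomial of degree m the action of ζ ^ j is multiplication by
(ζ ^ m) ^ j, and these factors sum to d or to 0. -/
theorem sum_rescale_eq [IsDomain S] {d r : ℕ} {ζ : S} (hζ : IsPrimitiveRoot ζ d)
    (f : MvPowerSeries (Fin 2) S) :
    ∑ j ∈ Finset.range d, MvPowerSeries.rescale ![ζ ^ j, (ζ ^ j) ^ r] f =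
      (d : S) • degreeZero d r f := by
  ext m
  have e : ∀ j, MvPowerSeries.coeff m (MvPowerSeries.rescale ![ζ ^ j, (ζ ^ j) ^ r] f) =
      (ζ ^ (m 0 + r * m 1)) ^ j * MvPowerSeries.coeff m f := by
    intro j
    rw [MvPowerSeries.coeff_rescale]
    congr 1
    rw [Finsupp.prod_fintype _ _ (by simp)]
    simp only [Fin.prod_univ_two, Matrix.cons_val_zero, Matrix.cons_val_one]
    rw [← pow_mul, ← pow_mul, ← pow_mul, ← pow_mul, ← pow_add]
    congr 1
    ring
  simp only [map_sum, e, ← Finset.sum_mul, sum_primitiveRoot_pow hζ]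
  rw [LinearMap.map_smul, coeff_restrictSupport, smul_eq_mul]
  split_ifs <;> simp

theorem mk_mem_rootInvariants_iff {ϖ : S} {a b m r : ℕ} (h : m ∣ r * b + a)
    (f : MvPowerSeries (Fin 2) S) :
    (Ideal.Quotient.mk _ f : PowerSeriesQuotient (crossing ϖ a b)) ∈ rootInvariants ϖ h ↔
      ∀ ξ : rootsOfUnity m S, (Ideal.Quotient.mk _
        (MvPowerSeries.rescale ![((ξ : Sˣ) : S), ((ξ : Sˣ) : S) ^ r] f) :
          PowerSeriesQuotient (crossing ϖ a b)) = Ideal.Quotient.mk _ f := by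
  rw [rootInvariants, Algebra.mem_iInf]
  refine forall_congr' fun ξ => ?_
  rw [AlgHom.mem_equalizer, rootAction, Ideal.quotient_map_mkₐ,
    MvPowerSeries.rescaleAlgHom_apply]
  rfl

theorem rescale_of_mem_gradedSeries {d r : ℕ} {f : MvPowerSeries (Fin 2) S}
    (hf : f ∈ gradedSeries S d r) (ξ : rootsOfUnity d S) :
    MvPowerSeries.rescale ![((ξ : Sˣ) : S), ((ξ : Sˣ) : S) ^ r] f = f := by
  rw [mem_gradedSeries, degreeZero_eq_self_iff] at hf
  have h1 : ((ξ : Sˣ) : S) ^ d = 1 := by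
    have := (mem_rootsOfUnity d (ξ : Sˣ)).1 ξ.2
    rw [← Units.val_pow_eq_pow_val, this, Units.val_one]
  ext m
  by_cases hm : MvPowerSeries.coeff m f = 0
  · rw [MvPowerSeries.coeff_rescale, hm, mul_zero]
  · obtain ⟨k, hk⟩ := hf m hm
    rw [MvPowerSeries.coeff_rescale, Finsupp.prod_fintype _ _ (by simp)]
    simp only [Fin.prod_univ_two, Matrix.cons_val_zero, Matrix.cons_val_one]
    rw [← pow_mul, ← pow_add, hk, pow_mul, h1, one_pow, one_mul]

/-- An invariant class equals its own average over the roots of unity. As m is invertible, that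
average is represented by the degree-zero part of any representative. -/
theorem mk_mem_rootInvariants_iff_exists [IsDomain S] {ϖ : S} {a b m r : ℕ} (h : m ∣ r * b + a)
    {ζ : S} (hζ : IsPrimitiveRoot ζ m) (hm : IsUnit (m : S)) (f : MvPowerSeries (Fin 2) S) :
    (Ideal.Quotient.mk _ f : PowerSeriesQuotient (crossing ϖ a b)) ∈ rootInvariants ϖ h ↔
      ∃ g ∈ gradedSeries S m r, (Ideal.Quotient.mk _ f : PowerSeriesQuotient (crossing ϖ a b)) =
        Ideal.Quotient.mk _ g := by
  constructor
  · intro hf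
    rw [mk_mem_rootInvariants_iff] at hf
    have hm0 : m ≠ 0 := by
      rintro rfl
      exact not_isUnit_zero (M₀ := S) (by simp at hm)
    have : NeZero m := ⟨hm0⟩
    refine ⟨degreeZero m r f, degreeZero_idem m r f, ?_⟩
    obtain ⟨y, hy⟩ := hm.exists_right_inv
    let mk := Ideal.Quotient.mkₐ S (Ideal.span {crossing ϖ a b})
    change mk f = mk (degreeZero m r f)
    have h1 : ∀ j, mk (MvPowerSeries.rescale ![ζ ^ j, (ζ ^ j) ^ r] f) = mk f := by
      intro j
      have := hf (hζ.toRootsOfUnity ^ j)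
      simp only [Subgroup.coe_pow, Units.val_pow_eq_pow_val, hζ.val_toRootsOfUnity_coe] at this
      exact this
    have h2 := congrArg mk (sum_rescale_eq (r := r) hζ f)
    rw [map_sum, Finset.sum_congr rfl fun j _ => h1 j, Finset.sum_const, Finset.card_range,
      map_smul, ← Nat.cast_smul_eq_nsmul S] at h2
    calc mk f = (y * (m : S)) • mk f := by rw [mul_comm, hy, one_smul]
      _ = (y * (m : S)) • mk (degreeZero m r f) := by rw [mul_smul, h2, mul_smul]
      _ = _ := by rw [mul_comm, hy, one_smul]
  · rintro ⟨g, hg, e⟩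
    rw [e, mk_mem_rootInvariants_iff]
    intro ξ
    rw [rescale_of_mem_gradedSeries hg]

theorem rescale_mem_gradedSeries {d r : ℕ} {f : MvPowerSeries (Fin 2) S}
    (hf : f ∈ gradedSeries S d r) (x : Fin 2 → S) :
    MvPowerSeries.rescale x f ∈ gradedSeries S d r := by
  rw [mem_gradedSeries, degreeZero_eq_self_iff] at hf ⊢
  intro m hm
  refine hf m fun h => hm ?_
  rw [MvPowerSeries.coeff_rescale, h, mul_zero]

theorem rescale_rescale_inv {x y : Fin 2 → S} (hxy : ∀ i, x i * y i = 1)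
    (f : MvPowerSeries (Fin 2) S) :
    MvPowerSeries.rescale x (MvPowerSeries.rescale y f) = f := by
  ext m
  rw [MvPowerSeries.coeff_rescale, MvPowerSeries.coeff_rescale, ← mul_assoc,
    ← Finsupp.prod_mul]
  simp only [← mul_pow, hxy, one_pow]
  rw [Finsupp.prod_fintype _ _ (by simp)]
  simp

/-- Rescaling the first variable removes a constant factor and identifies the graded part with the
invariants. -/
theorem nonempty_gradedPart_equiv_rootInvariants [IsDomain S] {ϖ : S} {a b m r : ℕ}
    (h : m ∣ r * b + a) {ζ : S} (hζ : IsPrimitiveRoot ζ m) (hm : IsUnit (m : S)) (α : Sˣ) :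
    Nonempty (gradedPart ϖ (MvPowerSeries.C ((α : S) ^ a)) a b m r ≃ₐ[S] rootInvariants ϖ h) := by
  set x : Fin 2 → S := ![(α : S), 1] with hx
  set y : Fin 2 → S := ![((α⁻¹ : Sˣ) : S), 1] with hy
  have hxy : ∀ i, x i * y i = 1 := by intro i; fin_cases i <;> simp [hx, hy]
  have hyx : ∀ i, y i * x i = 1 := by intro i; rw [mul_comm]; exact hxy i
  set c := (MvPowerSeries.C ((α : S) ^ a) : MvPowerSeries (Fin 2) S) with hc
  have hxF : MvPowerSeries.rescale x (crossing ϖ a b) = branch ϖ c a b := by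
    rw [crossing, branch, map_sub, map_mul, map_pow, map_pow, rescale_C, rescale_X, rescale_X]
    simp only [hx, hc, Matrix.cons_val_zero, Matrix.cons_val_one, map_one, map_pow]
    ring
  have hyF : MvPowerSeries.rescale y (branch ϖ c a b) = crossing ϖ a b := by
    rw [← hxF, rescale_rescale_inv hyx]
  let Φ : BranchRing ϖ c a b →ₐ[S] PowerSeriesQuotient (crossing ϖ a b) :=
    Ideal.quotientMapₐ _ (MvPowerSeries.rescaleAlgHom y) (by
      rw [Ideal.span_singleton_le_iff_mem, Ideal.mem_comap]
      change MvPowerSeries.rescaleAlgHom _ (branch ϖ c a b) ∈ _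
      rw [MvPowerSeries.rescaleAlgHom_apply, hyF]
      exact Ideal.mem_span_singleton_self _)
  let Ψ : PowerSeriesQuotient (crossing ϖ a b) →ₐ[S] BranchRing ϖ c a b :=
    Ideal.quotientMapₐ _ (MvPowerSeries.rescaleAlgHom x) (by
      rw [Ideal.span_singleton_le_iff_mem, Ideal.mem_comap]
      change MvPowerSeries.rescaleAlgHom _ (crossing ϖ a b) ∈ _
      rw [MvPowerSeries.rescaleAlgHom_apply, hxF]
      exact Ideal.mem_span_singleton_self _)
  have hΦ : ∀ f, Φ (BranchRing.mk ϖ c a b f) = Ideal.Quotient.mk _ (MvPowerSeries.rescale y f) := by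
    intro f
    rw [← MvPowerSeries.rescaleAlgHom_apply]
    exact Ideal.quotient_map_mkₐ _ _ _
  have hΨ : ∀ f, Ψ (Ideal.Quotient.mk _ f) = BranchRing.mk ϖ c a b (MvPowerSeries.rescale x f) := by
    intro f
    rw [← MvPowerSeries.rescaleAlgHom_apply]
    exact Ideal.quotient_map_mkₐ _ _ _
  have h1 : ∀ u, Ψ (Φ u) = u := by
    intro u
    obtain ⟨f, rfl⟩ := BranchRing.mk_surjective ϖ c a b u
    rw [hΦ, hΨ, rescale_rescale_inv hxy]
  have h2 : ∀ u, Φ (Ψ u) = u := by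
    intro u
    obtain ⟨f, rfl⟩ := Ideal.Quotient.mk_surjective u
    rw [hΨ, hΦ, rescale_rescale_inv hyx]
  let e : BranchRing ϖ c a b ≃ₐ[S] PowerSeriesQuotient (crossing ϖ a b) :=
    AlgEquiv.ofAlgHom Φ Ψ (AlgHom.ext h2) (AlgHom.ext h1)
  have hmap : (gradedPart ϖ c a b m r).map (e : BranchRing ϖ c a b →ₐ[S] _) =
      rootInvariants ϖ h := by
    ext u
    constructor
    · rintro ⟨_, ⟨f, hf, rfl⟩, rfl⟩
      change Φ (BranchRing.mk ϖ c a b f) ∈ _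
      rw [hΦ, mk_mem_rootInvariants_iff_exists h hζ hm]
      exact ⟨_, rescale_mem_gradedSeries hf y, rfl⟩
    · intro hu
      obtain ⟨f, rfl⟩ := Ideal.Quotient.mk_surjective u
      obtain ⟨g, hg, e1⟩ := (mk_mem_rootInvariants_iff_exists h hζ hm f).1 hu
      rw [e1]
      refine ⟨BranchRing.mk ϖ c a b (MvPowerSeries.rescale x g),
        mk_mem_gradedPart (rescale_mem_gradedSeries hg x), ?_⟩
      have h3 := h2 (Ideal.Quotient.mk _ g)
      rw [hΨ] at h3
      exact h3
  exact ⟨(e.subalgebraMap _).trans (Subalgebra.equivOfEq _ _ hmap)⟩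

end Graded


/-! ### Roots of units and roots of unity in complete local rings -/

section Hensel

/-- Hensel's lemma applies because the derivative n y ^ (n - 1) is a unit. -/
theorem exists_pow_eq_of_pow_sub_mem {E : Type*} [CommRing E] {I : Ideal E} [HenselianRing E I]
    {n : ℕ} (hn : IsUnit (n : E)) (hn0 : n ≠ 0) {x y : E} (hy : IsUnit y) (h : y ^ n - x ∈ I) :
    ∃ z, z ^ n = x ∧ z - y ∈ I := by
  obtain ⟨z, hz, hzy⟩ := HenselianRing.is_henselian (I := I) (Polynomial.X ^ n - Polynomial.C x)
    (Polynomial.monic_X_pow_sub_C x hn0) y (by simpa using h) (by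
      refine IsUnit.map _ ?_
      have : ((Polynomial.X ^ n - Polynomial.C x).derivative).eval y = n * y ^ (n - 1) := by
        simp [Polynomial.derivative_X_pow]
      rw [this]
      exact hn.mul (hy.pow (n - 1)))
  refine ⟨z, ?_, hzy⟩
  simpa [sub_eq_zero] using hz

variable {R : Type*} [CommRing R] [IsLocalRing R] [IsAdicComplete (maximalIdeal R) R]

theorem isUnit_natCast_of_not_dvd {R : Type*} [CommRing R] [IsLocalRing R]
    (p : ℕ) [CharP (ResidueField R) p] {n : ℕ} (hn : ¬ p ∣ n) :
    IsUnit (n : R) := by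
  by_contra h
  apply hn
  rw [← CharP.cast_eq_zero_iff (ResidueField R) p, ← map_natCast (residue R),
    residue_eq_zero_iff]
  exact h

/-- In a complete local ring, a unit has an `n`-th root with prescribed residue. -/
theorem exists_pow_eq_of_residue {n : ℕ} (hn : IsUnit (n : R)) {x : R}
    (hx : IsUnit x) {κ : ResidueField R} (hκ : κ ^ n = residue R x) :
    ∃ y, y ^ n = x ∧ residue R y = κ := by
  have hn0 : n ≠ 0 := by
    rintro rfl
    simp at hn
  obtain ⟨y, rfl⟩ := residue_surjective (R := R) κ
  have hy : IsUnit y := by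
    rw [← isUnit_map_iff (residue R)]
    have h1 : IsUnit (residue R y ^ n) := by
      rw [hκ]
      exact hx.map _
    exact (isUnit_pow_iff hn0).1 h1
  obtain ⟨z, hz, hzy⟩ := exists_pow_eq_of_pow_sub_mem (I := maximalIdeal R) hn hn0 (x := x) hy (by
    rw [← residue_eq_zero_iff, map_sub, map_pow, hκ, sub_self])
  refine ⟨z, hz, ?_⟩
  rwa [← residue_eq_zero_iff, map_sub, sub_eq_zero] at hzy

/-- In y ^ n - 1 = (1 + y + ... + y ^ (n - 1)) (y - 1) the first factor has residue n and is a unit.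
-/
theorem pow_eq_one_of_residue_eq_one {R : Type*} [CommRing R] [IsLocalRing R]
    {n : ℕ} (hn : IsUnit (n : R)) {y : R} (h : y ^ n = 1) (hy : residue R y = 1) : y = 1 := by
  have h1 : IsUnit (∑ i ∈ Finset.range n, y ^ i) := by
    rw [← isUnit_map_iff (residue R)]
    simpa [hy] using (hn.map (residue R))
  have h2 := geom_sum_mul y n
  rw [h, sub_self] at h2
  exact sub_eq_zero.1 ((h1.mul_right_eq_zero).1 h2)

variable [IsAlgClosed (ResidueField R)]

theorem exists_isPrimitiveRoot {n : ℕ} (hn : IsUnit (n : R)) :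
    ∃ ζ : R, IsPrimitiveRoot ζ n := by
  have hnk : (n : ResidueField R) ≠ 0 := by
    have := hn.map (residue R)
    rw [map_natCast] at this
    exact this.ne_zero
  have : NeZero (n : ResidueField R) := ⟨hnk⟩
  have : HasEnoughRootsOfUnity (ResidueField R) n := inferInstance
  obtain ⟨κ, hκ⟩ := HasEnoughRootsOfUnity.exists_primitiveRoot (ResidueField R) n
  obtain ⟨ζ, h1, h2⟩ := exists_pow_eq_of_residue hn isUnit_one (κ := κ)
    (by rw [map_one, hκ.pow_eq_one])
  refine ⟨ζ, h1, fun l hl => hκ.dvd_of_pow_eq_one l ?_⟩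
  rw [← h2, ← map_pow, hl, map_one]

theorem not_dvd_orderOf {k : Type*} [Field k] (p : ℕ) [CharP k p] {x : k} (hx : IsOfFinOrder x) :
    ¬ p ∣ orderOf x := by
  rintro ⟨m, hm⟩
  have hpos := hx.orderOf_pos
  rcases CharP.char_is_prime_or_zero k p with hp | rfl
  · have : Fact p.Prime := ⟨hp⟩
    have h1 : (x ^ m) ^ p = 1 := by
      rw [← pow_mul, mul_comm, ← hm, pow_orderOf_eq_one]
    have h2 : x ^ m = 1 := by
      apply frobenius_inj k p
      rw [frobenius_def, h1, map_one]
    have h3 : p * m ∣ m := hm ▸ orderOf_dvd_of_pow_eq_one h2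
    have hm0 : 0 < m := by
      rcases Nat.eq_zero_or_pos m with rfl | h
      · simp [hm] at hpos
      · exact h
    have := Nat.le_of_dvd hm0 h3
    have := hp.two_le
    nlinarith
  · simp [hm] at hpos

/-- A root of unity of order prime to the residue characteristic has roots of any order. -/
theorem exists_pow_eq_of_pow_eq_one (p : ℕ) [CharP (ResidueField R) p] {n a : ℕ} (hn : ¬ p ∣ n)
    (ha : 0 < a) {κ : R} (hκ : κ ^ n = 1) : ∃ α : Rˣ, (α : R) ^ a = κ := by
  have hn0 : n ≠ 0 := by rintro rfl; simp at hn
  obtain ⟨α₀, hα₀⟩ := IsAlgClosed.exists_pow_nat_eq (residue R κ) ha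
  have hfin : α₀ ^ (a * n) = 1 := by rw [pow_mul, hα₀, ← map_pow, hκ, map_one]
  -- The exponent a may be divisible by p, so α₀ cannot be lifted as a root of X ^ a - κ. Its order
  -- m is prime to p, and it is lifted as an m-th root of unity instead.
  have hord := not_dvd_orderOf p
    (isOfFinOrder_iff_pow_eq_one.2 ⟨a * n, Nat.mul_pos ha (Nat.pos_of_ne_zero hn0), hfin⟩)
  set m := orderOf α₀ with hm
  have hmu : IsUnit (m : R) := isUnit_natCast_of_not_dvd p hord
  have hnu : IsUnit (n : R) := isUnit_natCast_of_not_dvd p hn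
  obtain ⟨α, h1, h2⟩ := exists_pow_eq_of_residue hmu isUnit_one (κ := α₀)
    (by rw [map_one, hm, pow_orderOf_eq_one])
  have hm0 : m ≠ 0 := by rintro h; rw [h] at hord; simp at hord
  have hαu : IsUnit α := IsUnit.of_pow_eq_one h1 hm0
  refine ⟨hαu.unit, ?_⟩
  rw [IsUnit.unit_spec]
  have hκu : IsUnit κ := IsUnit.of_pow_eq_one hκ hn0
  obtain ⟨κ', hκ'⟩ := hκu.exists_right_inv
  -- Both factors are roots of unity of order prime to p and their product has residue 1, so the
  -- product is exactly 1.
  have h3 : α ^ a * κ' = 1 := by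
    refine pow_eq_one_of_residue_eq_one (n := m * n) (by push_cast; exact hmu.mul hnu) ?_ ?_
    · have e1 : κ' ^ n = 1 := by
        have := congrArg (· ^ n) hκ'
        simpa [mul_pow, hκ] using this
      rw [mul_pow, ← pow_mul, mul_comm m n, pow_mul κ', e1, one_pow, mul_one,
        show a * (n * m) = m * (a * n) by ring, pow_mul, h1, one_pow]
    · rw [map_mul, map_pow, h2, hα₀, ← map_mul, hκ', map_one]
  calc α ^ a = α ^ a * (κ * κ') := by rw [hκ', mul_one]
    _ = κ * (α ^ a * κ') := by ring
    _ = κ := by rw [h3, mul_one]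

end Hensel

/-! ### Integral elements in a Kummer extension -/

section IntegralClosure

variable {A K L : Type*} [CommRing A] [IsDomain A] [IsIntegrallyClosed A] [Field K] [Algebra A K]
  [IsFractionRing A K] [Field L] [Algebra K L] [Algebra A L] [IsScalarTower A K L]
  {n : ℕ} {T : L} {π : A} {ζ : A}

omit [IsDomain A] [IsIntegrallyClosed A] in
-- The automorphism T ↦ ζ T preserves integrality, and the terms of z are its eigencomponents. A
-- weighted sum of the conjugates isolates one of them up to the invertible factor n.
theorem isIntegral_term (hn : IsUnit (n : A)) (hζ : IsPrimitiveRoot ζ n)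
    {σ : L →ₐ[K] L} (hσ : σ T = algebraMap A L ζ * T) {α : ℕ → K}
    (hz : IsIntegral A (∑ i ∈ Finset.range n, algebraMap K L (α i) * T ^ i)) {i : ℕ} (hi : i < n) :
    IsIntegral A (algebraMap K L (α i) * T ^ i) := by
  set z := ∑ i ∈ Finset.range n, algebraMap K L (α i) * T ^ i with hzdef
  have hinj : Function.Injective (algebraMap A L) := by
    rw [IsScalarTower.algebraMap_eq A K L]
    exact (algebraMap K L).injective.comp (IsFractionRing.injective A K)
  have hζ' : IsPrimitiveRoot (algebraMap A L ζ) n := hζ.map_of_injective hinj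
  have hσζ : σ (algebraMap A L ζ) = algebraMap A L ζ := by
    rw [IsScalarTower.algebraMap_apply A K L, σ.commutes]
  have hσT : ∀ j, (σ ^ j) T = algebraMap A L ζ ^ j * T := by
    intro j
    induction j with
    | zero => simp
    | succ j ih =>
      rw [pow_succ', AlgHom.mul_apply, ih, map_mul, map_pow, hσζ, hσ]; ring
  have hσz : ∀ j, IsIntegral A ((σ ^ j) z) := fun j =>
    hz.map ((σ ^ j).restrictScalars A)
  -- The weight ζ ^ (n - i) stands for ζ ^ (-i) with a natural exponent. It cancels the eigenvalue
  -- on T ^ i, and for l < n the condition n ∣ n - i + l forces l = i.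
  have hint : IsIntegral A (∑ j ∈ Finset.range n,
      (algebraMap A L ζ ^ (n - i)) ^ j * (σ ^ j) z) :=
    IsIntegral.sum _ fun j _ =>
      ((isIntegral_algebraMap (R := A) (x := ζ)).pow _ |>.pow _).mul (hσz j)
  have hcalc : ∑ j ∈ Finset.range n, (algebraMap A L ζ ^ (n - i)) ^ j * (σ ^ j) z =
      (n : L) * (algebraMap K L (α i) * T ^ i) := by
    have e1 : ∀ j, (algebraMap A L ζ ^ (n - i)) ^ j * (σ ^ j) z =
        ∑ l ∈ Finset.range n, (algebraMap K L (α l) * T ^ l) *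
          (algebraMap A L ζ ^ (n - i + l)) ^ j := by
      intro j
      rw [hzdef, map_sum, Finset.mul_sum]
      refine Finset.sum_congr rfl fun l _ => ?_
      rw [map_mul, AlgHom.commutes, map_pow, hσT]
      ring
    rw [Finset.sum_congr rfl fun j _ => e1 j, Finset.sum_comm]
    simp only [← Finset.mul_sum, sum_primitiveRoot_pow hζ']
    rw [Finset.sum_eq_single i]
    · rw [if_pos (by rw [Nat.sub_add_cancel hi.le]), mul_comm]
    · intro l hl hli
      rw [Finset.mem_range] at hl
      rw [if_neg, mul_zero]
      rintro ⟨q, hq⟩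
      have : q = 1 := by
        have h1 : n * q < n * 2 := by omega
        have h2 : 0 < n * q := by omega
        have := Nat.lt_of_mul_lt_mul_left h1
        have := Nat.pos_of_mul_pos_left h2
        omega
      subst this
      omega
    · simp [hi]
  rw [hcalc] at hint
  obtain ⟨m, hm⟩ := hn.exists_right_inv
  have h3 : (algebraMap A L m) * ((n : L) * (algebraMap K L (α i) * T ^ i)) =
      algebraMap K L (α i) * T ^ i := by
    have : algebraMap A L m * (n : L) = 1 := by
      rw [← map_natCast (algebraMap A L), ← map_mul, mul_comm, hm, map_one]
    rw [← mul_assoc, this, one_mul]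
  rw [← h3]
  exact isIntegral_algebraMap.mul hint

omit [IsDomain A] in
-- The exponents are below n, so β t₁ t₂ has n-th power in A and lies in A by normality. That n-th
-- power is divisible by t₁ t₂, and since t₁ t₂ is radical it can be cancelled again.
theorem mem_range_of_pow_mul {t₁ t₂ : A} (hrad : IsRadical (t₁ * t₂)) (ht₁ : t₁ ≠ 0) (ht₂ : t₂ ≠ 0)
    {β : K} {r₁ r₂ : ℕ} (h₁ : r₁ < n) (h₂ : r₂ < n)
    (h : ∃ x, β ^ n * algebraMap A K (t₁ ^ r₁ * t₂ ^ r₂) = algebraMap A K x) :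
    ∃ y, β = algebraMap A K y := by
  obtain ⟨x, hx⟩ := h
  have hinj := IsFractionRing.injective A K
  have e1 : (β * algebraMap A K (t₁ * t₂)) ^ n =
      algebraMap A K (x * (t₁ ^ (n - r₁) * t₂ ^ (n - r₂))) := by
    rw [map_mul _ x, ← hx, mul_assoc, ← map_mul, mul_pow, ← map_pow]
    congr 2
    obtain ⟨u, rfl⟩ := Nat.exists_eq_add_of_lt h₁
    obtain ⟨v, hv⟩ := Nat.exists_eq_add_of_lt h₂
    rw [mul_pow, show r₁ + u + 1 - r₁ = u + 1 by omega, show r₁ + u + 1 - r₂ = v + 1 by omega]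
    nth_rewrite 2 [hv]
    ring
  have hint : IsIntegral A (β * algebraMap A K (t₁ * t₂)) := by
    refine IsIntegral.of_pow (Nat.zero_lt_of_lt h₁) ?_
    rw [e1]
    exact isIntegral_algebraMap
  obtain ⟨γ, hγ⟩ := IsIntegrallyClosed.isIntegral_iff.1 hint
  rw [← hγ, ← map_pow] at e1
  have hdvd : t₁ * t₂ ∣ γ ^ n := by
    rw [hinj e1]
    refine Dvd.dvd.mul_left (mul_dvd_mul ?_ ?_) _ <;>
    exact dvd_pow_self _ (by omega)
  obtain ⟨δ, rfl⟩ := hrad n γ hdvd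
  refine ⟨δ, ?_⟩
  have hne : algebraMap A K (t₁ * t₂) ≠ 0 := by
    rw [map_mul]
    exact mul_ne_zero ((map_ne_zero_iff _ hinj).2 ht₁) ((map_ne_zero_iff _ hinj).2 ht₂)
  apply mul_right_cancel₀ hne
  rw [← hγ, map_mul _ _ δ, mul_comm]

/-- The monomials `T ^ i / (t₁ ^ ⌊i a / n⌋ t₂ ^ ⌊i b / n⌋)` generate the integral closure of `A`
in `K(T)`, where `T ^ n = c t₁ ^ a t₂ ^ b`. -/
theorem exists_eq_sum_of_isIntegral (hn : IsUnit (n : A)) (hζ : IsPrimitiveRoot ζ n)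
    {σ : L →ₐ[K] L} (hσ : σ T = algebraMap A L ζ * T) {t₁ t₂ c : A} {a b : ℕ}
    (hT : T ^ n = algebraMap A L (c * (t₁ ^ a * t₂ ^ b)))
    (hrad : IsRadical (t₁ * t₂)) (ht₁ : t₁ ≠ 0) (ht₂ : t₂ ≠ 0) (hc : IsUnit c)
    (hspan : ∀ z : L, ∃ α : ℕ → K, z = ∑ i ∈ Finset.range n, algebraMap K L (α i) * T ^ i)
    {e : ℕ → L} (he : ∀ i, e i * algebraMap A L (t₁ ^ (i * a / n) * t₂ ^ (i * b / n)) = T ^ i)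
    {z : L} (hz : IsIntegral A z) :
    ∃ β : ℕ → A, z = ∑ i ∈ Finset.range n, algebraMap A L (β i) * e i := by
  have hn0 : n ≠ 0 := by rintro rfl; simp at hn
  have hinj : Function.Injective (algebraMap A L) := by
    rw [IsScalarTower.algebraMap_eq A K L]
    exact (algebraMap K L).injective.comp (IsFractionRing.injective A K)
  obtain ⟨α, rfl⟩ := hspan z
  have key : ∀ i ∈ Finset.range n, ∃ β : A, algebraMap K L (α i) * T ^ i =
      algebraMap A L β * e i := by
    intro i hi
    rw [Finset.mem_range] at hi
    have h1 := isIntegral_term hn hζ hσ hz hi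
    -- The n-th power of a term lies in K, so normality of A applies to it. Dividing i a and i b by
    -- n splits off the denominator of e i and leaves exponents smaller than n.
    have h2 : IsIntegral A (α i ^ n * algebraMap A K (c * (t₁ ^ a * t₂ ^ b)) ^ i) := by
      rw [← isIntegral_algebraMap_iff (algebraMap K L).injective]
      convert h1.pow n using 1
      rw [map_mul, map_pow, map_pow, ← IsScalarTower.algebraMap_apply A K L, ← hT]
      ring
    obtain ⟨x, hx⟩ := IsIntegrallyClosed.isIntegral_iff.1 h2
    obtain ⟨c', hc'⟩ := hc.exists_right_inv
    obtain ⟨β, hβ⟩ := mem_range_of_pow_mul (K := K) (n := n) hrad ht₁ ht₂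
      (β := α i * algebraMap A K (t₁ ^ (i * a / n) * t₂ ^ (i * b / n)))
      (r₁ := i * a % n) (r₂ := i * b % n) (Nat.mod_lt _ (Nat.pos_of_ne_zero hn0))
      (Nat.mod_lt _ (Nat.pos_of_ne_zero hn0)) ⟨c' ^ i * x, by
        rw [map_mul _ _ x, hx, mul_pow, mul_assoc, ← map_pow, ← map_mul, ← map_pow, mul_left_comm (algebraMap A K (c' ^ i)),
          ← map_mul]
        congr 2
        have e1 : (t₁ ^ (i * a / n) * t₂ ^ (i * b / n)) ^ n * (t₁ ^ (i * a % n) * t₂ ^ (i * b % n))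
            = t₁ ^ (n * (i * a / n) + i * a % n) * t₂ ^ (n * (i * b / n) + i * b % n) := by ring
        rw [e1, Nat.div_add_mod, Nat.div_add_mod]
        have e2 : c' ^ i * (c * (t₁ ^ a * t₂ ^ b)) ^ i =
          (c * c') ^ i * (t₁ ^ (i * a) * t₂ ^ (i * b)) := by ring
        rw [e2, hc', one_pow, one_mul]⟩
    refine ⟨β, ?_⟩
    rw [← he, IsScalarTower.algebraMap_apply A K L β, ← hβ, map_mul _ (α i),
      ← IsScalarTower.algebraMap_apply]
    ring
  choose! β hβ using key
  exact ⟨β, Finset.sum_congr rfl hβ⟩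

end IntegralClosure


/-! ### The ring R' is a local domain with maximal ideal (π') -/

section TameRing

variable {R : Type u} [CommRing R] [IsDomain R] [IsDiscreteValuationRing R] {π : R}
  (hπ : Irreducible π) (n : ℕ) [NeZero n]

include hπ in
-- Eisenstein's criterion at π, followed by Gauss's lemma.
theorem irreducible_X_pow_sub_C :
    Irreducible (Polynomial.X ^ n - Polynomial.C (algebraMap R (FractionRing R) π)) := by
  have hn : n ≠ 0 := NeZero.ne n
  have h1 : (Polynomial.X ^ n - Polynomial.C π).IsEisensteinAt (Ideal.span {π}) := by
    have hpr : (Ideal.span {π}).IsPrime := (Ideal.span_singleton_prime hπ.ne_zero).2 hπ.prime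
    refine (Polynomial.monic_X_pow_sub_C π hn).isEisensteinAt_of_mem_of_notMem hpr.ne_top ?_ ?_
    · intro m hm
      rw [Polynomial.natDegree_X_pow_sub_C] at hm
      rw [Polynomial.coeff_sub, Polynomial.coeff_X_pow, if_neg hm.ne, zero_sub, neg_mem_iff,
        Polynomial.coeff_C]
      split_ifs
      · exact Ideal.mem_span_singleton_self π
      · exact zero_mem _
    · rw [Polynomial.coeff_sub, Polynomial.coeff_X_pow, if_neg hn.symm, zero_sub, neg_mem_iff,
        Polynomial.coeff_C_zero, Ideal.span_singleton_pow, Ideal.mem_span_singleton]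
      rintro ⟨y, hy⟩
      apply hπ.not_isUnit
      refine IsUnit.of_mul_eq_one y ?_
      apply mul_left_cancel₀ hπ.ne_zero
      linear_combination -hy
  have h2 := h1.irreducible ((Ideal.span_singleton_prime hπ.ne_zero).2 hπ.prime)
    (Polynomial.monic_X_pow_sub_C π hn).isPrimitive
    (by rw [Polynomial.natDegree_X_pow_sub_C]; exact Nat.pos_of_ne_zero hn)
  have h3 := ((Polynomial.monic_X_pow_sub_C π hn).irreducible_iff_irreducible_map_fraction_map
    (K := FractionRing R)).1 h2
  simpa using h3

omit [IsDomain R] [IsDiscreteValuationRing R] in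
theorem tameRoot_pow : tameRoot R π n ^ n = algebraMap R (TameRing R π n) π := by
  ext
  have h := AdjoinRoot.eval₂_root
    (Polynomial.X ^ n - Polynomial.C (algebraMap R (FractionRing R) π) :
        Polynomial (FractionRing R))
  simp only [Polynomial.eval₂_sub, Polynomial.eval₂_X_pow, Polynomial.eval₂_C, sub_eq_zero] at h
  exact h

include hπ in
theorem isDomain_tameRing : IsDomain (TameRing R π n) := by
  have : Fact (Irreducible (Polynomial.X ^ n - Polynomial.C (algebraMap R (FractionRing R) π))) :=
    ⟨irreducible_X_pow_sub_C hπ n⟩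
  infer_instance

include hπ in
theorem algebraMap_tameField_injective :
    Function.Injective (algebraMap R (TameField R π n)) := by
  have : Fact (Irreducible (Polynomial.X ^ n - Polynomial.C (algebraMap R (FractionRing R) π))) :=
    ⟨irreducible_X_pow_sub_C hπ n⟩
  rw [IsScalarTower.algebraMap_eq R (FractionRing R) (TameField R π n)]
  exact (algebraMap (FractionRing R) (TameField R π n)).injective.comp
    (IsFractionRing.injective R (FractionRing R))

include hπ in
theorem algebraMap_tameRing_injective :
    Function.Injective (algebraMap R (TameRing R π n)) := fun _ _ h =>
  algebraMap_tameField_injective hπ n (congrArg Subtype.val h)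

include hπ in
-- The description of integral elements in a Kummer extension with t₁ = 1 and t₂ = π to the first
-- power: for i < n the denominator exponent ⌊i/n⌋ vanishes, so plain powers of π' suffice.
theorem tameRing_exists_eq_sum {ζ : R} (hζ : IsPrimitiveRoot ζ n) (hn : IsUnit (n : R))
    (s : TameRing R π n) :
    ∃ β : ℕ → R, s = ∑ i ∈ Finset.range n, algebraMap R _ (β i) * tameRoot R π n ^ i := by
  have hn0 : n ≠ 0 := NeZero.ne n
  set F := (Polynomial.X ^ n - Polynomial.C (algebraMap R (FractionRing R) π) :
        Polynomial (FractionRing R)) with hF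
  have hFirr : Fact (Irreducible F) := ⟨irreducible_X_pow_sub_C hπ n⟩
  have hFm : F.Monic := Polynomial.monic_X_pow_sub_C _ hn0
  have hdeg : F.natDegree = n := Polynomial.natDegree_X_pow_sub_C
  have hroot : AdjoinRoot.root F ^ n = algebraMap R (AdjoinRoot F) π :=
    congrArg Subtype.val (tameRoot_pow (π := π) n)
  have hζF : Polynomial.eval₂ (algebraMap (FractionRing R) (AdjoinRoot F))
      (algebraMap R (AdjoinRoot F) ζ * AdjoinRoot.root F) F = 0 := by
    change Polynomial.eval₂ _ _
      (Polynomial.X ^ n - Polynomial.C (algebraMap R (FractionRing R) π)) = 0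
    simp only [Polynomial.eval₂_sub, Polynomial.eval₂_X_pow, Polynomial.eval₂_C]
    rw [mul_pow, ← map_pow, hζ.pow_eq_one, map_one, one_mul, hroot,
      ← IsScalarTower.algebraMap_apply, sub_self]
  let σ : AdjoinRoot F →ₐ[FractionRing R] AdjoinRoot F :=
    AdjoinRoot.liftAlgHom F (Algebra.ofId _ _) _ hζF
  have hσ : σ (AdjoinRoot.root F) = algebraMap R (AdjoinRoot F) ζ * AdjoinRoot.root F :=
    AdjoinRoot.liftAlgHom_root ..
  obtain ⟨β, hβ⟩ := exists_eq_sum_of_isIntegral (A := R) (K := FractionRing R)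
    (L := AdjoinRoot F) (T := AdjoinRoot.root F) (c := 1) (t₁ := 1) (t₂ := π) (a := 0) (b := 1)
    (e := fun i => AdjoinRoot.root F ^ i / algebraMap R (AdjoinRoot F) (π ^ (i / n)))
    hn hζ hσ (by simpa using hroot) (by simpa using hπ.prime.isRadical) one_ne_zero hπ.ne_zero
    isUnit_one
    (by
      intro z
      obtain ⟨P, rfl⟩ := AdjoinRoot.mk_surjective z
      refine ⟨fun i => (P %ₘ F).coeff i, ?_⟩
      rw [← AdjoinRoot.mk_leftInverse hFm (AdjoinRoot.mk F P), AdjoinRoot.modByMonicHom_mk]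
      have h1 : (P %ₘ F).natDegree < n := by
        rw [← hdeg]
        exact Polynomial.natDegree_modByMonic_lt P hFm (fun h => hn0 (by rw [← hdeg, h]; simp))
      conv_lhs => rw [(P %ₘ F).as_sum_range' n h1]
      rw [map_sum]
      refine Finset.sum_congr rfl fun i _ => ?_
      rw [← Polynomial.C_mul_X_pow_eq_monomial, map_mul, map_pow, AdjoinRoot.mk_X]
      rfl)
    (by
      intro i
      simp only [mul_zero, Nat.zero_div, pow_zero, one_mul, mul_one]
      refine div_mul_cancel₀ _ ?_
      exact (map_ne_zero_iff _ (algebraMap_tameField_injective hπ n)).2 (pow_ne_zero _ hπ.ne_zero))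
    s.2
  refine ⟨β, ?_⟩
  ext
  rw [hβ, AddSubmonoidClass.coe_finsetSum]
  refine Finset.sum_congr rfl fun i hi => ?_
  rw [Finset.mem_range] at hi
  simp only [Nat.div_eq_of_lt hi, pow_zero, map_one, div_one]
  rfl

variable {ζ : R} (hζ : IsPrimitiveRoot ζ n) (hn : IsUnit (n : R))

include hπ hζ hn

theorem adjoin_tameRoot : Algebra.adjoin R {tameRoot R π n} = ⊤ := by
  rw [eq_top_iff]
  rintro s -
  obtain ⟨β, rfl⟩ := tameRing_exists_eq_sum hπ n hζ hn s
  refine sum_mem fun i _ => mul_mem (algebraMap_mem _ _) (pow_mem (Algebra.subset_adjoin ?_) _)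
  exact Set.mem_singleton _

theorem exists_sub_mem_span_tameRoot (s : TameRing R π n) :
    ∃ x : R, s - algebraMap R _ x ∈ Ideal.span {tameRoot R π n} := by
  obtain ⟨β, rfl⟩ := tameRing_exists_eq_sum hπ n hζ hn s
  refine ⟨β 0, ?_⟩
  rw [Finset.range_eq_Ico, Finset.sum_eq_sum_Ico_succ_bot (Nat.pos_of_ne_zero (NeZero.ne n)),
    pow_zero, mul_one, add_sub_cancel_left]
  refine sum_mem fun i hi => ?_
  exact Ideal.mul_mem_left _ _ (Ideal.pow_mem_of_mem _ (Ideal.mem_span_singleton_self _) _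
    (Finset.mem_Ico.1 hi).1)

omit hζ hn in
theorem not_isUnit_tameRoot : ¬ IsUnit (tameRoot R π n) := by
  intro h
  have h1 := h.pow n
  rw [tameRoot_pow] at h1
  have hD := isDomain_tameRing hπ n
  have h2 : (algebraMap R (TameRing R π n)).IsIntegral := algebraMap_isIntegral_iff.2 inferInstance
  exact hπ.not_isUnit ((h2.isLocalHom (algebraMap_tameRing_injective hπ n)).map_nonunit π h1)

/-- Every maximal ideal lies over that of R by integrality, hence contains π and therefore π'.
Modulo π' the element s is congruent to some x in R, which must be a unit. -/
theorem isUnit_of_notMem_span_tameRoot {s : TameRing R π n}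
    (hs : s ∉ Ideal.span {tameRoot R π n}) : IsUnit s := by
  have hD := isDomain_tameRing hπ n
  obtain ⟨x, hx⟩ := exists_sub_mem_span_tameRoot hπ n hζ hn s
  have hxu : IsUnit x := by
    by_contra h
    have h1 : x ∈ maximalIdeal R := h
    rw [hπ.maximalIdeal_eq, Ideal.mem_span_singleton] at h1
    obtain ⟨y, rfl⟩ := h1
    apply hs
    have : s = (s - algebraMap R _ (π * y)) + algebraMap R _ (π * y) := by ring
    rw [this]
    refine add_mem hx ?_
    rw [map_mul, ← tameRoot_pow (π := π) n]
    exact Ideal.mul_mem_right _ _ (Ideal.pow_mem_of_mem _ (Ideal.mem_span_singleton_self _) _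
      (Nat.pos_of_ne_zero (NeZero.ne n)))
  by_contra hsu
  obtain ⟨M, hM, hsM⟩ := exists_max_ideal_of_mem_nonunits hsu
  have hMR : M.comap (algebraMap R (TameRing R π n)) = maximalIdeal R :=
    IsLocalRing.eq_maximalIdeal (Ideal.isMaximal_comap_of_isIntegral_of_isMaximal M)
  have hπM : algebraMap R (TameRing R π n) π ∈ M := by
    rw [← Ideal.mem_comap, hMR]
    exact hπ.not_isUnit
  rw [← tameRoot_pow] at hπM
  have hrM := hM.isPrime.mem_of_pow_mem _ hπM
  have : algebraMap R (TameRing R π n) x ∈ M := by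
    have h3 := sub_mem hsM ((Ideal.span_singleton_le_iff_mem M).2 hrM hx)
    rwa [sub_sub_cancel] at h3
  exact hM.ne_top (Ideal.eq_top_of_isUnit_mem _ this (hxu.map _))

theorem isLocalRing_tameRing : IsLocalRing (TameRing R π n) := by
  have hD := isDomain_tameRing hπ n
  refine IsLocalRing.of_nonunits_add fun {x y} hx hy => ?_
  have hx' : x ∈ Ideal.span {tameRoot R π n} := by
    by_contra h
    exact hx (isUnit_of_notMem_span_tameRoot hπ n hζ hn h)
  have hy' : y ∈ Ideal.span {tameRoot R π n} := by
    by_contra h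
    exact hy (isUnit_of_notMem_span_tameRoot hπ n hζ hn h)
  intro hxy
  apply not_isUnit_tameRoot hπ n
  rw [← Ideal.span_singleton_eq_top]
  exact Ideal.eq_top_of_isUnit_mem _ (add_mem hx' hy') hxy

theorem maximalIdeal_tameRing [IsLocalRing (TameRing R π n)] :
    maximalIdeal (TameRing R π n) = Ideal.span {tameRoot R π n} := by
  refine le_antisymm (fun s hs => ?_) ?_
  · by_contra h
    exact hs (isUnit_of_notMem_span_tameRoot hπ n hζ hn h)
  · rw [Ideal.span_singleton_le_iff_mem]
    exact not_isUnit_tameRoot hπ n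

omit hζ hn in
theorem tameRoot_ne_zero : tameRoot R π n ≠ 0 := by
  have hD := isDomain_tameRing hπ n
  intro h
  have := tameRoot_pow (π := π) n
  rw [h, zero_pow (NeZero.ne n), eq_comm, map_eq_zero_iff _ (algebraMap_tameRing_injective hπ n)] at this
  exact hπ.ne_zero this

theorem prime_tameRoot : Prime (tameRoot R π n) := by
  have hD := isDomain_tameRing hπ n
  have := isLocalRing_tameRing hπ n hζ hn
  rw [← Ideal.span_singleton_prime (tameRoot_ne_zero hπ n), ← maximalIdeal_tameRing hπ n hζ hn]
  infer_instance

theorem isNoetherianRing_tameRing : IsNoetherianRing (TameRing R π n) := by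
  have : Module.Finite R (TameRing R π n) := by
    refine ⟨⟨(Finset.range n).image fun i => tameRoot R π n ^ i, ?_⟩⟩
    rw [eq_top_iff]
    rintro s -
    obtain ⟨β, rfl⟩ := tameRing_exists_eq_sum hπ n hζ hn s
    refine sum_mem fun i hi => ?_
    rw [← Algebra.smul_def]
    exact Submodule.smul_mem _ _ (Submodule.subset_span (Finset.mem_image_of_mem _ hi))
  exact IsNoetherianRing.of_finite R (TameRing R π n)

end TameRing


/-! ### Congruences between exponents -/

section Arithmetic

theorem exists_coprime_dvd_mul_add {d a b : ℕ} (hd : d ≠ 0) (hb : b.Coprime d) :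
    ∃ r : ℕ, d ∣ r * b + a := by
  obtain ⟨x, -, hx⟩ := Nat.exists_mul_mod_eq_of_coprime (d - a % d) hb hd
  refine ⟨x, ?_⟩
  have h1 : a % d < d := Nat.mod_lt _ (Nat.pos_of_ne_zero hd)
  have h2 : (b * x + a) ≡ (d - a % d) + a % d [MOD d] :=
    Nat.ModEq.add hx (Nat.mod_modEq a d).symm
  rw [Nat.sub_add_cancel h1.le] at h2
  rw [mul_comm]
  exact (Nat.modEq_zero_iff_dvd.1 (h2.trans (by simp [Nat.ModEq])))

theorem coprime_of_dvd_mul_add {d a b r : ℕ} (ha : a.Coprime d) (h : d ∣ r * b + a) :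
    r.Coprime d := by
  have h1 : Nat.gcd r d ∣ a := by
    have h2 : Nat.gcd r d ∣ r * b + a := (Nat.gcd_dvd_right r d).trans h
    exact (Nat.dvd_add_right ((Nat.gcd_dvd_left r d).mul_right b)).1 h2
  have h3 : Nat.gcd r d ∣ Nat.gcd a d := Nat.dvd_gcd h1 (Nat.gcd_dvd_right r d)
  rw [ha] at h3
  exact Nat.dvd_one.1 h3

/-- The exponents `(i, j)` with `d ∣ i + r j` are those of the form `(l a, l b)` modulo
`(n₁, n₂)`. -/
theorem exists_mul_modEq {n₁ n₂ a b r i j : ℕ} (ha : a.Coprime n₁) (hb : b.Coprime n₂)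
    (hn₁ : n₁ ≠ 0) (hn₂ : n₂ ≠ 0) (hr : n₁.gcd n₂ ∣ r * b + a) (hij : n₁.gcd n₂ ∣ i + r * j) :
    ∃ l < n₁.lcm n₂, l * a ≡ i [MOD n₁] ∧ l * b ≡ j [MOD n₂] := by
  obtain ⟨x, -, hx⟩ := Nat.exists_mul_mod_eq_of_coprime i ha hn₁
  obtain ⟨y, -, hy⟩ := Nat.exists_mul_mod_eq_of_coprime j hb hn₂
  set d := n₁.gcd n₂ with hd
  have had : a.Coprime d := ha.coprime_dvd_right (Nat.gcd_dvd_left _ _)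
  have hxd : a * x ≡ i [MOD d] := Nat.ModEq.of_dvd (Nat.gcd_dvd_left _ _) hx
  have hyd : b * y ≡ j [MOD d] := Nat.ModEq.of_dvd (Nat.gcd_dvd_right _ _) hy
  -- The two congruences for l are compatible modulo d: subtracting r b y from both sides gives a x
  -- ≡ a y, and a is prime to d.
  have hcomp : x ≡ y [MOD d] := by
    have e1 : a * x + r * (b * y) ≡ 0 [MOD d] :=
      (hxd.add (hyd.mul_left r)).trans (Nat.modEq_zero_iff_dvd.2 hij)
    have e2 : a * y + r * (b * y) ≡ 0 [MOD d] := by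
      rw [Nat.modEq_zero_iff_dvd, show a * y + r * (b * y) = (r * b + a) * y by ring]
      exact hr.mul_right y
    have e3 := Nat.ModEq.add_right_cancel' _ (e1.trans e2.symm)
    exact Nat.ModEq.cancel_left_of_coprime (by rwa [Nat.Coprime, Nat.gcd_comm] at had) e3
  obtain ⟨l, hl1, hl2⟩ := Nat.chineseRemainder' hcomp
  have hL : 0 < n₁.lcm n₂ := Nat.lcm_pos (Nat.pos_of_ne_zero hn₁) (Nat.pos_of_ne_zero hn₂)
  refine ⟨l % n₁.lcm n₂, Nat.mod_lt _ hL, ?_, ?_⟩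
  · have := Nat.ModEq.of_dvd (Nat.dvd_lcm_left n₁ n₂) (Nat.mod_modEq l (n₁.lcm n₂))
    rw [mul_comm]
    exact ((this.trans hl1).mul_left a).trans hx
  · have := Nat.ModEq.of_dvd (Nat.dvd_lcm_right n₁ n₂) (Nat.mod_modEq l (n₁.lcm n₂))
    rw [mul_comm]
    exact ((this.trans hl2).mul_left b).trans hy

/-- Uniqueness to match `exists_mul_modEq`: together they put indices below the least common
multiple in bijection with the degree-zero exponents in the box. -/
theorem eq_of_mul_modEq {n₁ n₂ a b l l' : ℕ} (ha : a.Coprime n₁) (hb : b.Coprime n₂)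
    (hl : l < n₁.lcm n₂) (hl' : l' < n₁.lcm n₂) (h₁ : l * a ≡ l' * a [MOD n₁])
    (h₂ : l * b ≡ l' * b [MOD n₂]) : l = l' := by
  have e1 := Nat.ModEq.cancel_right_of_coprime (by rwa [Nat.Coprime, Nat.gcd_comm] at ha) h₁
  have e2 := Nat.ModEq.cancel_right_of_coprime (by rwa [Nat.Coprime, Nat.gcd_comm] at hb) h₂
  have e3 : l ≡ l' [MOD n₁.lcm n₂] := by
    rw [Nat.modEq_iff_dvd] at e1 e2 ⊢
    rw [Int.natCast_dvd] at e1 e2 ⊢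
    exact Nat.lcm_dvd e1 e2
  exact Nat.ModEq.eq_of_lt_of_lt e3 hl hl'

end Arithmetic

/-! ### Independence of monomials in a box -/

section Independence

variable {E : Type*} [CommRing E] [IsLocalRing E]

/-- Monomials with exponents in a box are independent modulo the corners of the box, for
coefficients which are units. -/
theorem eq_empty_of_sum_mem {z w : E} (hreg : RegPair z w)
    (hz : z ∈ maximalIdeal E) (hw : w ∈ maximalIdeal E) {n₁ n₂ : ℕ} {ι : Type*} (s : Finset ι)
    (c : ι → E) (p q : ι → ℕ) (hc : ∀ i ∈ s, IsUnit (c i)) (hp : ∀ i ∈ s, p i < n₁)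
    (hq : ∀ i ∈ s, q i < n₂) (hinj : ∀ i ∈ s, ∀ j ∈ s, p i = p j → q i = q j → i = j)
    (h : ∑ i ∈ s, c i * (z ^ p i * w ^ q i) ∈ Ideal.span {z ^ n₁, w ^ n₂}) : s = ∅ := by
  classical
  by_contra hne
  -- For the lexicographically least exponent pair, every other term is a multiple of z ^ (p i + 1),
  -- or of z ^ p i * w ^ (q i + 1).
  obtain ⟨i, hi, hmin⟩ := Finset.exists_min_image s (fun i => toLex (p i, q i))
    (Finset.nonempty_iff_ne_empty.2 hne)
  have hterm : ∀ j ∈ s.erase i, ∃ x y, c j * (z ^ p j * w ^ q j) =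
      z ^ p i * (z * x + w ^ (q i + 1) * y) := by
    intro j hj
    obtain ⟨hji, hj⟩ := Finset.mem_erase.1 hj
    rcases (Prod.Lex.le_iff).1 (hmin j hj) with h1 | ⟨h1, h2⟩
    · obtain ⟨k, hk⟩ := Nat.exists_eq_add_of_lt h1
      simp only [ofLex_toLex] at hk
      exact ⟨c j * z ^ k * w ^ q j, 0, by rw [hk]; ring⟩
    · simp only [ofLex_toLex] at h1 h2
      have h3 : q i < q j := lt_of_le_of_ne h2 fun h3 => hji (hinj i hi j hj h1 h3).symm
      obtain ⟨k, hk⟩ := Nat.exists_eq_add_of_lt h3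
      exact ⟨0, c j * w ^ k, by rw [hk, ← h1]; ring⟩
  choose! x y hxy using hterm
  rw [← Finset.add_sum_erase s _ hi, Finset.sum_congr rfl hxy, ← Finset.mul_sum,
    Finset.sum_add_distrib, ← Finset.mul_sum, ← Finset.mul_sum] at h
  set X := ∑ j ∈ s.erase i, x j
  set Y := ∑ j ∈ s.erase i, y j
  obtain ⟨α, β, hαβ⟩ := Ideal.mem_span_pair.1 h
  obtain ⟨k₁, hk₁⟩ := Nat.exists_eq_add_of_lt (hp i hi)
  obtain ⟨k₂, hk₂⟩ := Nat.exists_eq_add_of_lt (hq i hi)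
  -- Regularity first cancels z ^ p i modulo w ^ n₂ and then w ^ q i modulo z. What remains puts the
  -- unit c i into the maximal ideal.
  obtain ⟨β', hβ', -⟩ := hreg.pow (p i) n₂
    (c i * w ^ q i + z * X + w ^ (q i + 1) * Y - z * (z ^ k₁ * α)) β (by
      rw [hk₁] at hαβ
      linear_combination -hαβ)
  obtain ⟨γ, hγ, -⟩ := hreg.symm.pow (q i) 1 (c i + w * Y - w * (w ^ k₂ * β'))
    (z ^ k₁ * α - X) (by
      rw [hk₂] at hβ'
      linear_combination hβ')
  have : c i = z ^ 1 * γ - w * Y + w * (w ^ k₂ * β') := by rw [← hγ]; ring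
  apply (mem_maximalIdeal _).1 _ (hc i hi)
  rw [this, pow_one]
  exact add_mem (sub_mem (Ideal.mul_mem_right _ _ hz) (Ideal.mul_mem_right _ _ hw))
    (Ideal.mul_mem_right _ _ hw)

end Independence

/-! ### The substitution u = z^n₁, v = w^n₂ -/

section Substitution

variable {R : Type*} {S : Type u} [CommRing R] [CommRing S] [Algebra R S]

theorem hasSubst_X_pow {n₁ n₂ : ℕ} (h₁ : n₁ ≠ 0) (h₂ : n₂ ≠ 0) :
    MvPowerSeries.HasSubst (![MvPowerSeries.X 0 ^ n₁, MvPowerSeries.X 1 ^ n₂] :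
      Fin 2 → MvPowerSeries (Fin 2) S) :=
  MvPowerSeries.hasSubst_of_constantCoeff_zero fun i => by
    fin_cases i <;> simp [h₁, h₂]

theorem subst_mem_gradedSeries {n₁ n₂ d r : ℕ} (h₁ : n₁ ≠ 0) (h₂ : n₂ ≠ 0) (hd₁ : d ∣ n₁)
    (hd₂ : d ∣ n₂) (f : MvPowerSeries (Fin 2) R) :
    MvPowerSeries.subst (![MvPowerSeries.X 0 ^ n₁, MvPowerSeries.X 1 ^ n₂] :
      Fin 2 → MvPowerSeries (Fin 2) S) f ∈ gradedSeries S d r := by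
  classical
  rw [mem_gradedSeries, degreeZero_eq_self_iff]
  intro m hm
  rw [MvPowerSeries.coeff_subst (hasSubst_X_pow h₁ h₂)] at hm
  obtain ⟨e, he⟩ := not_forall.1 fun h => hm (finsum_eq_zero_of_forall_eq_zero h)
  rw [Finsupp.prod_fintype _ _ (by simp)] at he
  simp only [Fin.prod_univ_two, Matrix.cons_val_zero, Matrix.cons_val_one] at he
  rw [← pow_mul, ← pow_mul, MvPowerSeries.X_pow_eq, MvPowerSeries.X_pow_eq,
    MvPowerSeries.monomial_mul_monomial, MvPowerSeries.coeff_monomial] at he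
  have : m = Finsupp.single 0 (n₁ * e 0) + Finsupp.single 1 (n₂ * e 1) := by
    by_contra h
    exact he (by rw [if_neg h, smul_zero])
  subst this
  simpa using dvd_add (hd₁.mul_right _) ((hd₂.mul_right _).mul_left r)

theorem constantCoeff_subst_X_pow {n₁ n₂ : ℕ} (h₁ : n₁ ≠ 0) (h₂ : n₂ ≠ 0)
    (f : MvPowerSeries (Fin 2) R) :
    MvPowerSeries.constantCoeff (MvPowerSeries.subst
      (![MvPowerSeries.X 0 ^ n₁, MvPowerSeries.X 1 ^ n₂] :
        Fin 2 → MvPowerSeries (Fin 2) S) f) = algebraMap R S (MvPowerSeries.constantCoeff f) := by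
  have h := hasSubst_X_pow (S := S) h₁ h₂
  have h0 := (mem_span_X_iff (f - MvPowerSeries.C (MvPowerSeries.constantCoeff f))).2 (by simp)
  obtain ⟨x, y, hxy⟩ := Ideal.mem_span_pair.1 h0
  have e : f = x * MvPowerSeries.X 0 + y * MvPowerSeries.X 1 +
      algebraMap R (MvPowerSeries (Fin 2) R) (MvPowerSeries.constantCoeff f) := by
    rw [hxy]
    change f = f - MvPowerSeries.C (MvPowerSeries.constantCoeff f) +
      MvPowerSeries.C (MvPowerSeries.constantCoeff f)
    ring
  rw [← MvPowerSeries.substAlgHom_apply h]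
  conv_lhs => rw [e]
  simp only [map_add, map_mul, AlgHom.commutes, MvPowerSeries.substAlgHom_X,
    Matrix.cons_val_zero, Matrix.cons_val_one, map_pow, MvPowerSeries.constantCoeff_X,
    zero_pow h₁, zero_pow h₂, mul_zero, zero_add]
  rw [MvPowerSeries.algebraMap_apply, MvPowerSeries.constantCoeff_C]

end Substitution


/-! ### Kummer generators of fraction fields and homomorphisms out of them -/

section Generator

variable {K L : Type*} [Field K] [Field L] [Algebra K L] {n : ℕ} {T : L} {π : K}

/-- Irreducibility makes X ^ n - π the minimal polynomial of the generator T, so T may go to any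
n-th root of π. This yields both the automorphism T ↦ ζ T and the extension of A → E to O. -/
theorem exists_algHom_of_pow_eq (hn : n ≠ 0) (hT : T ^ n = algebraMap K L π)
    (hirr : Irreducible (Polynomial.X ^ n - Polynomial.C π))
    (hspan : ∀ z : L, ∃ α : ℕ → K, z = ∑ i ∈ Finset.range n, algebraMap K L (α i) * T ^ i)
    {F : Type*} [Field F] [Algebra K F] {τ : F} (hτ : τ ^ n = algebraMap K F π) :
    ∃ σ : L →ₐ[K] F, σ T = τ := by
  have hmin : Polynomial.X ^ n - Polynomial.C π = minpoly K T :=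
    minpoly.eq_of_irreducible_of_monic hirr (by simp [hT]) (Polynomial.monic_X_pow_sub_C π hn)
  have hint : IsIntegral K T := ⟨_, Polynomial.monic_X_pow_sub_C π hn, by simp [hT]⟩
  have htop : Algebra.adjoin K {T} = ⊤ := by
    rw [eq_top_iff]
    rintro z -
    obtain ⟨α, rfl⟩ := hspan z
    refine sum_mem fun i _ => mul_mem (algebraMap_mem _ _) (pow_mem (Algebra.subset_adjoin ?_) _)
    exact Set.mem_singleton _
  let pb := PowerBasis.ofAdjoinEqTop hint htop
  have hgen : pb.gen = T := PowerBasis.ofAdjoinEqTop_gen hint htop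
  have h : Polynomial.aeval τ (minpoly K pb.gen) = 0 := by
    rw [hgen, ← hmin]
    simp [hτ]
  refine ⟨pb.lift τ h, ?_⟩
  have := pb.lift_gen τ h
  rwa [hgen] at this

/-- Clearing denominators places O, hence its fraction field, inside K(T). This equals K[T] as T is
algebraic, and polynomials in T are reduced modulo X ^ n - π. -/
theorem exists_eq_sum_of_fraction {A O : Type*} [CommRing A] [IsDomain A] [CommRing O]
    [Algebra A O] [Algebra A K] [IsFractionRing A K] [Algebra O L] [IsFractionRing O L]
    [Algebra A L] [IsScalarTower A K L] [IsScalarTower A O L] (hn : n ≠ 0)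
    (hT : T ^ n = algebraMap K L π) {T₀ : O} (hT₀ : algebraMap O L T₀ = T)
    (hgen : ∀ o : O, ∃ s : A, s ≠ 0 ∧ ∃ α : ℕ → A,
      algebraMap A O s * o = ∑ i ∈ Finset.range n, algebraMap A O (α i) * T₀ ^ i) (z : L) :
    ∃ α : ℕ → K, z = ∑ i ∈ Finset.range n, algebraMap K L (α i) * T ^ i := by
  have hint : IsIntegral K T := ⟨_, Polynomial.monic_X_pow_sub_C π hn, by simp [hT]⟩
  have hO : ∀ o : O, algebraMap O L o ∈ IntermediateField.adjoin K {T} := by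
    intro o
    obtain ⟨s, hs, α, h⟩ := hgen o
    have hs' : algebraMap A L s ≠ 0 := by
      rw [IsScalarTower.algebraMap_apply A K L, Ne, map_eq_zero,
        map_eq_zero_iff _ (IsFractionRing.injective A K)]
      exact hs
    have hA : ∀ x : A, algebraMap A L x ∈ IntermediateField.adjoin K {T} := by
      intro x
      rw [IsScalarTower.algebraMap_apply A K L]
      exact IntermediateField.algebraMap_mem _ _
    have h2 := congrArg (algebraMap O L) h
    rw [map_mul, ← IsScalarTower.algebraMap_apply, map_sum] at h2
    have h3 : algebraMap O L o = (algebraMap A L s)⁻¹ * ∑ i ∈ Finset.range n,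
        algebraMap O L (algebraMap A O (α i) * T₀ ^ i) := by
      rw [← h2, inv_mul_cancel_left₀ hs']
    rw [h3]
    refine mul_mem (inv_mem (hA s)) (sum_mem fun i _ => ?_)
    rw [map_mul, ← IsScalarTower.algebraMap_apply, map_pow, hT₀]
    exact mul_mem (hA _) (pow_mem (IntermediateField.mem_adjoin_simple_self K T) _)
  have hz : z ∈ IntermediateField.adjoin K {T} := by
    obtain ⟨x, y, -, rfl⟩ := IsFractionRing.div_surjective O z
    exact div_mem (hO x) (hO y)
  rw [← IntermediateField.mem_toSubalgebra,
    IntermediateField.adjoin_simple_toSubalgebra_of_isAlgebraic hint.isAlgebraic,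
    Algebra.adjoin_singleton_eq_range_aeval] at hz
  obtain ⟨P, rfl⟩ := hz
  have hF : (Polynomial.X ^ n - Polynomial.C π).Monic := Polynomial.monic_X_pow_sub_C π hn
  refine ⟨fun i => (P %ₘ (Polynomial.X ^ n - Polynomial.C π)).coeff i, ?_⟩
  have h1 : (P %ₘ (Polynomial.X ^ n - Polynomial.C π)).natDegree < n := by
    conv_rhs => rw [← Polynomial.natDegree_X_pow_sub_C (n := n) (r := π)]
    refine Polynomial.natDegree_modByMonic_lt P hF fun h => hn ?_
    rw [← Polynomial.natDegree_X_pow_sub_C (n := n) (r := π), h, Polynomial.natDegree_one]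
  have h2 : Polynomial.aeval T P =
      Polynomial.aeval T (P %ₘ (Polynomial.X ^ n - Polynomial.C π)) := by
    conv_lhs => rw [← Polynomial.modByMonic_add_div P (Polynomial.X ^ n - Polynomial.C π)]
    simp [hT]
  change Polynomial.aeval T P = _
  rw [h2]
  conv_lhs => rw [(P %ₘ (Polynomial.X ^ n - Polynomial.C π)).as_sum_range' n h1]
  simp [Polynomial.aeval_monomial]

theorem exists_ringHom_of_mem_range {O E F : Type*} [CommRing O] [CommRing E] [CommRing F]
    (ι : E →+* F) (hι : Function.Injective ι) (ψ : O →+* F) (h : ∀ o, ∃ x, ι x = ψ o) :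
    ∃ φ : O →+* E, ∀ o, ι (φ o) = ψ o := by
  choose f hf using h
  refine ⟨⟨⟨⟨f, hι ?_⟩, fun x y => hι ?_⟩, hι ?_, fun x y => hι ?_⟩, hf⟩
  · rw [hf, map_one, map_one]
  · rw [hf, map_mul, map_mul, hf, hf]
  · change ι (f 0) = _
    rw [hf, map_zero, map_zero]
  · change ι (f (x + y)) = ι (f x + f y)
    rw [hf, map_add, map_add, hf, hf]

end Generator

/-- `O` is the local ring at a point of the normalization of `A[T]/(T ^ n - π)`. -/
structure IsNormalizedRootExtension {A O : Type*} [CommRing A] [CommRing O] [Algebra A O]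
    (n : ℕ) (π : A) (T : O) : Prop where
  injective : Function.Injective (algebraMap A O)
  irreducible : Irreducible
    (Polynomial.X ^ n - Polynomial.C (algebraMap A (FractionRing A) π))
  pow_eq : T ^ n = algebraMap A O π
  isIntegrallyClosed : IsIntegrallyClosed O
  exists_generic : ∀ o : O, ∃ s : A, s ≠ 0 ∧ ∃ α : ℕ → A,
      algebraMap A O s * o = ∑ i ∈ Finset.range n, algebraMap A O (α i) * T ^ i
  exists_integral : ∀ o : O, ∃ x y : O, IsIntegral A x ∧ IsIntegral A y ∧ IsUnit y ∧ o * y = x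

/-! ### The monomials T^i / (t₁^⌊ia/n⌋ t₂^⌊ib/n⌋) -/

section Monomials

variable {A O : Type*} [CommRing A] [IsDomain A] [CommRing O] [IsDomain O]
  [Algebra A O] {n : ℕ} {T : O} {c t₁ t₂ : A} {a b : ℕ}

/-- The n-th power of the quotient is c ^ i times t₁ and t₂ to the remainders of i a and i b modulo
n. It lies in A, so normality of O contains the quotient. -/
theorem IsNormalizedRootExtension.exists_monomials (hn : n ≠ 0)
    (h : IsNormalizedRootExtension n (c * (t₁ ^ a * t₂ ^ b)) T)
    (ht₁ : t₁ ≠ 0) (ht₂ : t₂ ≠ 0) :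
    ∃ e : ℕ → O, ∀ i, e i * algebraMap A O (t₁ ^ (i * a / n) * t₂ ^ (i * b / n)) = T ^ i := by
  have hO := h.isIntegrallyClosed
  have key : ∀ i, ∃ e : O, e * algebraMap A O (t₁ ^ (i * a / n) * t₂ ^ (i * b / n)) = T ^ i := by
    intro i
    set m := algebraMap A O (t₁ ^ (i * a / n) * t₂ ^ (i * b / n)) with hm
    have hm0 : algebraMap O (FractionRing O) m ≠ 0 := by
      rw [map_ne_zero_iff _ (IsFractionRing.injective O (FractionRing O)), hm,
        map_ne_zero_iff _ h.injective]
      exact mul_ne_zero (pow_ne_zero _ ht₁) (pow_ne_zero _ ht₂)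
    have hint : IsIntegral O
        (algebraMap O (FractionRing O) (T ^ i) / algebraMap O (FractionRing O) m) := by
      refine IsIntegral.of_pow (Nat.pos_of_ne_zero hn) ?_
      have : (algebraMap O (FractionRing O) (T ^ i) / algebraMap O (FractionRing O) m) ^ n =
          algebraMap O (FractionRing O) (algebraMap A O
            (c ^ i * (t₁ ^ (i * a % n) * t₂ ^ (i * b % n)))) := by
        rw [div_pow, div_eq_iff (pow_ne_zero _ hm0), ← map_pow, ← map_pow, ← map_mul, ← pow_mul,
          mul_comm i n, pow_mul, h.pow_eq, hm, ← map_pow, ← map_pow, ← map_mul]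
        congr 2
        have e1 : c ^ i * (t₁ ^ (i * a % n) * t₂ ^ (i * b % n)) *
            (t₁ ^ (i * a / n) * t₂ ^ (i * b / n)) ^ n =
            c ^ i * (t₁ ^ (n * (i * a / n) + i * a % n) * t₂ ^ (n * (i * b / n) + i * b % n)) := by
          ring
        rw [e1, Nat.div_add_mod, Nat.div_add_mod]
        ring
      rw [this]
      exact isIntegral_algebraMap
    obtain ⟨e, he⟩ := IsIntegrallyClosed.isIntegral_iff.1 hint
    refine ⟨e, IsFractionRing.injective O (FractionRing O) ?_⟩
    rw [map_mul, he, div_mul_cancel₀ _ hm0]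
  choose e he using key
  exact ⟨e, he⟩

variable (h : IsNormalizedRootExtension n (c * (t₁ ^ a * t₂ ^ b)) T) (ht₁ : t₁ ≠ 0) (ht₂ : t₂ ≠ 0)
  {e : ℕ → O} (he : ∀ i, e i * algebraMap A O (t₁ ^ (i * a / n) * t₂ ^ (i * b / n)) = T ^ i)

include h ht₁ ht₂

omit [IsDomain O] in
theorem IsNormalizedRootExtension.map_monomial_ne_zero (k l : ℕ) :
    algebraMap A O (t₁ ^ k * t₂ ^ l) ≠ 0 :=
  (map_ne_zero_iff _ h.injective).2 (mul_ne_zero (pow_ne_zero _ ht₁) (pow_ne_zero _ ht₂))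

include he

theorem IsNormalizedRootExtension.monomial_pow (i : ℕ) :
    e i ^ n = algebraMap A O (c ^ i * (t₁ ^ (i * a % n) * t₂ ^ (i * b % n))) := by
  have h0 := h.map_monomial_ne_zero ht₁ ht₂ (n * (i * a / n)) (n * (i * b / n))
  apply mul_right_cancel₀ h0
  rw [← map_mul]
  have e1 : c ^ i * (t₁ ^ (i * a % n) * t₂ ^ (i * b % n)) *
      (t₁ ^ (n * (i * a / n)) * t₂ ^ (n * (i * b / n))) =
      c ^ i * (t₁ ^ (n * (i * a / n) + i * a % n) * t₂ ^ (n * (i * b / n) + i * b % n)) := by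
    ring
  have e2 : e i ^ n * algebraMap A O (t₁ ^ (n * (i * a / n)) * t₂ ^ (n * (i * b / n))) =
      (e i * algebraMap A O (t₁ ^ (i * a / n) * t₂ ^ (i * b / n))) ^ n := by
    rw [mul_pow, ← map_pow]
    congr 2
    ring
  rw [e1, e2, he, Nat.div_add_mod, Nat.div_add_mod, ← pow_mul, mul_comm i n, pow_mul, h.pow_eq,
    ← map_pow]
  congr 1
  ring

variable {N g a₁ b₁ : ℕ} (hn : n ≠ 0) (hNa : N * a = a₁ * n) (hNb : N * b = b₁ * n)

include hn hNa hNb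

/-- Both N a and N b are multiples of n, so a shift of the index by N changes the floors by exact
amounts. -/
theorem IsNormalizedRootExtension.monomial_add (i j : ℕ) : e (i + j * N) = e i * e N ^ j := by
  have d1 : ∀ j, (i + j * N) * a / n = i * a / n + j * a₁ := by
    intro j
    rw [show (i + j * N) * a = i * a + (j * a₁) * n by rw [add_mul, mul_assoc, hNa]; ring,
      Nat.add_mul_div_right _ _ (Nat.pos_of_ne_zero hn)]
  have d2 : ∀ j, (i + j * N) * b / n = i * b / n + j * b₁ := by
    intro j
    rw [show (i + j * N) * b = i * b + (j * b₁) * n by rw [add_mul, mul_assoc, hNb]; ring,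
      Nat.add_mul_div_right _ _ (Nat.pos_of_ne_zero hn)]
  have hN := he N
  rw [hNa, hNb, Nat.mul_div_cancel _ (Nat.pos_of_ne_zero hn),
    Nat.mul_div_cancel _ (Nat.pos_of_ne_zero hn)] at hN
  have h0 := h.map_monomial_ne_zero ht₁ ht₂ ((i + j * N) * a / n) ((i + j * N) * b / n)
  apply mul_right_cancel₀ h0
  rw [he, d1, d2]
  have e1 : e i * e N ^ j * algebraMap A O (t₁ ^ (i * a / n + j * a₁) * t₂ ^ (i * b / n + j * b₁)) =
      (e i * algebraMap A O (t₁ ^ (i * a / n) * t₂ ^ (i * b / n))) *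
        (e N * algebraMap A O (t₁ ^ a₁ * t₂ ^ b₁)) ^ j := by
    simp only [map_mul, map_pow]
    ring
  rw [e1, he, hN]
  ring

/-- The g-th power of the fraction for e N is T ^ n divided by t₁ ^ a t₂ ^ b. Hence e N is a unit
whenever c is, and its residue is a g-th root of that of c. -/
theorem IsNormalizedRootExtension.monomial_pow_eq (hga : g * a₁ = a) (hgb : g * b₁ = b)
    (hNg : N * g = n) : e N ^ g = algebraMap A O c := by
  have hN := he N
  rw [hNa, hNb, Nat.mul_div_cancel _ (Nat.pos_of_ne_zero hn),
    Nat.mul_div_cancel _ (Nat.pos_of_ne_zero hn)] at hN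
  have h0 := h.map_monomial_ne_zero ht₁ ht₂ a b
  apply mul_right_cancel₀ h0
  have e1 : e N ^ g * algebraMap A O (t₁ ^ a * t₂ ^ b) =
      (e N * algebraMap A O (t₁ ^ a₁ * t₂ ^ b₁)) ^ g := by
    rw [← hga, ← hgb]
    simp only [map_mul, map_pow]
    ring
  rw [e1, hN, ← pow_mul, hNg, h.pow_eq, map_mul]

end Monomials

/-! ### Residues of integral elements -/

section Residue

/-- If the residue field of `A` is algebraically closed, every element of `O` which is integral over
`A` has the residue of an element of `A`. -/
theorem exists_sub_mem_maximalIdeal {A O : Type*} [CommRing A] [IsLocalRing A] [CommRing O]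
    [IsLocalRing O] [Algebra A O] [IsLocalHom (algebraMap A O)] [IsAlgClosed (ResidueField A)]
    {x : O} (hx : IsIntegral A x) : ∃ η : A, x - algebraMap A O η ∈ maximalIdeal O := by
  have h1 : IsIntegral (ResidueField A) (residue O x) := by
    obtain ⟨P, hP, hPx⟩ := hx
    refine ⟨P.map (residue A), hP.map _, ?_⟩
    have := congrArg (residue O) hPx
    rw [map_zero, Polynomial.hom_eval₂] at this
    rw [Polynomial.eval₂_map]
    exact this
  obtain ⟨κ, hκ⟩ := h1.mem_range_algebraMap_of_minpoly_splits (K := ResidueField A)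
    (IsAlgClosed.splits _)
  obtain ⟨η, rfl⟩ := residue_surjective κ
  refine ⟨η, ?_⟩
  rw [← residue_eq_zero_iff, map_sub, ← hκ]
  exact sub_self _

end Residue


/-! ### Integral elements of O as combinations of the monomials -/

section IntegralElements

variable {A O : Type*} [CommRing A] [IsDomain A] [IsIntegrallyClosed A] [CommRing O] [IsDomain O]
  [Algebra A O] {n : ℕ} {T : O} {c t₁ t₂ : A} {a b : ℕ}

omit [IsIntegrallyClosed A] in
theorem IsNormalizedRootExtension.exists_fraction_data (hn : n ≠ 0) {π : A}
    (h : IsNormalizedRootExtension n π T) :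
    ∃ (_ : Algebra (FractionRing A) (FractionRing O))
      (_ : IsScalarTower A (FractionRing A) (FractionRing O)),
      (algebraMap O (FractionRing O) T) ^ n =
        algebraMap (FractionRing A) (FractionRing O) (algebraMap A (FractionRing A) π) ∧
      ∀ z : FractionRing O, ∃ α : ℕ → FractionRing A, z = ∑ i ∈ Finset.range n,
        algebraMap (FractionRing A) (FractionRing O) (α i) * algebraMap O (FractionRing O) T ^ i := by
  have hinj : Function.Injective ((algebraMap O (FractionRing O)).comp (algebraMap A O)) :=
    (IsFractionRing.injective O (FractionRing O)).comp h.injective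
  let i1 : Algebra (FractionRing A) (FractionRing O) := (IsFractionRing.lift hinj).toAlgebra
  have i3 : IsScalarTower A (FractionRing A) (FractionRing O) :=
    IsScalarTower.of_algebraMap_eq fun x => by
      rw [IsScalarTower.algebraMap_apply A O (FractionRing O)]
      exact (IsFractionRing.lift_algebraMap hinj x).symm
  have hT : (algebraMap O (FractionRing O) T) ^ n =
      algebraMap (FractionRing A) (FractionRing O) (algebraMap A (FractionRing A) π) := by
    rw [← map_pow, h.pow_eq, ← IsScalarTower.algebraMap_apply, ← IsScalarTower.algebraMap_apply]
  exact ⟨i1, i3, hT, exists_eq_sum_of_fraction hn hT rfl h.exists_generic⟩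

theorem IsNormalizedRootExtension.exists_eq_sum (hn : IsUnit (n : A)) {ζ : A}
    (hζ : IsPrimitiveRoot ζ n) (h : IsNormalizedRootExtension n (c * (t₁ ^ a * t₂ ^ b)) T)
    (hc : IsUnit c) (ht₁ : t₁ ≠ 0) (ht₂ : t₂ ≠ 0) (hrad : IsRadical (t₁ * t₂))
    {e : ℕ → O} (he : ∀ i, e i * algebraMap A O (t₁ ^ (i * a / n) * t₂ ^ (i * b / n)) = T ^ i)
    {x : O} (hx : IsIntegral A x) :
    ∃ β : ℕ → A, x = ∑ i ∈ Finset.range n, algebraMap A O (β i) * e i := by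
  have hn0 : n ≠ 0 := by rintro rfl; simp at hn
  obtain ⟨i1, i3, hT, hspan⟩ := h.exists_fraction_data hn0
  obtain ⟨σ, hσ⟩ := exists_algHom_of_pow_eq hn0 hT h.irreducible hspan
    (F := FractionRing O) (τ := algebraMap A (FractionRing O) ζ * algebraMap O (FractionRing O) T)
    (by rw [mul_pow, ← map_pow, hζ.pow_eq_one, map_one, one_mul, hT])
  have hx' : IsIntegral A (algebraMap O (FractionRing O) x) := hx.algebraMap
  obtain ⟨β, hβ⟩ := exists_eq_sum_of_isIntegral (K := FractionRing A) hn hζ hσ (c := c)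
    (t₁ := t₁) (t₂ := t₂) (a := a) (b := b)
    (by rw [hT, ← IsScalarTower.algebraMap_apply]) hrad ht₁ ht₂ hc hspan
    (e := fun i => algebraMap O (FractionRing O) (e i))
    (by
      intro i
      rw [IsScalarTower.algebraMap_apply A O (FractionRing O), ← map_mul, he, map_pow]) hx'
  refine ⟨β, IsFractionRing.injective O (FractionRing O) ?_⟩
  rw [hβ, map_sum]
  refine Finset.sum_congr rfl fun i _ => ?_
  rw [map_mul, ← IsScalarTower.algebraMap_apply]

end IntegralElements

/-! ### Extension of A → E to the local ring O -/

section Extension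

variable {A O E : Type*} [CommRing A] [IsDomain A] [IsLocalRing A]
  [CommRing O] [IsDomain O] [IsLocalRing O] [Algebra A O] [IsLocalHom (algebraMap A O)]
  [CommRing E] [IsDomain E] [IsLocalRing E]
  {n : ℕ} {T : O} {c t₁ t₂ : A} {a b : ℕ}
  (hmA : maximalIdeal A = Ideal.span {t₁, t₂})
  (h : IsNormalizedRootExtension n (c * (t₁ ^ a * t₂ ^ b)) T)
  (ht₁ : t₁ ≠ 0) (ht₂ : t₂ ≠ 0)
  {e : ℕ → O} (he : ∀ i, e i * algebraMap A O (t₁ ^ (i * a / n) * t₂ ^ (i * b / n)) = T ^ i)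
  (θ : A →+* E) {z w ϖ : E} (c' g₁ g₂ : Eˣ) {a' b' n₁ n₂ h₁ h₂ : ℕ}
  (hz : z ∈ maximalIdeal E) (hw : w ∈ maximalIdeal E)
  (hϖ : ϖ = c' * (z ^ a' * w ^ b'))
  (hθ₁ : a ≠ 0 → θ t₁ = g₁ * z ^ n₁) (hθ₂ : θ t₂ = g₂ * w ^ n₂)
  (ha : a = a' * h₁) (hn₁ : n = n₁ * h₁) (hb : b = b' * h₂) (hn₂ : n = n₂ * h₂) (hn : n ≠ 0)
  (ha' : a'.Coprime n₁) (hb' : b'.Coprime n₂)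

/-- The unit factor of the image of `T ^ i / (t₁ ^ ⌊i a / n⌋ t₂ ^ ⌊i b / n⌋)`. -/
abbrev monomialUnit {E : Type*} [CommRing E] (c' g₁ g₂ : Eˣ) (n a b i : ℕ) : Eˣ :=
  c' ^ i * g₁⁻¹ ^ (i * a / n) * g₂⁻¹ ^ (i * b / n)

/-- The image of `T ^ i / (t₁ ^ ⌊i a / n⌋ t₂ ^ ⌊i b / n⌋)`. -/
abbrev monomialImage {E : Type*} [CommRing E] (z w : E) (c' g₁ g₂ : Eˣ)
    (n a b a' b' n₁ n₂ i : ℕ) : E :=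
  monomialUnit c' g₁ g₂ n a b i * (z ^ (i * a' % n₁) * w ^ (i * b' % n₂))

include hϖ hθ₁ hθ₂ ha hn₁ hb hn₂ hn in
omit [IsDomain A] [IsLocalRing A] [IsDomain E] [IsLocalRing E] in
theorem monomialImage_mul (i : ℕ) :
    monomialImage z w c' g₁ g₂ n a b a' b' n₁ n₂ i *
      θ (t₁ ^ (i * a / n) * t₂ ^ (i * b / n)) = ϖ ^ i := by
  have hh₁ : 0 < h₁ := Nat.pos_of_ne_zero fun h => hn (by rw [hn₁, h, mul_zero])
  have hh₂ : 0 < h₂ := Nat.pos_of_ne_zero fun h => hn (by rw [hn₂, h, mul_zero])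
  have d1 : i * a / n = i * a' / n₁ := by
    rw [ha, hn₁, ← mul_assoc, Nat.mul_div_mul_right _ _ hh₁]
  have d2 : i * b / n = i * b' / n₂ := by
    rw [hb, hn₂, ← mul_assoc, Nat.mul_div_mul_right _ _ hh₂]
  -- For a = 0 nothing is assumed about the shape of θ t₁, and the exponent vanishes.
  have hθ₁' : θ t₁ ^ (i * a / n) = (g₁ * z ^ n₁) ^ (i * a / n) := by
    by_cases h0 : a = 0
    · simp [h0]
    · rw [hθ₁ h0]
  have hg₁ : (g₁⁻¹ : Eˣ).val * g₁ = 1 := g₁.inv_mul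
  have hg₂ : (g₂⁻¹ : Eˣ).val * g₂ = 1 := g₂.inv_mul
  rw [map_mul, map_pow, map_pow, hθ₁', hθ₂, hϖ]
  simp only [monomialImage, monomialUnit, Units.val_mul, Units.val_pow_eq_pow_val]
  rw [d1, d2]
  calc _ = (c' : E) ^ i * ((g₁⁻¹ : Eˣ).val * g₁) ^ (i * a' / n₁) *
        ((g₂⁻¹ : Eˣ).val * g₂) ^ (i * b' / n₂) * (z ^ (n₁ * (i * a' / n₁) + i * a' % n₁) *
          w ^ (n₂ * (i * b' / n₂) + i * b' % n₂)) := by ring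
    _ = _ := by
      rw [Nat.div_add_mod, Nat.div_add_mod, hg₁, hg₂, one_pow, one_pow]
      ring

theorem dvd_of_mod_eq_zero (ha' : a'.Coprime n₁) (hb' : b'.Coprime n₂) {i : ℕ}
    (hi₁ : i * a' % n₁ = 0) (hi₂ : i * b' % n₂ = 0) : n₁.lcm n₂ ∣ i :=
  Nat.lcm_dvd (ha'.symm.dvd_of_dvd_mul_right (Nat.dvd_of_mod_eq_zero hi₁))
    (hb'.symm.dvd_of_dvd_mul_right (Nat.dvd_of_mod_eq_zero hi₂))

variable {a₁ b₁ : ℕ} (hNa : n₁.lcm n₂ * a = a₁ * n) (hNb : n₁.lcm n₂ * b = b₁ * n)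
  {η : A} (hη : e (n₁.lcm n₂) - algebraMap A O η ∈ maximalIdeal O)
  (hU : (monomialUnit c' g₁ g₂ n a b (n₁.lcm n₂) : E) - θ η ∈ maximalIdeal E)

include hmA h ht₁ ht₂ he hz hw ha hn₁ hb hn₂ hn ha' hb' hNa hNb hη hU in
omit [IsDomain E] in
-- If N divides i, then e i is a power of e N and both residues are the corresponding power of that
-- of η. Otherwise the monomial and its image are both nonunits and 0 serves. This comparison shows
-- that denominators which are units of O stay units in E.
theorem exists_common_residue (i : ℕ) : ∃ α : A, e i - algebraMap A O α ∈ maximalIdeal O ∧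
    monomialImage z w c' g₁ g₂ n a b a' b' n₁ n₂ i - θ α ∈ maximalIdeal E := by
  have hh₁ : h₁ ≠ 0 := fun h => hn (by rw [hn₁, h, mul_zero])
  have hh₂ : h₂ ≠ 0 := fun h => hn (by rw [hn₂, h, mul_zero])
  have ht₁m : t₁ ∈ maximalIdeal A := by rw [hmA]; exact Ideal.subset_span (by simp)
  have ht₂m : t₂ ∈ maximalIdeal A := by rw [hmA]; exact Ideal.subset_span (by simp)
  by_cases hi : n₁.lcm n₂ ∣ i
  · obtain ⟨j, rfl⟩ := hi
    refine ⟨η ^ j, ?_, ?_⟩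
    · have e0 : e 0 = 1 := by simpa using he 0
      have := h.monomial_add ht₁ ht₂ he hn hNa hNb 0 j
      rw [zero_add, e0, one_mul, mul_comm] at this
      rw [this, map_pow]
      exact Ideal.mem_of_dvd _ (sub_dvd_pow_sub_pow _ _ j) hη
    · have m1 : n₁.lcm n₂ * j * a' % n₁ = 0 :=
        Nat.mod_eq_zero_of_dvd (((Nat.dvd_lcm_left n₁ n₂).mul_right j).mul_right a')
      have m2 : n₁.lcm n₂ * j * b' % n₂ = 0 :=
        Nat.mod_eq_zero_of_dvd (((Nat.dvd_lcm_right n₁ n₂).mul_right j).mul_right b')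
      have m3 : n₁.lcm n₂ * j * a / n = a₁ * j := by
        rw [mul_right_comm, hNa, mul_right_comm, Nat.mul_div_cancel _ (Nat.pos_of_ne_zero hn)]
      have m4 : n₁.lcm n₂ * j * b / n = b₁ * j := by
        rw [mul_right_comm, hNb, mul_right_comm, Nat.mul_div_cancel _ (Nat.pos_of_ne_zero hn)]
      have m5 : monomialUnit c' g₁ g₂ n a b (n₁.lcm n₂ * j) =
          monomialUnit c' g₁ g₂ n a b (n₁.lcm n₂) ^ j := by
        simp only [monomialUnit]
        rw [m3, m4, hNa, hNb, Nat.mul_div_cancel _ (Nat.pos_of_ne_zero hn),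
          Nat.mul_div_cancel _ (Nat.pos_of_ne_zero hn), mul_pow, mul_pow, pow_mul, pow_mul, pow_mul]
      rw [monomialImage, m1, m2, pow_zero, pow_zero, mul_one, mul_one, m5,
        Units.val_pow_eq_pow_val, map_pow]
      exact Ideal.mem_of_dvd _ (sub_dvd_pow_sub_pow _ _ j) hU
  · refine ⟨0, ?_, ?_⟩
    · rw [map_zero, sub_zero]
      refine (maximalIdeal.isMaximal O).isPrime.mem_of_pow_mem n ?_
      rw [h.monomial_pow ht₁ ht₂ he]
      change _ ∈ nonunits O
      rw [map_mem_nonunits_iff, mem_nonunits_iff, ← mem_nonunits_iff, ← mem_maximalIdeal]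
      refine Ideal.mul_mem_left _ _ ?_
      rw [ha, hn₁, ← mul_assoc, Nat.mul_mod_mul_right, hb, ← hn₁, hn₂, ← mul_assoc,
        Nat.mul_mod_mul_right]
      by_cases hi₁ : i * a' % n₁ = 0
      · have hi₂ : i * b' % n₂ ≠ 0 := fun hi₂ => hi (dvd_of_mod_eq_zero ha' hb' hi₁ hi₂)
        exact Ideal.mul_mem_left _ _ (Ideal.pow_mem_of_mem _ ht₂m _
          (Nat.pos_of_ne_zero (mul_ne_zero hi₂ hh₂)))
      · exact Ideal.mul_mem_right _ _ (Ideal.pow_mem_of_mem _ ht₁m _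
          (Nat.pos_of_ne_zero (mul_ne_zero hi₁ hh₁)))
    · rw [map_zero, sub_zero]
      refine Ideal.mul_mem_left _ _ ?_
      by_cases hi₁ : i * a' % n₁ = 0
      · have hi₂ : i * b' % n₂ ≠ 0 := fun hi₂ => hi (dvd_of_mod_eq_zero ha' hb' hi₁ hi₂)
        exact Ideal.mul_mem_left _ _ (Ideal.pow_mem_of_mem _ hw _ (Nat.pos_of_ne_zero hi₂))
      · exact Ideal.mul_mem_right _ _ (Ideal.pow_mem_of_mem _ hz _ (Nat.pos_of_ne_zero hi₁))


variable (hθinj : Function.Injective θ) [IsLocalHom θ]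
  (hθπ : ϖ ^ n = θ (c * (t₁ ^ a * t₂ ^ b)))
  (hsum : ∀ x : O, IsIntegral A x →
    ∃ β : ℕ → A, x = ∑ i ∈ Finset.range n, algebraMap A O (β i) * e i)

include hmA h ht₁ ht₂ he hz hw hϖ hθ₁ hθ₂ ha hn₁ hb hn₂ hn ha' hb' hNa hNb hη hU hθinj hθπ hsum in
/-- The homomorphism `θ` extends to the local ring `O`, with `T ↦ ϖ`. -/
theorem exists_extension : ∃ ψ : O →+* E, (∀ x, ψ (algebraMap A O x) = θ x) ∧ ψ T = ϖ ∧
    (∀ i, ψ (e i) = monomialImage z w c' g₁ g₂ n a b a' b' n₁ n₂ i) ∧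
    (∀ o ∈ maximalIdeal O, ψ o ∈ maximalIdeal E) := by
  obtain ⟨i1, i3, hT, hspan⟩ := h.exists_fraction_data hn
  have hinj : Function.Injective ((algebraMap E (FractionRing E)).comp θ) :=
    (IsFractionRing.injective E (FractionRing E)).comp hθinj
  let i5 : Algebra (FractionRing A) (FractionRing E) := (IsFractionRing.lift hinj).toAlgebra
  have hlift : ∀ x : A, algebraMap (FractionRing A) (FractionRing E) (algebraMap A _ x) =
      algebraMap E (FractionRing E) (θ x) := fun x => IsFractionRing.lift_algebraMap hinj x
  -- The extension is first built on fraction fields, where it only needs an n-th root of the image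
  -- of π; that it takes values in E is shown afterwards.
  obtain ⟨σ, hσ⟩ := exists_algHom_of_pow_eq hn hT h.irreducible hspan
    (F := FractionRing E) (τ := algebraMap E (FractionRing E) ϖ)
    (by rw [← map_pow, hθπ, hlift])
  let ψL : O →+* FractionRing E := (σ : FractionRing O →+* FractionRing E).comp
    (algebraMap O (FractionRing O))
  have hA : ∀ x, ψL (algebraMap A O x) = algebraMap E (FractionRing E) (θ x) := by
    intro x
    change σ (algebraMap O (FractionRing O) (algebraMap A O x)) = _
    rw [← IsScalarTower.algebraMap_apply,
      IsScalarTower.algebraMap_apply A (FractionRing A) (FractionRing O), σ.commutes, hlift]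
  have hTL : ψL T = algebraMap E (FractionRing E) ϖ := hσ
  set ε := monomialImage z w c' g₁ g₂ n a b a' b' n₁ n₂ with hε
  have heL : ∀ i, ψL (e i) = algebraMap E (FractionRing E) (ε i) := by
    intro i
    have h0 : algebraMap E (FractionRing E) (θ (t₁ ^ (i * a / n) * t₂ ^ (i * b / n))) ≠ 0 := by
      rw [map_ne_zero_iff _ (IsFractionRing.injective E (FractionRing E)),
        map_ne_zero_iff _ hθinj]
      exact mul_ne_zero (pow_ne_zero _ ht₁) (pow_ne_zero _ ht₂)
    apply mul_right_cancel₀ h0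
    rw [← map_mul, hε, monomialImage_mul θ c' g₁ g₂ hϖ hθ₁ hθ₂ ha hn₁ hb hn₂ hn, ← hA, ← map_mul,
      he, map_pow, hTL, map_pow]
  -- An integral element and its image are both congruent to one and the same γ of A, and both A → O
  -- and A → E are local, so one is a unit exactly when the other is.
  have hint : ∀ x : O, IsIntegral A x → ∃ y : E, ψL x = algebraMap E (FractionRing E) y ∧
      (x ∈ maximalIdeal O ↔ y ∈ maximalIdeal E) := by
    intro x hx
    obtain ⟨β, hβ⟩ := hsum x hx
    choose α hα using exists_common_residue hmA h ht₁ ht₂ he θ c' g₁ g₂ hz hw ha hn₁ hb hn₂ hn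
      ha' hb' hNa hNb hη hU
    refine ⟨∑ i ∈ Finset.range n, θ (β i) * ε i, ?_, ?_⟩
    · rw [hβ, map_sum, map_sum]
      refine Finset.sum_congr rfl fun i _ => ?_
      rw [map_mul, map_mul, hA, heL]
    · set γ := ∑ i ∈ Finset.range n, β i * α i with hγ
      have r1 : x - algebraMap A O γ ∈ maximalIdeal O := by
        rw [hβ, hγ, map_sum, ← Finset.sum_sub_distrib]
        refine sum_mem fun i _ => ?_
        rw [map_mul, ← mul_sub]
        exact Ideal.mul_mem_left _ _ (hα i).1
      have r2 : (∑ i ∈ Finset.range n, θ (β i) * ε i) - θ γ ∈ maximalIdeal E := by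
        rw [hγ, map_sum, ← Finset.sum_sub_distrib]
        refine sum_mem fun i _ => ?_
        rw [map_mul, ← mul_sub]
        exact Ideal.mul_mem_left _ _ (hα i).2
      have q1 : algebraMap A O γ ∈ maximalIdeal O ↔ γ ∈ maximalIdeal A := by
        simp only [mem_maximalIdeal, map_mem_nonunits_iff]
      have q2 : θ γ ∈ maximalIdeal E ↔ γ ∈ maximalIdeal A := by
        simp only [mem_maximalIdeal, map_mem_nonunits_iff]
      rw [← Ideal.add_mem_iff_right _ r1 (b := algebraMap A O γ), sub_add_cancel] at q1
      rw [← Ideal.add_mem_iff_right _ r2 (b := θ γ), sub_add_cancel] at q2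
      rw [q1, q2]
  obtain ⟨ψ, hψ⟩ := exists_ringHom_of_mem_range (algebraMap E (FractionRing E))
    (IsFractionRing.injective E (FractionRing E)) ψL (by
      intro o
      obtain ⟨x, y, hx, hy, hyu, hxy⟩ := h.exists_integral o
      obtain ⟨x', hx', -⟩ := hint x hx
      obtain ⟨y', hy', hyM⟩ := hint y hy
      have hyu' : IsUnit y' := by
        by_contra h
        exact (mem_maximalIdeal y).1 (hyM.2 h) hyu
      obtain ⟨v, hv⟩ := hyu'.exists_right_inv
      refine ⟨x' * v, ?_⟩
      rw [map_mul, ← hx', ← hxy, map_mul, hy', mul_assoc, ← map_mul, hv, map_one, mul_one])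
  have hinjE := IsFractionRing.injective E (FractionRing E)
  refine ⟨ψ, fun x => hinjE (by rw [hψ, hA]), hinjE (by rw [hψ, hTL]),
    fun i => hinjE (by rw [hψ, heL]), ?_⟩
  intro o ho
  obtain ⟨x, y, hx, hy, hyu, hxy⟩ := h.exists_integral o
  obtain ⟨x', hx', hxM⟩ := hint x hx
  have e1 : ψ x = x' := hinjE (by rw [hψ, hx'])
  have h1 : ψ x ∈ maximalIdeal E := by
    rw [e1, ← hxM, ← hxy]
    exact Ideal.mul_mem_right _ _ ho
  rw [← hxy, map_mul] at h1
  exact ((maximalIdeal.isMaximal E).isPrime.mem_or_mem h1).resolve_right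
    fun h2 => (mem_maximalIdeal _).1 h2 (hyu.map ψ)

end Extension


theorem sum_range_mul {M : Type*} [AddCommMonoid M] (f : ℕ → M) (N g : ℕ) :
    ∑ k ∈ Finset.range (N * g), f k =
      ∑ j ∈ Finset.range g, ∑ i ∈ Finset.range N, f (i + j * N) := by
  induction g with
  | zero => simp
  | succ g ih =>
    rw [Nat.mul_succ, Finset.sum_range_add, ih, Finset.sum_range_succ]
    congr 1
    refine Finset.sum_congr rfl fun i _ => ?_
    rw [add_comm, mul_comm]

/-! ### The comparison of O with the graded part modulo (t₁, t₂) -/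

section Core

variable {S A O E : Type*} [CommRing S] [CommRing A] [IsDomain A] [IsLocalRing A]
  [CommRing O] [IsDomain O] [IsLocalRing O] [Algebra A O] [IsLocalHom (algebraMap A O)]
  [CommRing E] [IsDomain E] [IsLocalRing E] [Algebra S E]
  {D : Subalgebra S E} {ρ : E →+ E} (hρ : IsRetraction D ρ)
  {n : ℕ} {T : O} {c t₁ t₂ : A} {a b : ℕ}
  (hmA : maximalIdeal A = Ideal.span {t₁, t₂})
  {e : ℕ → O}
  {θ : A →+* E} {z w : E} {c' g₁ g₂ : Eˣ} {a' b' n₁ n₂ : ℕ}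
  (hmax : maximalIdeal E = Ideal.span {z, w})
  (hJ : Ideal.span {θ t₁, θ t₂} = Ideal.span {z ^ n₁, w ^ n₂})
  (hn₁ : n₁ ≠ 0) (hn₂ : n₂ ≠ 0)
  (ha' : a'.Coprime n₁) (hb' : b'.Coprime n₂)
  {ψ : O →+* E} (hψA : ∀ x, ψ (algebraMap A O x) = θ x)
  (hψe : ∀ i, ψ (e i) = monomialImage z w c' g₁ g₂ n a b a' b' n₁ n₂ i)
  (hsum : ∀ x : O, IsIntegral A x →
    ∃ β : ℕ → A, x = ∑ i ∈ Finset.range n, algebraMap A O (β i) * e i)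
  (hfrac : ∀ o : O, ∃ x y : O, IsIntegral A x ∧ IsIntegral A y ∧ IsUnit y ∧ o * y = x)
  {r : ℕ} (hr : n₁.gcd n₂ ∣ r * b' + a')
  (hmono : ∀ i j, n₁.gcd n₂ ∣ i + r * j → z ^ i * w ^ j ∈ D)
  (hθD : ∀ x, θ x ∈ D) (hcD : (c' : E) ∈ D) (hg₁D : (g₁ : E) ∈ D) (hg₂D : (g₂ : E) ∈ D)

include hρ hcD hg₁D hg₂D in
omit [IsDomain E] [IsLocalRing E] in
theorem monomialUnit_mem (i : ℕ) : (monomialUnit c' g₁ g₂ n a b i : E) ∈ D := by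
  simp only [monomialUnit, Units.val_mul, Units.val_pow_eq_pow_val]
  exact mul_mem (mul_mem (pow_mem hcD _) (pow_mem (hρ.inv_mem hg₁D g₁.mul_inv) _))
    (pow_mem (hρ.inv_mem hg₂D g₂.mul_inv) _)

theorem dvd_mod_add_mod (hr : n₁.gcd n₂ ∣ r * b' + a') (i : ℕ) :
    n₁.gcd n₂ ∣ i * a' % n₁ + r * (i * b' % n₂) := by
  have h1 : i * a' % n₁ ≡ i * a' [MOD n₁.gcd n₂] :=
    (Nat.mod_modEq _ _).of_dvd (Nat.gcd_dvd_left _ _)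
  have h2 : i * b' % n₂ ≡ i * b' [MOD n₁.gcd n₂] :=
    (Nat.mod_modEq _ _).of_dvd (Nat.gcd_dvd_right _ _)
  have h3 := h1.add (h2.mul_left r)
  rw [← Nat.modEq_zero_iff_dvd]
  refine h3.trans ?_
  rw [Nat.modEq_zero_iff_dvd, show i * a' + r * (i * b') = i * (r * b' + a') by ring]
  exact hr.mul_left i

include hρ hr hmono hθD hcD hg₁D hg₂D hψA hψe hsum hfrac in
omit [IsDomain A] [IsLocalRing A] [IsDomain O] [IsLocalRing O] [IsLocalHom (algebraMap A O)]
  [IsDomain E] [IsLocalRing E] in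
-- The images of the monomials have degree zero, so integral elements land in D. General elements
-- are fractions with unit denominators, and the retract D contains the inverses of its elements
-- that are invertible in E.
theorem extension_mem (o : O) : ψ o ∈ D := by
  have hint : ∀ x, IsIntegral A x → ψ x ∈ D := by
    intro x hx
    obtain ⟨β, rfl⟩ := hsum x hx
    rw [map_sum]
    refine sum_mem fun i _ => ?_
    rw [map_mul, hψA, hψe]
    exact mul_mem (hθD _) (mul_mem (monomialUnit_mem hρ hcD hg₁D hg₂D i)
      (hmono _ _ (dvd_mod_add_mod hr i)))
  obtain ⟨x, y, hx, hy, hyu, hxy⟩ := hfrac o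
  obtain ⟨v, hv⟩ := hyu.exists_right_inv
  have h1 : ψ y * ψ v = 1 := by rw [← map_mul, hv, map_one]
  have h2 : ψ o = ψ x * ψ v := by rw [← hxy, map_mul, mul_assoc, h1, mul_one]
  rw [h2]
  exact mul_mem (hint x hx) (hρ.inv_mem (hint y hy) h1)

variable (hθres : ∀ x ∈ D, ∃ α : A, x - θ α ∈ maximalIdeal E)
  (hgr : ∀ x ∈ D, x ∈ maximalIdeal E → ∃ (F : Finset (ℕ × ℕ)) (δ : ℕ × ℕ → E),
    (∀ m ∈ F, δ m ∈ D ∧ n₁.gcd n₂ ∣ m.1 + r * m.2 ∧ 0 < m.1 + m.2) ∧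
    x - ∑ m ∈ F, δ m * (z ^ m.1 * w ^ m.2) ∈ Ideal.span {z ^ n₁, w ^ n₂})

include hρ hr hθD hcD hg₁D hg₂D hψA hψe hθres hgr hn₁ hn₂ ha' hb' in
omit [IsDomain A] [IsLocalRing A] [IsDomain O] [IsLocalRing O] [IsLocalHom (algebraMap A O)]
  [IsDomain E] in
/-- Every graded monomial with coefficient in `D` is congruent to an element of the image
of `O`. -/
theorem exists_sub_extension_mem (k : ℕ) : ∀ i j, n₁.gcd n₂ ∣ i + r * j → n₁ + n₂ ≤ i + j + k →
    ∀ x ∈ D, ∃ o, x * (z ^ i * w ^ j) - ψ o ∈ Ideal.span {z ^ n₁, w ^ n₂} := by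
  have hzJ : z ^ n₁ ∈ Ideal.span {z ^ n₁, w ^ n₂} := Ideal.subset_span (by simp)
  have hwJ : w ^ n₂ ∈ Ideal.span {z ^ n₁, w ^ n₂} := Ideal.subset_span (by simp)
  have big : ∀ i j, n₁ ≤ i ∨ n₂ ≤ j → ∀ x, x * (z ^ i * w ^ j) ∈ Ideal.span {z ^ n₁, w ^ n₂} := by
    rintro i j (h | h) x
    · exact Ideal.mul_mem_left _ _ (Ideal.mul_mem_right _ _
        (Ideal.mem_of_dvd _ (pow_dvd_pow z h) hzJ))
    · exact Ideal.mul_mem_left _ _ (Ideal.mul_mem_left _ _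
        (Ideal.mem_of_dvd _ (pow_dvd_pow w h) hwJ))
  induction k with
  | zero =>
    intro i j _ hij x _
    exact ⟨0, by rw [map_zero, sub_zero]; exact big i j (by omega) x⟩
  | succ k ih =>
    intro i j hdvd hij x hx
    by_cases hbig : n₁ ≤ i ∨ n₂ ≤ j
    · exact ⟨0, by rw [map_zero, sub_zero]; exact big i j hbig x⟩
    push Not at hbig
    -- Some e l maps to a unit times exactly z ^ i * w ^ j, the exponents being smaller than n₁ and
    -- n₂.
    obtain ⟨l, -, hl₁, hl₂⟩ := exists_mul_modEq ha' hb' hn₁ hn₂ hr hdvd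
    have m1 : l * a' % n₁ = i := by rw [hl₁, Nat.mod_eq_of_lt hbig.1]
    have m2 : l * b' % n₂ = j := by rw [hl₂, Nat.mod_eq_of_lt hbig.2]
    set U : Eˣ := monomialUnit c' g₁ g₂ n a b l with hUdef
    have hUD : (U : E) ∈ D := monomialUnit_mem hρ hcD hg₁D hg₂D l
    have hUiD : ((U⁻¹ : Eˣ) : E) ∈ D := hρ.inv_mem hUD U.mul_inv
    -- Subtracting α e l leaves a coefficient in the maximal ideal. Its expansion involves graded
    -- monomials of positive total degree only, so i + j grows and the budget k decreases.
    obtain ⟨α, hα⟩ := hθres _ (mul_mem hx hUiD)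
    obtain ⟨F, δ, hF, hsub⟩ := hgr (x - θ α * U) (sub_mem hx (mul_mem (hθD α) hUD)) (by
      have : x - θ α * U = (x * ((U⁻¹ : Eˣ) : E) - θ α) * U := by
        rw [sub_mul, mul_assoc, U.inv_mul, mul_one]
      rw [this]
      exact Ideal.mul_mem_right _ _ hα)
    have hterm : ∀ m ∈ F, ∃ o, δ m * (z ^ (i + m.1) * w ^ (j + m.2)) - ψ o ∈
        Ideal.span {z ^ n₁, w ^ n₂} := by
      intro m hm
      obtain ⟨h1, h2, h3⟩ := hF m hm
      refine ih (i + m.1) (j + m.2) ?_ (by omega) _ h1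
      rw [show i + m.1 + r * (j + m.2) = (i + r * j) + (m.1 + r * m.2) by ring]
      exact dvd_add hdvd h2
    choose! o ho using hterm
    refine ⟨algebraMap A O α * e l + ∑ m ∈ F, o m, ?_⟩
    have e1 : x * (z ^ i * w ^ j) - ψ (algebraMap A O α * e l + ∑ m ∈ F, o m) =
        (x - θ α * U - ∑ m ∈ F, δ m * (z ^ m.1 * w ^ m.2)) * (z ^ i * w ^ j) +
        ∑ m ∈ F, (δ m * (z ^ (i + m.1) * w ^ (j + m.2)) - ψ (o m)) := by
      rw [map_add, map_mul, hψA, hψe, monomialImage, m1, m2, ← hUdef, map_sum,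
        Finset.sum_sub_distrib, sub_mul _ (∑ m ∈ F, _), Finset.sum_mul]
      have e2 : ∀ m ∈ F, δ m * (z ^ m.1 * w ^ m.2) * (z ^ i * w ^ j) =
          δ m * (z ^ (i + m.1) * w ^ (j + m.2)) := by intro m _; ring
      rw [Finset.sum_congr rfl e2]
      ring
    rw [e1]
    exact add_mem (Ideal.mul_mem_right _ _ hsub) (sum_mem ho)

variable (hreg : RegPair z w) {g a₁ b₁ : ℕ}
  (hadd : ∀ i j, e (i + j * n₁.lcm n₂) = e i * e (n₁.lcm n₂) ^ j)
  (hpow : e (n₁.lcm n₂) ^ g = algebraMap A O c) (hNg : n₁.lcm n₂ * g = n)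
  {η : A} (hη : e (n₁.lcm n₂) - algebraMap A O η ∈ maximalIdeal O) (hηu : IsUnit η)
  (hg : IsUnit (g : A))

include hη hηu hg hpow in
omit [IsDomain A] [IsDomain O] in
-- Factor e N ^ g - η ^ g, which equals c - η ^ g and lies in the maximal ideal of A. The cofactor
-- of e N - η has residue g η ^ (g - 1), a unit. So a congruence modulo the maximal ideal of O
-- improves to one modulo (t₁, t₂).
theorem monomial_sub_mem : e (n₁.lcm n₂) - algebraMap A O η ∈
    (maximalIdeal A).map (algebraMap A O) := by
  set x := e (n₁.lcm n₂)
  have h1 : c - η ^ g ∈ maximalIdeal A := by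
    have h2 : algebraMap A O (c - η ^ g) ∈ maximalIdeal O := by
      rw [map_sub, ← hpow, map_pow]
      exact Ideal.mem_of_dvd _ (sub_dvd_pow_sub_pow _ _ g) hη
    simpa only [mem_maximalIdeal, map_mem_nonunits_iff] using h2
  have h2 := (Commute.all x (algebraMap A O η)).geom_sum₂_mul g
  have h3 : IsUnit (∑ i ∈ Finset.range g, x ^ i * algebraMap A O η ^ (g - 1 - i)) := by
    have h4 : (∑ i ∈ Finset.range g, x ^ i * algebraMap A O η ^ (g - 1 - i)) -
        algebraMap A O (g * η ^ (g - 1)) ∈ maximalIdeal O := by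
      have : algebraMap A O (g * η ^ (g - 1)) =
          ∑ i ∈ Finset.range g, algebraMap A O η ^ i * algebraMap A O η ^ (g - 1 - i) := by
        rw [Finset.sum_congr rfl (g := fun i => algebraMap A O (η ^ (g - 1)))]
        · simp
        · intro i hi
          rw [Finset.mem_range] at hi
          rw [← pow_add, map_pow]
          congr 1
          omega
      rw [this, ← Finset.sum_sub_distrib]
      refine sum_mem fun i _ => ?_
      rw [← sub_mul]
      exact Ideal.mul_mem_right _ _ (Ideal.mem_of_dvd _ (sub_dvd_pow_sub_pow _ _ i) hη)
    by_contra h5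
    have h6 := sub_mem (show _ ∈ maximalIdeal O from h5) h4
    rw [sub_sub_cancel] at h6
    exact (mem_maximalIdeal _).1 h6 ((hg.mul (hηu.pow _)).map _)
  obtain ⟨v, hv⟩ := h3.exists_right_inv
  have h5 : x - algebraMap A O η = v * algebraMap A O (c - η ^ g) := by
    rw [map_sub, ← hpow, map_pow, ← h2]
    linear_combination -(x - algebraMap A O η) * hv
  rw [h5]
  exact Ideal.mul_mem_left _ _ (Ideal.mem_map_of_mem _ h1)

include hmA hmax hJ hn₁ hn₂ ha' hb' hψA hψe hsum hfrac hreg hadd hpow hNg hη hηu hg in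
omit [IsDomain A] [IsDomain O] [IsDomain E] in
theorem mem_span_of_extension_mem [IsLocalHom θ] (o : O)
    (ho : ψ o ∈ Ideal.span {θ t₁, θ t₂}) :
    o ∈ Ideal.span {algebraMap A O t₁, algebraMap A O t₂} := by
  classical
  have hN : 0 < n₁.lcm n₂ := Nat.lcm_pos (Nat.pos_of_ne_zero hn₁) (Nat.pos_of_ne_zero hn₂)
  set N := n₁.lcm n₂ with hNdef
  set I := Ideal.span {algebraMap A O t₁, algebraMap A O t₂} with hI
  have hImap : (maximalIdeal A).map (algebraMap A O) = I := by
    rw [hmA, Ideal.map_span, Set.image_pair]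
  have hIJ : ∀ x ∈ I, ψ x ∈ Ideal.span {θ t₁, θ t₂} := by
    intro x hx
    have := Ideal.mem_map_of_mem ψ hx
    rw [hI, Ideal.map_span, Set.image_pair, hψA, hψA] at this
    exact this
  have hsubη := monomial_sub_mem (n₁ := n₁) (n₂ := n₂) hpow hη hηu hg
  rw [hImap] at hsubη
  obtain ⟨x, y, hx, hy, hyu, hxy⟩ := hfrac o
  have hxJ : ψ x ∈ Ideal.span {θ t₁, θ t₂} := by
    rw [← hxy, map_mul]
    exact Ideal.mul_mem_right _ _ ho
  suffices hxI : x ∈ I by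
    obtain ⟨v, hv⟩ := hyu.exists_right_inv
    have : o = x * v := by rw [← hxy, mul_assoc, hv, mul_one]
    rw [this]
    exact Ideal.mul_mem_right _ _ hxI
  obtain ⟨β, hβ⟩ := hsum x hx
  -- Modulo (t₁, t₂) the element e N may be replaced by η, which folds the n monomials into the N
  -- with index below N.
  let γ : ℕ → A := fun i => ∑ j ∈ Finset.range g, β (i + j * N) * η ^ j
  have hγ : x - ∑ i ∈ Finset.range N, algebraMap A O (γ i) * e i ∈ I := by
    have e1 : x = ∑ i ∈ Finset.range N, ∑ j ∈ Finset.range g,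
        algebraMap A O (β (i + j * N)) * e (i + j * N) := by
      rw [hβ, ← hNg, Finset.sum_comm, sum_range_mul]
    rw [e1, ← Finset.sum_sub_distrib]
    refine sum_mem fun i _ => ?_
    rw [map_sum, Finset.sum_mul, ← Finset.sum_sub_distrib]
    refine sum_mem fun j _ => ?_
    have e2 : algebraMap A O (β (i + j * N)) * e (i + j * N) -
        algebraMap A O (β (i + j * N) * η ^ j) * e i =
        algebraMap A O (β (i + j * N)) * e i * (e N ^ j - algebraMap A O η ^ j) := by
      rw [hadd, map_mul, map_pow]
      ring
    rw [e2]
    exact Ideal.mul_mem_left _ _ (Ideal.mem_of_dvd _ (sub_dvd_pow_sub_pow _ _ j) hsubη)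
  -- Terms with nonunit coefficient already lie in (t₁, t₂) O. The images of the others are unit
  -- multiples of distinct monomials in the box, so independence leaves no such term.
  let F := (Finset.range N).filter fun i => IsUnit (γ i)
  have hF : x - ∑ i ∈ F, algebraMap A O (γ i) * e i ∈ I := by
    have e1 : x - ∑ i ∈ F, algebraMap A O (γ i) * e i =
        (x - ∑ i ∈ Finset.range N, algebraMap A O (γ i) * e i) +
        ∑ i ∈ (Finset.range N).filter fun i => ¬ IsUnit (γ i), algebraMap A O (γ i) * e i := by
      rw [← Finset.sum_filter_add_sum_filter_not (Finset.range N) fun i => IsUnit (γ i)]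
      ring
    rw [e1]
    refine add_mem hγ (sum_mem fun i hi => ?_)
    rw [← hImap]
    exact Ideal.mul_mem_right _ _ (Ideal.mem_map_of_mem _ (Finset.mem_filter.1 hi).2)
  have hFJ : ∑ i ∈ F, (θ (γ i) * monomialUnit c' g₁ g₂ n a b i) *
      (z ^ (i * a' % n₁) * w ^ (i * b' % n₂)) ∈ Ideal.span {z ^ n₁, w ^ n₂} := by
    rw [← hJ]
    have := sub_mem hxJ (hIJ _ hF)
    rw [← map_sub, sub_sub_cancel, map_sum] at this
    convert this using 2
    rw [map_mul, hψA, hψe, mul_assoc]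
  have hempty := eq_empty_of_sum_mem hreg
    (by rw [hmax]; exact Ideal.subset_span (by simp))
    (by rw [hmax]; exact Ideal.subset_span (by simp)) F
    (fun i => θ (γ i) * monomialUnit c' g₁ g₂ n a b i) (fun i => i * a' % n₁)
    (fun i => i * b' % n₂)
    (fun i hi => ((Finset.mem_filter.1 hi).2.map θ).mul (Units.isUnit _))
    (fun i _ => Nat.mod_lt _ (Nat.pos_of_ne_zero hn₁))
    (fun i _ => Nat.mod_lt _ (Nat.pos_of_ne_zero hn₂))
    (fun i hi j hj h1 h2 => eq_of_mul_modEq ha' hb'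
      (Finset.mem_range.1 (Finset.mem_filter.1 hi).1)
      (Finset.mem_range.1 (Finset.mem_filter.1 hj).1) h1 h2) hFJ
  rw [hempty, Finset.sum_empty, sub_zero] at hF
  exact hF

end Core


theorem mem_span_X_pow_of_coeff {S : Type u} [CommRing S] {n₁ n₂ : ℕ}
    {f : MvPowerSeries (Fin 2) S}
    (h : ∀ m : Fin 2 →₀ ℕ, m 0 < n₁ → m 1 < n₂ → MvPowerSeries.coeff m f = 0) :
    f ∈ Ideal.span {(MvPowerSeries.X 0 ^ n₁ : MvPowerSeries (Fin 2) S),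
      MvPowerSeries.X 1 ^ n₂} := by
  obtain ⟨g, hg⟩ := exists_eq_X_pow_mul_add_restrictSupport 0 n₁ f
  have h2 : MvPowerSeries.X 1 ^ n₂ ∣ restrictSupport (fun m => m 0 < n₁) f := by
    rw [MvPowerSeries.X_pow_dvd_iff]
    intro m hm
    rw [coeff_restrictSupport]
    split_ifs with h0
    · exact h m h0 hm
    · rfl
  rw [hg]
  exact add_mem (Ideal.mul_mem_right _ _ (Ideal.subset_span (by simp)))
    (Ideal.mem_of_dvd _ h2 (Ideal.subset_span (by simp)))

/-! ### Truncated expansion of graded elements -/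

section GradedFiltration

variable {S : Type u} [CommRing S] [IsLocalRing S] {ϖ : S} (hϖ : maximalIdeal S = Ideal.span {ϖ})
  {c : MvPowerSeries (Fin 2) S} {a b d r : ℕ} (hb : 0 < b)

include hϖ hb in
theorem gradedPart_filtration (hc : c ∈ gradedSeries S d r) (hd : d ∣ a + r * b) (n₁ n₂ : ℕ)
    {x : BranchRing ϖ c a b} (hx : x ∈ gradedPart ϖ c a b d r)
    (hxm : x ∈ Ideal.span {BranchRing.z ϖ c a b, BranchRing.w ϖ c a b}) :
    ∃ (F : Finset (ℕ × ℕ)) (δ : ℕ × ℕ → BranchRing ϖ c a b),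
      (∀ m ∈ F, δ m ∈ gradedPart ϖ c a b d r ∧ d ∣ m.1 + r * m.2 ∧ 0 < m.1 + m.2) ∧
      x - ∑ m ∈ F, δ m * (BranchRing.z ϖ c a b ^ m.1 * BranchRing.w ϖ c a b ^ m.2) ∈
        Ideal.span {BranchRing.z ϖ c a b ^ n₁, BranchRing.w ϖ c a b ^ n₂} := by
  classical
  obtain ⟨f, hf, rfl⟩ := hx
  change BranchRing.mk ϖ c a b f ∈ _ at hxm
  rw [BranchRing.mk_mem_span_iff hϖ hb] at hxm
  have hxm' : MvPowerSeries.constantCoeff f ∈ maximalIdeal S := hxm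
  rw [hϖ, Ideal.mem_span_singleton] at hxm'
  obtain ⟨s, hs⟩ := hxm'
  -- The constant coefficient of f is s ϖ. Subtracting this multiple of the equation, itself of
  -- degree zero, removes it, so that only monomials of positive total degree occur.
  set f' := f - MvPowerSeries.C s * branch ϖ c a b with hf'
  have hf'g : f' ∈ gradedSeries S d r :=
    sub_mem hf (mul_mem (degreeZero_C d r s) (branch_mem_gradedSeries hc hd))
  have hf'0 : MvPowerSeries.constantCoeff f' = 0 := by
    rw [hf', map_sub, map_mul, hs, constantCoeff_branch hb, MvPowerSeries.constantCoeff_C]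
    ring
  have hmk : BranchRing.mk ϖ c a b f' = BranchRing.mk ϖ c a b f := by
    rw [← sub_eq_zero, ← map_sub, BranchRing.mk_eq_zero_iff]
    exact ⟨-MvPowerSeries.C s, by rw [hf']; ring⟩
  let mon : ℕ × ℕ → (Fin 2 →₀ ℕ) := fun m => Finsupp.single 0 m.1 + Finsupp.single 1 m.2
  have mon0 : ∀ m, mon m 0 = m.1 := fun m => by simp [mon]
  have mon1 : ∀ m, mon m 1 = m.2 := fun m => by simp [mon]
  have hmon : ∀ m : Fin 2 →₀ ℕ, mon (m 0, m 1) = m := by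
    intro m
    ext i
    fin_cases i
    · exact mon0 _
    · exact mon1 _
  let F := (Finset.range n₁ ×ˢ Finset.range n₂).filter fun m => MvPowerSeries.coeff (mon m) f' ≠ 0
  refine ⟨F, fun m => BranchRing.mk ϖ c a b (.C (MvPowerSeries.coeff (mon m) f')), ?_, ?_⟩
  · intro m hm
    have h1 := (Finset.mem_filter.1 hm).2
    rw [mem_gradedSeries, degreeZero_eq_self_iff] at hf'g
    have h2 := hf'g _ h1
    rw [mon0, mon1] at h2
    refine ⟨mk_mem_gradedPart (degreeZero_C d r _), h2, ?_⟩
    by_contra h3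
    have h4 : m = (0, 0) := by ext <;> simp <;> omega
    apply h1
    rw [h4]
    have : mon (0, 0) = 0 := by simp [mon]
    rw [this]
    exact hf'0
  · change BranchRing.mk ϖ c a b f - _ ∈ _
    rw [← hmk]
    have key : f' - ∑ m ∈ F, MvPowerSeries.C (MvPowerSeries.coeff (mon m) f') *
        (MvPowerSeries.X 0 ^ m.1 * MvPowerSeries.X 1 ^ m.2) ∈
        Ideal.span {(MvPowerSeries.X 0 ^ n₁ : MvPowerSeries (Fin 2) S),
          MvPowerSeries.X 1 ^ n₂} := by
      refine mem_span_X_pow_of_coeff fun m h1 h2 => ?_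
      have hterm : ∀ l : ℕ × ℕ, MvPowerSeries.coeff m
          (MvPowerSeries.C (MvPowerSeries.coeff (mon l) f') *
          (MvPowerSeries.X 0 ^ l.1 * MvPowerSeries.X 1 ^ l.2)) =
          if l = (m 0, m 1) then MvPowerSeries.coeff m f' else 0 := by
        intro l
        rw [MvPowerSeries.X_pow_eq, MvPowerSeries.X_pow_eq, MvPowerSeries.monomial_mul_monomial,
          MvPowerSeries.coeff_C_mul, MvPowerSeries.coeff_monomial]
        by_cases hl : l = (m 0, m 1)
        · rw [if_pos hl, hl, hmon, if_pos, one_mul, mul_one]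
          exact (hmon m).symm
        · rw [if_neg hl, if_neg, mul_zero]
          intro h
          apply hl
          rw [h]
          ext
          · exact (mon0 l).symm
          · exact (mon1 l).symm
      rw [map_sub, map_sum, Finset.sum_congr rfl fun l _ => hterm l, Finset.sum_ite_eq']
      split_ifs with hF
      · exact sub_self _
      · rw [sub_zero]
        by_contra h3
        apply hF
        refine Finset.mem_filter.2 ⟨?_, ?_⟩
        · simp [h1, h2]
        · rw [hmon]
          exact h3
    have := Ideal.mem_map_of_mem (BranchRing.mk ϖ c a b) key
    rw [Ideal.map_span, Set.image_pair] at this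
    simpa only [map_sub, map_sum, map_mul, map_pow] using this

end GradedFiltration

/-! ### The substitution on quotient rings -/

section SubstHom

variable {R : Type u} {S : Type u} [CommRing R] [CommRing S] [Algebra R S] {π : R} {ϖ : S} {n : ℕ}
  {c₀ c : MvPowerSeries (Fin 2) R} {a b a' b' n₁ n₂ h₁ h₂ : ℕ}

/-- The substitution `u ↦ z ^ n₁`, `v ↦ w ^ n₂`. -/
noncomputable abbrev substPow (S : Type u) [CommRing S] [Algebra R S] (n₁ n₂ : ℕ)
    (f : MvPowerSeries (Fin 2) R) : MvPowerSeries (Fin 2) S :=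
  MvPowerSeries.subst (![MvPowerSeries.X 0 ^ n₁, MvPowerSeries.X 1 ^ n₂] :
    Fin 2 → MvPowerSeries (Fin 2) S) f

/-- The n-th power of ϖ = c' z^a' w^b' is the image of π = c₀ u^a v^b, by a' n = n₁ a, b' n = n₂ b
and c ^ n = c₀. -/
theorem exists_substHom (hϖn : ϖ ^ n = algebraMap R S π) (hc : c ^ n = c₀)
    (hn₁0 : n₁ ≠ 0) (hn₂0 : n₂ ≠ 0)
    (ha : a = a' * h₁) (hn₁ : n = n₁ * h₁) (hb : b = b' * h₂) (hn₂ : n = n₂ * h₂) :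
    ∃ q : BranchRing π c₀ a b →+* BranchRing ϖ (substPow S n₁ n₂ c) a' b',
      (∀ f, q (BranchRing.mk π c₀ a b f) = BranchRing.mk _ _ _ _ (substPow S n₁ n₂ f)) ∧
      (∀ x : R, q (algebraMap R _ x) = algebraMap S _ (algebraMap R S x)) ∧
      q (BranchRing.z π c₀ a b) = BranchRing.z _ _ _ _ ^ n₁ ∧
      q (BranchRing.w π c₀ a b) = BranchRing.w _ _ _ _ ^ n₂ := by
  have hs := hasSubst_X_pow (S := S) hn₁0 hn₂0
  set c' := substPow S n₁ n₂ c with hc'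
  let sub : MvPowerSeries (Fin 2) R →ₐ[R] MvPowerSeries (Fin 2) S := MvPowerSeries.substAlgHom hs
  let Φ : MvPowerSeries (Fin 2) R →+* BranchRing ϖ c' a' b' :=
    (BranchRing.mk ϖ c' a' b').toRingHom.comp (sub : MvPowerSeries (Fin 2) R →+* _)
  have hΦ : ∀ f, Φ f = BranchRing.mk ϖ c' a' b' (substPow S n₁ n₂ f) := by
    intro f
    change BranchRing.mk ϖ c' a' b' (MvPowerSeries.substAlgHom hs f) = _
    rw [MvPowerSeries.substAlgHom_apply]
  have hΦC : ∀ x : R, Φ (MvPowerSeries.C x) = algebraMap S _ (algebraMap R S x) := by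
    intro x
    change BranchRing.mk ϖ c' a' b' (MvPowerSeries.substAlgHom hs
      (algebraMap R (MvPowerSeries (Fin 2) R) x)) = _
    rw [AlgHom.commutes, ← (BranchRing.mk ϖ c' a' b').commutes, MvPowerSeries.algebraMap_apply,
      MvPowerSeries.algebraMap_apply, Algebra.algebraMap_self, RingHom.id_apply]
  have hΦ0 : Φ (MvPowerSeries.X 0) = BranchRing.z ϖ c' a' b' ^ n₁ := by
    change BranchRing.mk ϖ c' a' b' (MvPowerSeries.substAlgHom hs (MvPowerSeries.X 0)) = _
    rw [MvPowerSeries.substAlgHom_X, ← map_pow]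
    rfl
  have hΦ1 : Φ (MvPowerSeries.X 1) = BranchRing.w ϖ c' a' b' ^ n₂ := by
    change BranchRing.mk ϖ c' a' b' (MvPowerSeries.substAlgHom hs (MvPowerSeries.X 1)) = _
    rw [MvPowerSeries.substAlgHom_X, ← map_pow]
    rfl
  have hker : ∀ f ∈ Ideal.span {branch π c₀ a b}, Φ f = 0 := by
    have h0 : Φ (branch π c₀ a b) = 0 := by
      change Φ (.C π - c₀ * (.X 0 ^ a * .X 1 ^ b)) = 0
      rw [map_sub, map_mul, map_mul, map_pow, map_pow, hΦC, hΦ0, hΦ1, ← hϖn, map_pow,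
        BranchRing.algebraMap_eq, ← hc, map_pow, hΦ, ← hc', ← pow_mul, ← pow_mul, mul_pow, mul_pow,
        ← pow_mul, ← pow_mul]
      have e1 : a' * n = n₁ * a := by rw [ha, hn₁]; ring
      have e2 : b' * n = n₂ * b := by rw [hb, hn₂]; ring
      rw [e1, e2, sub_self]
    intro f hf
    obtain ⟨g, rfl⟩ := Ideal.mem_span_singleton.1 hf
    rw [map_mul, h0, zero_mul]
  refine ⟨Ideal.Quotient.lift _ Φ hker, fun f => ?_, fun x => ?_, ?_, ?_⟩
  · exact hΦ f
  · exact hΦC x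
  · exact hΦ0
  · exact hΦ1

end SubstHom


/-! ### The completion of O as a graded part -/

section Main

variable {R S A O : Type u} [CommRing R] [IsLocalRing R] [IsAlgClosed (ResidueField R)]
  [CommRing S] [IsDomain S] [IsLocalRing S] [IsNoetherianRing S] [Algebra R S]
  [IsLocalHom (algebraMap R S)]
  [CommRing A] [IsDomain A] [IsLocalRing A] [IsNoetherianRing A] [IsIntegrallyClosed A]
  [Algebra R A] [IsAlgClosed (ResidueField A)]
  [CommRing O] [IsDomain O] [IsLocalRing O] [Algebra A O] [IsLocalHom (algebraMap A O)]
  [Algebra S O]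

omit [IsAlgClosed (ResidueField R)] [IsDomain S] [IsNoetherianRing S] in
theorem isLocalHom_substHom {π : R} {ϖ : S} {c₀ c : MvPowerSeries (Fin 2) R}
    {a b a' b' n₁ n₂ : ℕ} (hπ : maximalIdeal R = Ideal.span {π})
    (hϖ : maximalIdeal S = Ideal.span {ϖ}) (hb : 0 < b) (hb' : 0 < b')
    (hn₁ : n₁ ≠ 0) (hn₂ : n₂ ≠ 0)
    {q : BranchRing π c₀ a b →+* BranchRing ϖ (substPow S n₁ n₂ c) a' b'}
    (hq : ∀ f, q (BranchRing.mk π c₀ a b f) = BranchRing.mk _ _ _ _ (substPow S n₁ n₂ f)) :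
    IsLocalHom q where
  map_nonunit x hx := by
    obtain ⟨f, rfl⟩ := BranchRing.mk_surjective π c₀ a b x
    rw [hq, BranchRing.isUnit_mk_iff hϖ hb', constantCoeff_subst_X_pow hn₁ hn₂,
      isUnit_map_iff] at hx
    rwa [BranchRing.isUnit_mk_iff hπ hb]

/-- The completion of the local ring `O` of the normalization, in terms of the completion of `A`. -/
theorem exists_completion_equiv_gradedPart {π : R} {ϖ : S} (hπ : maximalIdeal R = Ideal.span {π})
    (hπ0 : π ≠ 0) [IsDomain R] [IsNoetherianRing R]
    (hϖ : maximalIdeal S = Ideal.span {ϖ}) (hϖ0 : ϖ ≠ 0) {n : ℕ}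
    (hϖn : ϖ ^ n = algebraMap R S π) (hadj : Algebra.adjoin R {ϖ} = ⊤)
    (hres : ∀ s : S, ∃ x : R, s - algebraMap R S x ∈ Ideal.span {ϖ})
    {c₀ : MvPowerSeries (Fin 2) R} {a b : ℕ} (hb : 0 < b)
    {c₁ t₁ t₂ : A} (hc₁ : IsUnit c₁) (hmA : maximalIdeal A = Ideal.span {t₁, t₂})
    (ht₁ : t₁ ≠ 0) (ht₂ : t₂ ≠ 0) (hrad : IsRadical (t₁ * t₂))
    (hπA : algebraMap R A π = c₁ * (t₁ ^ a * t₂ ^ b))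
    (φ : A →+* BranchRing π c₀ a b) [IsLocalHom φ]
    (hφR : ∀ x, φ (algebraMap R A x) = algebraMap R _ x)
    {γ₁ γ₂ δ : BranchRing π c₀ a b} (hγ₁ : IsUnit γ₁) (hγ₂ : IsUnit γ₂) (hδ : a ≠ 0 → δ = 0)
    (hφ₁ : φ t₁ = γ₁ * BranchRing.z π c₀ a b + δ * BranchRing.w π c₀ a b)
    (hφ₂ : φ t₂ = γ₂ * BranchRing.w π c₀ a b)
    (hn : IsUnit (n : A)) {ζ : A} (hζ : IsPrimitiveRoot ζ n)
    (h : IsNormalizedRootExtension n (c₁ * (t₁ ^ a * t₂ ^ b)) (algebraMap S O ϖ))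
    (hcomp : ∀ x : R, algebraMap S O (algebraMap R S x) = algebraMap A O (algebraMap R A x))
    {a' b' n₁ n₂ h₁ h₂ : ℕ}
    (ha : a = a' * h₁) (hn₁ : n = n₁ * h₁) (hbb : b = b' * h₂) (hn₂ : n = n₂ * h₂)
    (ha' : a'.Coprime n₁) (hb' : b'.Coprime n₂)
    {r : ℕ} (hr : n₁.gcd n₂ ∣ r * b' + a') :
    ∃ κ : ResidueField R, κ ^ n = residue R (MvPowerSeries.constantCoeff c₀) ∧
      ∀ c : MvPowerSeries (Fin 2) R, c ^ n = c₀ → IsUnit c →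
        residue R (MvPowerSeries.constantCoeff c) = κ →
        ∃ e : AdicCompletion (maximalIdeal O) O ≃+*
          gradedPart ϖ (substPow S n₁ n₂ c) a' b' (n₁.gcd n₂) r,
          ∀ s : S, e (algebraMap O _ (algebraMap S O s)) = algebraMap S _ s := by
  have hn0 : n ≠ 0 := by rintro rfl; simp at hn
  have hn₁0 : n₁ ≠ 0 := by rintro rfl; simp at hn₁; exact hn0 hn₁
  have hn₂0 : n₂ ≠ 0 := by rintro rfl; simp at hn₂; exact hn0 hn₂
  have hb'0 : 0 < b' := Nat.pos_of_ne_zero (by rintro rfl; simp at hbb; omega)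
  set N := n₁.lcm n₂ with hN
  have hN0 : N ≠ 0 := Nat.lcm_ne_zero hn₁0 hn₂0
  obtain ⟨k₁, hk₁⟩ : n₁ ∣ N := Nat.dvd_lcm_left _ _
  obtain ⟨k₂, hk₂⟩ : n₂ ∣ N := Nat.dvd_lcm_right _ _
  obtain ⟨g, hg⟩ : N ∣ n := Nat.lcm_dvd ⟨h₁, hn₁⟩ ⟨h₂, hn₂⟩
  have hh₁ : h₁ = k₁ * g := by
    apply Nat.eq_of_mul_eq_mul_left (Nat.pos_of_ne_zero hn₁0)
    rw [← hn₁, hg, hk₁, mul_assoc]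
  have hh₂ : h₂ = k₂ * g := by
    apply Nat.eq_of_mul_eq_mul_left (Nat.pos_of_ne_zero hn₂0)
    rw [← hn₂, hg, hk₂, mul_assoc]
  set a₁ := a' * k₁ with ha₁
  set b₁ := b' * k₂ with hb₁
  have hga : g * a₁ = a := by rw [ha, hh₁, ha₁]; ring
  have hgb : g * b₁ = b := by rw [hbb, hh₂, hb₁]; ring
  have hNa : N * a = a₁ * n := by rw [hg, ← hga]; ring
  have hNb : N * b = b₁ * n := by rw [hg, ← hgb]; ring
  obtain ⟨e, he⟩ := h.exists_monomials hn0 ht₁ ht₂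
  have hpow := h.monomial_pow_eq ht₁ ht₂ he hn0 hNa hNb hga hgb hg.symm
  have hadd := h.monomial_add ht₁ ht₂ he hn0 hNa hNb
  have hsum : ∀ x : O, IsIntegral A x → _ := fun x hx =>
    h.exists_eq_sum hn hζ hc₁ ht₁ ht₂ hrad he hx
  obtain ⟨η, hη⟩ := exists_sub_mem_maximalIdeal (A := A) (x := e N) (by
    refine IsIntegral.of_pow (Nat.pos_of_ne_zero hn0) ?_
    rw [h.monomial_pow ht₁ ht₂ he]
    exact isIntegral_algebraMap)
  have hg0 : g ≠ 0 := by rintro rfl; exact hn0 (by rw [hg, mul_zero])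
  have hgu : IsUnit (g : A) := by
    rw [hg] at hn
    push_cast at hn
    exact isUnit_of_mul_isUnit_right hn
  have heu : IsUnit (e N) := by
    rw [← isUnit_pow_iff hg0, hpow]
    exact hc₁.map _
  have hηu : IsUnit η := by
    by_contra h1
    have h2 : algebraMap A O η ∈ maximalIdeal O := by
      rw [mem_maximalIdeal, map_mem_nonunits_iff]
      exact h1
    have h3 := add_mem hη h2
    rw [sub_add_cancel] at h3
    exact (mem_maximalIdeal _).1 h3 heu
  have hηc : c₁ - η ^ g ∈ maximalIdeal A := by
    have h2 : algebraMap A O (c₁ - η ^ g) ∈ maximalIdeal O := by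
      rw [map_sub, ← hpow, map_pow]
      exact Ideal.mem_of_dvd _ (sub_dvd_pow_sub_pow _ _ g) hη
    simpa only [mem_maximalIdeal, map_mem_nonunits_iff] using h2
  have hQl := BranchRing.isLocalRing (c := c₀) (a := a) hπ hb
  have hQd := BranchRing.isDomain (c := c₀) (a := a) hπ hb hπ0
  have hQres : ∀ f, BranchRing.mk π c₀ a b f ∈ maximalIdeal _ ↔
      residue R (MvPowerSeries.constantCoeff f) = 0 := by
    intro f
    rw [BranchRing.maximalIdeal_eq hπ hb, BranchRing.mk_mem_span_iff hπ hb, residue_eq_zero_iff]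
    rfl
  -- The image of e N will be c ^ N γ₁ ^ (-a₁) γ₂ ^ (-b₁). It must have the residue of η, so the
  -- N-th power of the residue κ of c has to be that of fω; any N-th root will do.
  obtain ⟨fω, hfω⟩ := BranchRing.mk_surjective π c₀ a b (φ η * (γ₁ ^ a₁ * γ₂ ^ b₁))
  have hw0 : BranchRing.w π c₀ a b ≠ 0 := fun h0 =>
    one_ne_zero (BranchRing.w_mul_eq_zero (c := c₀) (a := a) hb hπ0 (x := 1) (by rw [h0]; simp))
  have hz0 : BranchRing.z π c₀ a b ≠ 0 := fun h0 =>
    BranchRing.not_w_dvd_z (c := c₀) (a := a) hπ hb (by rw [h0]; exact dvd_zero _)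
  -- Cancel z ^ a * w ^ b between the two expressions for π in the domain Q.
  have hc₀Q : BranchRing.mk π c₀ a b c₀ = φ c₁ * (γ₁ ^ a * γ₂ ^ b) := by
    have h1 := congrArg φ hπA
    rw [hφR, BranchRing.algebraMap_eq, map_mul, map_mul, map_pow, map_pow, hφ₂] at h1
    have h2 : φ t₁ ^ a = (γ₁ * BranchRing.z π c₀ a b) ^ a := by
      by_cases h0 : a = 0
      · have e0 : ∀ (m : ℕ) (x y : BranchRing π c₀ a b), m = 0 → x ^ m = y ^ m := by
          rintro _ x y rfl
          rw [pow_zero, pow_zero]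
        exact e0 _ _ _ h0
      · rw [hφ₁, hδ h0, zero_mul, add_zero]
    rw [h2] at h1
    apply mul_right_cancel₀ (mul_ne_zero (pow_ne_zero a hz0) (pow_ne_zero b hw0))
    rw [h1]
    ring
  obtain ⟨κ, hκ⟩ := IsAlgClosed.exists_pow_nat_eq (residue R (MvPowerSeries.constantCoeff fω))
    (Nat.pos_of_ne_zero hN0)
  refine ⟨κ, ?_, ?_⟩
  · have h1 : BranchRing.mk π c₀ a b (c₀ - fω ^ g) ∈ maximalIdeal _ := by
      rw [map_sub, map_pow, hfω, hc₀Q]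
      have h2 : φ c₁ * (γ₁ ^ a * γ₂ ^ b) - (φ η * (γ₁ ^ a₁ * γ₂ ^ b₁)) ^ g =
          φ (c₁ - η ^ g) * (γ₁ ^ a * γ₂ ^ b) := by
        have e1 : γ₁ ^ a = (γ₁ ^ a₁) ^ g := by rw [← pow_mul, mul_comm, hga]
        have e2 : γ₂ ^ b = (γ₂ ^ b₁) ^ g := by rw [← pow_mul, mul_comm, hgb]
        rw [e1, e2, map_sub, map_pow]
        ring
      rw [h2]
      refine Ideal.mul_mem_right _ _ ?_
      rw [mem_maximalIdeal, map_mem_nonunits_iff]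
      exact hηc
    rw [hQres, map_sub, map_sub, sub_eq_zero, map_pow, map_pow] at h1
    rw [h1, ← hκ, ← pow_mul, ← hg]
  intro c hc hcu hcκ
  set c' := substPow S n₁ n₂ c with hc'
  obtain ⟨q, hq, hqR, hqz, hqw⟩ :
      ∃ q : BranchRing π c₀ a b →+* BranchRing ϖ c' a' b',
        (∀ f, q (BranchRing.mk π c₀ a b f) = BranchRing.mk ϖ c' a' b' (substPow S n₁ n₂ f)) ∧
        (∀ x : R, q (algebraMap R _ x) = algebraMap S _ (algebraMap R S x)) ∧
        q (BranchRing.z π c₀ a b) = BranchRing.z ϖ c' a' b' ^ n₁ ∧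
        q (BranchRing.w π c₀ a b) = BranchRing.w ϖ c' a' b' ^ n₂ :=
    exists_substHom (c := c) hϖn hc hn₁0 hn₂0 ha hn₁ hbb hn₂
  have hEl := BranchRing.isLocalRing (c := c') (a := a') hϖ hb'0
  have hEd := BranchRing.isDomain (c := c') (a := a') hϖ hb'0 hϖ0
  have hEc := BranchRing.isAdicComplete (c := c') (a := a') hϖ hb'0
  have hmax := BranchRing.maximalIdeal_eq (c := c') (a := a') hϖ hb'0
  have hreg := BranchRing.regPair (c := c') (a := a') hϖ hb'0 hϖ0
  have hql : IsLocalHom q := isLocalHom_substHom hπ hϖ hb hb'0 hn₁0 hn₂0 hq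
  have hd₁ : n₁.gcd n₂ ∣ n₁ := Nat.gcd_dvd_left _ _
  have hd₂ : n₁.gcd n₂ ∣ n₂ := Nat.gcd_dvd_right _ _
  have hr' : n₁.gcd n₂ ∣ a' + r * b' := by rwa [add_comm]
  have hc'g : c' ∈ gradedSeries S (n₁.gcd n₂) r := subst_mem_gradedSeries hn₁0 hn₂0 hd₁ hd₂ c
  obtain ⟨ρ, hρ, -⟩ := exists_isRetraction_gradedPart (ϖ := ϖ) hc'g hr'
  set E := BranchRing ϖ c' a' b'
  set z : E := BranchRing.z ϖ c' a' b' with hz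
  set w : E := BranchRing.w ϖ c' a' b' with hw
  have hqD : ∀ x, q x ∈ gradedPart ϖ c' a' b' (n₁.gcd n₂) r := by
    intro x
    obtain ⟨f, rfl⟩ := BranchRing.mk_surjective π c₀ a b x
    rw [hq]
    exact mk_mem_gradedPart (subst_mem_gradedSeries hn₁0 hn₂0 hd₁ hd₂ f)
  let θ : A →+* E := q.comp φ
  have hθl : IsLocalHom θ := inferInstanceAs (IsLocalHom (q.comp φ))
  have hzm : z ∈ maximalIdeal E := by rw [hmax]; exact Ideal.subset_span (by simp)
  have hwm : w ∈ maximalIdeal E := by rw [hmax]; exact Ideal.subset_span (by simp)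
  have hcE : q (BranchRing.mk π c₀ a b c) = BranchRing.mk ϖ c' a' b' c' := hq c
  have hcEu : IsUnit (q (BranchRing.mk π c₀ a b c)) := (hcu.map _).map _
  set C' : Eˣ := hcEu.unit with hC'
  set g₁ : Eˣ := (hγ₁.map q).unit with hg₁
  set g₂ : Eˣ := (hγ₂.map q).unit with hg₂
  have hC'v : (C' : E) = q (BranchRing.mk π c₀ a b c) := rfl
  have hg₁v : (g₁ : E) = q γ₁ := rfl
  have hg₂v : (g₂ : E) = q γ₂ := rfl
  have hϖE : algebraMap S E ϖ = C' * (z ^ a' * w ^ b') := by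
    rw [hC'v, hcE]
    exact BranchRing.algebraMap_eq ϖ c' a' b'
  have hθ₁ : θ t₁ = g₁ * z ^ n₁ + q δ * w ^ n₂ := by
    change q (φ t₁) = _
    rw [hφ₁, map_add, map_mul, map_mul, hqz, hqw, hg₁v]
  have hθ₂ : θ t₂ = g₂ * w ^ n₂ := by
    change q (φ t₂) = _
    rw [hφ₂, map_mul, hqw, hg₂v]
  have hθ₁' : a ≠ 0 → θ t₁ = g₁ * z ^ n₁ := by
    intro h0
    rw [hθ₁, hδ h0, map_zero, zero_mul, add_zero]
  have hJ : Ideal.span {θ t₁, θ t₂} = Ideal.span {z ^ n₁, w ^ n₂} := by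
    have hzJ : z ^ n₁ ∈ Ideal.span {z ^ n₁, w ^ n₂} := Ideal.subset_span (by simp)
    have hwJ : w ^ n₂ ∈ Ideal.span {z ^ n₁, w ^ n₂} := Ideal.subset_span (by simp)
    have h1J : θ t₁ ∈ Ideal.span {θ t₁, θ t₂} := Ideal.subset_span (by simp)
    have h2J : θ t₂ ∈ Ideal.span {θ t₁, θ t₂} := Ideal.subset_span (by simp)
    have e2 : w ^ n₂ = ((g₂⁻¹ : Eˣ) : E) * θ t₂ := by
      rw [hθ₂, ← mul_assoc, g₂.inv_mul, one_mul]
    have e1 : z ^ n₁ = ((g₁⁻¹ : Eˣ) : E) * (θ t₁ - q δ * (((g₂⁻¹ : Eˣ) : E) * θ t₂)) := by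
      rw [← e2, hθ₁, add_sub_cancel_right, ← mul_assoc, g₁.inv_mul, one_mul]
    apply le_antisymm <;> rw [Ideal.span_le]
    · rintro _ (rfl | rfl)
      · rw [hθ₁]
        exact add_mem (Ideal.mul_mem_left _ _ hzJ) (Ideal.mul_mem_left _ _ hwJ)
      · rw [hθ₂]
        exact Ideal.mul_mem_left _ _ hwJ
    · rintro _ (rfl | rfl)
      · rw [e1]
        exact Ideal.mul_mem_left _ _ (sub_mem h1J (Ideal.mul_mem_left _ _
          (Ideal.mul_mem_left _ _ h2J)))
      · rw [e2]
        exact Ideal.mul_mem_left _ _ h2J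
  have hregθ : RegPair (θ t₁) (θ t₂) := by
    rw [hθ₁, hθ₂]
    exact (((hreg.pow n₁ n₂).symm.unit_mul_right g₁.isUnit).symm.add_mul_left (q δ)).unit_mul_right
      g₂.isUnit
  -- Quasi-regularity of the images of t₁, t₂ puts the kernel into every power of the maximal ideal
  -- of A, and Krull's theorem finishes.
  have hθinj : Function.Injective θ := by
    rw [injective_iff_map_eq_zero]
    intro x hx
    have hk : ∀ k, x ∈ maximalIdeal A ^ k := by
      intro k
      rw [hmA]
      refine mem_span_pow_of_map_mem θ (RingHom.id E) rfl rfl hregθ (fun k y => ⟨y, by simp⟩)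
        (fun k d hd => hd) ?_ k x (by rw [hx]; exact zero_mem _)
      intro o ho
      rw [← hmA]
      have h1 : θ o ∈ maximalIdeal E := by
        have h2 : Ideal.span {θ t₁, θ t₂} ≤ maximalIdeal E := by
          rw [hJ, Ideal.span_le]
          rintro _ (rfl | rfl)
          · exact Ideal.pow_mem_of_mem _ hzm _ (Nat.pos_of_ne_zero hn₁0)
          · exact Ideal.pow_mem_of_mem _ hwm _ (Nat.pos_of_ne_zero hn₂0)
        exact h2 ho
      simpa only [mem_maximalIdeal, map_mem_nonunits_iff] using h1
    have := Ideal.iInf_pow_eq_bot_of_isLocalRing (maximalIdeal A) (Ideal.IsPrime.ne_top')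
    rw [← Ideal.mem_bot, ← this]
    exact (Submodule.mem_iInf _).2 hk
  have hθπ : (algebraMap S E ϖ) ^ n = θ (c₁ * (t₁ ^ a * t₂ ^ b)) := by
    rw [← hπA]
    change _ = q (φ _)
    rw [hφR, hqR, ← hϖn, map_pow]
  have hU : (monomialUnit C' g₁ g₂ n a b N : E) - θ η ∈ maximalIdeal E := by
    have h1 : q (BranchRing.mk π c₀ a b (c ^ N - fω)) ∈ maximalIdeal E := by
      rw [mem_maximalIdeal, map_mem_nonunits_iff, ← mem_maximalIdeal, hQres, map_sub, map_sub,
        map_pow, map_pow, hcκ, hκ, sub_self]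
    rw [map_sub, map_sub, map_pow, map_pow, hfω] at h1
    have e1 : (monomialUnit C' g₁ g₂ n a b N : E) - θ η =
        (q (BranchRing.mk π c₀ a b c) ^ N - q (φ η * (γ₁ ^ a₁ * γ₂ ^ b₁))) *
          (((g₁⁻¹ : Eˣ) : E) ^ a₁ * ((g₂⁻¹ : Eˣ) : E) ^ b₁) := by
      rw [map_mul, map_mul, map_pow, map_pow, ← hg₁v, ← hg₂v, ← hC'v]
      have i1 : (g₁ : E) ^ a₁ * ((g₁⁻¹ : Eˣ) : E) ^ a₁ = 1 := by
        rw [← mul_pow, g₁.mul_inv, one_pow]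
      have i2 : (g₂ : E) ^ b₁ * ((g₂⁻¹ : Eˣ) : E) ^ b₁ = 1 := by
        rw [← mul_pow, g₂.mul_inv, one_pow]
      simp only [monomialUnit, Units.val_mul, Units.val_pow_eq_pow_val]
      rw [hNa, hNb, Nat.mul_div_cancel _ (Nat.pos_of_ne_zero hn0),
        Nat.mul_div_cancel _ (Nat.pos_of_ne_zero hn0)]
      change _ - q (φ η) = _
      linear_combination (q (φ η) * (g₂ : E) ^ b₁ * ((g₂⁻¹ : Eˣ) : E) ^ b₁) * i1 + q (φ η) * i2
    rw [e1]
    exact Ideal.mul_mem_right _ _ h1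
  obtain ⟨ψ, hψA, hψT, hψe, hψM⟩ := exists_extension hmA h ht₁ ht₂ he θ C' g₁ g₂ hzm hwm hϖE hθ₁'
    hθ₂ ha hn₁ hbb hn₂ hn0 ha' hb' hNa hNb hη hU hθinj hθπ hsum
  have hmono : ∀ i j, n₁.gcd n₂ ∣ i + r * j →
      z ^ i * w ^ j ∈ gradedPart ϖ c' a' b' (n₁.gcd n₂) r := by
    intro i j hij
    rw [hz, hw, ← map_pow, ← map_pow, ← map_mul]
    exact mk_mem_gradedPart (degreeZero_monomial hij)
  have hθD : ∀ x, θ x ∈ gradedPart ϖ c' a' b' (n₁.gcd n₂) r := fun x => hqD _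
  have hθres : ∀ x ∈ gradedPart ϖ c' a' b' (n₁.gcd n₂) r, ∃ α : A,
      x - θ α ∈ maximalIdeal E := by
    intro x _
    obtain ⟨f, rfl⟩ := BranchRing.mk_surjective ϖ c' a' b' x
    obtain ⟨y, hy⟩ := hres (MvPowerSeries.constantCoeff f)
    refine ⟨algebraMap R A y, ?_⟩
    have e1 : θ (algebraMap R A y) = BranchRing.mk ϖ c' a' b' (.C (algebraMap R S y)) := by
      change q (φ _) = _
      rw [hφR, hqR]
      rfl
    rw [e1, ← map_sub, hmax, BranchRing.mk_mem_span_iff hϖ hb'0, map_sub,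
      MvPowerSeries.constantCoeff_C]
    rw [← hϖ] at hy
    exact hy
  have hgr : ∀ x ∈ gradedPart ϖ c' a' b' (n₁.gcd n₂) r, x ∈ maximalIdeal E → _ :=
    fun x hx hxm => gradedPart_filtration hϖ hb'0 hc'g hr' n₁ n₂ hx (by rwa [hmax] at hxm)
  have hCD : (C' : E) ∈ gradedPart ϖ c' a' b' (n₁.gcd n₂) r := hqD _
  have hg₁D : (g₁ : E) ∈ gradedPart ϖ c' a' b' (n₁.gcd n₂) r := hqD _
  have hg₂D : (g₂ : E) ∈ gradedPart ϖ c' a' b' (n₁.gcd n₂) r := hqD _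
  obtain ⟨f, hf⟩ := exists_completion_equiv_of_retract hρ hmax ψ
    (extension_mem hρ hψA hψe hsum h.exists_integral hr hmono hθD hCD hg₁D hg₂D)
    (s := algebraMap A O t₁) (t := algebraMap A O t₂) (n₁ := n₁) (n₂ := n₂)
    (by omega) (by rw [hψA, hψA, hJ]) (by rwa [hψA, hψA])
    (by
      rw [mem_maximalIdeal, map_mem_nonunits_iff, ← mem_maximalIdeal, hmA]
      exact Ideal.subset_span (by simp))
    (by
      rw [mem_maximalIdeal, map_mem_nonunits_iff, ← mem_maximalIdeal, hmA]
      exact Ideal.subset_span (by simp))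
    hψM
    (by
      intro o ho
      rw [hψA, hψA] at ho
      exact mem_span_of_extension_mem hmA hmax hJ hn₁0 hn₂0 ha' hb' hψA hψe hsum
        h.exists_integral hreg hadd hpow hg.symm hη hηu hgu o ho)
    (by
      intro d hd
      rw [hψA, hψA, hJ]
      have := exists_sub_extension_mem hρ hn₁0 hn₂0 ha' hb' hψA hψe hr hθD hCD hg₁D hg₂D hθres hgr
        (n₁ + n₂) 0 0 (by simp) (by omega) d hd
      simpa using this)
  refine ⟨f, fun s => Subtype.ext ?_⟩
  rw [hf]
  change ψ (algebraMap S O s) = algebraMap S E s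
  -- Since R' is generated by ϖ over R, compatibility needs checking only on R and on ϖ.
  have hs : s ∈ Algebra.adjoin R {ϖ} := by rw [hadj]; trivial
  induction hs using Algebra.adjoin_induction with
  | mem x hx => rw [Set.mem_singleton_iff.1 hx, hψT]
  | algebraMap x =>
    rw [hcomp, hψA]
    change q (φ _) = _
    rw [hφR, hqR]
  | add x y _ _ hx hy => rw [map_add, map_add, map_add, hx, hy]
  | mul x y _ _ hx hy => rw [map_mul, map_mul, map_mul, hx, hy]

end Main


/-! ### Two-generated maximal ideals: primality of parameters and normality -/

section Parameters

variable {A : Type*} [CommRing A] [IsLocalRing A] [IsNoetherianRing A]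

/-- Krull's intersection theorem in A / (q) for the ideal generated by t. -/
theorem dvd_of_forall_dvd_sub_pow_mul {t q p : A} (ht : t ∈ maximalIdeal A)
    (h : ∀ k : ℕ, ∃ y, q ∣ p - t ^ k * y) : q ∣ p := by
  by_cases hq : IsUnit q
  · exact hq.dvd
  have : Nontrivial (A ⧸ Ideal.span {q}) :=
    Ideal.Quotient.nontrivial_iff.2 (by rwa [Ne, Ideal.span_singleton_eq_top])
  have : IsLocalRing (A ⧸ Ideal.span {q}) :=
    IsLocalRing.of_surjective' (Ideal.Quotient.mk _) Ideal.Quotient.mk_surjective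
  have hloc : IsLocalHom (Ideal.Quotient.mk (Ideal.span {q})) :=
    (Ideal.Quotient.mk_surjective).isLocalHom
  have h0 := Ideal.iInf_pow_eq_bot_of_isLocalRing (Ideal.span {Ideal.Quotient.mk (Ideal.span {q}) t})
    (by
      rw [Ne, Ideal.span_singleton_eq_top, isUnit_map_iff]
      exact (IsLocalRing.mem_maximalIdeal _).1 ht)
  rw [← Ideal.mem_span_singleton, ← Ideal.Quotient.eq_zero_iff_mem, ← Ideal.mem_bot, ← h0,
    Ideal.mem_iInf]
  intro k
  obtain ⟨y, hy⟩ := h k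
  rw [← Ideal.mem_span_singleton, ← Ideal.Quotient.eq_zero_iff_mem, map_sub, sub_eq_zero] at hy
  rw [hy, Ideal.span_singleton_pow, map_mul, map_pow]
  exact Ideal.mul_mem_right _ _ (Ideal.mem_span_singleton_self _)

/-- The maximal ideal of A / (t₁) is generated by t₂, so a nonzero class there is a unit times a
power of t₂, as in a discrete valuation ring. The exponent serves as a valuation below. -/
theorem exists_dvd_sub_unit_mul_pow {t₁ t₂ x : A} (hm : maximalIdeal A = Ideal.span {t₁, t₂})
    (hx : ¬ t₁ ∣ x) : ∃ (i : ℕ) (u : A), IsUnit u ∧ t₁ ∣ x - u * t₂ ^ i := by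
  classical
  have ht₂ : t₂ ∈ maximalIdeal A := hm ▸ Ideal.subset_span (by simp)
  have hex : ∃ k : ℕ, ¬ ∃ y, t₁ ∣ x - t₂ ^ k * y := by
    by_contra! h
    exact hx (dvd_of_forall_dvd_sub_pow_mul ht₂ h)
  obtain ⟨k, hk, hmin⟩ : ∃ k, (¬ ∃ y, t₁ ∣ x - t₂ ^ (k + 1) * y) ∧ ∃ y, t₁ ∣ x - t₂ ^ k * y := by
    have hpos : Nat.find hex ≠ 0 := fun h0 => by
      have := Nat.find_spec hex
      rw [h0] at this
      exact this ⟨x, by simp⟩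
    obtain ⟨k, hk⟩ := Nat.exists_eq_succ_of_ne_zero hpos
    refine ⟨k, ?_, ?_⟩
    · have := Nat.find_spec hex
      rwa [hk] at this
    · exact not_not.1 (Nat.find_min hex (m := k) (by omega))
  obtain ⟨y, hy⟩ := hmin
  refine ⟨k, y, ?_, by rwa [mul_comm]⟩
  by_contra hu
  have hym : y ∈ maximalIdeal A := (IsLocalRing.mem_maximalIdeal _).2 hu
  rw [hm, Ideal.mem_span_pair] at hym
  obtain ⟨α, β, rfl⟩ := hym
  refine hk ⟨β, ?_⟩
  obtain ⟨z, hz⟩ := hy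
  exact ⟨z + t₂ ^ k * α, by linear_combination hz⟩

theorem prime_of_not_dvd_pow {t₁ t₂ : A} (hm : maximalIdeal A = Ideal.span {t₁, t₂})
    (h₁ : t₁ ≠ 0) (hnd : ∀ i : ℕ, ¬ t₁ ∣ t₂ ^ i) : Prime t₁ := by
  refine ⟨h₁, fun hu => hnd 0 hu.dvd, fun x y hxy => ?_⟩
  by_contra! hcon
  obtain ⟨i, u, hu, hi⟩ := exists_dvd_sub_unit_mul_pow hm hcon.1
  obtain ⟨j, v, hv, hj⟩ := exists_dvd_sub_unit_mul_pow hm hcon.2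
  apply hnd (i + j)
  rw [← (hu.mul hv).dvd_mul_left]
  have : u * v * t₂ ^ (i + j) = x * y - (x - u * t₂ ^ i) * y
      - u * t₂ ^ i * (y - v * t₂ ^ j) := by ring
  rw [this]
  exact dvd_sub (dvd_sub hxy (hi.mul_right _)) (hj.mul_left _)

theorem RegPair.not_dvd_pow {t₁ t₂ : A} (hm : maximalIdeal A = Ideal.span {t₁, t₂})
    (h : RegPair t₁ t₂) (i : ℕ) : ¬ t₁ ∣ t₂ ^ i := by
  rintro ⟨y, hy⟩
  obtain ⟨z, -, hz⟩ := h.pow_right i y 1 (by rw [← hy, mul_one])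
  have ht : t₁ ∈ maximalIdeal A := hm ▸ Ideal.subset_span (by simp)
  exact (IsLocalRing.mem_maximalIdeal _).1 ht (IsUnit.of_mul_eq_one _ hz.symm)

theorem RegPair.prime_left [IsDomain A] {t₁ t₂ : A}
    (hm : maximalIdeal A = Ideal.span {t₁, t₂}) (h : RegPair t₁ t₂) (h₁ : t₁ ≠ 0) : Prime t₁ :=
  prime_of_not_dvd_pow hm h₁ (h.not_dvd_pow hm)

/-- Otherwise every prime containing t₁ would contain t₂, the maximal ideal would be minimal over
(t₁), and Krull's principal ideal theorem would bound its height by one. -/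
theorem not_dvd_pow_of_ringKrullDim {t₁ t₂ : A} (hm : maximalIdeal A = Ideal.span {t₁, t₂})
    (hdim : 2 ≤ ringKrullDim A) (i : ℕ) : ¬ t₁ ∣ t₂ ^ i := by
  intro hdvd
  have hmem : maximalIdeal A ∈ (Ideal.span {t₁}).minimalPrimes := by
    refine ⟨⟨inferInstance, ?_⟩, fun P hP hle => ?_⟩
    · rw [hm]; exact Ideal.span_mono (by simp)
    · have h1 : t₁ ∈ P := hP.2 (Ideal.mem_span_singleton_self _)
      have h2 : t₂ ∈ P := hP.1.mem_of_pow_mem i (P.mem_of_dvd hdvd h1)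
      rw [hm, Ideal.span_le]
      rintro x (rfl | rfl)
      exacts [h1, h2]
  have h1 := Ideal.height_le_one_of_isPrincipal_of_mem_minimalPrimes _ _ hmem
  rw [← IsLocalRing.maximalIdeal_height_eq_ringKrullDim] at hdim
  have h2 : (2 : ℕ∞) ≤ 1 := (WithBot.coe_le_coe.1 hdim).trans h1
  exact absurd h2 (by decide)

theorem ne_zero_of_ringKrullDim {t₁ t₂ : A} (hm : maximalIdeal A = Ideal.span {t₁, t₂})
    (hdim : 2 ≤ ringKrullDim A) : t₂ ≠ 0 := by
  rintro rfl
  exact not_dvd_pow_of_ringKrullDim hm hdim 1 (by simp)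

/-! ### Normality through almost integral elements -/

section IntegrallyClosed

/-- The hypothesis says that c is a common denominator of all powers of p / q. It remains one for
the powers of p / q - r, by the binomial formula. -/
theorem pow_dvd_mul_sub_pow {A : Type*} [CommRing A] {q c p r : A} (h : ∀ n : ℕ, q ^ n ∣ c * p ^ n) (n : ℕ) :
    q ^ n ∣ c * (p - q * r) ^ n := by
  rw [sub_eq_add_neg, add_pow, Finset.mul_sum]
  refine Finset.dvd_sum fun k hk => ?_
  have hk' : k ≤ n := by simpa [Nat.lt_succ_iff] using hk
  obtain ⟨y, hy⟩ := h k
  refine ⟨y * (-r) ^ (n - k) * (n.choose k), ?_⟩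
  have : (-(q * r)) ^ (n - k) = q ^ (n - k) * (-r) ^ (n - k) := by rw [← mul_pow]; ring
  rw [this]
  calc _ = (c * p ^ k) * (q ^ (n - k) * (-r) ^ (n - k) * (n.choose k)) := by ring
    _ = (q ^ k * q ^ (n - k)) * (y * (-r) ^ (n - k) * (n.choose k)) := by rw [hy]; ring
    _ = _ := by rw [← pow_add, Nat.add_sub_cancel' hk']

variable {t₁ t₂ : A}

/-- Division of p by q modulo t₁: possible when the t₂-exponent i of q is at most the exponent j of
p in A / (t₁). -/
theorem exists_eq_mul_add_mul_of_pow_dvd (hm : maximalIdeal A = Ideal.span {t₁, t₂})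
    (ht : Prime t₁) (hnd : ∀ i : ℕ, ¬ t₁ ∣ t₂ ^ i) {q c p : A} (hq : ¬ t₁ ∣ q)
    (hc : ¬ t₁ ∣ c) (h : ∀ n : ℕ, q ^ n ∣ c * p ^ n) : ∃ r p₁, p = q * r + t₁ * p₁ := by
  by_cases hp : t₁ ∣ p
  · obtain ⟨p₁, rfl⟩ := hp
    exact ⟨0, p₁, by simp⟩
  obtain ⟨i, u, hu, hi⟩ := exists_dvd_sub_unit_mul_pow hm hq
  obtain ⟨j, v, hv, hj⟩ := exists_dvd_sub_unit_mul_pow hm hp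
  obtain ⟨l, w, hw, hl⟩ := exists_dvd_sub_unit_mul_pow hm hc
  rcases le_or_gt i j with hij | hij
  · obtain ⟨k, rfl⟩ := Nat.exists_eq_add_of_le hij
    obtain ⟨u, rfl⟩ := hu
    obtain ⟨y, hy⟩ := hi
    obtain ⟨z, hz⟩ := hj
    refine ⟨(↑u⁻¹ : A) * v * t₂ ^ k, z - ↑u⁻¹ * v * t₂ ^ k * y, ?_⟩
    have h1 : (↑u⁻¹ : A) * u = 1 := by simp
    linear_combination hz - (↑u⁻¹ : A) * v * t₂ ^ k * hy - v * t₂ ^ (i + k) * h1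
  · exfalso
    obtain ⟨z, hz⟩ := h (l + 1)
    have hzt : ¬ t₁ ∣ z := by
      intro hzt
      have : t₁ ∣ c * p ^ (l + 1) := hz ▸ hzt.mul_left _
      rcases ht.dvd_or_dvd this with h | h
      exacts [hc h, hp (ht.dvd_of_dvd_pow h)]
    obtain ⟨m, y, hy, hmz⟩ := exists_dvd_sub_unit_mul_pow hm hzt
    have key : (Ideal.Quotient.mk (Ideal.span {t₁})) ((u * t₂ ^ i) ^ (l + 1) * (y * t₂ ^ m)) =
        Ideal.Quotient.mk (Ideal.span {t₁}) (w * t₂ ^ l * (v * t₂ ^ j) ^ (l + 1)) := by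
      have e : ∀ {a b : A}, t₁ ∣ a - b → Ideal.Quotient.mk (Ideal.span {t₁}) b =
          Ideal.Quotient.mk (Ideal.span {t₁}) a := fun h =>
        (Ideal.Quotient.eq.2 (Ideal.mem_span_singleton.2 h)).symm
      rw [map_mul, map_pow, e hi, e hmz, map_mul _ (w * t₂ ^ l), map_pow, e hl, e hj, ← map_pow,
        ← map_mul, ← map_pow, ← map_mul, hz]
    rw [Ideal.Quotient.eq, Ideal.mem_span_singleton] at key
    obtain ⟨d, rfl⟩ := Nat.exists_eq_add_of_lt hij
    apply hnd (l + j * (l + 1))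
    have hunit : IsUnit (u ^ (l + 1) * y * t₂ ^ ((d + 1) * (l + 1) + m - l) - w * v ^ (l + 1)) := by
      have ht₂ : t₂ ∈ maximalIdeal A := hm ▸ Ideal.subset_span (by simp)
      by_contra hcon
      have h1 : w * v ^ (l + 1) ∈ maximalIdeal A := by
        rw [← sub_sub_cancel (u ^ (l + 1) * y * t₂ ^ ((d + 1) * (l + 1) + m - l)) (w * v ^ (l + 1))]
        refine Ideal.sub_mem _ (Ideal.mul_mem_left _ _ (Ideal.pow_mem_of_mem _ ht₂ _ ?_))
          ((IsLocalRing.mem_maximalIdeal _).2 hcon)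
        have : (d + 1) * (l + 1) = d * l + d + l + 1 := by ring
        omega
      exact (IsLocalRing.mem_maximalIdeal _).1 h1 (hw.mul (hv.pow _))
    rw [← hunit.dvd_mul_left]
    convert key using 1
    have e1 : t₂ ^ ((d + 1) * (l + 1) + m - l) * t₂ ^ (l + j * (l + 1)) =
        (t₂ ^ (j + d + 1)) ^ (l + 1) * t₂ ^ m := by
      rw [← pow_add, ← pow_mul, ← pow_add]
      congr 1
      have h1 : (d + 1) * (l + 1) = d * l + d + l + 1 := by ring
      have h2 : (j + d + 1) * (l + 1) = j * (l + 1) + (d * l + d + l + 1) := by ring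
      omega
    rw [mul_pow, mul_pow]
    linear_combination (u ^ (l + 1) * y) * e1

variable [IsDomain A]

/-- When t₁ divides neither q nor c, iterated division modulo t₁ writes p as a multiple of q plus a
multiple of t₁ ^ k for every k, and Krull's theorem concludes. Factors t₁ of q and c are stripped
off first. -/
theorem dvd_of_pow_dvd_mul_pow (hm : maximalIdeal A = Ideal.span {t₁, t₂})
    (ht : Prime t₁) (hnd : ∀ i : ℕ, ¬ t₁ ∣ t₂ ^ i) {q c p : A} (hq : q ≠ 0) (hc : c ≠ 0)
    (h : ∀ n : ℕ, q ^ n ∣ c * p ^ n) : q ∣ p := by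
  have htm : t₁ ∈ maximalIdeal A := hm ▸ Ideal.subset_span (by simp)
  have coprime : ∀ {q c p : A}, ¬ t₁ ∣ q → ¬ t₁ ∣ c → (∀ n : ℕ, q ^ n ∣ c * p ^ n) → q ∣ p := by
    intro q c p hq hc h
    have step : ∀ k : ℕ, ∃ r p₁, p = q * r + t₁ ^ k * p₁ ∧ ∀ n : ℕ, q ^ n ∣ c * p₁ ^ n := by
      intro k
      induction k with
      | zero => exact ⟨0, p, by simp, h⟩
      | succ k ih =>
        obtain ⟨r, p₁, e, h'⟩ := ih
        obtain ⟨r', p₂, e'⟩ := exists_eq_mul_add_mul_of_pow_dvd hm ht hnd hq hc h'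
        refine ⟨r + t₁ ^ k * r', p₂, by rw [e, e']; ring, fun n => ?_⟩
        have h1 := pow_dvd_mul_sub_pow (r := r') h' n
        have h2 : p₁ - q * r' = t₁ * p₂ := by rw [e']; ring
        obtain ⟨z, hz⟩ := h1
        rw [h2, mul_pow] at hz
        obtain ⟨z', rfl⟩ := ht.pow_dvd_of_dvd_mul_left n
          (fun h => hq (ht.dvd_of_dvd_pow h)) ⟨c * p₂ ^ n, by rw [← hz]; ring⟩
        exact ⟨z', mul_left_cancel₀ (pow_ne_zero n ht.ne_zero) (by linear_combination hz)⟩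
    refine dvd_of_forall_dvd_sub_pow_mul htm fun k => ?_
    obtain ⟨r, p₁, e, -⟩ := step k
    exact ⟨p₁, r, by rw [e]; ring⟩
  have hfin : ∀ {x : A}, x ≠ 0 → ∃ (k : ℕ) (y : A), ¬ t₁ ∣ y ∧ x = t₁ ^ k * y := fun hx =>
    let ⟨k, y, h1, h2⟩ := WfDvdMonoid.max_power_factor hx ht.irreducible
    ⟨k, y, h1, h2⟩
  obtain ⟨l, q, hqt, rfl⟩ := hfin hq
  obtain ⟨k, c, hct, rfl⟩ := hfin hc
  clear hq
  induction l generalizing p with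
  | zero =>
    rw [pow_zero, one_mul]
    refine coprime hqt hct fun n => ?_
    obtain ⟨z, hz⟩ := h n
    rw [pow_zero, one_mul] at hz
    obtain ⟨z', rfl⟩ := ht.pow_dvd_of_dvd_mul_left k
      (fun h => hqt (ht.dvd_of_dvd_pow h)) ⟨c * p ^ n, by rw [← hz]; ring⟩
    exact ⟨z', mul_left_cancel₀ (pow_ne_zero k ht.ne_zero) (by linear_combination hz)⟩
  | succ l ih =>
    have hp : t₁ ∣ p := by
      by_contra hp
      have h1 : t₁ ^ (k + 1) ∣ t₁ ^ k * (c * p ^ (k + 1)) := by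
        rw [← mul_assoc]
        refine dvd_trans ?_ (h (k + 1))
        exact pow_dvd_pow_of_dvd (Dvd.intro (t₁ ^ l * q) (by ring)) _
      rw [pow_succ, mul_dvd_mul_iff_left (pow_ne_zero k ht.ne_zero)] at h1
      rcases ht.dvd_or_dvd h1 with h | h
      exacts [hct h, hp (ht.dvd_of_dvd_pow h)]
    obtain ⟨p, rfl⟩ := hp
    have := ih (p := p) fun n => by
      have := h n
      rw [pow_succ', mul_assoc t₁, mul_pow, mul_pow t₁,
        mul_left_comm, mul_dvd_mul_iff_left (pow_ne_zero n ht.ne_zero)] at this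
      exact this
    rw [pow_succ', mul_assoc]
    exact mul_dvd_mul_left _ this

theorem isIntegrallyClosed_of_not_dvd_pow (hm : maximalIdeal A = Ideal.span {t₁, t₂})
    (ht : Prime t₁) (hnd : ∀ i : ℕ, ¬ t₁ ∣ t₂ ^ i) : IsIntegrallyClosed A := by
  rw [isIntegrallyClosed_iff (FractionRing A)]
  intro x hx
  obtain ⟨c, hc, h⟩ := hx.isAlmostIntegral
  obtain ⟨p, q, hq, rfl⟩ := IsFractionRing.div_surjective (A := A) x
  have hq0 : q ≠ 0 := nonZeroDivisors.ne_zero hq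
  have hq' : algebraMap A (FractionRing A) q ≠ 0 := by simpa using hq0
  have hdvd : q ∣ p := by
    refine dvd_of_pow_dvd_mul_pow hm ht hnd hq0 (nonZeroDivisors.ne_zero hc) fun n => ?_
    obtain ⟨d, hd⟩ := h n
    refine ⟨d, IsFractionRing.injective A (FractionRing A) ?_⟩
    rw [Algebra.smul_def, div_pow, mul_div_assoc', eq_div_iff (pow_ne_zero _ hq')] at hd
    simp only [map_mul, map_pow]
    rw [← hd]; ring
  obtain ⟨y, rfl⟩ := hdvd
  exact ⟨y, by rw [map_mul, mul_div_cancel_left₀ _ hq']⟩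

end IntegrallyClosed

end Parameters


/-! ### Factorization into powers of two primes -/

section Factorization

variable {A : Type*} [CommRing A] [IsDomain A]

theorem dvd_of_dvd_prime_pow_mul {t c y : A} (ht : Prime t) (hc : ¬ t ∣ c) {k : ℕ}
    (h : c ∣ t ^ k * y) : c ∣ y := by
  obtain ⟨z, hz⟩ := h
  obtain ⟨z', rfl⟩ := ht.pow_dvd_of_dvd_mul_left k hc ⟨y, by rw [hz]⟩
  exact ⟨z', mul_left_cancel₀ (pow_ne_zero k ht.ne_zero) (by linear_combination hz)⟩

/-- A nonzero element that divides a power of `t₁ * t₂`, for primes `t₁`, `t₂`, is a monomial in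
`t₁` and `t₂` up to a unit. -/
theorem exists_eq_unit_mul_of_dvd_pow [IsNoetherianRing A] {t₁ t₂ x : A} (h₁ : Prime t₁)
    (h₂ : Prime t₂) (hx : x ≠ 0) {k : ℕ} (h : x ∣ (t₁ * t₂) ^ k) :
    ∃ (c : A) (a b : ℕ), IsUnit c ∧ x = c * (t₁ ^ a * t₂ ^ b) := by
  obtain ⟨a, y, hy, rfl⟩ := WfDvdMonoid.max_power_factor hx h₁.irreducible
  have hy0 : y ≠ 0 := right_ne_zero_of_mul hx
  obtain ⟨b, c, hc, rfl⟩ := WfDvdMonoid.max_power_factor hy0 h₂.irreducible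
  refine ⟨c, a, b, isUnit_of_dvd_one ?_, by ring⟩
  have h1 : ¬ t₁ ∣ c := fun h => hy (h.mul_left _)
  refine dvd_of_dvd_prime_pow_mul h₁ h1 (k := k) (dvd_of_dvd_prime_pow_mul h₂ hc (k := k) ?_)
  refine dvd_trans ⟨t₁ ^ a * t₂ ^ b, by ring⟩ (h.trans (dvd_of_eq ?_))
  ring

theorem exponent_eq_of_eq {w x y : A} (hw : Prime w) (hx : ¬ w ∣ x) (hy : ¬ w ∣ y) {k l : ℕ}
    (h : x * w ^ k = y * w ^ l) : k = l := by
  have aux : ∀ {x y : A}, ¬ w ∣ x → ∀ {k l : ℕ}, x * w ^ k = y * w ^ l → l ≤ k := by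
    intro x y hx k l h
    by_contra! hkl
    obtain ⟨d, rfl⟩ := Nat.exists_eq_add_of_lt hkl
    refine hx ⟨y * w ^ d, mul_right_cancel₀ (pow_ne_zero k hw.ne_zero) ?_⟩
    rw [h]; ring
  exact le_antisymm (aux hy h.symm) (aux hx h)

theorem isRadical_mul_of_prime {t₁ t₂ : A} (h₁ : Prime t₁) (h₂ : Prime t₂) (h : ¬ t₁ ∣ t₂) :
    IsRadical (t₁ * t₂) := by
  intro n x hx
  obtain ⟨y, rfl⟩ := h₁.dvd_of_dvd_pow ((Dvd.intro _ rfl).trans hx)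
  refine mul_dvd_mul_left _ ?_
  rcases h₂.dvd_or_dvd (h₂.dvd_of_dvd_pow ((Dvd.intro_left _ rfl).trans hx)) with h' | h'
  · obtain ⟨z, hz⟩ := h'
    rcases h₁.irreducible.isUnit_or_isUnit hz with hu | hu
    · exact absurd hu h₂.not_unit
    · exact absurd (by rw [hz, hu.mul_right_dvd] : t₁ ∣ t₂) h
  · exact h'

end Factorization

/-! ### Comparison of parameters of A with the coordinates of a normal form -/

section Matching

variable {Q : Type*} [CommRing Q] [IsDomain Q] [IsLocalRing Q] [IsNoetherianRing Q] {z w : Q}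

theorem maximalIdeal_ne_span_singleton (hm : maximalIdeal Q = Ideal.span {z, w})
    (h : RegPair z w) (hw : w ≠ 0) (τ : Q) : maximalIdeal Q ≠ Ideal.span {τ} := by
  intro hτ
  have hz' : z ∈ Ideal.span {τ} := hτ ▸ hm ▸ Ideal.subset_span (by simp)
  have hw' : w ∈ Ideal.span {τ} := hτ ▸ hm ▸ Ideal.subset_span (by simp)
  obtain ⟨x, hx⟩ := Ideal.mem_span_singleton.1 hz'
  obtain ⟨y, hy⟩ := Ideal.mem_span_singleton.1 hw'
  obtain ⟨t, ht, -⟩ := h y x (by rw [hx, hy]; ring)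
  have : IsUnit τ := IsUnit.of_mul_eq_one t <| mul_left_cancel₀ hw <| by
    rw [mul_one]; nth_rw 2 [hy]; rw [ht]; ring
  have hτm : τ ∈ maximalIdeal Q := hτ ▸ Ideal.mem_span_singleton_self τ
  exact (IsLocalRing.mem_maximalIdeal _).1 hτm this

/-- If the maximal ideal is generated by `x` and `y` but is not principal, the coefficient of a
multiple `y = γ * y' + r * x` with `y'` in the maximal ideal is a unit. -/
theorem isUnit_of_span_pair {x y y' γ r : Q} (hm : maximalIdeal Q = Ideal.span {x, y})
    (hnp : ∀ τ, maximalIdeal Q ≠ Ideal.span {τ}) (hy' : y' ∈ maximalIdeal Q)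
    (h : y = γ * y' + r * x) : IsUnit γ := by
  by_contra hγ
  have hγm : γ ∈ maximalIdeal Q := (IsLocalRing.mem_maximalIdeal _).2 hγ
  -- If γ were not a unit, y would lie in (x) modulo the square of the maximal ideal, and by
  -- Nakayama x alone would generate.
  have hle : maximalIdeal Q ≤ Ideal.span {x} ⊔ maximalIdeal Q • maximalIdeal Q := by
    conv_lhs => rw [hm]
    rw [Ideal.span_le]
    rintro _ (rfl | rfl)
    · exact Ideal.mem_sup_left (Ideal.mem_span_singleton_self _)
    · rw [SetLike.mem_coe, h, add_comm]
      exact Ideal.add_mem _ (Ideal.mem_sup_left (Ideal.mul_mem_left _ _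
        (Ideal.mem_span_singleton_self _))) (Ideal.mem_sup_right (Ideal.mul_mem_mul hγm hy'))
  have := Submodule.le_of_le_smul_of_le_jacobson_bot (N := Ideal.span {x})
    (IsNoetherian.noetherian (maximalIdeal Q)) (IsLocalRing.maximalIdeal_le_jacobson _) hle
  exact hnp x (le_antisymm this (by rw [hm]; exact Ideal.span_mono (by simp)))

variable {A : Type*} [CommRing A] [IsLocalRing A] (φ : A →+* Q)

/-- Comparison of the parameters at a point with those of a local normal form. -/
theorem exists_matching [IsLocalHom φ] (hmQ : maximalIdeal Q = Ideal.span {z, w}) (hreg : RegPair z w)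
    (hz : z ≠ 0) (hw : w ≠ 0) {c : Q} (hc : IsUnit c) {a b : ℕ} (hb : 0 < b)
    {t₁ t₂ : A} (hmA : maximalIdeal A = Ideal.span {t₁, t₂})
    (hmap : (maximalIdeal A).map φ = maximalIdeal Q) {c₁ : A} (hc₁ : IsUnit c₁) {a₁ b₁ : ℕ}
    (h : φ (c₁ * (t₁ ^ a₁ * t₂ ^ b₁)) = c * (z ^ a * w ^ b)) :
    ∃ (s₁ s₂ : A) (γ₁ γ₂ δ : Q), ((s₁ = t₁ ∧ s₂ = t₂ ∧ a₁ = a ∧ b₁ = b) ∨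
        (s₁ = t₂ ∧ s₂ = t₁ ∧ b₁ = a ∧ a₁ = b)) ∧
      IsUnit γ₁ ∧ IsUnit γ₂ ∧ (a ≠ 0 → δ = 0) ∧ φ s₁ = γ₁ * z + δ * w ∧ φ s₂ = γ₂ * w := by
  have hmQ' : maximalIdeal Q = Ideal.span {w, z} := by rw [hmQ, Set.pair_comm]
  have hwp : Prime w := hreg.symm.prime_left hmQ' hw
  have hzp : Prime z := hreg.prime_left hmQ hz
  have hwz : ¬ w ∣ z := by simpa using hreg.symm.not_dvd_pow hmQ' 1
  have hzw : ¬ z ∣ w := by simpa using hreg.not_dvd_pow hmQ 1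
  have hnp := maximalIdeal_ne_span_singleton hmQ hreg hw
  have hwm : w ∈ maximalIdeal Q := hmQ ▸ Ideal.subset_span (by simp)
  have hzm : z ∈ maximalIdeal Q := hmQ ▸ Ideal.subset_span (by simp)
  have main : ∀ {t₁ t₂ : A} {a₁ b₁ : ℕ}, maximalIdeal A = Ideal.span {t₁, t₂} →
      φ (c₁ * (t₁ ^ a₁ * t₂ ^ b₁)) = c * (z ^ a * w ^ b) → w ∣ φ t₂ →
      ∃ (γ₁ γ₂ δ : Q), (a₁ = a ∧ b₁ = b) ∧
      IsUnit γ₁ ∧ IsUnit γ₂ ∧ (a ≠ 0 → δ = 0) ∧ φ t₁ = γ₁ * z + δ * w ∧ φ t₂ = γ₂ * w := by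
    intro t₁ t₂ a₁ b₁ hmA h hdvd
    have hmQt : maximalIdeal Q = Ideal.span {φ t₁, φ t₂} := by
      rw [← hmap, hmA, Ideal.map_span, Set.image_pair]
    have hmQt' : maximalIdeal Q = Ideal.span {φ t₂, φ t₁} := by rw [hmQt, Set.pair_comm]
    have ht₁m : φ t₁ ∈ maximalIdeal Q := hmQt ▸ Ideal.subset_span (by simp)
    have ht₁u : ¬ IsUnit (φ t₁) := (IsLocalRing.mem_maximalIdeal _).1 ht₁m
    obtain ⟨γ₂, hγ₂⟩ := hdvd
    rw [mul_comm] at hγ₂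
    have hu₂ : IsUnit γ₂ := isUnit_of_span_pair (r := 0) hmQt hnp hwm (by rw [hγ₂]; ring)
    have hwt₁ : ¬ w ∣ φ t₁ := by
      intro hd
      refine hnp w (le_antisymm ?_ ?_)
      · rw [hmQt, Ideal.span_le]
        rintro _ (rfl | rfl)
        · exact Ideal.mem_span_singleton.2 hd
        · exact Ideal.mem_span_singleton.2 ⟨γ₂, by rw [hγ₂, mul_comm]⟩
      · rw [hmQ]; exact Ideal.span_mono (by simp)
    have hcφ : IsUnit (φ c₁) := hc₁.map φ
    have hnu : ∀ {x v : Q}, Prime x → IsUnit v → ¬ x ∣ v := fun hx hv hd =>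
      hx.not_unit (isUnit_of_dvd_unit hd hv)
    have h' : φ c₁ * (φ t₁ ^ a₁ * (γ₂ * w) ^ b₁) = c * (z ^ a * w ^ b) := by
      rw [← h, ← hγ₂]; simp
    have hbb : b₁ = b := by
      refine exponent_eq_of_eq (x := φ c₁ * φ t₁ ^ a₁ * γ₂ ^ b₁) (y := c * z ^ a) hwp ?_ ?_
        (by linear_combination h')
      · intro hd
        rcases hwp.dvd_or_dvd hd with hd | hd
        · rcases hwp.dvd_or_dvd hd with hd | hd
          exacts [hnu hwp hcφ hd, hwt₁ (hwp.dvd_of_dvd_pow hd)]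
        · exact hnu hwp (hu₂.pow _) hd
      · intro hd
        rcases hwp.dvd_or_dvd hd with hd | hd
        exacts [hnu hwp hc hd, hwz (hwp.dvd_of_dvd_pow hd)]
    subst hbb
    have h'' : φ c₁ * φ t₁ ^ a₁ * γ₂ ^ b₁ = c * z ^ a :=
      mul_right_cancel₀ (pow_ne_zero b₁ hwp.ne_zero) (by linear_combination h')
    -- When a = 0 the coordinate z does not occur in the equation, so t₁ is only known as a
    -- combination of z and w; this is the source of δ.
    by_cases ha : a = 0
    · subst ha
      rw [pow_zero, mul_one] at h''
      have ha₁ : a₁ = 0 := by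
        by_contra ha₁
        refine ht₁u (isUnit_of_dvd_unit (y := c) ?_ hc)
        exact ((dvd_pow_self _ ha₁).mul_left _).trans (Dvd.intro _ h'')
      obtain ⟨γ, δ, hγδ⟩ := Ideal.mem_span_pair.1 (hmQ ▸ ht₁m)
      refine ⟨γ, γ₂, δ, ⟨ha₁, rfl⟩, ?_, hu₂, by simp, hγδ.symm, hγ₂⟩
      obtain ⟨v, hv⟩ := hu₂
      refine isUnit_of_span_pair (r := δ * (↑v⁻¹ : Q)) hmQt' hnp hzm ?_
      rw [hγ₂, ← hv, ← hγδ]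
      have : (↑v⁻¹ : Q) * v = 1 := by simp
      linear_combination -δ * w * this
    · have hzt : z ∣ φ t₁ := by
        have : z ∣ φ c₁ * φ t₁ ^ a₁ * γ₂ ^ b₁ := h'' ▸ (dvd_pow_self _ ha).mul_left _
        rcases hzp.dvd_or_dvd this with hd | hd
        · rcases hzp.dvd_or_dvd hd with hd | hd
          exacts [absurd hd (hnu hzp hcφ), hzp.dvd_of_dvd_pow hd]
        · exact absurd hd (hnu hzp (hu₂.pow _))
      obtain ⟨γ₁, hγ₁⟩ := hzt
      rw [mul_comm] at hγ₁
      have hu₁ : IsUnit γ₁ := isUnit_of_span_pair (r := 0) hmQt' hnp hzm (by rw [hγ₁]; ring)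
      refine ⟨γ₁, γ₂, 0, ⟨?_, rfl⟩, hu₁, hu₂, by simp, by rw [hγ₁]; ring, hγ₂⟩
      refine exponent_eq_of_eq (x := φ c₁ * γ₂ ^ b₁ * γ₁ ^ a₁) (y := c) hzp
        (hnu hzp ((hcφ.mul (hu₂.pow _)).mul (hu₁.pow _))) (hnu hzp hc) ?_
      rw [← h'', hγ₁]; ring
  -- As b > 0, the prime w divides π, hence the image of one of the parameters; the labels are
  -- exchanged if it is t₁.
  have hwd : w ∣ φ t₁ ∨ w ∣ φ t₂ := by
    have : w ∣ φ c₁ * (φ t₁ ^ a₁ * φ t₂ ^ b₁) := by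
      rw [← map_pow, ← map_pow, ← map_mul, ← map_mul, h]
      exact ((dvd_pow_self _ hb.ne').mul_left _).mul_left _
    rcases hwp.dvd_or_dvd this with hd | hd
    · exact absurd (isUnit_of_dvd_unit hd (hc₁.map φ)) hwp.not_unit
    rcases hwp.dvd_or_dvd hd with hd | hd
    exacts [.inl (hwp.dvd_of_dvd_pow hd), .inr (hwp.dvd_of_dvd_pow hd)]
  rcases hwd with hd | hd
  · obtain ⟨γ₁, γ₂, δ, ⟨h1, h2⟩, h3⟩ := main (t₁ := t₂) (t₂ := t₁) (a₁ := b₁) (b₁ := a₁)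
      (by rw [hmA, Set.pair_comm]) (by rw [← h]; ring_nf) hd
    exact ⟨t₂, t₁, γ₁, γ₂, δ, .inr ⟨rfl, rfl, h1, h2⟩, h3⟩
  · obtain ⟨γ₁, γ₂, δ, ⟨h1, h2⟩, h3⟩ := main hmA h hd
    exact ⟨t₁, t₂, γ₁, γ₂, δ, .inl ⟨rfl, rfl, h1, h2⟩, h3⟩

end Matching


/-! ### Monomial form of an element at a normal crossings point -/

section NormalCrossings

/-- The radical of `(x)` is generated by a product of distinct members of a minimal system of
generators of the maximal ideal. -/
def IsNormalCrossings {A : Type*} [CommRing A] [IsLocalRing A] (x : A) : Prop :=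
  ∃ (d : ℕ) (t : Fin d → A) (s : Finset (Fin d)), ringKrullDim A = d ∧
    Ideal.span (Set.range t) = maximalIdeal A ∧
    (Ideal.span {x}).radical = Ideal.span {∏ i ∈ s, t i}

theorem IsNormalCrossings.exists_eq {A : Type*} [CommRing A] [IsDomain A] [IsLocalRing A]
    [IsNoetherianRing A] {x : A} (h : IsNormalCrossings x) (hdim : ringKrullDim A = 2)
    (hx : x ≠ 0) :
    ∃ (t₁ t₂ c : A) (a b : ℕ), maximalIdeal A = Ideal.span {t₁, t₂} ∧ IsUnit c ∧
      x = c * (t₁ ^ a * t₂ ^ b) := by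
  obtain ⟨d, t, s, hd, ht, hs⟩ := h
  obtain rfl : d = 2 := by
    rw [hdim] at hd
    exact_mod_cast hd.symm
  have hm : maximalIdeal A = Ideal.span {t 0, t 1} := by
    rw [← ht]
    congr 1
    ext y
    simp [Fin.exists_fin_two, eq_comm]
  have hdim' : 2 ≤ ringKrullDim A := hdim.ge
  have hm' : maximalIdeal A = Ideal.span {t 1, t 0} := by rw [hm, Set.pair_comm]
  have h₁ := prime_of_not_dvd_pow hm (ne_zero_of_ringKrullDim hm' hdim')
    (not_dvd_pow_of_ringKrullDim hm hdim')
  have h₂ := prime_of_not_dvd_pow hm' (ne_zero_of_ringKrullDim hm hdim')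
    (not_dvd_pow_of_ringKrullDim hm' hdim')
  -- Only this inclusion of the radical is needed: x divides a power of the product of both
  -- parameters, hence is a monomial in them up to a unit.
  have hmem : ∏ i ∈ s, t i ∈ (Ideal.span {x}).radical := hs ▸ Ideal.mem_span_singleton_self _
  obtain ⟨k, hk⟩ := hmem
  obtain ⟨c, a, b, hc, e⟩ := exists_eq_unit_mul_of_dvd_pow h₁ h₂ hx (k := k) (by
    refine (Ideal.mem_span_singleton.1 hk).trans (pow_dvd_pow_of_dvd ?_ k)
    rw [← Fin.prod_univ_two]
    exact Finset.prod_dvd_prod_of_subset _ _ _ (Finset.subset_univ s))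
  exact ⟨t 0, t 1, c, a, b, hm, hc, e⟩

end NormalCrossings

/-! ### What a normal form of the completion says about A -/

section NormalForm

variable {R A : Type u} [CommRing R] [IsLocalRing R] [IsDomain R] [IsNoetherianRing R]
  [CommRing A] [Algebra R A] {π : R} (hπ : maximalIdeal R = Ideal.span {π})
  (hπ0 : π ≠ 0) {c₀ : MvPowerSeries (Fin 2) R} {a b : ℕ} (hb : 0 < b)

include hπ hπ0 hb

theorem BranchRing.spanFinrank_eq [IsLocalRing (BranchRing π c₀ a b)] :
    (maximalIdeal (BranchRing π c₀ a b)).spanFinrank = 2 := by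
  have hr := BranchRing.isRegularLocalRing (c := c₀) (a := a) hπ hb hπ0
  have hd := BranchRing.isDomain (c := c₀) (a := a) hπ hb hπ0
  have hm := BranchRing.maximalIdeal_eq (c := c₀) (a := a) hπ hb
  have h1 := (isRegularLocalRing_iff (BranchRing π c₀ a b)).1 hr
  refine le_antisymm ?_ ?_
  · rw [hm]
    refine (Submodule.spanFinrank_span_le_ncard_of_finite (by simp)).trans ?_
    exact (Set.ncard_insert_le _ _).trans (by simp)
  · have hreg := BranchRing.regPair (c := c₀) (a := a) hπ hb hπ0
    have hm' := hm.trans (congrArg Ideal.span (Set.pair_comm _ _))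
    have hw0 : BranchRing.w π c₀ a b ≠ 0 := fun h =>
      one_ne_zero (BranchRing.w_mul_eq_zero (c := c₀) (a := a) hb hπ0 (x := 1) (by rw [h]; simp))
    have hz : ¬ IsUnit (BranchRing.z π c₀ a b) := by
      rw [← mem_nonunits_iff, ← mem_maximalIdeal, hm]
      exact Ideal.subset_span (by simp)
    have := two_le_ringKrullDim_of_prime hz (hreg.symm.prime_left hm' hw0)
      (BranchRing.not_w_dvd_z hπ hb)
    rw [← h1] at this
    exact_mod_cast this

variable [IsRegularLocalRing A]

/-- A is regular, so its dimension is its embedding dimension, and this number does not change under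
completion. -/
theorem ringKrullDim_eq_two_of_completion
    (e : AdicCompletion (maximalIdeal A) A ≃+* BranchRing π c₀ a b) : ringKrullDim A = 2 := by
  have := BranchRing.isLocalRing (c := c₀) (a := a) hπ hb
  rw [← (isRegularLocalRing_iff A).1 inferInstance, ← AdicCompletion.spanFinrank_maximalIdeal_eq,
    ← Ideal.spanFinrank_map_eq_of_ringEquiv e, map_ringEquiv_maximalIdeal e,
    BranchRing.spanFinrank_eq hπ hπ0 hb]
  rfl

variable (e : AdicCompletion (maximalIdeal A) A ≃+* BranchRing π c₀ a b)
  (he : ∀ x : R, e (algebraMap A _ (algebraMap R A x)) = algebraMap R _ x)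

include he

omit hπ0 [IsDomain R] [IsNoetherianRing R] in
theorem isLocalHom_algebraMap_of_completion : IsLocalHom (algebraMap R A) where
  map_nonunit x hx := by
    have h := (hx.map (algebraMap A (AdicCompletion (maximalIdeal A) A))).map e
    rw [he] at h
    have h2 : BranchRing.mk π c₀ a b (MvPowerSeries.C x) = algebraMap R _ x :=
      (BranchRing.mk π c₀ a b).commutes x
    rw [← h2, BranchRing.isUnit_mk_iff hπ hb] at h
    simpa using h

omit hπ0 [IsDomain R] [IsNoetherianRing R] in
-- In the normal form, residues are read off constant coefficients, so A has the residue field of R.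
theorem isAlgClosed_residueField_of_completion [IsAlgClosed (ResidueField R)] :
    IsAlgClosed (ResidueField A) := by
  have := isLocalHom_algebraMap_of_completion hπ hb e he
  refine IsAlgClosed.of_ringEquiv _ _
    (RingEquiv.ofBijective (ResidueField.map (algebraMap R A)) ⟨RingHom.injective _, ?_⟩)
  intro y
  obtain ⟨y, rfl⟩ := residue_surjective y
  obtain ⟨f, hf⟩ := BranchRing.mk_surjective π c₀ a b (e (algebraMap A _ y))
  refine ⟨residue R (MvPowerSeries.constantCoeff f), ?_⟩
  rw [ResidueField.map_residue, ← sub_eq_zero, ← map_sub, residue_eq_zero_iff, mem_maximalIdeal,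
    mem_nonunits_iff]
  intro hu
  have h := (hu.map (algebraMap A (AdicCompletion (maximalIdeal A) A))).map e
  have h2 : BranchRing.mk π c₀ a b (MvPowerSeries.C (MvPowerSeries.constantCoeff f)) =
    algebraMap R _ (MvPowerSeries.constantCoeff f) := (BranchRing.mk π c₀ a b).commutes _
  rw [map_sub, map_sub, he, ← hf, ← h2, ← map_sub, BranchRing.isUnit_mk_iff hπ hb] at h
  simp at h

end NormalForm

/-! ### O is Noetherian -/

section Noetherian

variable {A O : Type*} [CommRing A] [IsDomain A] [IsIntegrallyClosed A] [IsNoetherianRing A]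
  [CommRing O] [IsDomain O] [Algebra A O] {n : ℕ} {T : O} {c t₁ t₂ ζ : A} {a b : ℕ}

/-- The integral closure of A in O is a finite A-module, generated by the monomials. Elements of O
are fractions of it with unit denominators, so every ideal of O is extended from it. -/
theorem IsNormalizedRootExtension.isNoetherianRing (hn : IsUnit (n : A))
    (hζ : IsPrimitiveRoot ζ n) (h : IsNormalizedRootExtension n (c * (t₁ ^ a * t₂ ^ b)) T)
    (hc : IsUnit c) (ht₁ : t₁ ≠ 0) (ht₂ : t₂ ≠ 0) (hrad : IsRadical (t₁ * t₂)) :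
    IsNoetherianRing O := by
  have hn0 : n ≠ 0 := by rintro rfl; simp at hn
  obtain ⟨e, he⟩ := h.exists_monomials hn0 ht₁ ht₂
  have hint : ∀ i, IsIntegral A (e i) := fun i => by
    refine IsIntegral.of_pow (Nat.pos_of_ne_zero hn0) ?_
    rw [h.monomial_pow ht₁ ht₂ he]
    exact isIntegral_algebraMap
  have hfin : Module.Finite A (integralClosure A O) := by
    classical
    refine ⟨⟨(Finset.range n).image fun i => ⟨e i, hint i⟩, ?_⟩⟩
    rw [eq_top_iff]
    rintro ⟨x, hx⟩ -
    obtain ⟨β, hβ⟩ := h.exists_eq_sum hn hζ hc ht₁ ht₂ hrad he hx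
    have : (⟨x, hx⟩ : integralClosure A O) =
        ∑ i ∈ Finset.range n, β i • (⟨e i, hint i⟩ : integralClosure A O) := by
      refine Subtype.ext (hβ.trans ?_)
      simp [Algebra.smul_def]
    rw [this]
    refine sum_mem fun i hi => Submodule.smul_mem _ _ (Submodule.subset_span ?_)
    exact Finset.mem_coe.2 (Finset.mem_image_of_mem _ hi)
  have hN : IsNoetherianRing (integralClosure A O) := IsNoetherianRing.of_finite A _
  refine (isNoetherianRing_iff_ideal_fg _).2 fun J => ?_
  have : J = (J.comap (algebraMap (integralClosure A O) O)).map
      (algebraMap (integralClosure A O) O) := by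
    refine le_antisymm (fun o ho => ?_) Ideal.map_comap_le
    obtain ⟨x, y, hx, hy, hu, e⟩ := h.exists_integral o
    rw [← Ideal.unit_mul_mem_iff_mem _ hu, mul_comm, e]
    exact Ideal.mem_map_of_mem (algebraMap (integralClosure A O) O)
      (x := (⟨x, hx⟩ : integralClosure A O)) (show x ∈ J from e ▸ J.mul_mem_right _ ho)
  rw [this]
  exact Ideal.FG.map (IsNoetherian.noetherian _) _

end Noetherian

/-! ### The completion of O at a normal crossings point -/

section Main

variable {R S A O : Type u} [CommRing R] [IsLocalRing R] [IsAlgClosed (ResidueField R)]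
  [IsDomain R] [IsNoetherianRing R]
  [CommRing S] [IsDomain S] [IsLocalRing S] [IsNoetherianRing S] [Algebra R S]
  [IsLocalHom (algebraMap R S)]
  [CommRing A] [IsDomain A] [IsRegularLocalRing A] [Algebra R A]
  [CommRing O] [IsDomain O] [IsLocalRing O] [Algebra A O] [IsLocalHom (algebraMap A O)]
  [Algebra S O]

/-- The completion of the local ring `O` of the normalization at a normal crossings point with
local ring `A`, in terms of a normal form of the completion of `A`. -/
theorem exists_completion_equiv_of_isNormalCrossings {π : R} {ϖ : S}
    (hπ : maximalIdeal R = Ideal.span {π}) (hπ0 : π ≠ 0)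
    (hϖ : maximalIdeal S = Ideal.span {ϖ}) (hϖ0 : ϖ ≠ 0) {n : ℕ}
    (hϖn : ϖ ^ n = algebraMap R S π) (hadj : Algebra.adjoin R {ϖ} = ⊤)
    (hres : ∀ s : S, ∃ x : R, s - algebraMap R S x ∈ Ideal.span {ϖ})
    (hn : IsUnit (n : R)) {ζ : R} (hζ : IsPrimitiveRoot ζ n)
    {c₀ : MvPowerSeries (Fin 2) R} (hc₀ : IsUnit c₀) {a b : ℕ} (hb : 0 < b)
    (hsnc : IsNormalCrossings (algebraMap R A π))
    (e : AdicCompletion (maximalIdeal A) A ≃+* BranchRing π c₀ a b)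
    (he : ∀ x : R, e (algebraMap A _ (algebraMap R A x)) = algebraMap R _ x)
    (h : IsIntegrallyClosed A → IsNormalizedRootExtension n (algebraMap R A π) (algebraMap S O ϖ))
    (hcomp : ∀ x : R, algebraMap S O (algebraMap R S x) = algebraMap A O (algebraMap R A x))
    {a' b' n₁ n₂ h₁ h₂ : ℕ}
    (ha : a = a' * h₁) (hn₁ : n = n₁ * h₁) (hbb : b = b' * h₂) (hn₂ : n = n₂ * h₂)
    (ha' : a'.Coprime n₁) (hb' : b'.Coprime n₂)
    {r : ℕ} (hr : n₁.gcd n₂ ∣ r * b' + a') :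
    IsNoetherianRing O ∧
    ∃ κ : ResidueField R, κ ^ n = residue R (MvPowerSeries.constantCoeff c₀) ∧
      ∀ c : MvPowerSeries (Fin 2) R, c ^ n = c₀ → IsUnit c →
        residue R (MvPowerSeries.constantCoeff c) = κ →
        ∃ e : AdicCompletion (maximalIdeal O) O ≃+*
          gradedPart ϖ (substPow S n₁ n₂ c) a' b' (n₁.gcd n₂) r,
          ∀ s : S, e (algebraMap O _ (algebraMap S O s)) = algebraMap S _ s := by
  have hloc := BranchRing.isLocalRing (c := c₀) (a := a) hπ hb
  have hdom := BranchRing.isDomain (c := c₀) (a := a) hπ hb hπ0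
  have hm := BranchRing.maximalIdeal_eq (c := c₀) (a := a) hπ hb
  have hreg := BranchRing.regPair (c := c₀) (a := a) hπ hb hπ0
  have hw0 : BranchRing.w π c₀ a b ≠ 0 := fun h =>
    one_ne_zero (BranchRing.w_mul_eq_zero (c := c₀) (a := a) hb hπ0 (x := 1) (by rw [h]; simp))
  have hz0 : BranchRing.z π c₀ a b ≠ 0 := fun h =>
    BranchRing.not_w_dvd_z (c := c₀) (a := a) hπ hb (by rw [h]; exact dvd_zero _)
  have hdim := ringKrullDim_eq_two_of_completion hπ hπ0 hb e
  have hRA := isLocalHom_algebraMap_of_completion hπ hb e he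
  have hkA := isAlgClosed_residueField_of_completion hπ hb e he
  let φ : A →+* BranchRing π c₀ a b := e.toRingHom.comp (algebraMap A _)
  have hφl : IsLocalHom φ := by
    have : IsLocalHom e.toRingHom := ⟨fun x hx => by simpa using hx.map e.symm⟩
    exact RingHom.isLocalHom_comp _ _
  have hφR : ∀ x, φ (algebraMap R A x) = algebraMap R _ x := he
  have hmap : (maximalIdeal A).map φ = maximalIdeal (BranchRing π c₀ a b) := by
    rw [← Ideal.map_map, ← AdicCompletion.maximalIdeal_eq_map]
    exact map_ringEquiv_maximalIdeal e
  have hcQ : IsUnit (BranchRing.mk π c₀ a b c₀) := hc₀.map _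
  have hπQ := BranchRing.algebraMap_eq π c₀ a b
  have hπA0 : algebraMap R A π ≠ 0 := by
    intro h0
    have := hφR π
    rw [h0, map_zero, hπQ] at this
    exact mul_ne_zero hcQ.ne_zero (mul_ne_zero (pow_ne_zero _ hz0) (pow_ne_zero _ hw0)) this.symm
  obtain ⟨t₁, t₂, c₁, a₁, b₁, hmA, hc₁, hπA⟩ := hsnc.exists_eq hdim hπA0
  have key := exists_matching φ hm hreg hz0 hw0 hcQ (a := a) hb hmA hmap hc₁
    (a₁ := a₁) (b₁ := b₁) (by rw [← hπA, hφR, hπQ])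
  obtain ⟨s₁, s₂, γ₁, γ₂, δ, hs, hγ₁, hγ₂, hδ, hφ₁, hφ₂⟩ := key
  have hs' : maximalIdeal A = Ideal.span {s₁, s₂} ∧
      algebraMap R A π = c₁ * (s₁ ^ a * s₂ ^ b) := by
    rcases hs with ⟨rfl, rfl, rfl, rfl⟩ | ⟨rfl, rfl, rfl, rfl⟩
    · exact ⟨hmA, hπA⟩
    · exact ⟨by rw [hmA, Set.pair_comm], by rw [hπA]; ring⟩
  obtain ⟨hmA', hπA'⟩ := hs'
  have hmA'' : maximalIdeal A = Ideal.span {s₂, s₁} := by rw [hmA', Set.pair_comm]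
  have h₁ := prime_of_not_dvd_pow hmA' (ne_zero_of_ringKrullDim hmA'' hdim.ge)
    (not_dvd_pow_of_ringKrullDim hmA' hdim.ge)
  have h₂ := prime_of_not_dvd_pow hmA'' (ne_zero_of_ringKrullDim hmA' hdim.ge)
    (not_dvd_pow_of_ringKrullDim hmA'' hdim.ge)
  have hic := isIntegrallyClosed_of_not_dvd_pow hmA' h₁ (not_dvd_pow_of_ringKrullDim hmA' hdim.ge)
  have hinj : Function.Injective (algebraMap R A) := by
    rw [injective_iff_map_eq_zero]
    intro x hx
    by_contra hx0
    have hp : Prime π := (Ideal.span_singleton_prime hπ0).1 (hπ ▸ inferInstance)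
    obtain ⟨k, u, hu, rfl⟩ := WfDvdMonoid.max_power_factor hx0 hp.irreducible
    have huu : IsUnit u := by
      by_contra h
      rw [← mem_nonunits_iff, ← mem_maximalIdeal, hπ, Ideal.mem_span_singleton] at h
      exact hu h
    rw [map_mul, map_pow] at hx
    exact mul_ne_zero (pow_ne_zero k hπA0) (huu.map _).ne_zero hx
  have hrad := isRadical_mul_of_prime h₁ h₂
    (by simpa using not_dvd_pow_of_ringKrullDim hmA' hdim.ge 1)
  have hnA : IsUnit (n : A) := by simpa using hn.map (algebraMap R A)
  have hζA := hζ.map_of_injective hinj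
  have hext : IsNormalizedRootExtension n (c₁ * (s₁ ^ a * s₂ ^ b)) (algebraMap S O ϖ) :=
    hπA' ▸ h hic
  exact ⟨hext.isNoetherianRing hnA hζA hc₁ h₁.ne_zero h₂.ne_zero hrad,
    exists_completion_equiv_gradedPart hπ hπ0 hϖ hϖ0 hϖn hadj hres hb hc₁ hmA' h₁.ne_zero
      h₂.ne_zero hrad hπA' φ hφR hγ₁ hγ₂ hδ hφ₁ hφ₂ hnA hζA hext hcomp ha hn₁ hbb hn₂ ha' hb' hr⟩

end Main


/-- A normal Noetherian local domain of dimension at most one is a field or a discrete valuation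
ring, so its maximal ideal needs at most one generator. -/
theorem two_le_ringKrullDim_of_isIntegrallyClosed {O : Type*} [CommRing O] [IsDomain O]
    [IsLocalRing O] [IsNoetherianRing O] [IsIntegrallyClosed O]
    (h : 1 < (maximalIdeal O).spanFinrank) : 2 ≤ ringKrullDim O := by
  by_contra hd
  have hP : (maximalIdeal O).IsPrincipal := by
    refine ((tfae_of_isNoetherianRing_of_isLocalRing_of_isDomain O).out 3 4 rfl rfl).1
      ⟨inferInstance, fun P hP hP' => ?_⟩
    by_contra hPm
    obtain ⟨x, hxP, hx0⟩ := Submodule.exists_mem_ne_zero_of_ne_bot hP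
    obtain ⟨y, hy, hyP⟩ := SetLike.exists_of_lt ((le_maximalIdeal hP'.ne_top).lt_of_ne hPm)
    have h1 := ringKrullDim_quotient_succ_le_of_nonZeroDivisor
      (mem_nonZeroDivisors_of_ne_zero hx0)
    have hloc : IsLocalHom (Ideal.Quotient.mk P) :=
      IsLocalHom.of_surjective _ Ideal.Quotient.mk_surjective
    have h2 : 1 ≤ ringKrullDim (O ⧸ P) :=
      one_le_ringKrullDim_of_not_isUnit (z := Ideal.Quotient.mk P y)
        (by rwa [Ne, Ideal.Quotient.eq_zero_iff_mem])
        (fun hu => hy (isUnit_of_map_unit _ _ hu))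
    have h3 : ringKrullDim (O ⧸ P) ≤ ringKrullDim (O ⧸ Ideal.span {x}) :=
      ringKrullDim_le_of_surjective (Ideal.Quotient.factor
        ((Ideal.span_singleton_le_iff_mem _).2 hxP)) (Ideal.Quotient.factor_surjective _)
    apply hd
    calc (2 : WithBot ℕ∞) = 1 + 1 := by norm_num
      _ ≤ _ := (add_le_add_left (h2.trans h3) 1).trans h1
  obtain ⟨t, ht⟩ := hP
  have : (maximalIdeal O).spanFinrank ≤ 1 := by
    rw [ht]
    exact (Submodule.spanFinrank_span_le_ncard_of_finite (by simp)).trans (by simp)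
  omega

/-- Identifies the order d of the grading with the number n'' of the theorem. -/
theorem gcd_div_gcd_eq {a b n : ℕ} (hn : n ≠ 0) :
    (n / a.gcd n).gcd (n / b.gcd n) = n * (a.gcd b).gcd n / (a.gcd n * b.gcd n) := by
  have h₁ : 0 < a.gcd n := Nat.gcd_pos_of_pos_right _ (Nat.pos_of_ne_zero hn)
  have h₂ : 0 < b.gcd n := Nat.gcd_pos_of_pos_right _ (Nat.pos_of_ne_zero hn)
  refine (Nat.div_eq_of_eq_mul_left (Nat.mul_pos h₁ h₂) ?_).symm
  have e₁ := Nat.div_mul_cancel (Nat.gcd_dvd_right a n)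
  have e₂ := Nat.div_mul_cancel (Nat.gcd_dvd_right b n)
  have hg : (a.gcd b).gcd n = (b.gcd n).gcd (a.gcd n) := by
    apply Nat.dvd_antisymm
    · refine Nat.dvd_gcd (Nat.dvd_gcd ?_ (Nat.gcd_dvd_right _ _))
        (Nat.dvd_gcd ?_ (Nat.gcd_dvd_right _ _))
      · exact (Nat.gcd_dvd_left _ _).trans (Nat.gcd_dvd_right _ _)
      · exact (Nat.gcd_dvd_left _ _).trans (Nat.gcd_dvd_left _ _)
    · refine Nat.dvd_gcd (Nat.dvd_gcd ?_ ?_) ?_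
      · exact (Nat.gcd_dvd_right _ _).trans (Nat.gcd_dvd_left _ _)
      · exact (Nat.gcd_dvd_left _ _).trans (Nat.gcd_dvd_left _ _)
      · exact (Nat.gcd_dvd_left _ _).trans (Nat.gcd_dvd_right _ _)
  rw [hg, ← Nat.gcd_mul_left, ← Nat.gcd_mul_right]
  congr 1
  · nth_rw 1 [← e₁]; ring
  · nth_rw 1 [← e₂]; ring

theorem exists_ringEquiv_congr {S E : Type u} [CommRing S] [CommRing E]
    {F G : MvPowerSeries (Fin 2) S} (h : F = G) (e : E ≃+* PowerSeriesQuotient F) {j : S → E}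
    (he : ∀ x, e (j x) = algebraMap S _ x) :
    ∃ e : E ≃+* PowerSeriesQuotient G, ∀ x, e (j x) = algebraMap S _ x := by
  subst h
  exact ⟨e, he⟩

theorem substPow_C {R S : Type u} [CommRing R] [CommRing S] [Algebra R S] {n₁ n₂ : ℕ}
    (h₁ : n₁ ≠ 0) (h₂ : n₂ ≠ 0) (x : R) :
    substPow S n₁ n₂ (MvPowerSeries.C x) = MvPowerSeries.C (algebraMap R S x) := by
  have h := (MvPowerSeries.substAlgHom (R := R) (hasSubst_X_pow (S := S) h₁ h₂)).commutes x
  rw [MvPowerSeries.substAlgHom_apply] at h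
  refine Eq.trans ?_ (h.trans ?_)
  · rfl
  · rw [IsScalarTower.algebraMap_apply R S (MvPowerSeries (Fin 2) S)]
    rfl

theorem exists_ringEquiv_rootInvariants {S E : Type u} [CommRing S] [IsDomain S] [CommRing E]
    {ϖ : S} {a b m r : ℕ} (h : m ∣ r * b + a) {ζ : S} (hζ : IsPrimitiveRoot ζ m)
    (hm : IsUnit (m : S)) (α : Sˣ) {c : MvPowerSeries (Fin 2) S}
    (hc : c = MvPowerSeries.C ((α : S) ^ a)) {m' : ℕ} (hm' : m' = m)
    (e : E ≃+* gradedPart ϖ c a b m' r) {j : S → E} (he : ∀ x, e (j x) = algebraMap S _ x) :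
    ∃ e : E ≃+* rootInvariants ϖ h, ∀ x, e (j x) = algebraMap S _ x := by
  subst hm' hc
  obtain ⟨ε⟩ := nonempty_gradedPart_equiv_rootInvariants (ϖ := ϖ) h hζ hm α
  exact ⟨e.trans ε.toRingEquiv, fun s => (congrArg ε (he s)).trans (ε.commutes s)⟩

theorem exists_ringEquiv_of_gcd_eq_one {S E : Type u} [CommRing S] [CommRing E]
    {ϖ : S} {a b m r : ℕ} (hm : m = 1) {c c' : MvPowerSeries (Fin 2) S} (hc : c = c')
    (e : E ≃+* gradedPart ϖ c a b m r) {j : S → E} (he : ∀ x, e (j x) = algebraMap S _ x) :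
    ∃ e : E ≃+* BranchRing ϖ c' a b, ∀ x, e (j x) = algebraMap S _ x := by
  subst hm hc
  let ε : gradedPart ϖ c a b 1 r ≃ₐ[S] BranchRing ϖ c a b :=
    (Subalgebra.equivOfEq _ _ (gradedPart_one (ϖ := ϖ) (c := c) (a := a) (b := b) (r := r))).trans
      Subalgebra.topEquiv
  exact ⟨e.trans ε.toRingEquiv, fun s => (congrArg ε (he s)).trans (ε.commutes s)⟩

/-! ### The completions over R' in the two cases -/

section LocalStructure

variable {R A O : Type u} [CommRing R] [IsDomain R] [IsDiscreteValuationRing R]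
  [IsAdicComplete (maximalIdeal R) R] [IsAlgClosed (ResidueField R)]
  (p : ℕ) [CharP (ResidueField R) p] {π : R} (hπ : Irreducible π)
  {n : ℕ} [NeZero n] (hn : ¬ p ∣ n)
  [CommRing A] [IsDomain A] [IsRegularLocalRing A] [Algebra R A]
  [CommRing O] [IsDomain O] [IsLocalRing O] [Algebra A O] [IsLocalHom (algebraMap A O)]
  [Algebra (TameRing R π n) O]
  (hsnc : IsNormalCrossings (algebraMap R A π))
  (hext : IsIntegrallyClosed A → IsNormalizedRootExtension n (algebraMap R A π)
    (algebraMap (TameRing R π n) O (tameRoot R π n)))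
  (hO : IsIntegrallyClosed O)
  (hcomp : ∀ x : R, algebraMap (TameRing R π n) O (algebraMap R _ x) =
    algebraMap A O (algebraMap R A x))

include p hπ hn hsnc hext hcomp

theorem exists_completion_equiv_gradedPart_tameRing {c₀ : MvPowerSeries (Fin 2) R}
    (hc₀ : IsUnit c₀) {a b : ℕ} (hb : 0 < b)
    (e : AdicCompletion (maximalIdeal A) A ≃+* BranchRing π c₀ a b)
    (he : ∀ x : R, e (algebraMap A _ (algebraMap R A x)) = algebraMap R _ x)
    {a' b' n₁ n₂ h₁ h₂ : ℕ}
    (ha : a = a' * h₁) (hn₁ : n = n₁ * h₁) (hbb : b = b' * h₂) (hn₂ : n = n₂ * h₂)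
    (ha' : a'.Coprime n₁) (hb' : b'.Coprime n₂)
    {r : ℕ} (hr : n₁.gcd n₂ ∣ r * b' + a') :
    IsNoetherianRing O ∧
    ∃ κ : ResidueField R, κ ^ n = residue R (MvPowerSeries.constantCoeff c₀) ∧
      ∀ c : MvPowerSeries (Fin 2) R, c ^ n = c₀ → IsUnit c →
        residue R (MvPowerSeries.constantCoeff c) = κ →
        ∃ e : AdicCompletion (maximalIdeal O) O ≃+*
          gradedPart (tameRoot R π n) (substPow (TameRing R π n) n₁ n₂ c) a' b' (n₁.gcd n₂) r,
          ∀ s : TameRing R π n, e (algebraMap O _ (algebraMap _ O s)) = algebraMap _ _ s := by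
  have hnu := isUnit_natCast_of_not_dvd (R := R) p hn
  obtain ⟨ζ, hζ⟩ := exists_isPrimitiveRoot hnu
  have i1 := isDomain_tameRing hπ n
  have i2 := isLocalRing_tameRing hπ n hζ hnu
  have i3 := isNoetherianRing_tameRing hπ n hζ hnu
  have i4 : IsLocalHom (algebraMap R (TameRing R π n)) :=
    (algebraMap_isIntegral_iff.2 inferInstance : (algebraMap R (TameRing R π n)).IsIntegral).isLocalHom
      (algebraMap_tameRing_injective hπ n)
  exact exists_completion_equiv_of_isNormalCrossings (IsDiscreteValuationRing.irreducible_iff_uniformizer π |>.1 hπ)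
    hπ.ne_zero (maximalIdeal_tameRing hπ n hζ hnu) (tameRoot_ne_zero hπ n) (tameRoot_pow n)
    (adjoin_tameRoot hπ n hζ hnu) (exists_sub_mem_span_tameRoot hπ n hζ hnu) hnu hζ hc₀ hb hsnc e he
    hext hcomp ha hn₁ hbb hn₂ ha' hb' hr

set_option maxHeartbeats 400000 in
theorem exists_completion_equiv_rootInvariants {a b : ℕ} (ha : 0 < a) (hb : 0 < b)
    (e : AdicCompletion (maximalIdeal A) A ≃+* PowerSeriesQuotient (crossing π a b))
    (he : ∀ x : R, e (algebraMap A _ (algebraMap R A x)) = algebraMap R _ x)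
    {r : ℕ} (hr : n * (a.gcd b).gcd n / (a.gcd n * b.gcd n) ∣ r * (b / b.gcd n) + a / a.gcd n) :
    IsNoetherianRing O ∧ ∃ e : AdicCompletion (maximalIdeal O) O ≃+*
        rootInvariants (tameRoot R π n) hr,
      ∀ s : TameRing R π n, e (algebraMap O _ (algebraMap _ O s)) = algebraMap _ _ s := by
  obtain ⟨e, he⟩ := exists_ringEquiv_congr (crossing_eq_branch π a b) e he
  have hn0 : n ≠ 0 := NeZero.ne n
  have hnu := isUnit_natCast_of_not_dvd (R := R) p hn
  have hg₁ : 0 < a.gcd n := Nat.gcd_pos_of_pos_left _ ha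
  have hg₂ : 0 < b.gcd n := Nat.gcd_pos_of_pos_left _ hb
  have ea := Nat.div_mul_cancel (Nat.gcd_dvd_left a n)
  have eb := Nat.div_mul_cancel (Nat.gcd_dvd_left b n)
  have e₁ := Nat.div_mul_cancel (Nat.gcd_dvd_right a n)
  have e₂ := Nat.div_mul_cancel (Nat.gcd_dvd_right b n)
  have hm := gcd_div_gcd_eq (a := a) (b := b) hn0
  obtain ⟨hN, κ, hκ, h⟩ := exists_completion_equiv_gradedPart_tameRing p hπ hn hsnc hext hcomp
    isUnit_one hb e he ea.symm e₁.symm eb.symm e₂.symm (Nat.coprime_div_gcd_div_gcd hg₁)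
    (Nat.coprime_div_gcd_div_gcd hg₂) (r := r) (by rwa [hm])
  refine ⟨hN, ?_⟩
  have i1 := isDomain_tameRing hπ n
  obtain ⟨ζ, hζ⟩ := exists_isPrimitiveRoot hnu
  -- Here c₀ = 1, so c can be taken to be a constant root of unity with the prescribed residue.
  -- Writing it as α ^ a'' lets a rescaling of z remove it.
  obtain ⟨κ', hκ', hκκ⟩ := exists_pow_eq_of_residue hnu isUnit_one (κ := κ) (by rw [hκ, map_one])
  have ha'' : 0 < a / a.gcd n := Nat.div_pos (Nat.gcd_le_left _ ha) hg₁
  obtain ⟨α, hα⟩ := exists_pow_eq_of_pow_eq_one p hn ha'' hκ'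
  have hn₁ : n / a.gcd n ≠ 0 := fun h0 => hn0 (by rw [← e₁, h0, zero_mul])
  have hn₂ : n / b.gcd n ≠ 0 := fun h0 => hn0 (by rw [← e₂, h0, zero_mul])
  obtain ⟨e', he'⟩ := h (MvPowerSeries.C κ') (by rw [← map_pow, hκ', map_one])
    (MvPowerSeries.isUnit_iff_constantCoeff.2 (by
      simpa using IsUnit.of_pow_eq_one hκ' hn0)) (by simpa using hκκ)
  let α' : (TameRing R π n)ˣ := Units.map (algebraMap R (TameRing R π n)).toMonoidHom α
  have hsub : substPow (TameRing R π n) (n / a.gcd n) (n / b.gcd n) (MvPowerSeries.C κ') =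
      MvPowerSeries.C ((α' : TameRing R π n) ^ (a / a.gcd n)) := by
    rw [substPow_C hn₁ hn₂, ← hα, map_pow]
    rfl
  have hζ' : IsPrimitiveRoot (algebraMap R (TameRing R π n) ζ) n :=
    hζ.map_of_injective (algebraMap_tameRing_injective hπ n)
  obtain ⟨k, hk⟩ : n * (a.gcd b).gcd n / (a.gcd n * b.gcd n) ∣ n := by
    rw [← hm]
    exact (Nat.gcd_dvd_left _ _).trans (Dvd.intro _ e₁)
  refine exists_ringEquiv_rootInvariants hr
    (hζ'.pow (Nat.pos_of_ne_zero hn0) (by rw [mul_comm]; exact hk)) ?_ α' hsub hm e' he'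
  rw [hk, Nat.cast_mul] at hnu
  simpa using (isUnit_of_mul_isUnit_left hnu).map (algebraMap R (TameRing R π n))

include hO in
theorem isRegularLocalRing_of_eq_one {a b : ℕ} (ha : 0 < a) (hb : 0 < b)
    (e : AdicCompletion (maximalIdeal A) A ≃+* PowerSeriesQuotient (crossing π a b))
    (he : ∀ x : R, e (algebraMap A _ (algebraMap R A x)) = algebraMap R _ x)
    (h1 : n * (a.gcd b).gcd n / (a.gcd n * b.gcd n) = 1) : IsRegularLocalRing O := by
  -- With a trivial group every r is allowed; r = 0 is taken. The invariants are then the whole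
  -- ring, of embedding dimension two, and normality of O supplies the lower bound on its dimension.
  have hr : n * (a.gcd b).gcd n / (a.gcd n * b.gcd n) ∣ 0 * (b / b.gcd n) + a / a.gcd n :=
    h1 ▸ one_dvd _
  obtain ⟨hN, e', -⟩ := exists_completion_equiv_rootInvariants p hπ hn hsnc hext hcomp ha hb e he hr
  have hnu := isUnit_natCast_of_not_dvd (R := R) p hn
  obtain ⟨ζ, hζ⟩ := exists_isPrimitiveRoot hnu
  have i1 := isDomain_tameRing hπ n
  have i2 := isLocalRing_tameRing hπ n hζ hnu
  have i3 := isNoetherianRing_tameRing hπ n hζ hnu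
  have htop : ∀ (m : ℕ) (h : m ∣ 0 * (b / b.gcd n) + a / a.gcd n), m = 1 →
      Nonempty (rootInvariants (tameRoot R π n) h ≃+*
        BranchRing (tameRoot R π n) (MvPowerSeries.C (1 ^ (a / a.gcd n))) (a / a.gcd n)
          (b / b.gcd n)) := by
    rintro m h rfl
    obtain ⟨ε⟩ := nonempty_gradedPart_equiv_rootInvariants (ϖ := tameRoot R π n) h
      (IsPrimitiveRoot.one) (by simp) 1
    rw [gradedPart_one, Units.val_one] at ε
    exact ⟨ε.symm.toRingEquiv.trans (Subalgebra.topEquiv).toRingEquiv⟩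
  obtain ⟨ε⟩ := htop _ hr h1
  have hb'' : 0 < b / b.gcd n :=
    Nat.div_pos (Nat.gcd_le_left _ hb) (Nat.gcd_pos_of_pos_left _ hb)
  have hloc := BranchRing.isLocalRing (c := MvPowerSeries.C (1 ^ (a / a.gcd n)))
    (a := a / a.gcd n) (maximalIdeal_tameRing hπ n hζ hnu) hb''
  have hrank : (maximalIdeal O).spanFinrank = 2 := by
    rw [← AdicCompletion.spanFinrank_maximalIdeal_eq,
      ← Ideal.spanFinrank_map_eq_of_ringEquiv (e'.trans ε), map_ringEquiv_maximalIdeal,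
      BranchRing.spanFinrank_eq (maximalIdeal_tameRing hπ n hζ hnu) (tameRoot_ne_zero hπ n) hb'']
  refine IsRegularLocalRing.of_spanFinrank_maximalIdeal_le O ?_
  have := two_le_ringKrullDim_of_isIntegrallyClosed (O := O) (by omega)
  rw [hrank]
  exact_mod_cast this

theorem exists_completion_equiv_oneBranch {c₀ : MvPowerSeries (Fin 2) R} (hc₀ : IsUnit c₀)
    {b : ℕ} (hb : 0 < b)
    (e : AdicCompletion (maximalIdeal A) A ≃+* PowerSeriesQuotient (oneBranch π c₀ b))
    (he : ∀ x : R, e (algebraMap A _ (algebraMap R A x)) = algebraMap R _ x) :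
    ∃ (c : MvPowerSeries (Fin 2) R) (c' : MvPowerSeries (Fin 2) (TameRing R π n)),
      IsUnit c ∧ c ^ n = c₀ ∧
      c' = MvPowerSeries.subst ![MvPowerSeries.X 0, MvPowerSeries.X 1 ^ (n / b.gcd n)] c ∧
      IsRegularLocalRing (PowerSeriesQuotient
        (oneBranch (tameRoot R π n) c' (b / b.gcd n))) ∧
      ∃ e : AdicCompletion (maximalIdeal O) O ≃+*
        PowerSeriesQuotient (oneBranch (tameRoot R π n) c' (b / b.gcd n)),
        ∀ s : TameRing R π n, e (algebraMap O _ (algebraMap _ O s)) = algebraMap _ _ s := by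
  obtain ⟨e, he⟩ := exists_ringEquiv_congr (oneBranch_eq_branch π c₀ b) e he
  have hn0 : n ≠ 0 := NeZero.ne n
  have hnu := isUnit_natCast_of_not_dvd (R := R) p hn
  have hg₂ : 0 < b.gcd n := Nat.gcd_pos_of_pos_left _ hb
  have eb := Nat.div_mul_cancel (Nat.gcd_dvd_left b n)
  have e₂ := Nat.div_mul_cancel (Nat.gcd_dvd_right b n)
  -- With a = 0 one has a' = 0, n₁ = 1 and h₁ = n, so the grading is trivial and the first variable
  -- is not raised to a power.
  obtain ⟨-, κ, hκ, h⟩ := exists_completion_equiv_gradedPart_tameRing p hπ hn hsnc hext hcomp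
    hc₀ hb e he (a' := 0) (n₁ := 1) (h₁ := n) (by simp) (by simp) eb.symm e₂.symm (by simp)
    (Nat.coprime_div_gcd_div_gcd hg₂) (r := 0) (by simp)
  have i1 := isDomain_tameRing hπ n
  obtain ⟨ζ, hζ⟩ := exists_isPrimitiveRoot hnu
  have i2 := isLocalRing_tameRing hπ n hζ hnu
  have i3 := isNoetherianRing_tameRing hπ n hζ hnu
  have hc₀' := MvPowerSeries.isUnit_iff_constantCoeff.1 hc₀
  obtain ⟨y, hy, hyκ⟩ := exists_pow_eq_of_residue hnu hc₀' hκ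
  have hyu : IsUnit y := by
    rw [← hy] at hc₀'
    exact (isUnit_pow_iff hn0).1 hc₀'
  have hI : Ideal.span (Set.range (MvPowerSeries.X : Fin 2 → MvPowerSeries (Fin 2) R)) =
      Ideal.span {MvPowerSeries.X 0, MvPowerSeries.X 1} := by
    congr 1
    ext f
    simp [Fin.exists_fin_two, eq_comm]
  -- The root of c₀ is built in two stages: its constant term with the prescribed residue in R, then
  -- the series itself by Hensel's lemma for the ideal of the variables.
  obtain ⟨c, hc, hcy⟩ := exists_pow_eq_of_pow_sub_mem
    (I := Ideal.span (Set.range (MvPowerSeries.X : Fin 2 → MvPowerSeries (Fin 2) R)))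
    (by simpa using hnu.map (MvPowerSeries.C (σ := Fin 2) (R := R))) hn0 (x := c₀)
    (y := MvPowerSeries.C y) (hyu.map _) (by
      rw [hI, mem_span_X_iff]
      simp [hy])
  rw [hI, mem_span_X_iff, map_sub, MvPowerSeries.constantCoeff_C, sub_eq_zero] at hcy
  have hcu : IsUnit c := by rwa [← hc, isUnit_pow_iff hn0] at hc₀
  obtain ⟨e', he'⟩ := h c hc hcu (by rw [hcy, hyκ])
  refine ⟨c, _, hcu, hc, rfl, ?_, ?_⟩
  · rw [oneBranch_eq_branch]
    exact BranchRing.isRegularLocalRing (maximalIdeal_tameRing hπ n hζ hnu)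
      (Nat.div_pos (Nat.gcd_le_left _ hb) hg₂) (tameRoot_ne_zero hπ n)
  · obtain ⟨e', he'⟩ := exists_ringEquiv_of_gcd_eq_one (by simp) (by rw [substPow, pow_one]) e' he'
    exact exists_ringEquiv_congr (oneBranch_eq_branch _ _ _).symm e' he'

end LocalStructure


/-! ### Irreducibility of T^n - π over the function field -/

section BaseChangeRing

variable {R : Type u} [CommRing R] [IsDomain R] [IsDiscreteValuationRing R]
  {π : R} (hπ : Irreducible π) {n : ℕ} [NeZero n] {ζ : R} (hζ : IsPrimitiveRoot ζ n)
  (hn : IsUnit (n : R))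
  {A C : Type u} [CommRing A] [CommRing C] [Algebra R A] [Algebra R C]
  [Algebra A C] [Algebra (TameRing R π n) C] [IsScalarTower R A C]
  [IsScalarTower R (TameRing R π n) C] [Algebra.IsPushout R A (TameRing R π n) C]

include hπ hζ hn in
theorem exists_eq_sum_of_isPushout (c : C) : ∃ α : ℕ → A, c = ∑ i ∈ Finset.range n,
    algebraMap A C (α i) * algebraMap (TameRing R π n) C (tameRoot R π n) ^ i := by
  refine (Algebra.IsPushout.out (R := R) (S := A) (R' := TameRing R π n) (S' := C)).inductionOn c _
    ⟨0, by simp⟩ (fun s => ?_) (fun a x hx => ?_) (fun x y hx hy => ?_)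
  · obtain ⟨β, rfl⟩ := tameRing_exists_eq_sum hπ n hζ hn s
    refine ⟨fun i => algebraMap R A (β i), ?_⟩
    simp [← IsScalarTower.algebraMap_apply]
  · obtain ⟨α, rfl⟩ := hx
    exact ⟨fun i => a * α i, by simp [Algebra.smul_def, Finset.mul_sum, mul_assoc]⟩
  · obtain ⟨α, rfl⟩ := hx
    obtain ⟨β, rfl⟩ := hy
    exact ⟨fun i => α i + β i, by simp [add_mul, Finset.sum_add_distrib]⟩

variable [IsDomain A] (hA : Function.Injective (algebraMap R A))
  {K : Type u} [Field K] [Algebra A K] [IsFractionRing A K]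

include hA in
theorem exists_algHom_adjoinRoot : ∃ θ : C →+* AdjoinRoot
      (Polynomial.X ^ n - Polynomial.C (algebraMap A K (algebraMap R A π))),
    (∀ a, θ (algebraMap A C a) = AdjoinRoot.of _ (algebraMap A K a)) ∧
    θ (algebraMap (TameRing R π n) C (tameRoot R π n)) = AdjoinRoot.root _ := by
  set F := (Polynomial.X ^ n - Polynomial.C (algebraMap A K (algebraMap R A π))) with hF
  let i : R →+* K := (algebraMap A K).comp (algebraMap R A)
  have hi : Function.Injective i := (IsFractionRing.injective A K).comp hA
  let i' : FractionRing R →+* K := IsFractionRing.lift hi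
  have hi' : ∀ x, i' (algebraMap R _ x) = i x := fun x => IsFractionRing.lift_algebraMap hi x
  have hroot : AdjoinRoot.root F ^ n = AdjoinRoot.of F (algebraMap A K (algebraMap R A π)) := by
    have := AdjoinRoot.eval₂_root F
    simp only [hF, Polynomial.eval₂_sub, Polynomial.eval₂_X_pow, Polynomial.eval₂_C] at this
    exact sub_eq_zero.1 this
  have hκ : Polynomial.eval₂ ((AdjoinRoot.of F).comp i') (AdjoinRoot.root F)
      (Polynomial.X ^ n - Polynomial.C (algebraMap R (FractionRing R) π)) = 0 := by
    simp only [Polynomial.eval₂_sub, Polynomial.eval₂_X_pow, Polynomial.eval₂_C,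
      RingHom.comp_apply, hi']
    rw [hroot]
    exact sub_self _
  let κ : TameField R π n →+* AdjoinRoot F :=
    AdjoinRoot.lift ((AdjoinRoot.of F).comp i') (AdjoinRoot.root F) hκ
  letI : Algebra R (AdjoinRoot F) := ((AdjoinRoot.of F).comp i).toAlgebra
  let g₁ : A →ₐ[R] AdjoinRoot F := ⟨(AdjoinRoot.of F).comp (algebraMap A K), fun _ => rfl⟩
  let g₂ : TameRing R π n →ₐ[R] AdjoinRoot F :=
    ⟨κ.comp (algebraMap (TameRing R π n) (TameField R π n)), fun x => by
      have : algebraMap (TameRing R π n) (TameField R π n) (algebraMap R _ x) =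
          AdjoinRoot.of _ (algebraMap R (FractionRing R) x) := rfl
      change κ (algebraMap (TameRing R π n) (TameField R π n) (algebraMap R _ x)) = _
      rw [this]
      change AdjoinRoot.lift _ _ _ _ = _
      rw [AdjoinRoot.lift_of, RingHom.comp_apply, hi']
      rfl⟩
  refine ⟨(Algebra.pushoutDesc C g₁ g₂ fun _ _ => mul_comm _ _).toRingHom, fun a => ?_, ?_⟩
  · exact Algebra.pushoutDesc_left C g₁ g₂ _ a
  · refine (Algebra.pushoutDesc_right C g₁ g₂ _ (tameRoot R π n)).trans ?_
    exact AdjoinRoot.lift_root hκ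

variable (C) in
include hπ hζ hn hA in
/-- If the spectrum of `A ⊗ R'` is irreducible, then `X ^ n - π` is irreducible over the fraction
field of `A`. -/
theorem irreducible_of_irreducible_baseChange
    (hC : ∀ c d : C, c * d = 0 → IsNilpotent c ∨ IsNilpotent d) :
    Irreducible (Polynomial.X ^ n - Polynomial.C (algebraMap A K (algebraMap R A π))) := by
  set F := (Polynomial.X ^ n - Polynomial.C (algebraMap A K (algebraMap R A π))) with hF
  obtain ⟨θ, hθA, hθT⟩ : ∃ θ : C →+* AdjoinRoot F,
      (∀ a, θ (algebraMap A C a) = AdjoinRoot.of F (algebraMap A K a)) ∧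
      θ (algebraMap (TameRing R π n) C (tameRoot R π n)) = AdjoinRoot.root F :=
    exists_algHom_adjoinRoot hA
  have hn0 : n ≠ 0 := NeZero.ne n
  have hmonic : F.Monic := Polynomial.monic_X_pow_sub_C _ hn0
  have hdeg : F.degree = n := Polynomial.degree_X_pow_sub_C (Nat.pos_of_ne_zero hn0) _
  -- As n π is nonzero in K, the ring K[T] / (T ^ n - π) is reduced, and the hypothesis on
  -- nilpotents becomes primality of T ^ n - π.
  have hsep : F.Separable := by
    refine Polynomial.separable_X_pow_sub_C _ ?_ ?_
    · have := (hn.map (algebraMap R A)).map (algebraMap A K)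
      rw [map_natCast, map_natCast] at this
      exact this.ne_zero
    · rw [map_ne_zero_iff _ (IsFractionRing.injective A K), map_ne_zero_iff _ hA]
      exact hπ.ne_zero
  have hrad : ∀ G : Polynomial K, IsNilpotent (AdjoinRoot.mk F G) → AdjoinRoot.mk F G = 0 := by
    rintro G ⟨k, hk⟩
    rw [← map_pow, AdjoinRoot.mk_eq_zero] at hk
    rw [AdjoinRoot.mk_eq_zero]
    exact hsep.squarefree.isRadical k G hk
  set T := algebraMap (TameRing R π n) C (tameRoot R π n) with hT
  have hθpoly : ∀ G : Polynomial A, θ (Polynomial.aeval T G) =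
      AdjoinRoot.mk F (G.map (algebraMap A K)) := by
    intro G
    rw [Polynomial.aeval_def, Polynomial.hom_eval₂, hθT]
    have : θ.comp (algebraMap A C) = (AdjoinRoot.of F).comp (algebraMap A K) :=
      RingHom.ext hθA
    rw [this, ← Polynomial.eval₂_map, ← AdjoinRoot.algebraMap_eq, ← Polynomial.aeval_def,
      AdjoinRoot.aeval_eq]
  -- An element of the base change is a polynomial in T of degree below n, which is zero if T ^ n -
  -- π divides it.
  have hθ : Function.Injective θ := by
    rw [injective_iff_map_eq_zero]
    intro c hc
    obtain ⟨α, rfl⟩ := exists_eq_sum_of_isPushout (A := A) hπ hζ hn c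
    set G : Polynomial A := ∑ i ∈ Finset.range n, Polynomial.C (α i) * Polynomial.X ^ i with hG
    have hGT : Polynomial.aeval T G = ∑ i ∈ Finset.range n, algebraMap A C (α i) * T ^ i := by
      simp [hG]
    rw [← hGT, hθpoly, AdjoinRoot.mk_eq_zero] at hc
    have hGdeg : G.degree < n := by
      refine (Polynomial.degree_sum_le _ _).trans_lt ?_
      refine (Finset.sup_lt_iff (WithBot.bot_lt_coe n)).2 fun i hi => ?_
      exact (Polynomial.degree_C_mul_X_pow_le _ _).trans_lt
        (WithBot.coe_lt_coe.2 (Finset.mem_range.1 hi))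
    have h0 : G.map (algebraMap A K) = 0 := by
      by_contra h
      have h1 := Polynomial.degree_le_of_dvd hc h
      rw [hdeg] at h1
      exact absurd (h1.trans Polynomial.degree_map_le) (not_le.2 hGdeg)
    rw [Polynomial.map_eq_zero_iff (IsFractionRing.injective A K)] at h0
    rw [← hGT, h0, map_zero]
  have hlift : ∀ G : Polynomial K, ∃ (s : A) (c : C), s ≠ 0 ∧
      θ c = AdjoinRoot.of F (algebraMap A K s) * AdjoinRoot.mk F G := by
    intro G
    obtain ⟨s, hs, h⟩ := IsLocalization.integerNormalization_spec (nonZeroDivisors A) G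
    refine ⟨s, Polynomial.aeval T (IsLocalization.integerNormalization (nonZeroDivisors A) G),
      nonZeroDivisors.ne_zero hs, ?_⟩
    rw [hθpoly, h, ← AdjoinRoot.mk_C, ← map_mul, Algebra.smul_def]
    rfl
  refine Prime.irreducible ⟨hmonic.ne_zero, ?_, fun G H hGH => ?_⟩
  · intro hu
    have := Polynomial.degree_eq_zero_of_isUnit hu
    rw [hdeg] at this
    exact hn0 (by exact_mod_cast this)
  · obtain ⟨s, c, hs, hc⟩ := hlift G
    obtain ⟨t, d, ht, hd⟩ := hlift H
    have hunit : ∀ {s : A}, s ≠ 0 → IsUnit (AdjoinRoot.of F (algebraMap A K s)) := fun hs =>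
      (IsUnit.mk0 _ ((map_ne_zero_iff _ (IsFractionRing.injective A K)).2 hs)).map _
    have hcd : c * d = 0 := hθ <| by
      rw [map_mul, hc, hd, map_zero, mul_mul_mul_comm, ← map_mul (AdjoinRoot.mk F) G,
        AdjoinRoot.mk_eq_zero.2 hGH, mul_zero]
    have key : ∀ {s : A} {c : C} {G : Polynomial K}, s ≠ 0 →
        θ c = AdjoinRoot.of F (algebraMap A K s) * AdjoinRoot.mk F G → IsNilpotent c → F ∣ G := by
      rintro s c G hs hc ⟨k, hk⟩
      rw [← AdjoinRoot.mk_eq_zero]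
      refine hrad G ⟨k, ?_⟩
      have := congrArg θ hk
      rw [map_pow, hc, mul_pow, map_zero] at this
      exact ((hunit hs).pow k).mul_right_eq_zero.1 this
    exact (hC c d hcd).imp (key hs hc) (key ht hd)

end BaseChangeRing

/-! ### Passage from affine charts to local rings -/

section Charts

variable {R : Type u} [CommRing R] [IsDomain R] [IsDiscreteValuationRing R]
  {π : R} (hπ : Irreducible π) {n : ℕ} [NeZero n] {ζ : R} (hζ : IsPrimitiveRoot ζ n)
  (hn : IsUnit (n : R))
  {A₀ B C A O : Type u} [CommRing A₀] [IsDomain A₀] [CommRing B] [IsDomain B] [CommRing C]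
  [CommRing A] [IsDomain A] [CommRing O] [IsDomain O]
  [Algebra R A₀] [Algebra R C] [Algebra A₀ C] [Algebra (TameRing R π n) C] [IsScalarTower R A₀ C]
  [IsScalarTower R (TameRing R π n) C] [Algebra.IsPushout R A₀ (TameRing R π n) C]
  [Algebra A₀ B] [Algebra.IsIntegral A₀ B] [Algebra A₀ A] [Algebra B O] [Algebra A O]
  [Algebra A₀ O] [IsScalarTower A₀ A O] [IsScalarTower A₀ B O] [Algebra (TameRing R π n) O]
  {P : Ideal A₀} [P.IsPrime] [IsLocalization.AtPrime A P]
  {Q : Ideal B} [Q.IsPrime] [IsLocalization.AtPrime O Q]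

include hπ hζ hn in
-- Here B is a chart of the normalization, C of the base change and A₀ of X. Fractions of B are
-- rewritten over C and then over A₀, since an integral element of a domain divides a nonzero
-- element of the base.
theorem isNormalizedRootExtension_of_charts (P : Ideal A₀) [P.IsPrime] [IsLocalization.AtPrime A P]
    (Q : Ideal B) [Q.IsPrime] [IsLocalization.AtPrime O Q] (ρ : C →ₐ[A₀] B)
    (hρ : ∀ s, algebraMap B O (ρ (algebraMap (TameRing R π n) C s)) = algebraMap _ O s)
    (hC : ∀ c d : C, c * d = 0 → IsNilpotent c ∨ IsNilpotent d)
    (hR : Function.Injective (algebraMap R A₀)) (hB : Function.Injective (algebraMap A₀ B))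
    (hfrac : ∀ b : B, ∃ c₁ c₂ : C, ρ c₂ ≠ 0 ∧ ρ c₂ * b = ρ c₁)
    (hO : IsIntegrallyClosed O) :
    IsNormalizedRootExtension n (algebraMap A₀ A (algebraMap R A₀ π))
      (algebraMap (TameRing R π n) O (tameRoot R π n)) := by
  have hBO : Function.Injective (algebraMap B O) :=
    IsLocalization.injective O Q.primeCompl_le_nonZeroDivisors
  have hA₀A : Function.Injective (algebraMap A₀ A) :=
    IsLocalization.injective A P.primeCompl_le_nonZeroDivisors
  have hA₀O : Function.Injective (algebraMap A₀ O) := by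
    rw [IsScalarTower.algebraMap_eq A₀ B O]
    exact hBO.comp hB
  have hcomp : ∀ x : A₀, algebraMap A O (algebraMap A₀ A x) = algebraMap B O (algebraMap A₀ B x) :=
    fun x => by rw [← IsScalarTower.algebraMap_apply, ← IsScalarTower.algebraMap_apply]
  have hAO : Function.Injective (algebraMap A O) := by
    refine IsLocalization.injective_of_map_algebraMap_zero (M := P.primeCompl) A _ fun x hx => ?_
    rw [← IsScalarTower.algebraMap_apply, map_eq_zero_iff _ hA₀O] at hx
    rw [hx, map_zero]
  have hfracO : ∀ o : O, ∃ b s : B, IsUnit (algebraMap B O s) ∧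
      o * algebraMap B O s = algebraMap B O b := fun o => by
    obtain ⟨⟨b, s⟩, h⟩ := IsLocalization.surj Q.primeCompl o
    exact ⟨b, s, IsLocalization.map_units O s, h⟩
  have hmul : ∀ y : B, y ≠ 0 → ∃ (r : A₀) (y' : B), r ≠ 0 ∧ algebraMap A₀ B r = y * y' := by
    intro y hy
    obtain ⟨r, hr, y', h⟩ := ((Algebra.IsIntegral.isIntegral (R := A₀) y).isAlgebraic).exists_nonzero_dvd
      (mem_nonZeroDivisors_of_ne_zero hy)
    exact ⟨r, y', hr, h⟩
  have hsum : ∀ b : B, ∃ s : A₀, s ≠ 0 ∧ ∃ c : C, algebraMap A₀ B s * b = ρ c := by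
    intro b
    obtain ⟨c₁, c₂, hc₂, h⟩ := hfrac b
    have hint : IsIntegral A₀ (⟨ρ c₂, c₂, rfl⟩ : ρ.range) := by
      have : IsIntegral A₀ (ρ c₂) := Algebra.IsIntegral.isIntegral _
      exact (isIntegral_algHom_iff ρ.range.val Subtype.val_injective).1 this
    obtain ⟨s, hs, ⟨_, c₃, rfl⟩, h'⟩ := hint.isAlgebraic.exists_nonzero_dvd
      (mem_nonZeroDivisors_of_ne_zero (fun h0 => hc₂ (congrArg Subtype.val h0)))
    have h'' : algebraMap A₀ B s = ρ c₂ * ρ c₃ := congrArg Subtype.val h'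
    exact ⟨s, hs, c₁ * c₃, by rw [h'', map_mul, ← h]; ring⟩
  have hK : IsFractionRing A₀ (FractionRing A) := by
    have : FaithfulSMul A₀ (FractionRing A) := by
      rw [faithfulSMul_iff_algebraMap_injective, IsScalarTower.algebraMap_eq A₀ A (FractionRing A)]
      exact (IsFractionRing.injective A _).comp hA₀A
    refine IsFractionRing.of_field _ _ fun z => ?_
    obtain ⟨x, y, hy, rfl⟩ := IsFractionRing.div_surjective (A := A) z
    obtain ⟨⟨x₁, x₂⟩, hx⟩ := IsLocalization.surj P.primeCompl x
    obtain ⟨⟨y₁, y₂⟩, hy'⟩ := IsLocalization.surj P.primeCompl y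
    have hne : ∀ w : P.primeCompl, algebraMap A (FractionRing A) (algebraMap A₀ A w) ≠ 0 := fun w =>
      ((IsLocalization.map_units A w).map _).ne_zero
    have hy0 : algebraMap A (FractionRing A) y ≠ 0 := by
      rw [map_ne_zero_iff _ (IsFractionRing.injective A _)]
      exact nonZeroDivisors.ne_zero hy
    have hx' := congrArg (algebraMap A (FractionRing A)) hx
    have hy'' := congrArg (algebraMap A (FractionRing A)) hy'
    rw [map_mul] at hx' hy''
    refine ⟨x₁ * y₂, y₁ * x₂, ?_⟩
    rw [IsScalarTower.algebraMap_apply A₀ A (FractionRing A),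
      IsScalarTower.algebraMap_apply A₀ A (FractionRing A)]
    simp only [map_mul]
    rw [← hx', ← hy'']
    have h1 := hne x₂
    have h2 := hne y₂
    field_simp
  refine ⟨hAO, ?_, ?_, hO, fun o => ?_, fun o => ?_⟩
  · have := irreducible_of_irreducible_baseChange (K := FractionRing A) hπ hζ hn C hR hC
    rwa [IsScalarTower.algebraMap_apply A₀ A (FractionRing A)] at this
  · rw [← map_pow, tameRoot_pow, ← hρ, ← IsScalarTower.algebraMap_apply,
      IsScalarTower.algebraMap_apply R A₀ C, AlgHom.commutes, hcomp]
  · obtain ⟨b, y, hy, h⟩ := hfracO o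
    have hy0 : y ≠ 0 := by rintro rfl; simp at hy
    obtain ⟨r, y', hr, hry⟩ := hmul y hy0
    obtain ⟨s, hs, c, hc⟩ := hsum (b * y')
    obtain ⟨α, rfl⟩ := exists_eq_sum_of_isPushout (A := A₀) hπ hζ hn c
    refine ⟨algebraMap A₀ A (s * r), ?_, fun i => algebraMap A₀ A (α i), ?_⟩
    · rw [map_ne_zero_iff _ hA₀A]
      exact mul_ne_zero hs hr
    · have h1 := congrArg (algebraMap B O) hc
      simp only [map_sum, map_mul, map_pow, AlgHom.commutes, hρ] at h1
      simp only [hcomp]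
      rw [← h1, map_mul, hry, map_mul, map_mul, ← h]
      ring
  · obtain ⟨b, y, hy, h⟩ := hfracO o
    have hint : ∀ b : B, IsIntegral A (algebraMap B O b) := fun b =>
      ((Algebra.IsIntegral.isIntegral (R := A₀) b).algebraMap (B := O)).tower_top
    exact ⟨_, _, hint b, hint y, hy, h⟩

end Charts


/-! ### Structure maps on sections and stalks -/

section Sections

variable {D : Type u} [CommRing D] {Y : Scheme.{u}} (g : Y ⟶ Spec (CommRingCat.of D))

theorem le_preimage_top {Y Z : Scheme.{u}} (g : Y ⟶ Z) (U : Y.Opens) : U ≤ g ⁻¹ᵁ ⊤ := le_top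

/-- The structure map `D → Γ(Y, U)` of a `D`-scheme. -/
noncomputable def toSections (U : Y.Opens) : D →+* Γ(Y, U) :=
  ((Scheme.ΓSpecIso (CommRingCat.of D)).inv ≫ g.appLE ⊤ U (le_preimage_top g U)).hom

theorem germ_toSections (U : Y.Opens) (y : Y) (hy : y ∈ U) (d : D) :
    Y.presheaf.germ U y hy (toSections g U d) = toStalk g y d := by
  have : ((Scheme.ΓSpecIso (CommRingCat.of D)).inv ≫ g.appLE ⊤ U (le_preimage_top g U)) ≫
      Y.presheaf.germ U y hy = (Scheme.ΓSpecIso (CommRingCat.of D)).inv ≫ g.appTop ≫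
        Y.presheaf.germ ⊤ y (TopologicalSpace.Opens.mem_top y) := by
    rw [Category.assoc, ← Scheme.Hom.appLE_map g le_rfl (homOfLE (le_preimage_top g U)).op,
      Category.assoc, TopCat.Presheaf.germ_res, ← Scheme.Hom.app_eq_appLE]
    rfl
  exact congrArg (fun k => k.hom d) this

theorem appLE_toSections {Y' : Scheme.{u}} (h : Y' ⟶ Y) (U : Y.Opens) (V : Y'.Opens)
    (e : V ≤ h ⁻¹ᵁ U) (d : D) : h.appLE U V e (toSections g U d) = toSections (h ≫ g) V d := by
  have : ((Scheme.ΓSpecIso (CommRingCat.of D)).inv ≫ g.appLE ⊤ U (le_preimage_top g U)) ≫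
      h.appLE U V e = (Scheme.ΓSpecIso (CommRingCat.of D)).inv ≫
        (h ≫ g).appLE ⊤ V (le_preimage_top _ V) := by
    rw [Category.assoc, Scheme.Hom.appLE_comp_appLE]
  exact congrArg (fun k => k.hom d) this

theorem toSections_comp_SpecMap {D' : Type u} [CommRing D'] (φ : D' →+* D) (U : Y.Opens) (d : D') :
    toSections (g ≫ Spec.map (CommRingCat.ofHom φ)) U d = toSections g U (φ d) := by
  have : (Scheme.ΓSpecIso (CommRingCat.of D')).inv ≫
      (g ≫ Spec.map (CommRingCat.ofHom φ)).appLE ⊤ U (le_preimage_top _ U) =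
      CommRingCat.ofHom φ ≫ (Scheme.ΓSpecIso (CommRingCat.of D)).inv ≫
        g.appLE ⊤ U (le_preimage_top g U) := by
    rw [← Category.assoc, Scheme.ΓSpecIso_inv_naturality, Category.assoc, Scheme.Hom.comp_appLE]
    rfl
  exact congrArg (fun k => k.hom d) this

theorem toStalk_comp_SpecMap {D' : Type u} [CommRing D'] (φ : D' →+* D) (y : Y) (d : D') :
    toStalk (g ≫ Spec.map (CommRingCat.ofHom φ)) y d = toStalk g y (φ d) := by
  rw [← germ_toSections _ ⊤ y (TopologicalSpace.Opens.mem_top y), toSections_comp_SpecMap,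
    germ_toSections]

theorem stalkMap_toStalk {Y' : Scheme.{u}} (h : Y' ⟶ Y) (y : Y') (d : D) :
    h.stalkMap y (toStalk g (h y) d) = toStalk (h ≫ g) y d := by
  rw [← germ_toSections g ⊤ (h y) (TopologicalSpace.Opens.mem_top _),
    Scheme.Hom.germ_stalkMap_apply,
    ← germ_toSections (h ≫ g) (h ⁻¹ᵁ ⊤) y (TopologicalSpace.Opens.mem_top _),
    ← appLE_toSections g h ⊤ _ le_rfl]
  congr 1
  rw [Scheme.Hom.app_eq_appLE]

theorem toSections_isPushout {D' : Type u} [CommRing D'] (φ : D →+* D') {U : Y.Opens}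
    (hU : IsAffineOpen U) :
    IsPushout (CommRingCat.ofHom (toSections g U)) (CommRingCat.ofHom φ)
      ((pullback.fst g (Spec.map (CommRingCat.ofHom φ))).appLE U
        (pullback.fst g (Spec.map (CommRingCat.ofHom φ)) ⁻¹ᵁ U) le_rfl)
      (CommRingCat.ofHom (toSections (pullback.snd g (Spec.map (CommRingCat.ofHom φ)))
        (pullback.fst g (Spec.map (CommRingCat.ofHom φ)) ⁻¹ᵁ U))) := by
  have H := IsPullback.of_hasPullback g (Spec.map (CommRingCat.ofHom φ))
  have h1 := isIso_pushoutSection_of_isAffineOpen H (US := ⊤) (UT := ⊤) (UX := U) (le_preimage_top _ _) (le_preimage_top _ _)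
    (UY := pullback.fst g (Spec.map (CommRingCat.ofHom φ)) ⁻¹ᵁ U) (by simp)
    (isAffineOpen_top _) (isAffineOpen_top _) hU
  rw [isIso_pushoutSection_iff] at h1
  refine IsPushout.of_iso h1 (Scheme.ΓSpecIso (CommRingCat.of D)) (Iso.refl _)
    (Scheme.ΓSpecIso (CommRingCat.of D')) (Iso.refl _) ?_ ?_ ?_ ?_
  · simp [toSections]
  · rw [← Scheme.ΓSpecIso_naturality]
    congr 1
  · simp
  · simp [toSections]

end Sections

/-! ### Surjectivity and generic behaviour of the normalization -/

section Normalization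

variable {Y Z : Scheme.{u}} {ν : Y ⟶ Z}

/-- The image contains a dense open set by birationality and is closed by integrality. -/
theorem IsNormalization.surjective (h : IsNormalization ν) : Surjective ν := by
  have := h.isIntegralHom
  obtain ⟨U, hU, hiso⟩ := h.birational
  have hsub : (U : Set Z) ⊆ Set.range ν := by
    intro z hz
    obtain ⟨y, hy⟩ := (ν ∣_ U).surjective ⟨z, hz⟩
    refine ⟨(ν ⁻¹ᵁ U).ι y, ?_⟩
    rw [← Scheme.Hom.comp_apply, ← morphismRestrict_ι, Scheme.Hom.comp_apply, hy]
    rfl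
  refine ⟨Set.range_eq_univ.1 (Set.eq_univ_of_univ_subset ?_)⟩
  rw [← hU.closure_eq]
  exact closure_minimal hsub ν.isClosedMap.isClosed_range

theorem IsNormalization.irreducibleSpace (h : IsNormalization ν) : IrreducibleSpace Z := by
  have := h.isIntegral
  have := h.surjective
  have h1 : IsIrreducible (Set.univ : Set Z) := by
    rw [← ν.surjective.range_eq, ← Set.image_univ]
    exact (IrreducibleSpace.isIrreducible_univ Y).image _ ν.continuous.continuousOn
  exact (irreducibleSpace_def Z).2 h1

theorem isIso_stalkMap_of_isIso (ν : Y ⟶ Z) [IsIso ν] (y : Y) : IsIso (ν.stalkMap y) :=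
  inferInstance

theorem IsNormalization.isIso_stalkMap_genericPoint (h : IsNormalization ν)
    [IrreducibleSpace Y] : IsIso (ν.stalkMap (genericPoint Y)) := by
  have := h.surjective
  obtain ⟨U, hU, hiso⟩ := h.birational
  have hmem : genericPoint Y ∈ ν ⁻¹ᵁ U := by
    have hne : (U : Set Z).Nonempty := by
      have : Nonempty Z := ⟨ν (genericPoint Y)⟩
      exact hU.nonempty
    obtain ⟨z, hz⟩ := hne
    obtain ⟨y, rfl⟩ := ν.surjective z
    exact (genericPoint_specializes y).mem_open (ν ⁻¹ᵁ U).2 hz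
  have := ((MorphismProperty.isomorphisms CommRingCat).arrow_mk_iso_iff
    (morphismRestrictStalkMap ν U ⟨genericPoint Y, hmem⟩)).1
    (show IsIso ((ν ∣_ U).stalkMap _) from isIso_stalkMap_of_isIso _ _)
  exact this

end Normalization

/-! ### Zero divisors on an irreducible scheme -/

section Nilpotent

/-- Two nonempty basic open sets of an irreducible space meet, and over an affine open an empty
basic open set means a nilpotent section. -/
theorem isNilpotent_or_of_mul_eq_zero {Z : Scheme.{u}} [IrreducibleSpace Z] {U : Z.Opens}
    (hU : IsAffineOpen U) {c d : Γ(Z, U)} (h : c * d = 0) : IsNilpotent c ∨ IsNilpotent d := by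
  have hc := Z.isNilpotent_iff_basicOpen_eq_bot_of_isCompact hU.isCompact
  rw [hc, hc]
  by_contra! hne
  have h1 : Z.basicOpen c ⊓ Z.basicOpen d = ⊥ := by
    rw [← Scheme.basicOpen_mul, h, Scheme.basicOpen_zero]
  have hn : ∀ {V : Z.Opens}, V ≠ ⊥ → (V : Set Z).Nonempty := fun {V} hV => by
    rwa [Ne, ← TopologicalSpace.Opens.coe_inj, TopologicalSpace.Opens.coe_bot,
      ← Ne, ← Set.nonempty_iff_ne_empty] at hV
  have h2 := nonempty_preirreducible_inter (Z.basicOpen c).2 (Z.basicOpen d).2 (hn hne.1) (hn hne.2)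
  have h3 : ((Z.basicOpen c ⊓ Z.basicOpen d : Z.Opens) : Set Z).Nonempty := h2
  rw [h1] at h3
  simp at h3

end Nilpotent


/-! ### Sections of the normalization as fractions -/

section Fractions

variable {Y Z : Scheme.{u}}

theorem app_injective_of_surjective (g : Y ⟶ Z) [AlgebraicGeometry.IsIntegral Z] [Surjective g]
    (U : Z.Opens) : Function.Injective (g.app U) := by
  rw [injective_iff_map_eq_zero]
  intro a ha
  rw [← basicOpen_eq_bot_iff]
  have h2 : g ⁻¹ᵁ (Z.basicOpen a) = ⊥ := by
    rw [Scheme.preimage_basicOpen, ha, Scheme.basicOpen_zero]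
  ext z
  obtain ⟨y, rfl⟩ := g.surjective z
  refine ⟨fun hz => ?_, fun hz => hz.elim⟩
  have : y ∈ g ⁻¹ᵁ (Z.basicOpen a) := hz
  rw [h2] at this
  exact this

/-- At the generic point ν induces an isomorphism of stalks, so b is there a quotient of sections
over V; sections of an integral scheme are determined by their germs at the generic point. -/
theorem IsNormalization.exists_fraction {ν : Y ⟶ Z} (hν : IsNormalization ν) {V : Z.Opens}
    (hV : IsAffineOpen V) (hne : Nonempty (ν ⁻¹ᵁ V)) (b : Γ(Y, ν ⁻¹ᵁ V)) :
    ∃ c₁ c₂ : Γ(Z, V), ν.app V c₂ ≠ 0 ∧ ν.app V c₂ * b = ν.app V c₁ := by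
  have := hν.isIntegral
  obtain ⟨y, hy⟩ := hne
  have hη : genericPoint Y ∈ ν ⁻¹ᵁ V := (genericPoint_specializes y).mem_open (ν ⁻¹ᵁ V).2 hy
  have hη' : ν (genericPoint Y) ∈ V := hη
  have hiso := hν.isIso_stalkMap_genericPoint
  obtain ⟨τ, hτ⟩ := (ConcreteCategory.bijective_of_isIso (ν.stalkMap (genericPoint Y))).2
    (Y.presheaf.germ (ν ⁻¹ᵁ V) _ hη b)
  let := Z.presheaf.algebra_section_stalk ⟨ν (genericPoint Y), hη'⟩
  have hloc := hV.isLocalization_stalk ⟨ν (genericPoint Y), hη'⟩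
  obtain ⟨⟨c₁, c₂⟩, hc⟩ := IsLocalization.surj
    (hV.primeIdealOf ⟨ν (genericPoint Y), hη'⟩).asIdeal.primeCompl τ
  have hu : IsUnit (Z.presheaf.germ V (ν (genericPoint Y)) hη' c₂) :=
    IsLocalization.map_units _ c₂
  have hc' : τ * Z.presheaf.germ V (ν (genericPoint Y)) hη' c₂ =
      Z.presheaf.germ V (ν (genericPoint Y)) hη' c₁ := hc
  have hρ : ∀ c, ν.stalkMap (genericPoint Y) (Z.presheaf.germ V (ν (genericPoint Y)) hη' c) =
      Y.presheaf.germ (ν ⁻¹ᵁ V) _ hη (ν.app V c) := Scheme.Hom.germ_stalkMap_apply ν V _ hη'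
  refine ⟨c₁, c₂, fun h0 => ?_, ?_⟩
  · have := hu.map (ν.stalkMap (genericPoint Y)).hom
    have h1 := hρ c₂
    rw [h0, map_zero] at h1
    exact this.ne_zero h1
  · apply germ_injective_of_isIntegral Y _ hη
    have := congrArg (ν.stalkMap (genericPoint Y)) hc'
    rw [map_mul, hτ, hρ, hρ] at this
    rw [map_mul, mul_comm, this]

end Fractions

/-! ### The stalk of X' as a normalized root extension -/

section Stalks

variable {R : Type u} [CommRing R] [IsDomain R] [IsDiscreteValuationRing R]
  {X : Scheme.{u}} (f : X ⟶ Spec (CommRingCat.of R))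

theorem toSections_injective [AlgebraicGeometry.IsIntegral X] [Flat f] {U : X.Opens} (hU : IsAffineOpen U)
    [Nonempty U] : Function.Injective (toSections f U) := by
  have h1 : (toSections f U).Flat := by
    have h2 := f.flat_appLE (isAffineOpen_top _) hU (le_preimage_top f U)
    exact RingHom.Flat.comp
      (RingHom.Flat.of_bijective (ConcreteCategory.bijective_of_isIso (Scheme.ΓSpecIso (CommRingCat.of R)).inv)) h2
  let := (toSections f U).toAlgebra
  have : Module.Flat R Γ(X, U) := h1
  exact FaithfulSMul.algebraMap_injective R Γ(X, U)

variable {π : R} {n : ℕ}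
  {X' : Scheme.{u}} {ν : X' ⟶ baseChange f π n}

theorem surjective_SpecMap_tameRing (hπ : Irreducible π) [NeZero n] :
    Surjective (Spec.map (CommRingCat.ofHom (algebraMap R (TameRing R π n)))) := by
  refine ⟨fun P => ?_⟩
  have h := (algebraMap_isIntegral_iff.2 inferInstance :
    (algebraMap R (TameRing R π n)).IsIntegral).comap_surjective
      (algebraMap_tameRing_injective hπ n)
  exact h P

theorem isIntegralHom_SpecMap_tameRing :
    IsIntegralHom (Spec.map (CommRingCat.ofHom (algebraMap R (TameRing R π n)))) := by
  rw [IsIntegralHom.SpecMap_iff]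
  exact algebraMap_isIntegral_iff.2 inferInstance

theorem isNormalizedRootExtension_stalk [AlgebraicGeometry.IsIntegral X] [Flat f] [NeZero n]
    (hπ : Irreducible π) {ζ : R} (hζ : IsPrimitiveRoot ζ n) (hn : IsUnit (n : R))
    (hν : IsNormalization ν) (x' : X') :
    letI : Algebra (X.presheaf.stalk ((ν ≫ pullback.fst _ _) x')) (X'.presheaf.stalk x') :=
      ((ν ≫ pullback.fst _ _).stalkMap x').hom.toAlgebra
    IsNormalizedRootExtension n (toStalk f ((ν ≫ pullback.fst _ _) x') π)
      (toStalk (ν ≫ pullback.snd _ _) x' (tameRoot R π n)) := by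
  set s := Spec.map (CommRingCat.ofHom (algebraMap R (TameRing R π n))) with hs
  set g : X' ⟶ X := ν ≫ pullback.fst f s with hg
  have i1 := isIntegralHom_SpecMap_tameRing (π := π) (n := n)
  have i2 := surjective_SpecMap_tameRing (π := π) (n := n) hπ
  have i3 := hν.isIntegralHom
  have i4 := hν.surjective
  have i5 := hν.isIntegral
  have i6 := hν.irreducibleSpace
  have i7 : IsIntegralHom g := inferInstance
  have i8 : Surjective (pullback.fst f s) := (MorphismProperty.of_isPullback (P := @Surjective) (IsPullback.of_hasPullback f s).flip i2)
  have i9 : Surjective g := inferInstance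
  obtain ⟨U, hU, hxU, -⟩ := exists_isAffineOpen_mem_and_subset (x := g x') (U := ⊤) trivial
  set V : (pullback f s).Opens := pullback.fst f s ⁻¹ᵁ U with hVdef
  have hV : IsAffineOpen V := hU.preimage _
  set W : X'.Opens := ν ⁻¹ᵁ V with hWdef
  have hW : IsAffineOpen W := hV.preimage _
  have hxW : x' ∈ W := hxU
  have hWU : W ≤ g ⁻¹ᵁ U := le_rfl
  have : Nonempty U := ⟨⟨_, hxU⟩⟩
  have : Nonempty W := ⟨⟨_, hxW⟩⟩
  let a1 : Algebra R Γ(X, U) := (toSections f U).toAlgebra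
  let a2 : Algebra Γ(X, U) Γ(pullback f s, V) :=
    ((pullback.fst f s).appLE U V le_rfl).hom.toAlgebra
  let a3 : Algebra (TameRing R π n) Γ(pullback f s, V) :=
    (toSections (pullback.snd f s) V).toAlgebra
  let a4 : Algebra R Γ(pullback f s, V) :=
    ((algebraMap Γ(X, U) Γ(pullback f s, V)).comp (algebraMap R Γ(X, U))).toAlgebra
  have t1 : IsScalarTower R Γ(X, U) Γ(pullback f s, V) := .of_algebraMap_eq fun _ => rfl
  have t2 : IsScalarTower R (TameRing R π n) Γ(pullback f s, V) := .of_algebraMap_eq fun d => by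
    change (pullback.fst f s).appLE U V le_rfl (toSections f U d) =
      toSections (pullback.snd f s) V (algebraMap R (TameRing R π n) d)
    rw [appLE_toSections, ← toSections_comp_SpecMap, pullback.condition]
  have t3 : Algebra.IsPushout R Γ(X, U) (TameRing R π n) Γ(pullback f s, V) :=
    CommRingCat.isPushout_iff_isPushout.1 (toSections_isPushout f (algebraMap R (TameRing R π n)) hU)
  let a5 : Algebra Γ(X, U) Γ(X', W) := (g.appLE U W hWU).hom.toAlgebra
  have t4 : Algebra.IsIntegral Γ(X, U) Γ(X', W) := by
    rw [← algebraMap_isIntegral_iff]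
    have := IsIntegralHom.isIntegral_app g U hU
    rw [Scheme.Hom.app_eq_appLE] at this
    exact this
  let ρ : Γ(pullback f s, V) →ₐ[Γ(X, U)] Γ(X', W) :=
    ⟨(ν.appLE V W le_rfl).hom, fun a => by
      have := Scheme.Hom.appLE_comp_appLE ν (pullback.fst f s) U V W le_rfl le_rfl
      exact congrArg (fun k => k.hom a) this⟩
  let a6 : Algebra (X.presheaf.stalk (g x')) (X'.presheaf.stalk x') := (g.stalkMap x').hom.toAlgebra
  let a7 : Algebra Γ(X, U) (X.presheaf.stalk (g x')) :=
    (X.presheaf.germ U (g x') hxU).hom.toAlgebra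
  let a8 : Algebra Γ(X', W) (X'.presheaf.stalk x') := (X'.presheaf.germ W x' hxW).hom.toAlgebra
  let a9 : Algebra Γ(X, U) (X'.presheaf.stalk x') :=
    ((algebraMap (X.presheaf.stalk (g x')) (X'.presheaf.stalk x')).comp
      (algebraMap Γ(X, U) (X.presheaf.stalk (g x')))).toAlgebra
  let a10 : Algebra (TameRing R π n) (X'.presheaf.stalk x') :=
    (toStalk (ν ≫ pullback.snd _ _) x').toAlgebra
  have t5 : IsScalarTower Γ(X, U) (X.presheaf.stalk (g x')) (X'.presheaf.stalk x') :=
    .of_algebraMap_eq fun _ => rfl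
  have t6 : IsScalarTower Γ(X, U) Γ(X', W) (X'.presheaf.stalk x') := .of_algebraMap_eq fun a => by
    refine (Scheme.Hom.germ_stalkMap_apply g U x' hxU a).trans ?_
    rw [Scheme.Hom.app_eq_appLE]
    rfl
  have t7 : IsLocalization.AtPrime (X.presheaf.stalk (g x')) (hU.primeIdealOf ⟨g x', hxU⟩).asIdeal :=
    hU.isLocalization_stalk ⟨g x', hxU⟩
  have t8 : IsLocalization.AtPrime (X'.presheaf.stalk x') (hW.primeIdealOf ⟨x', hxW⟩).asIdeal :=
    hW.isLocalization_stalk ⟨x', hxW⟩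
  have main := isNormalizedRootExtension_of_charts hπ hζ hn (A := X.presheaf.stalk (g x'))
    (O := X'.presheaf.stalk x') (hU.primeIdealOf ⟨g x', hxU⟩).asIdeal
    (hW.primeIdealOf ⟨x', hxW⟩).asIdeal ρ ?_ ?_ ?_ ?_ ?_ (hν.normal x')
  · have e1 : algebraMap Γ(X, U) (X.presheaf.stalk (g x')) (algebraMap R Γ(X, U) π) =
        toStalk f (g x') π := germ_toSections f U (g x') hxU π
    rw [e1] at main
    exact main
  · intro d
    change X'.presheaf.germ W x' hxW (ν.appLE V W le_rfl (toSections (pullback.snd f s) V d)) = _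
    rw [appLE_toSections, germ_toSections]
    rfl
  · exact fun c d h => isNilpotent_or_of_mul_eq_zero hV h
  · exact toSections_injective f hU
  · have := app_injective_of_surjective g U
    rw [Scheme.Hom.app_eq_appLE] at this
    exact this
  · intro b
    obtain ⟨c₁, c₂, h1, h2⟩ := hν.exists_fraction hV ⟨x', hxW⟩ b
    rw [Scheme.Hom.app_eq_appLE] at h1 h2
    exact ⟨c₁, c₂, h1, h2⟩

end Stalks


/-! ### Completed stalks as algebras -/

section Completed

variable {D : Type u} [CommRing D] {Y : Scheme.{u}} (g : Y ⟶ Spec (CommRingCat.of D))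

theorem nonempty_completedStalk_equiv_iff (y : Y) {B : Type u} [CommRing B] [Algebra D B] :
    Nonempty (CompletedStalk g y ≃ₐ[D] B) ↔
      ∃ e : AdicCompletion (maximalIdeal (Y.presheaf.stalk y)) (Y.presheaf.stalk y) ≃+* B,
        ∀ d, e (algebraMap _ _ (toStalk g y d)) = algebraMap D B d := by
  constructor
  · rintro ⟨e⟩
    exact ⟨(e.toRingEquiv : CompletedStalk g y ≃+* B), fun d => e.commutes d⟩
  · rintro ⟨e, he⟩
    exact ⟨AlgEquiv.ofRingEquiv (f := (e : CompletedStalk g y ≃+* B)) he⟩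

end Completed

/-! ### The local structure of X' on schemes -/

section Parts

variable {R : Type u} [CommRing R] [IsDomain R] [IsDiscreteValuationRing R]
  {X : Scheme.{u}} {f : X ⟶ Spec (CommRingCat.of R)}

theorem specialIdeal_eq {π : R} (hπ : Irreducible π) (x : X) :
    specialIdeal f x = Ideal.span {toStalk f x π} := by
  rw [specialIdeal, (IsDiscreteValuationRing.irreducible_iff_uniformizer π).1 hπ, Ideal.map_span,
    Set.image_singleton]

theorem IsSNCModel.isNormalCrossings (hf : IsSNCModel f) {π : R} (hπ : Irreducible π) {x : X}
    (hx : f x = closedPoint R) : IsNormalCrossings (toStalk f x π) := by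
  obtain ⟨d, t, s, h1, h2, h3⟩ := hf.normal_crossings x hx
  exact ⟨d, t, s, h1, h2, specialIdeal_eq (f := f) hπ x ▸ h3⟩

variable [IsAdicComplete (maximalIdeal R) R] [IsAlgClosed (ResidueField R)]
  (p : ℕ) [CharP (ResidueField R) p] {π : R} (hπ : Irreducible π)
  {n : ℕ} [NeZero n] (hn : ¬ p ∣ n) (hf : IsSNCModel f)
  {X' : Scheme.{u}} {ν : X' ⟶ baseChange f π n} (hν : IsNormalization ν)
  {x' : X'} (hx : f ((ν ≫ pullback.fst _ _) x') = closedPoint R)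

include p hπ hn hf hν hx

theorem completedStalk_equiv_rootInvariants {a b : ℕ} (ha : 0 < a) (hb : 0 < b)
    (h : Nonempty (CompletedStalk f ((ν ≫ pullback.fst _ _) x') ≃ₐ[R]
      PowerSeriesQuotient (crossing π a b))) :
    (∀ (r : ℕ) (hr : n * (a.gcd b).gcd n / (a.gcd n * b.gcd n) ∣ r * (b / b.gcd n) + a / a.gcd n),
      Nonempty (CompletedStalk (ν ≫ pullback.snd _ _) x' ≃ₐ[TameRing R π n]
        rootInvariants (tameRoot R π n) hr)) ∧
    (n * (a.gcd b).gcd n / (a.gcd n * b.gcd n) = 1 → IsRegularLocalRing (X'.presheaf.stalk x')) := by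
  have hnu := isUnit_natCast_of_not_dvd (R := R) p hn
  obtain ⟨ζ, hζ⟩ := exists_isPrimitiveRoot hnu
  have i1 := hf.isIntegral
  have i2 := hf.flat
  have i3 := hν.isIntegral
  have i4 := hf.regular ((ν ≫ pullback.fst _ _) x')
  have hext := isNormalizedRootExtension_stalk f hπ hζ hnu hν x'
  let a1 : Algebra (X.presheaf.stalk ((ν ≫ pullback.fst _ _) x')) (X'.presheaf.stalk x') :=
    ((ν ≫ pullback.fst _ _).stalkMap x').hom.toAlgebra
  let a2 : Algebra R (X.presheaf.stalk ((ν ≫ pullback.fst _ _) x')) := (toStalk f _).toAlgebra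
  let a3 : Algebra (TameRing R π n) (X'.presheaf.stalk x') :=
    (toStalk (ν ≫ pullback.snd _ _) x').toAlgebra
  have i5 : IsLocalHom (algebraMap (X.presheaf.stalk ((ν ≫ pullback.fst _ _) x'))
      (X'.presheaf.stalk x')) :=
    inferInstanceAs (IsLocalHom ((ν ≫ pullback.fst _ _).stalkMap x').hom)
  have hcomp : ∀ d : R, toStalk (ν ≫ pullback.snd _ _) x' (algebraMap R (TameRing R π n) d) =
      (ν ≫ pullback.fst _ _).stalkMap x' (toStalk f ((ν ≫ pullback.fst _ _) x') d) := by
    intro d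
    rw [stalkMap_toStalk, ← toStalk_comp_SpecMap, Category.assoc, Category.assoc,
      pullback.condition]
  obtain ⟨e, he⟩ := (nonempty_completedStalk_equiv_iff f _).1 h
  refine ⟨fun r hr => ?_, fun h1 => ?_⟩
  · obtain ⟨-, e', he'⟩ := exists_completion_equiv_rootInvariants
      (A := X.presheaf.stalk ((ν ≫ pullback.fst _ _) x')) (O := X'.presheaf.stalk x') p hπ hn
      (hf.isNormalCrossings hπ hx) (fun _ => hext) hcomp ha hb e he hr
    exact (nonempty_completedStalk_equiv_iff _ _).2 ⟨e', he'⟩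
  · exact isRegularLocalRing_of_eq_one
      (A := X.presheaf.stalk ((ν ≫ pullback.fst _ _) x')) (O := X'.presheaf.stalk x') p hπ hn
      (hf.isNormalCrossings hπ hx) (fun _ => hext) (hν.normal x') hcomp ha hb e he h1

theorem completedStalk_equiv_oneBranch {c₀ : MvPowerSeries (Fin 2) R} (hc₀ : IsUnit c₀)
    {b : ℕ} (hb : 0 < b)
    (h : Nonempty (CompletedStalk f ((ν ≫ pullback.fst _ _) x') ≃ₐ[R]
      PowerSeriesQuotient (oneBranch π c₀ b))) :
    ∃ (c : MvPowerSeries (Fin 2) R) (c' : MvPowerSeries (Fin 2) (TameRing R π n)),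
      IsUnit c ∧ c ^ n = c₀ ∧
      c' = MvPowerSeries.subst ![MvPowerSeries.X 0, MvPowerSeries.X 1 ^ (n / b.gcd n)] c ∧
      IsRegularLocalRing (PowerSeriesQuotient
        (oneBranch (tameRoot R π n) c' (b / b.gcd n))) ∧
      Nonempty (CompletedStalk (ν ≫ pullback.snd _ _) x' ≃ₐ[TameRing R π n]
        PowerSeriesQuotient (oneBranch (tameRoot R π n) c' (b / b.gcd n))) := by
  have hnu := isUnit_natCast_of_not_dvd (R := R) p hn
  obtain ⟨ζ, hζ⟩ := exists_isPrimitiveRoot hnu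
  have i1 := hf.isIntegral
  have i2 := hf.flat
  have i3 := hν.isIntegral
  have i4 := hf.regular ((ν ≫ pullback.fst _ _) x')
  have hext := isNormalizedRootExtension_stalk f hπ hζ hnu hν x'
  let a1 : Algebra (X.presheaf.stalk ((ν ≫ pullback.fst _ _) x')) (X'.presheaf.stalk x') :=
    ((ν ≫ pullback.fst _ _).stalkMap x').hom.toAlgebra
  let a2 : Algebra R (X.presheaf.stalk ((ν ≫ pullback.fst _ _) x')) := (toStalk f _).toAlgebra
  let a3 : Algebra (TameRing R π n) (X'.presheaf.stalk x') :=
    (toStalk (ν ≫ pullback.snd _ _) x').toAlgebra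
  have i5 : IsLocalHom (algebraMap (X.presheaf.stalk ((ν ≫ pullback.fst _ _) x'))
      (X'.presheaf.stalk x')) :=
    inferInstanceAs (IsLocalHom ((ν ≫ pullback.fst _ _).stalkMap x').hom)
  have hcomp : ∀ d : R, toStalk (ν ≫ pullback.snd _ _) x' (algebraMap R (TameRing R π n) d) =
      (ν ≫ pullback.fst _ _).stalkMap x' (toStalk f ((ν ≫ pullback.fst _ _) x') d) := by
    intro d
    rw [stalkMap_toStalk, ← toStalk_comp_SpecMap, Category.assoc, Category.assoc,
      pullback.condition]
  obtain ⟨e, he⟩ := (nonempty_completedStalk_equiv_iff f _).1 h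
  obtain ⟨c, c', h1, h2, h3, h4, e', he'⟩ := exists_completion_equiv_oneBranch
    (A := X.presheaf.stalk ((ν ≫ pullback.fst _ _) x')) (O := X'.presheaf.stalk x') p hπ hn
    (hf.isNormalCrossings hπ hx) (fun _ => hext) hcomp hc₀ hb e he
  exact ⟨c, c', h1, h2, h3, h4, (nonempty_completedStalk_equiv_iff _ _).2 ⟨e', he'⟩⟩

end Parts


/-! ### A height inequality for finitely generated algebras -/

section Height

/-- A chain of maximal length below P is pulled back, and the zero ideal goes below it because it
differs from every prime containing the kernel. -/
theorem height_add_one_le_height_comap {C B : Type*} [CommRing C] [IsDomain C] [IsNoetherianRing C]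
    [CommRing B] (φ : C →+* B) (hφ : Function.Surjective φ) (hker : RingHom.ker φ ≠ ⊥)
    (P : Ideal B) [P.IsPrime] : P.height + 1 ≤ (P.comap φ).height := by
  have : IsNoetherianRing B := isNoetherianRing_of_surjective _ _ φ hφ
  obtain ⟨l, hl, hlen⟩ := P.exists_ltSeries_length_eq_height
  let l' : LTSeries (PrimeSpectrum C) := l.map (PrimeSpectrum.comap φ) (fun a b hab => by
    refine lt_of_le_of_ne (Ideal.comap_mono hab.le) fun h => hab.ne ?_
    exact PrimeSpectrum.comap_injective_of_surjective φ hφ h)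
  have hlt : (⟨⊥, Ideal.isPrime_bot⟩ : PrimeSpectrum C) < l'.head := by
    refine lt_of_le_of_ne bot_le fun h => hker (le_bot_iff.1 ?_)
    have h1 : (⊥ : Ideal C) = l'.head.asIdeal := congrArg PrimeSpectrum.asIdeal h
    rw [h1]
    exact Ideal.comap_mono bot_le
  have h2 : (l'.cons _ hlt).last = ⟨P.comap φ, inferInstance⟩ := by
    rw [RelSeries.last_cons]
    change PrimeSpectrum.comap φ l.last = _
    rw [hl]
    rfl
  have h3 := Order.length_le_height h2.le
  rw [← PrimeSpectrum.height_eq_orderHeight] at h3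
  rw [← hlen]
  calc ((l.length : ℕ∞) + 1) = ((l'.cons _ hlt).length : ℕ∞) := by
        rw [RelSeries.cons_length]
        exact (Nat.cast_succ _).symm
    _ ≤ _ := h3

/-- B is the quotient of D[X] by a nonzero ideal. Adding the variable raises the height by one, and
passing to the quotient costs at least one. -/
theorem height_le_height_under_of_adjoin_singleton {D B : Type*} [CommRing D] [IsDomain D]
    [IsNoetherianRing D] [CommRing B] [Algebra D B] {x : B} (hx : IsAlgebraic D x)
    (htop : Algebra.adjoin D {x} = ⊤) (P : Ideal B) [P.IsMaximal] :
    P.height ≤ (P.under D).height := by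
  have hφ : Function.Surjective (Polynomial.aeval (R := D) x) := by
    rwa [← AlgHom.range_eq_top, ← Algebra.adjoin_singleton_eq_range_aeval]
  have hker : RingHom.ker (Polynomial.aeval (R := D) x).toRingHom ≠ ⊥ := by
    obtain ⟨q, hq, hq0⟩ := hx
    exact fun h => hq ((Submodule.mem_bot _).1 (h ▸ (RingHom.mem_ker.2 hq0)))
  have h1 := height_add_one_le_height_comap _ hφ hker P
  have hmax : (P.comap (Polynomial.aeval (R := D) x).toRingHom).IsMaximal :=
    Ideal.comap_isMaximal_of_surjective _ hφ
  have hover : (P.comap (Polynomial.aeval (R := D) x).toRingHom).LiesOver (P.under D) := by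
    constructor
    ext d
    simp [Ideal.under, Ideal.mem_comap]
  rw [Polynomial.height_eq_height_add_one (P.under D)] at h1
  exact (ENat.add_le_add_iff_right (by simp)).1 h1

theorem adjoin_eq_top_of_isScalarTower {D D' B : Type*} [CommRing D] [CommRing D'] [CommRing B]
    [Algebra D D'] [Algebra D B] [Algebra D' B] [IsScalarTower D D' B] {s t : Set B}
    (h : Algebra.adjoin D s = ⊤) (hst : ∀ x ∈ s, x ∈ t ∨ x ∈ (algebraMap D' B).range) :
    Algebra.adjoin D' t = ⊤ := by
  have h2 : Algebra.adjoin D s ≤ (Algebra.adjoin D' t).restrictScalars D := by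
    refine Algebra.adjoin_le fun x hx => ?_
    rcases hst x hx with hx | ⟨y, rfl⟩
    · exact (Subalgebra.mem_restrictScalars D).2 (Algebra.subset_adjoin hx)
    · exact (Subalgebra.mem_restrictScalars D).2 (Subalgebra.algebraMap_mem _ y)
  rw [eq_top_iff]
  intro y _
  exact h2 (h ▸ Algebra.mem_top)

/-- Generators are adjoined one at a time. That D already maps onto the residue field of P keeps the
contraction to each intermediate ring maximal. -/
theorem height_le_height_under_of_isAlgebraic {B : Type u} [CommRing B] [IsDomain B] (P : Ideal B)
    [P.IsMaximal] (s : Finset B) : ∀ {D : Type u} [CommRing D] [IsDomain D] [IsNoetherianRing D]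
    [Algebra D B] [FaithfulSMul D B], (∀ x ∈ s, IsAlgebraic D x) → Algebra.adjoin D (s : Set B) = ⊤ →
    Function.Surjective ((Ideal.Quotient.mk P).comp (algebraMap D B)) →
    P.height ≤ (P.under D).height := by
  classical
  induction s using Finset.induction_on with
  | empty =>
    intro D _ _ _ _ _ _ htop _
    refine height_le_height_under_of_adjoin_singleton (x := 0) isAlgebraic_zero ?_ P
    rw [eq_top_iff, ← htop]
    exact Algebra.adjoin_mono (by simp)
  | insert a s _ ih =>
    intro D _ _ _ _ _ halg htop hsurj
    let D' := Algebra.adjoin D ({a} : Set B)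
    have hft : Algebra.FiniteType D D' :=
      (Subalgebra.fg_iff_finiteType _).1 ⟨{a}, by simp [D']⟩
    have hnoeth : IsNoetherianRing D' := Algebra.FiniteType.isNoetherianRing D D'
    have hsurj' : Function.Surjective ((Ideal.Quotient.mk P).comp (algebraMap D' B)) := by
      intro y
      obtain ⟨d, hd⟩ := hsurj y
      exact ⟨algebraMap D D' d, hd⟩
    have h1 : P.height ≤ (P.under D').height := by
      refine ih (fun x hx => ?_) ?_ hsurj'
      · exact (halg x (Finset.mem_insert_of_mem hx)).extendScalars
          (FaithfulSMul.algebraMap_injective D D')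
      · refine adjoin_eq_top_of_isScalarTower htop fun x hx => ?_
        rw [Finset.coe_insert] at hx
        rcases hx with rfl | hx
        · exact Or.inr ⟨⟨x, Algebra.subset_adjoin rfl⟩, rfl⟩
        · exact Or.inl hx
    have hmax : (P.under D').IsMaximal := by
      let _ := Ideal.Quotient.field P
      have h2 := RingHom.ker_isMaximal_of_surjective _ hsurj'
      rwa [← RingHom.comap_ker, Ideal.mk_ker] at h2
    refine h1.trans ?_
    rw [show P.under D = (P.under D').under D from (Ideal.under_under P).symm]
    have ha : a ∈ D' := Algebra.subset_adjoin rfl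
    refine height_le_height_under_of_adjoin_singleton (x := (⟨a, ha⟩ : D')) ?_ ?_ _
    · exact (isAlgebraic_algebraMap_iff (A := B) Subtype.val_injective).1
        (halg a (Finset.mem_insert_self _ _))
    · have := Algebra.adjoin_adjoin_coe_preimage (R := D) (s := ({a} : Set B))
      rw [← this]
      congr 1
      ext y
      simp [Subtype.ext_iff]

/-- B is algebraic over a polynomial ring in one variable over R, whose dimension is that of R plus
one. -/
theorem height_le_of_trdeg_eq_one {R B : Type u} [CommRing R] [IsDomain R]
    [IsNoetherianRing R] [CommRing B] [IsDomain B] [Algebra R B] [FaithfulSMul R B]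
    [Algebra.FiniteType R B] (h : Algebra.trdeg R B = 1) (P : Ideal B) [P.IsMaximal]
    (hP : Function.Surjective ((Ideal.Quotient.mk P).comp (algebraMap R B))) :
    (P.height : WithBot ℕ∞) ≤ ringKrullDim R + 1 := by
  obtain ⟨ι, x, hx⟩ := exists_isTranscendenceBasis' R B
  rw [← hx.cardinalMk_eq_trdeg] at h
  have hfin : Finite ι := by
    rw [← Cardinal.lt_aleph0_iff_finite, h]
    exact Cardinal.one_lt_aleph0
  have hcard : Nat.card ι = 1 := by rw [Nat.card, h, Cardinal.one_toNat]
  let D := Algebra.adjoin R (Set.range x)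
  have hft : Algebra.FiniteType R D :=
    (Subalgebra.fg_iff_finiteType _).1 ⟨(Set.finite_range x).toFinset, by simp [D]⟩
  have hnoeth : IsNoetherianRing D := Algebra.FiniteType.isNoetherianRing R D
  have halg : Algebra.IsAlgebraic D B := hx.isAlgebraic
  obtain ⟨s, hs⟩ := (Algebra.FiniteType.out : (⊤ : Subalgebra R B).FG)
  have htop : Algebra.adjoin D (s : Set B) = ⊤ :=
    adjoin_eq_top_of_isScalarTower hs fun _ hx => Or.inl hx
  have h1 := height_le_height_under_of_isAlgebraic P s (D := D)
    (fun y _ => halg.isAlgebraic y) htop fun y => by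
      obtain ⟨d, hd⟩ := hP y
      exact ⟨algebraMap R D d, hd⟩
  have h2 : ringKrullDim D ≤ ringKrullDim (MvPolynomial ι R) := by
    let e := hx.1.aevalEquiv
    exact ringKrullDim_le_of_surjective e.toAlgHom.toRingHom e.surjective
  rw [MvPolynomial.ringKrullDim_of_isNoetherianRing, hcard] at h2
  calc (P.height : WithBot ℕ∞) ≤ ((P.under D).height : WithBot ℕ∞) := by exact_mod_cast h1
    _ ≤ ringKrullDim D := Ideal.height_le_ringKrullDim_of_ne_top Ideal.IsPrime.ne_top'
    _ ≤ _ := by simpa using h2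

end Height

/-! ### Transcendence degree of smooth algebras, and finiteness over complete rings -/

section Transcendence

/-- The algebra is étale over a polynomial ring in one variable, hence quasi-finite and therefore
algebraic over it. -/
theorem trdeg_eq_one_of_isStandardSmooth {D C : Type u} [CommRing D] [IsDomain D] [CommRing C]
    [IsDomain C] [Algebra D C] [FaithfulSMul D C]
    [Algebra.IsStandardSmoothOfRelativeDimension 1 D C] :
    Algebra.trdeg D C = 1 := by
  obtain ⟨g, hg⟩ := Algebra.IsStandardSmoothOfRelativeDimension.exists_etale_mvPolynomial 1 D C
  let M := MvPolynomial (Fin 1) D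
  let a1 : Algebra M C := g.toRingHom.toAlgebra
  have i1 : Algebra.Etale M C := hg
  have i2 : IsScalarTower D M C := IsScalarTower.of_algebraMap_eq fun d => (g.commutes d).symm
  have i3 : FaithfulSMul M C := inferInstance
  have i4 : Algebra.QuasiFinite M C := inferInstance
  have i5 : Algebra.IsAlgebraic M C := by
    let F := FractionRing M
    let L := FractionRing C
    let a2 : Algebra M L := inferInstance
    have i6 : Algebra.QuasiFinite M L := Algebra.QuasiFinite.trans M C L
    let a3 : Algebra F L := FractionRing.liftAlgebra M L
    have i7 : Algebra.QuasiFinite F L := Algebra.QuasiFinite.of_restrictScalars M F L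
    have i8 : Module.Finite F L := Module.Finite.of_quasiFinite
    have i9 : Algebra.IsAlgebraic M L :=
      (IsFractionRing.comap_isAlgebraic_iff (A := M) (K := F) (C := L)).2 inferInstance
    refine ⟨fun x => ?_⟩
    exact (isAlgebraic_algebraMap_iff (A := L) (IsFractionRing.injective C L)).1
      (i9.isAlgebraic _)
  rw [← trdeg_add_eq D M (A := C), trdeg_eq_zero (R := M) (A := C), MvPolynomial.trdeg_of_isDomain]
  simp

theorem isPrecomplete_pi {R : Type*} [CommRing R] {π : R} [IsPrecomplete (Ideal.span {π}) R]
    (N : ℕ) : IsPrecomplete (Ideal.span {π}) (Fin N → R) := by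
  have key : ∀ (M : Type _) [AddCommGroup M] [Module R M] (m : ℕ) (x y : M),
      x ≡ y [SMOD (Ideal.span {π} ^ m • ⊤ : Submodule R M)] ↔ ∃ z, π ^ m • z = x - y := by
    intro M _ _ m x y
    rw [SModEq.sub_mem, Ideal.span_singleton_pow, Submodule.ideal_span_singleton_smul,
      Submodule.mem_smul_pointwise_iff_exists]
    simp
  refine ⟨fun F hF => ?_⟩
  have h : ∀ i, ∃ L : R, ∀ m, F m i ≡ L [SMOD (Ideal.span {π} ^ m • ⊤ : Submodule R R)] := by
    intro i
    refine IsPrecomplete.prec inferInstance fun {m k} hmk => ?_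
    obtain ⟨z, hz⟩ := (key _ m _ _).1 (hF hmk)
    exact (key _ m _ _).2 ⟨z i, by simpa using congrFun hz i⟩
  choose L hL using h
  refine ⟨L, fun m => (key _ m _ _).2 ?_⟩
  have h2 : ∀ i, ∃ z : R, π ^ m • z = F m i - L i := fun i => (key _ m _ _).1 (hL i m)
  choose z hz using h2
  exact ⟨z, funext hz⟩

/-- Residues lift to R, so elements of A have t-adic expansions with coefficients in R. As π is a
unit times t ^ N, the powers t ^ i with i < N generate modulo π, and completeness of R removes the
reduction modulo π. -/
theorem finite_of_maximalIdeal_eq_span_singleton {R A : Type*} [CommRing R] [IsDomain R]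
    [IsDiscreteValuationRing R] [IsAdicComplete (maximalIdeal R) R] [CommRing A] [IsDomain A]
    [IsLocalRing A] [IsNoetherianRing A] [Algebra R A] {π : R} (hπ : Irreducible π)
    (hπ0 : algebraMap R A π ≠ 0) (hπm : algebraMap R A π ∈ maximalIdeal A) {t : A}
    (ht : maximalIdeal A = Ideal.span {t})
    (hres : Function.Surjective ((residue A).comp (algebraMap R A))) : Module.Finite R A := by
  have hmR := (IsDiscreteValuationRing.irreducible_iff_uniformizer π).1 hπ
  have htu : ¬ IsUnit t := fun h => (mem_maximalIdeal t).1
    (ht ▸ Ideal.mem_span_singleton_self t) h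
  obtain ⟨c, hc, hct⟩ :=
    (FiniteMultiplicity.of_not_isUnit htu hπ0).exists_eq_pow_mul_and_not_dvd
  set N := _root_.multiplicity t (algebraMap R A π)
  have hcu : IsUnit c := by
    by_contra h
    have : c ∈ maximalIdeal A := h
    rw [ht, Ideal.mem_span_singleton] at this
    exact hct this
  obtain ⟨d, hd⟩ := hcu.exists_right_inv
  have htN : t ^ N = algebraMap R A π * d := by rw [hc, mul_assoc, hd, mul_one]
  have hstep : ∀ a : A, ∃ (r : R) (a' : A), a = algebraMap R A r + t * a' := by
    intro a
    obtain ⟨r, hr⟩ := hres (residue A a)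
    have h1 : a - algebraMap R A r ∈ maximalIdeal A := by
      rw [← residue_eq_zero_iff, map_sub, ← hr, RingHom.comp_apply, sub_self]
    rw [ht, Ideal.mem_span_singleton] at h1
    obtain ⟨a', ha'⟩ := h1
    exact ⟨r, a', by rw [← ha']; ring⟩
  have hexp : ∀ (m : ℕ) (a : A), ∃ (r : ℕ → R) (a' : A),
      a = ∑ i ∈ Finset.range m, algebraMap R A (r i) * t ^ i + t ^ m * a' := by
    intro m
    induction m with
    | zero => exact fun a => ⟨0, a, by simp⟩
    | succ m ih =>
      intro a
      obtain ⟨r, a', h⟩ := ih a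
      obtain ⟨r', a'', h'⟩ := hstep a'
      refine ⟨Function.update r m r', a'', ?_⟩
      rw [Finset.sum_range_succ, Function.update_self]
      rw [Finset.sum_congr rfl fun i hi => by
        rw [Function.update_of_ne (Finset.mem_range.1 hi).ne]]
      rw [h, h']
      ring
  have hpre : IsPrecomplete (Ideal.span {π}) R := hmR ▸ inferInstance
  have hpi := isPrecomplete_pi (π := π) N
  have hhaus : IsHausdorff (Ideal.span {π}) A := by
    rw [← IsHausdorff.map_algebraMap_iff (S := A), Ideal.map_span, Set.image_singleton]
    refine ⟨fun x hx => ?_⟩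
    have h0 : (⨅ i : ℕ, Ideal.span {algebraMap R A π} ^ i) = ⊥ :=
      Ideal.iInf_pow_eq_bot_of_isLocalRing _ fun h =>
        (mem_maximalIdeal _).1 hπm (Ideal.span_singleton_eq_top.1 h)
    rw [← Submodule.mem_bot (R := A), ← h0, Submodule.mem_iInf]
    intro i
    have := hx i
    rw [SModEq.zero] at this
    simpa using this
  let F : (Fin N → R) →ₗ[R] A := Fintype.linearCombination R (fun i : Fin N => t ^ (i : ℕ))
  refine Module.Finite.of_surjective F (surjective_of_mkQ_comp_surjective (I := Ideal.span {π}) ?_)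
  intro y
  obtain ⟨a, rfl⟩ := Submodule.mkQ_surjective _ y
  obtain ⟨r, a', h⟩ := hexp N a
  refine ⟨fun i => r i, ?_⟩
  rw [LinearMap.comp_apply, ← sub_eq_zero, ← map_sub, Submodule.mkQ_apply,
    Submodule.Quotient.mk_eq_zero]
  have h3 : F (fun i => r i) - a = π • (- (d * a')) := by
    rw [Fintype.linearCombination_apply, h, htN, Finset.sum_range, Algebra.smul_def]
    simp only [Algebra.smul_def]
    ring
  rw [h3]
  exact Submodule.smul_mem_smul (Ideal.mem_span_singleton_self π) trivial

end Transcendence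


/-! ### Transcendence degree of ring homomorphisms -/

section HomTrdeg

variable {R S T : Type u} [CommRing R] [CommRing S] [CommRing T]

/-- The transcendence degree of a ring homomorphism. -/
noncomputable def homTrdeg (φ : R →+* S) : Cardinal.{u} := @Algebra.trdeg R S _ _ φ.toAlgebra

theorem homTrdeg_comp [Nontrivial R] [NoZeroDivisors T] {φ : R →+* S} {ψ : S →+* T}
    (hφ : Function.Injective φ) (hψ : Function.Injective ψ) :
    homTrdeg (ψ.comp φ) = homTrdeg φ + homTrdeg ψ := by
  let a1 := φ.toAlgebra
  let a2 := ψ.toAlgebra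
  let a3 := (ψ.comp φ).toAlgebra
  have i1 : IsScalarTower R S T := IsScalarTower.of_algebraMap_eq fun _ => rfl
  have i2 : FaithfulSMul R S := (faithfulSMul_iff_algebraMap_injective R S).2 hφ
  have i3 : FaithfulSMul S T := (faithfulSMul_iff_algebraMap_injective S T).2 hψ
  exact (trdeg_add_eq R S (A := T)).symm

theorem homTrdeg_eq_zero_of_surjective [Nontrivial R] {φ : R →+* S}
    (hφ : Function.Surjective φ) : homTrdeg φ = 0 := by
  let a1 := φ.toAlgebra
  have i1 : Algebra.IsAlgebraic R S := ⟨fun x => by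
    obtain ⟨y, rfl⟩ := hφ x
    exact isAlgebraic_algebraMap y⟩
  exact trdeg_eq_zero (R := R) (A := S)

theorem homTrdeg_algebraMap [Algebra R S] : homTrdeg (algebraMap R S) = Algebra.trdeg R S := by
  rw [homTrdeg, toAlgebra_algebraMap]

theorem homTrdeg_eq_zero_of_isLocalization [Nontrivial R] [Algebra R S] (M : Submonoid R)
    [IsLocalization M S] : homTrdeg (algebraMap R S) = 0 := by
  rw [homTrdeg_algebraMap]
  have := IsLocalization.isAlgebraic S M
  exact trdeg_eq_zero

end HomTrdeg

/-! ### Transcendence degree of stalks -/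

section Stalk

variable {D : Type u} [CommRing D] {Y : Scheme.{u}} (g : Y ⟶ Spec (CommRingCat.of D))

theorem mem_asIdeal_iff (y : Y) (d : D) :
    d ∈ (g y).asIdeal ↔ toStalk g y d ∈ maximalIdeal (Y.presheaf.stalk y) := by
  rw [mem_maximalIdeal, mem_nonunits_iff, ← not_iff_not, not_not]
  have h1 : IsUnit (toStalk g y d) ↔
      y ∈ Y.basicOpen (g.appTop ((Scheme.ΓSpecIso (CommRingCat.of D)).inv d)) :=
    (Y.mem_basicOpen_top _ _).symm
  rw [h1, ← Scheme.preimage_basicOpen_top, basicOpen_eq_of_affine']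
  simp only [Iso.inv_hom_id_apply]
  rfl

variable [AlgebraicGeometry.IsIntegral Y]

theorem homTrdeg_germ {U : Y.Opens} (hU : IsAffineOpen U) {y : Y} (hy : y ∈ U) :
    homTrdeg (Y.presheaf.germ U y hy).hom = 0 := by
  have : Nonempty U := ⟨⟨y, hy⟩⟩
  let a1 := (Y.presheaf.germ U y hy).hom.toAlgebra
  have h := hU.isLocalization_stalk ⟨y, hy⟩
  exact homTrdeg_eq_zero_of_isLocalization (R := Γ(Y, U)) (S := Y.presheaf.stalk y)
    (hU.primeIdealOf ⟨y, hy⟩).asIdeal.primeCompl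

theorem toStalk_injective {R : Type u} [CommRing R] [IsDomain R] [IsDiscreteValuationRing R] {X : Scheme.{u}}
    (f : X ⟶ Spec (CommRingCat.of R)) [AlgebraicGeometry.IsIntegral X] [Flat f] (x : X) :
    Function.Injective (toStalk f x) := by
  obtain ⟨U, hU, hxU, -⟩ := exists_isAffineOpen_mem_and_subset (TopologicalSpace.Opens.mem_top x)
  have : Nonempty U := ⟨⟨x, hxU⟩⟩
  have h1 : toStalk f x = (X.presheaf.germ U x hxU).hom.comp (toSections f U) :=
    RingHom.ext fun d => (germ_toSections f U x hxU d).symm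
  rw [h1]
  exact (germ_injective_of_isIntegral X x hxU).comp (toSections_injective f hU)

theorem homTrdeg_toStalk [Nontrivial D] {U : Y.Opens} (hU : IsAffineOpen U)
    (hinj : Function.Injective (toSections g U)) {y : Y} (hy : y ∈ U) :
    homTrdeg (toStalk g y) = homTrdeg (toSections g U) := by
  have h1 : toStalk g y = (Y.presheaf.germ U y hy).hom.comp (toSections g U) :=
    RingHom.ext fun d => (germ_toSections g U y hy d).symm
  rw [h1, homTrdeg_comp hinj (germ_injective_of_isIntegral Y y hy), homTrdeg_germ hU, add_zero]

/-- Localization does not change the transcendence degree, so each stalk is compared with the stalk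
at the generic point. -/
theorem homTrdeg_toStalk_eq {R : Type u} [CommRing R] [IsDomain R] [IsDiscreteValuationRing R] {X : Scheme.{u}}
    (f : X ⟶ Spec (CommRingCat.of R)) [AlgebraicGeometry.IsIntegral X] [Flat f] (x y : X) :
    homTrdeg (toStalk f x) = homTrdeg (toStalk f y) := by
  have h : ∀ x : X, homTrdeg (toStalk f x) = homTrdeg (toStalk f (genericPoint X)) := by
    intro x
    obtain ⟨U, hU, hxU, -⟩ := exists_isAffineOpen_mem_and_subset (TopologicalSpace.Opens.mem_top x)
    have : Nonempty U := ⟨⟨x, hxU⟩⟩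
    have h := toSections_injective f hU
    rw [homTrdeg_toStalk f hU h hxU,
      homTrdeg_toStalk f hU h ((genericPoint_specializes x).mem_open U.2 hxU)]
  rw [h, h y]

end Stalk

/-! ### The generic fibre as an open subscheme -/

section GenericFiber

variable {R : Type u} [CommRing R] [IsDomain R] [IsDiscreteValuationRing R]

/-- Inverting the uniformizer alone gives K; hence the generic fibre is open in X and shares its
stalks with X. -/
theorem isLocalization_away_fractionRing {π : R} (hπ : Irreducible π) :
    IsLocalization.Away π (FractionRing R) := by
  refine (isLocalization_iff _ _).2 ⟨?_, ?_, ?_⟩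
  · rintro ⟨_, m, rfl⟩
    refine IsUnit.mk0 _ ?_
    rw [map_pow]
    exact pow_ne_zero m (by simpa using hπ.ne_zero)
  · intro z
    obtain ⟨⟨a, s⟩, h⟩ := IsLocalization.surj (nonZeroDivisors R) z
    obtain ⟨m, v, hs⟩ := IsDiscreteValuationRing.eq_unit_mul_pow_irreducible
      (nonZeroDivisors.coe_ne_zero s) hπ
    refine ⟨⟨((v⁻¹ : Rˣ) : R) * a, ⟨π ^ m, m, rfl⟩⟩, ?_⟩
    have h1 : algebraMap R (FractionRing R) ((v⁻¹ : Rˣ) : R) * algebraMap R (FractionRing R) (v : R) = 1 := by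
      rw [← map_mul, Units.inv_mul, map_one]
    simp only [hs, map_mul] at h
    simp only [map_mul, ← h]
    linear_combination (- z * algebraMap R (FractionRing R) (π ^ m)) * h1
  · intro a b h
    exact ⟨1, by rw [IsFractionRing.injective R (FractionRing R) h]⟩

theorem isOpenImmersion_SpecMap_fractionRing :
    IsOpenImmersion (Spec.map (CommRingCat.ofHom (algebraMap R (FractionRing R)))) := by
  obtain ⟨π, hπ⟩ := IsDiscreteValuationRing.exists_irreducible R
  have := isLocalization_away_fractionRing hπ
  exact IsOpenImmersion.of_isLocalization π

variable {X : Scheme.{u}} {f : X ⟶ Spec (CommRingCat.of R)}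

theorem nonempty_genericFiber [AlgebraicGeometry.IsIntegral X] [Flat f] :
    Nonempty (pullback f (Spec.map (CommRingCat.ofHom (algebraMap R (FractionRing R)))) :) := by
  have hη : f (genericPoint X) = (⟨⊥, Ideal.isPrime_bot⟩ : PrimeSpectrum R) := by
    apply PrimeSpectrum.ext
    rw [eq_bot_iff]
    intro d hd
    rw [mem_asIdeal_iff] at hd
    have h1 : maximalIdeal (X.presheaf.stalk (genericPoint X)) = ⊥ :=
      IsLocalRing.maximalIdeal_eq_bot (R := X.functionField)
    rw [h1, Submodule.mem_bot] at hd
    exact (Submodule.mem_bot _).2 (toStalk_injective f _ (hd.trans (map_zero _).symm))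
  obtain ⟨z, -⟩ := Scheme.Pullback.exists_preimage_pullback (f := f)
    (g := Spec.map (CommRingCat.ofHom (algebraMap R (FractionRing R)))) (genericPoint X)
    (⟨⊥, Ideal.isPrime_bot⟩ : PrimeSpectrum (FractionRing R)) (by
      rw [hη]
      apply PrimeSpectrum.ext
      exact (Ideal.comap_bot_of_injective _ (IsFractionRing.injective R (FractionRing R))).symm)
  exact ⟨z⟩

theorem homTrdeg_toStalk_eq_one [AlgebraicGeometry.IsIntegral X] [Flat f]
    [SmoothOfRelativeDimension 1 (genericFiberHom f)] (x : X) :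
    homTrdeg (toStalk f x) = 1 := by
  have i1 := isOpenImmersion_SpecMap_fractionRing (R := R)
  have i2 := nonempty_genericFiber (f := f)
  obtain ⟨z⟩ := id i2
  have i3 := isIntegral_of_isOpenImmersion
    (pullback.fst f (Spec.map (CommRingCat.ofHom (algebraMap R (FractionRing R)))))
  set i := pullback.fst f (Spec.map (CommRingCat.ofHom (algebraMap R (FractionRing R)))) with hi
  set g := genericFiberHom f with hg
  rw [homTrdeg_toStalk_eq f x (i z)]
  have hcomp : (i.stalkMap z).hom.comp (toStalk f (i z)) =
      (toStalk g z).comp (algebraMap R (FractionRing R)) := by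
    ext d
    rw [RingHom.comp_apply, RingHom.comp_apply]
    refine (stalkMap_toStalk f i z d).trans ?_
    rw [← toStalk_comp_SpecMap, hi, pullback.condition]
  have hiso : Function.Bijective (i.stalkMap z).hom := ConcreteCategory.bijective_of_isIso (i.stalkMap z)
  have h1 : homTrdeg (toStalk f (i z)) = homTrdeg ((i.stalkMap z).hom.comp (toStalk f (i z))) := by
    rw [homTrdeg_comp (toStalk_injective f _) hiso.1, homTrdeg_eq_zero_of_surjective hiso.2, add_zero]
  have hginj : Function.Injective (toStalk g z) := (toStalk g z).injective
  rw [h1, hcomp, homTrdeg_comp (IsFractionRing.injective R (FractionRing R)) hginj,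
    homTrdeg_eq_zero_of_isLocalization (nonZeroDivisors R), zero_add]
  obtain ⟨U, hU, V, hV, hzV, e, hsm⟩ :=
    SmoothOfRelativeDimension.exists_isStandardSmoothOfRelativeDimension (n := 1) (f := g) z
  obtain rfl : U = ⊤ := by
    rw [eq_top_iff]
    intro y _
    have : y = g z := Subsingleton.elim (α := PrimeSpectrum (FractionRing R)) _ _
    exact this ▸ e hzV
  have : Nonempty V := ⟨⟨z, hzV⟩⟩
  have hisoK := ConcreteCategory.bijective_of_isIso (Scheme.ΓSpecIso (CommRingCat.of (FractionRing R))).inv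
  have hKdom : IsDomain Γ(Spec (CommRingCat.of (FractionRing R)), ⊤) := inferInstance
  have hKfield : IsField Γ(Spec (CommRingCat.of (FractionRing R)), ⊤) :=
    MulEquiv.isField (Field.toIsField (FractionRing R))
      (RingEquiv.ofBijective (Scheme.ΓSpecIso (CommRingCat.of (FractionRing R))).inv.hom
        hisoK).symm.toMulEquiv
  let _ := hKfield.toField
  have hinj : Function.Injective (g.appLE ⊤ V e).hom := (g.appLE ⊤ V e).hom.injective
  rw [homTrdeg_toStalk g hV (toSections g V).injective hzV]
  have h2 : toSections g V = (g.appLE ⊤ V e).hom.comp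
    (Scheme.ΓSpecIso (CommRingCat.of (FractionRing R))).inv.hom := rfl
  rw [h2, homTrdeg_comp hisoK.1 hinj, homTrdeg_eq_zero_of_surjective hisoK.2, zero_add]
  let a1 := (g.appLE ⊤ V e).hom.toAlgebra
  have i4 : Algebra.IsStandardSmoothOfRelativeDimension 1
    Γ(Spec (CommRingCat.of (FractionRing R)), ⊤) Γ(pullback f
      (Spec.map (CommRingCat.ofHom (algebraMap R (FractionRing R)))), V) := hsm
  have i5 := (faithfulSMul_iff_algebraMap_injective
    Γ(Spec (CommRingCat.of (FractionRing R)), ⊤) Γ(pullback f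
      (Spec.map (CommRingCat.ofHom (algebraMap R (FractionRing R)))), V)).2 hinj
  exact trdeg_eq_one_of_isStandardSmooth

end GenericFiber


/-- By the Nullstellensatz the residue field of P is finite over the algebraically closed residue
field of R, hence equal to it. -/
theorem surjective_mk_comp_algebraMap {R B : Type*} [CommRing R] [IsLocalRing R]
    [IsAlgClosed (ResidueField R)] [CommRing B] [Algebra R B] [Algebra.FiniteType R B]
    (P : Ideal B) [P.IsMaximal] (hP : maximalIdeal R ≤ P.under R) :
    Function.Surjective ((Ideal.Quotient.mk P).comp (algebraMap R B)) := by
  let F := Ideal.Quotient.field P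
  let φ : ResidueField R →+* B ⧸ P := Ideal.Quotient.lift (maximalIdeal R)
    ((Ideal.Quotient.mk P).comp (algebraMap R B)) (fun r hr =>
      Ideal.Quotient.eq_zero_iff_mem.2 (hP hr))
  let a1 : Algebra (ResidueField R) (B ⧸ P) := φ.toAlgebra
  have i1 : IsScalarTower R (ResidueField R) (B ⧸ P) := IsScalarTower.of_algebraMap_eq fun _ => rfl
  have i2 : Algebra.FiniteType (ResidueField R) (B ⧸ P) :=
    Algebra.FiniteType.of_restrictScalars_finiteType R _ _
  have i3 : Module.Finite (ResidueField R) (B ⧸ P) :=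
    finite_of_finite_type_of_isJacobsonRing _ _
  have h := (IsAlgClosed.algebraMap_bijective_of_isIntegral (k := ResidueField R) (K := B ⧸ P)).2
  intro y
  obtain ⟨c, rfl⟩ := h y
  obtain ⟨r, rfl⟩ := residue_surjective c
  exact ⟨r, rfl⟩

section

variable {R : Type u} [CommRing R] [IsDomain R] [IsDiscreteValuationRing R]
  [IsAlgClosed (ResidueField R)]

/-! ### Closed points of the special fibre have two-dimensional local rings -/

section Local

variable {B A : Type u} [CommRing B] [Algebra R B] [Algebra.FiniteType R B] [CommRing A]
  [IsLocalRing A] [Algebra B A] [Algebra R A] [IsScalarTower R B A] (P : Ideal B) [P.IsMaximal]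
  (hP : maximalIdeal R ≤ P.under R) [IsLocalization.AtPrime A P]

include P hP in
theorem surjective_residue_comp_algebraMap :
    Function.Surjective ((residue A).comp (algebraMap R A)) := by
  have h := surjective_mk_comp_algebraMap P hP
  intro y
  let e := IsLocalization.AtPrime.equivQuotMaximalIdeal P A
  obtain ⟨r, hr⟩ := h (e.symm y)
  refine ⟨r, ?_⟩
  have h2 : e (e.symm y) = y := e.apply_symm_apply y
  rw [← h2, ← hr]
  rw [IsScalarTower.algebraMap_eq R B A]
  exact (IsLocalization.AtPrime.equivQuotMaximalIdeal_apply_mk P A _).symm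

include hP in
theorem ringKrullDim_eq_two_of_trdeg_eq_one [IsAdicComplete (maximalIdeal R) R] [IsDomain B]
    [IsDomain A] [IsRegularLocalRing A] [FaithfulSMul R A] (h : Algebra.trdeg R A = 1) :
    ringKrullDim A = 2 := by
  have hres := surjective_residue_comp_algebraMap (A := A) P hP
  have hinj : Function.Injective (algebraMap B A) :=
    IsLocalization.injective A (Ideal.primeCompl_le_nonZeroDivisors P)
  have i1 : FaithfulSMul B A := (faithfulSMul_iff_algebraMap_injective B A).2 hinj
  have i2 : FaithfulSMul R B := (faithfulSMul_iff_algebraMap_injective R B).2 (by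
    have := FaithfulSMul.algebraMap_injective R A
    rw [IsScalarTower.algebraMap_eq R B A] at this
    exact Function.Injective.of_comp this)
  have hB : Algebra.trdeg R B = 1 := by
    have i3 := IsLocalization.isAlgebraic A P.primeCompl
    rw [← h, ← trdeg_add_eq R B (A := A), trdeg_eq_zero (R := B) (A := A), add_zero]
  have hle : ringKrullDim A ≤ 2 := by
    rw [IsLocalization.AtPrime.ringKrullDim_eq_height P A]
    refine (height_le_of_trdeg_eq_one hB P (surjective_mk_comp_algebraMap P hP)).trans ?_
    rw [IsPrincipalIdealRing.ringKrullDim_eq_one R (IsDiscreteValuationRing.not_isField R)]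
    norm_num
  refine le_antisymm hle ?_
  obtain ⟨π, hπ⟩ := IsDiscreteValuationRing.exists_irreducible R
  have hπ0 : algebraMap R A π ≠ 0 := by
    simpa using hπ.ne_zero
  have hπm : algebraMap R A π ∈ maximalIdeal A := by
    rw [IsScalarTower.algebraMap_apply R B A, ← IsLocalization.AtPrime.map_eq_maximalIdeal P A]
    exact Ideal.mem_map_of_mem _ (hP ((mem_maximalIdeal _).2 hπ.not_isUnit))
  by_contra hlt
  -- Regularity turns the failure of dimension two into a principal maximal ideal; A would then be
  -- finite over R, with transcendence degree zero.
  have hfin : (maximalIdeal A).spanFinrank ≤ 1 := by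
    have h1 := (isRegularLocalRing_iff A).1 inferInstance
    rw [← h1] at hlt
    have h2 : ((maximalIdeal A).spanFinrank : WithBot ℕ∞) < (2 : ℕ) := by simpa using hlt
    have h3 : (maximalIdeal A).spanFinrank < 2 := by exact_mod_cast h2
    omega
  have hfg : (maximalIdeal A).FG := IsNoetherian.noetherian _
  obtain ⟨t, ht⟩ : ∃ t, maximalIdeal A = Ideal.span {t} := by
    rcases Nat.le_one_iff_eq_zero_or_eq_one.1 hfin with h0 | h1
    · exact ⟨0, by rw [(Submodule.spanFinrank_eq_zero_iff_eq_bot hfg).1 h0]; simp⟩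
    · obtain ⟨t, ht⟩ := ((Submodule.spanFinrank_eq_one_iff _).1 h1).1
      exact ⟨t, ht⟩
  have hmf := finite_of_maximalIdeal_eq_span_singleton hπ hπ0 hπm ht hres
  rw [trdeg_eq_zero] at h
  exact zero_ne_one h

end Local

theorem isMaximal_primeIdealOf {X : Scheme.{u}} {U : X.Opens} (hU : IsAffineOpen U) {x : X}
    (hxU : x ∈ U) (hx : IsClosed {x}) : (hU.primeIdealOf ⟨x, hxU⟩).asIdeal.IsMaximal := by
  rw [← PrimeSpectrum.isClosed_singleton_iff_isMaximal]
  have h1 : ({hU.primeIdealOf ⟨x, hxU⟩} : Set (PrimeSpectrum Γ(X, U))) =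
      hU.fromSpec ⁻¹' {x} := by
    ext y
    rw [Set.mem_singleton_iff]
    change _ ↔ hU.fromSpec y = x
    refine ⟨fun h => ?_, fun h => ?_⟩
    · rw [h]
      exact hU.fromSpec_primeIdealOf ⟨x, hxU⟩
    · exact hU.fromSpec.isOpenEmbedding.injective (h.trans (hU.fromSpec_primeIdealOf ⟨x, hxU⟩).symm)
  rw [h1]
  exact hx.preimage hU.fromSpec.continuous

variable {X : Scheme.{u}} {f : X ⟶ Spec (CommRingCat.of R)}

theorem IsSNCModel.surjective_residue_and_ringKrullDim [IsAdicComplete (maximalIdeal R) R]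
    (hf : IsSNCModel f) {x : X} (hx : IsClosed {x}) (hxs : f x = closedPoint R) :
    Function.Surjective ((residue (X.presheaf.stalk x)).comp (toStalk f x)) ∧
      ringKrullDim (X.presheaf.stalk x) = 2 := by
  have i1 := hf.isIntegral
  have i2 := hf.isProper
  have i3 := hf.flat
  have i4 := hf.smooth_genericFiber
  have i5 := hf.regular x
  obtain ⟨U, hU, hxU, -⟩ := exists_isAffineOpen_mem_and_subset (TopologicalSpace.Opens.mem_top x)
  have : Nonempty U := ⟨⟨x, hxU⟩⟩
  let P := (hU.primeIdealOf ⟨x, hxU⟩).asIdeal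
  have hPmax : P.IsMaximal := isMaximal_primeIdealOf hU hxU hx
  let a1 : Algebra R Γ(X, U) := (toSections f U).toAlgebra
  let a2 : Algebra Γ(X, U) (X.presheaf.stalk x) := (X.presheaf.germ U x hxU).hom.toAlgebra
  let a3 : Algebra R (X.presheaf.stalk x) := (toStalk f x).toAlgebra
  have i6 : IsScalarTower R Γ(X, U) (X.presheaf.stalk x) :=
    IsScalarTower.of_algebraMap_eq fun d => (germ_toSections f U x hxU d).symm
  have i7 : Algebra.FiniteType R Γ(X, U) := by
    have h1 := f.finiteType_appLE (isAffineOpen_top _) hU (le_preimage_top f U)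
    exact RingHom.FiniteType.comp h1 (RingHom.FiniteType.of_surjective _
      (ConcreteCategory.bijective_of_isIso (Scheme.ΓSpecIso (CommRingCat.of R)).inv).2)
  have i8 : IsLocalization.AtPrime (X.presheaf.stalk x) P := hU.isLocalization_stalk ⟨x, hxU⟩
  have hP : maximalIdeal R ≤ P.under R := by
    intro r hr
    have h1 : r ∈ (f x).asIdeal := by rw [hxs]; exact hr
    rw [mem_asIdeal_iff] at h1
    exact (IsLocalization.AtPrime.to_map_mem_maximal_iff (X.presheaf.stalk x) P
      (algebraMap R Γ(X, U) r)).1 (by rwa [← IsScalarTower.algebraMap_apply])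
  have i9 : FaithfulSMul R (X.presheaf.stalk x) :=
    (faithfulSMul_iff_algebraMap_injective R _).2 (toStalk_injective f x)
  exact ⟨surjective_residue_comp_algebraMap P hP,
    ringKrullDim_eq_two_of_trdeg_eq_one P hP (homTrdeg_toStalk_eq_one x)⟩

end


theorem exists_ringHom_mvPowerSeries {σ R E : Type*} [Finite σ] [CommRing R] [CommRing E]
    (I : Ideal E) [IsAdicComplete I E] (j : R →+* E) {a : σ → E} (ha : ∀ i, a i ∈ I) :
    ∃ φ : MvPowerSeries σ R →+* E, (∀ r, φ (MvPowerSeries.C r) = j r) ∧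
      ∀ i, φ (MvPowerSeries.X i) = a i := by
  let _ : WithIdeal E := ⟨I⟩
  -- The coefficients get the discrete topology, so that the coefficient map is continuous for free
  -- and evaluation of power series applies.
  let _ : UniformSpace R := ⊥
  have hadic : IsAdic I := rfl
  have h1 := hadic.isAdicComplete_iff.1 inferInstance
  have := h1.1
  have := h1.2
  have : DiscreteTopology R := ⟨rfl⟩
  have hlin : IsLinearTopology E E := by
    refine IsLinearTopology.mk_of_hasBasis E (ι := ℕ) (p := fun _ => True) (s := fun n => I ^ n) ?_
    exact hadic.hasBasis_nhds_zero
  have hj : Continuous j := continuous_of_discreteTopology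
  have hev : MvPowerSeries.HasEval a := by
    refine ⟨fun s => ?_, ?_⟩
    · refine hadic.hasBasis_nhds_zero.tendsto_right_iff.2 fun n _ => ?_
      filter_upwards [Filter.eventually_ge_atTop n] with m hm
      exact Ideal.pow_le_pow_right hm (Ideal.pow_mem_pow (ha s) m)
    · rw [Filter.cofinite_eq_bot]
      exact Filter.tendsto_bot
  refine ⟨MvPowerSeries.eval₂Hom hj hev, fun r => ?_, fun i => ?_⟩
  · rw [MvPowerSeries.coe_eval₂Hom, MvPowerSeries.eval₂_C]
  · rw [MvPowerSeries.coe_eval₂Hom, MvPowerSeries.eval₂_X]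

/-! ### Power series coordinates on the completion -/

section Coordinates

variable {R A : Type u} [CommRing R] [IsLocalRing R] [IsDomain R] [IsNoetherianRing R]
  [CommRing A] [IsLocalRing A] [IsNoetherianRing A] [Algebra R A]

/-- The structure map to the completion of a local algebra. -/
noncomputable def toCompletion (R A : Type u) [CommRing R] [CommRing A] [IsLocalRing A]
    [Algebra R A] : R →+* AdicCompletion (maximalIdeal A) A :=
  (algebraMap A (AdicCompletion (maximalIdeal A) A)).comp (algebraMap R A)

theorem surjective_of_span_eq (hres : Function.Surjective ((residue A).comp (algebraMap R A)))
    {z w : AdicCompletion (maximalIdeal A) A}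
    (hzw : maximalIdeal (AdicCompletion (maximalIdeal A) A) = Ideal.span {z, w})
    {φ : MvPowerSeries (Fin 2) R →+* AdicCompletion (maximalIdeal A) A}
    (hC : ∀ r, φ (MvPowerSeries.C r) = toCompletion R A r)
    (h0 : φ (MvPowerSeries.X 0) = z) (h1 : φ (MvPowerSeries.X 1) = w) :
    Function.Surjective φ := by
  have hmap : (Ideal.span (Set.range (MvPowerSeries.X : Fin 2 → MvPowerSeries (Fin 2) R))).map φ =
      maximalIdeal (AdicCompletion (maximalIdeal A) A) := by
    rw [Ideal.map_span, hzw]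
    congr 1
    ext y
    simp [Fin.exists_fin_two, h0, h1, eq_comm]
  have hh : IsHausdorff ((Ideal.span (Set.range
      (MvPowerSeries.X : Fin 2 → MvPowerSeries (Fin 2) R))).map φ)
      (AdicCompletion (maximalIdeal A) A) := by
    rw [hmap]
    infer_instance
  refine surjective_of_mk_map_comp_surjective φ
    (I := Ideal.span (Set.range (MvPowerSeries.X : Fin 2 → MvPowerSeries (Fin 2) R))) ?_
  intro y
  obtain ⟨y, rfl⟩ := Ideal.Quotient.mk_surjective y
  obtain ⟨x, hx⟩ := (AdicCompletion.residueField_map_bijective (R := A)).2 (residue _ y)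
  obtain ⟨r, rfl⟩ := hres x
  refine ⟨MvPowerSeries.C r, ?_⟩
  rw [RingHom.comp_apply, hC, Ideal.Quotient.eq, hmap, ← residue_eq_zero_iff, map_sub, ← hx,
    sub_eq_zero]
  rfl

theorem ringKrullDim_le_completion [IsNoetherianRing (AdicCompletion (maximalIdeal A) A)] :
    ringKrullDim A ≤ ringKrullDim (AdicCompletion (maximalIdeal A) A) := by
  have hcomap : (maximalIdeal (AdicCompletion (maximalIdeal A) A)).comap
      (algebraMap A (AdicCompletion (maximalIdeal A) A)) = maximalIdeal A := by
    ext x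
    simp only [Ideal.mem_comap, mem_maximalIdeal, mem_nonunits_iff, isUnit_map_iff]
  have hover : (maximalIdeal (AdicCompletion (maximalIdeal A) A)).LiesOver (maximalIdeal A) :=
    ⟨hcomap.symm⟩
  have h := Ideal.height_eq_height_add_of_liesOver_of_hasGoingDown (maximalIdeal A)
    (maximalIdeal (AdicCompletion (maximalIdeal A) A))
  rw [← IsLocalRing.maximalIdeal_height_eq_ringKrullDim,
    ← IsLocalRing.maximalIdeal_height_eq_ringKrullDim, h]
  exact_mod_cast le_self_add

/-- A surjection from a domain of dimension two with nonzero kernel would drop the dimension, while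
the completion of A has dimension at least two by going down. -/
theorem exists_completion_equiv_branchRing {π : R} (hπ : maximalIdeal R = Ideal.span {π})
    (hπ0 : π ≠ 0) (hdim : ringKrullDim A = 2)
    (hres : Function.Surjective ((residue A).comp (algebraMap R A)))
    {z w : AdicCompletion (maximalIdeal A) A}
    (hzw : maximalIdeal (AdicCompletion (maximalIdeal A) A) = Ideal.span {z, w})
    {φ : MvPowerSeries (Fin 2) R →+* AdicCompletion (maximalIdeal A) A}
    (hC : ∀ r, φ (MvPowerSeries.C r) = toCompletion R A r)
    (h0 : φ (MvPowerSeries.X 0) = z) (h1 : φ (MvPowerSeries.X 1) = w)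
    {c₀ : MvPowerSeries (Fin 2) R} {a b : ℕ} (hb : 0 < b)
    (h : toCompletion R A π = φ c₀ * (z ^ a * w ^ b)) :
    ∃ e : AdicCompletion (maximalIdeal A) A ≃+* BranchRing π c₀ a b,
      ∀ r, e (toCompletion R A r) = algebraMap R _ r := by
  have hsurj := surjective_of_span_eq hres hzw hC h0 h1
  have hker : ∀ x ∈ Ideal.span {branch π c₀ a b}, φ x = 0 := by
    intro x hx
    obtain ⟨y, rfl⟩ := Ideal.mem_span_singleton.1 hx
    rw [map_mul, branch, map_sub, hC, h]
    simp only [map_mul, map_pow, h0, h1]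
    ring
  let ψ : BranchRing π c₀ a b →+* AdicCompletion (maximalIdeal A) A :=
    Ideal.Quotient.lift _ φ hker
  have hψ : Function.Surjective ψ := Ideal.Quotient.lift_surjective_of_surjective _ hker hsurj
  have i1 : IsNoetherianRing (AdicCompletion (maximalIdeal A) A) :=
    isNoetherianRing_of_surjective _ _ φ hsurj
  have i2 := BranchRing.isLocalRing (c := c₀) (a := a) hπ hb
  have i3 := BranchRing.isDomain (c := c₀) (a := a) hπ hb hπ0
  have i4 := BranchRing.isRegularLocalRing (c := c₀) (a := a) hπ hb hπ0
  have hdimB : ringKrullDim (BranchRing π c₀ a b) = 2 := by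
    rw [← (isRegularLocalRing_iff (BranchRing π c₀ a b)).1 i4,
      BranchRing.spanFinrank_eq (c₀ := c₀) (a := a) hπ hπ0 hb]
    rfl
  have hinj : Function.Injective ψ := by
    rw [injective_iff_map_eq_zero]
    intro x hx
    by_contra hne
    have h2 := ringKrullDim_succ_le_of_surjective ψ hψ (mem_nonZeroDivisors_of_ne_zero hne) hx
    rw [hdimB] at h2
    have h3 := ringKrullDim_le_completion (A := A)
    rw [hdim] at h3
    have h4 : (2 : WithBot ℕ∞) + 1 ≤ 2 := (add_le_add_left h3 1).trans h2
    exact absurd h4 (by decide)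
  let e := RingEquiv.ofBijective ψ ⟨hinj, hψ⟩
  refine ⟨e.symm, fun r => ?_⟩
  rw [RingEquiv.symm_apply_eq, ← hC]
  rfl

end Coordinates


/-! ### Normal forms of the completion of A -/

section LocalStructure

variable {R A : Type u} [CommRing R] [IsLocalRing R]
  [CommRing A] [IsLocalRing A] [IsNoetherianRing A] [Algebra R A]

theorem toCompletion_mem_maximalIdeal [IsLocalHom (algebraMap R A)] {r : R} (hr : r ∈ maximalIdeal R) :
    toCompletion R A r ∈ maximalIdeal (AdicCompletion (maximalIdeal A) A) :=
  map_nonunit (algebraMap A _) _ (map_nonunit (algebraMap R A) r hr)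

theorem maximalIdeal_completion_eq {t₁ t₂ : A} (hm : maximalIdeal A = Ideal.span {t₁, t₂})
    {d₁ d₂ : AdicCompletion (maximalIdeal A) A} (h₁ : IsUnit d₁) (h₂ : IsUnit d₂) :
    maximalIdeal (AdicCompletion (maximalIdeal A) A) =
      Ideal.span {d₁ * algebraMap A _ t₁, d₂ * algebraMap A _ t₂} := by
  have h := congrArg (Ideal.map (algebraMap A (AdicCompletion (maximalIdeal A) A))) hm
  rw [AdicCompletion.maximalIdeal_eq_map, h, Ideal.map_span, Set.image_pair, Ideal.span_insert, Ideal.span_insert,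
    Ideal.span_singleton_mul_left_unit h₁, Ideal.span_singleton_mul_left_unit h₂]

/-- The residue of c comes from R and has an n-th root there, which Hensel's lemma lifts in the
completion. -/
theorem exists_pow_eq_algebraMap_completion [IsLocalHom (algebraMap R A)]
    [IsAlgClosed (ResidueField R)]
    (hres : Function.Surjective ((residue A).comp (algebraMap R A))) {n : ℕ} (hn : IsUnit (n : R))
    {c : A} (hc : IsUnit c) :
    ∃ d : AdicCompletion (maximalIdeal A) A, IsUnit d ∧ d ^ n = algebraMap A _ c := by
  have hn0 : n ≠ 0 := by
    rintro rfl
    simp at hn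
  obtain ⟨r, hr⟩ := hres (residue A c)
  have hrc : algebraMap R A r - c ∈ maximalIdeal A := by
    rw [← residue_eq_zero_iff, map_sub, ← hr, RingHom.comp_apply, sub_self]
  have hru : IsUnit r := by
    by_contra h
    have h1 : algebraMap R A r ∈ maximalIdeal A := map_nonunit (algebraMap R A) r h
    have h2 := Ideal.sub_mem _ h1 hrc
    rw [sub_sub_cancel] at h2
    exact h2 hc
  obtain ⟨κ, hκ⟩ := IsAlgClosed.exists_pow_nat_eq (residue R r) (Nat.pos_of_ne_zero hn0)
  obtain ⟨s, rfl⟩ := residue_surjective (R := R) κ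
  have hsr : s ^ n - r ∈ maximalIdeal R := by
    rw [← residue_eq_zero_iff, map_sub, map_pow, hκ, sub_self]
  have hsu : IsUnit s := by
    rw [← isUnit_map_iff (residue R)]
    refine (isUnit_pow_iff hn0).1 ?_
    rw [hκ]
    exact hru.map _
  obtain ⟨d, hd, hds⟩ := exists_pow_eq_of_pow_sub_mem
    (I := maximalIdeal (AdicCompletion (maximalIdeal A) A)) (n := n)
    (by simpa using hn.map (toCompletion R A)) hn0 (x := algebraMap A _ c)
    (hsu.map (toCompletion R A)) (by
      have h1 := toCompletion_mem_maximalIdeal (A := A) hsr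
      have h2 : algebraMap A (AdicCompletion (maximalIdeal A) A) (algebraMap R A r - c) ∈
          maximalIdeal (AdicCompletion (maximalIdeal A) A) := map_nonunit (algebraMap A _) _ hrc
      have h3 := Ideal.add_mem _ h1 h2
      simp only [map_sub, map_pow, toCompletion, RingHom.comp_apply] at h3 ⊢
      convert h3 using 1
      ring)
  refine ⟨d, (isUnit_pow_iff hn0).1 ?_, hd⟩
  rw [hd]
  exact hc.map _

variable [IsDomain R] [IsNoetherianRing R] {π : R} (hπ : maximalIdeal R = Ideal.span {π})
  (hπ0 : π ≠ 0) (hdim : ringKrullDim A = 2)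
  (hres : Function.Surjective ((residue A).comp (algebraMap R A))) {t₁ t₂ c : A}
  (hm : maximalIdeal A = Ideal.span {t₁, t₂}) (hc : IsUnit c)

include hπ hπ0 hdim hres hm hc

/-- The unit c is absorbed into the parameter whose exponent is invertible in R; this is the only
use of the assumption on a and b. -/
theorem exists_completion_equiv_crossing_of_eq [IsLocalHom (algebraMap R A)]
    [IsAlgClosed (ResidueField R)] {a b : ℕ}
    (hb : 0 < b) (hab : IsUnit (a : R) ∨ IsUnit (b : R))
    (h : algebraMap R A π = c * (t₁ ^ a * t₂ ^ b)) :
    ∃ e : AdicCompletion (maximalIdeal A) A ≃+* PowerSeriesQuotient (crossing π a b),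
      ∀ r, e (toCompletion R A r) = algebraMap R _ r := by
  obtain ⟨d₁, d₂, h₁, h₂, hd⟩ : ∃ d₁ d₂ : AdicCompletion (maximalIdeal A) A,
      IsUnit d₁ ∧ IsUnit d₂ ∧ d₁ ^ a * d₂ ^ b = algebraMap A _ c := by
    rcases hab with h' | h'
    · obtain ⟨d, hd, e⟩ := exists_pow_eq_algebraMap_completion hres h' hc
      exact ⟨d, 1, hd, isUnit_one, by rw [e, one_pow, mul_one]⟩
    · obtain ⟨d, hd, e⟩ := exists_pow_eq_algebraMap_completion hres h' hc
      exact ⟨1, d, isUnit_one, hd, by rw [e, one_pow, one_mul]⟩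
  have hzw := maximalIdeal_completion_eq hm h₁ h₂
  obtain ⟨φ, hC, hX⟩ := exists_ringHom_mvPowerSeries
    (maximalIdeal (AdicCompletion (maximalIdeal A) A)) (toCompletion R A)
    (a := ![d₁ * algebraMap A _ t₁, d₂ * algebraMap A _ t₂]) (by
      rw [hzw, Fin.forall_fin_two]
      exact ⟨Ideal.subset_span (by simp), Ideal.subset_span (by simp)⟩)
  obtain ⟨e, he⟩ := exists_completion_equiv_branchRing hπ hπ0 hdim hres hzw hC (hX 0) (hX 1)
    (c₀ := 1) (a := a) hb (by
      rw [toCompletion, RingHom.comp_apply, h, map_mul, ← hd, map_one]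
      simp only [map_mul, map_pow]
      ring)
  exact exists_ringEquiv_congr (crossing_eq_branch π a b).symm e he

theorem exists_completion_equiv_oneBranch_of_eq {b : ℕ} (hb : 0 < b)
    (h : algebraMap R A π = c * t₂ ^ b) :
    ∃ c₀ : MvPowerSeries (Fin 2) R, IsUnit c₀ ∧
      ∃ e : AdicCompletion (maximalIdeal A) A ≃+* PowerSeriesQuotient (oneBranch π c₀ b),
        ∀ r, e (toCompletion R A r) = algebraMap R _ r := by
  have hzw := maximalIdeal_completion_eq hm (isUnit_one (M := AdicCompletion (maximalIdeal A) A))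
    isUnit_one
  obtain ⟨φ, hC, hX⟩ := exists_ringHom_mvPowerSeries
    (maximalIdeal (AdicCompletion (maximalIdeal A) A)) (toCompletion R A)
    (a := ![1 * algebraMap A _ t₁, 1 * algebraMap A _ t₂]) (by
      rw [hzw, Fin.forall_fin_two]
      exact ⟨Ideal.subset_span (by simp), Ideal.subset_span (by simp)⟩)
  obtain ⟨c₀, hc₀⟩ := surjective_of_span_eq hres hzw hC (hX 0) (hX 1) (algebraMap A _ c)
  have hφ : IsLocalHom φ := by
    have hs := surjective_of_span_eq hres hzw hC (hX 0) (hX 1)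
    exact IsLocalHom.of_surjective φ hs
  obtain ⟨e, he⟩ := exists_completion_equiv_branchRing hπ hπ0 hdim hres hzw hC (hX 0) (hX 1)
    (c₀ := c₀) (a := 0) hb (by
      rw [toCompletion, RingHom.comp_apply, h, map_mul, ← hc₀]
      simp only [map_pow, pow_zero, one_mul])
  refine ⟨c₀, ?_, exists_ringEquiv_congr (oneBranch_eq_branch π c₀ b).symm e he⟩
  exact (isUnit_map_iff φ c₀).1 (hc₀ ▸ hc.map _)

end LocalStructure


/-! ### Generizations of x as primes of the local ring -/

section Specializations

variable {X : Scheme.{u}} {x ξ η : X}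

/-- The prime ideal of the local ring at `x` that corresponds to a generization of `x`. -/
noncomputable def specPrime (h : ξ ⤳ x) : Ideal (X.presheaf.stalk x) :=
  (maximalIdeal (X.presheaf.stalk ξ)).comap (X.presheaf.stalkSpecializes h).hom

instance (h : ξ ⤳ x) : (specPrime h).IsPrime := by
  unfold specPrime
  infer_instance

theorem mem_specPrime_iff (h : ξ ⤳ x) (s : X.presheaf.stalk x) :
    s ∈ specPrime h ↔
      X.presheaf.stalkSpecializes h s ∈ maximalIdeal (X.presheaf.stalk ξ) := Iff.rfl

theorem comap_germ_specPrime {U : X.Opens} (hU : IsAffineOpen U) (h : ξ ⤳ x) (hx : x ∈ U)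
    (hξ : ξ ∈ U) :
    (specPrime h).comap (X.presheaf.germ U x hx).hom = (hU.primeIdealOf ⟨ξ, hξ⟩).asIdeal := by
  ext s
  let a1 := (X.presheaf.germ U ξ hξ).hom.toAlgebra
  have i1 := hU.isLocalization_stalk ⟨ξ, hξ⟩
  rw [Ideal.mem_comap, mem_specPrime_iff]
  have h1 : X.presheaf.stalkSpecializes h (X.presheaf.germ U x hx s) =
      X.presheaf.germ U ξ hξ s := TopCat.Presheaf.germ_stalkSpecializes_apply _ _ _ _
  rw [show (X.presheaf.germ U x hx).hom s = X.presheaf.germ U x hx s from rfl, h1]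
  exact IsLocalization.AtPrime.to_map_mem_maximal_iff (X.presheaf.stalk ξ)
    (hU.primeIdealOf ⟨ξ, hξ⟩).asIdeal s

theorem specializes_of_primeIdealOf_le {U : X.Opens} (hU : IsAffineOpen U) (hη : η ∈ U) (hξ : ξ ∈ U)
    (h : (hU.primeIdealOf ⟨η, hη⟩).asIdeal ≤ (hU.primeIdealOf ⟨ξ, hξ⟩).asIdeal) : η ⤳ ξ := by
  have h1 : hU.primeIdealOf ⟨η, hη⟩ ⤳ hU.primeIdealOf ⟨ξ, hξ⟩ :=
    (PrimeSpectrum.le_iff_specializes _ _).1 h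
  have h2 := h1.map hU.fromSpec.continuous
  rwa [hU.fromSpec_primeIdealOf ⟨η, hη⟩, hU.fromSpec_primeIdealOf ⟨ξ, hξ⟩] at h2

theorem specializes_of_specPrime_le (hη : η ⤳ x) (hξ : ξ ⤳ x)
    (h : specPrime hη ≤ specPrime hξ) : η ⤳ ξ := by
  obtain ⟨U, hU, hxU, -⟩ := exists_isAffineOpen_mem_and_subset (TopologicalSpace.Opens.mem_top x)
  refine specializes_of_primeIdealOf_le hU (hη.mem_open U.2 hxU) (hξ.mem_open U.2 hxU) ?_
  rw [← comap_germ_specPrime hU hη hxU, ← comap_germ_specPrime hU hξ hxU]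
  exact Ideal.comap_mono h

theorem eq_of_specPrime_eq (hη : η ⤳ x) (hξ : ξ ⤳ x) (h : specPrime hη = specPrime hξ) : η = ξ :=
  (specializes_of_specPrime_le hη hξ h.le).antisymm (specializes_of_specPrime_le hξ hη h.ge) |>.eq

theorem specPrime_mono (hξ : ξ ⤳ x) (h : η ⤳ ξ) : specPrime (h.trans hξ) ≤ specPrime hξ := by
  intro s hs
  rw [mem_specPrime_iff] at hs ⊢
  have h1 : X.presheaf.stalkSpecializes (h.trans hξ) s =
      X.presheaf.stalkSpecializes h (X.presheaf.stalkSpecializes hξ s) :=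
    (TopCat.Presheaf.stalkSpecializes_comp_apply _ h hξ s).symm
  rw [h1] at hs
  exact fun hu => hs (hu.map (X.presheaf.stalkSpecializes h).hom)

theorem exists_specPrime_eq (P : Ideal (X.presheaf.stalk x)) [P.IsPrime] :
    ∃ (ξ : X) (h : ξ ⤳ x), specPrime h = P := by
  obtain ⟨U, hU, hxU, -⟩ := exists_isAffineOpen_mem_and_subset (TopologicalSpace.Opens.mem_top x)
  let a1 := (X.presheaf.germ U x hxU).hom.toAlgebra
  have i1 := hU.isLocalization_stalk ⟨x, hxU⟩
  let Q : PrimeSpectrum Γ(X, U) := ⟨P.comap (X.presheaf.germ U x hxU).hom, inferInstance⟩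
  have hξU : hU.fromSpec Q ∈ U := by
    have : hU.fromSpec Q ∈ Set.range hU.fromSpec := ⟨Q, rfl⟩
    rwa [hU.range_fromSpec] at this
  have hQ : hU.primeIdealOf ⟨hU.fromSpec Q, hξU⟩ = Q :=
    hU.fromSpec.isOpenEmbedding.injective (hU.fromSpec_primeIdealOf ⟨hU.fromSpec Q, hξU⟩)
  have hspec : hU.fromSpec Q ⤳ x := by
    refine specializes_of_primeIdealOf_le hU hξU hxU ?_
    rw [hQ]
    intro s hs
    rw [← IsLocalization.AtPrime.to_map_mem_maximal_iff (X.presheaf.stalk x)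
      (hU.primeIdealOf ⟨x, hxU⟩).asIdeal s]
    exact le_maximalIdeal Ideal.IsPrime.ne_top' hs
  refine ⟨hU.fromSpec Q, hspec, ?_⟩
  have h1 := comap_germ_specPrime hU hspec hxU hξU
  rw [hQ] at h1
  have h2 := IsLocalization.map_under (hU.primeIdealOf ⟨x, hxU⟩).asIdeal.primeCompl
    (X.presheaf.stalk x) (specPrime hspec)
  have h3 := IsLocalization.map_under (hU.primeIdealOf ⟨x, hxU⟩).asIdeal.primeCompl
    (X.presheaf.stalk x) P
  rw [← h2, ← h3]
  exact congrArg _ h1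

end Specializations

/-! ### Components of the special fibre and minimal primes of π -/

section Components

variable {R : Type u} [CommRing R] [IsDomain R] [IsDiscreteValuationRing R]
  {X : Scheme.{u}} {f : X ⟶ Spec (CommRingCat.of R)} {π : R} (hπ : Irreducible π) {x ξ : X}

theorem stalkSpecializes_toStalk {R : Type u} [CommRing R] {f : X ⟶ Spec (CommRingCat.of R)} (h : ξ ⤳ x) (r : R) :
    X.presheaf.stalkSpecializes h (toStalk f x r) = toStalk f ξ r := by
  rw [← germ_toSections f ⊤ x (TopologicalSpace.Opens.mem_top _),
    ← germ_toSections f ⊤ ξ (TopologicalSpace.Opens.mem_top _)]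
  exact TopCat.Presheaf.germ_stalkSpecializes_apply _ _ _ _

include hπ

theorem eq_closedPoint_iff : f ξ = closedPoint R ↔
    toStalk f ξ π ∈ maximalIdeal (X.presheaf.stalk ξ) := by
  rw [← mem_asIdeal_iff]
  have hm := (IsDiscreteValuationRing.irreducible_iff_uniformizer π).1 hπ
  constructor
  · intro h
    rw [h]
    exact (mem_maximalIdeal _).2 hπ.not_isUnit
  · intro h
    apply PrimeSpectrum.ext
    have h1 : maximalIdeal R ≤ (f ξ).asIdeal := by
      rw [hm, Ideal.span_singleton_le_iff_mem]
      exact h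
    exact ((maximalIdeal.isMaximal R).eq_of_le (f ξ).2.ne_top h1).symm

theorem eq_closedPoint_iff_mem_specPrime (h : ξ ⤳ x) :
    f ξ = closedPoint R ↔ toStalk f x π ∈ specPrime h := by
  rw [eq_closedPoint_iff hπ, mem_specPrime_iff, stalkSpecializes_toStalk]

theorem isComponentPoint_iff (h : ξ ⤳ x) :
    IsComponentPoint f ξ ↔ specPrime h ∈ (Ideal.span {toStalk f x π}).minimalPrimes := by
  constructor
  · rintro ⟨h1, h2⟩
    refine ⟨⟨inferInstance, ?_⟩, ?_⟩
    · rw [Ideal.span_singleton_le_iff_mem]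
      exact (eq_closedPoint_iff_mem_specPrime hπ h).1 h1
    · rintro P ⟨hP, hπP⟩ hle
      obtain ⟨η, hη, rfl⟩ := exists_specPrime_eq P
      have h3 := h2 η (specializes_of_specPrime_le hη h hle)
        ((eq_closedPoint_iff_mem_specPrime hπ hη).2 (hπP (Ideal.mem_span_singleton_self _)))
      subst h3
      exact le_rfl
  · rintro ⟨⟨-, h1⟩, h2⟩
    refine ⟨(eq_closedPoint_iff_mem_specPrime hπ h).2 (h1 (Ideal.mem_span_singleton_self _)),
      fun η hη hfη => ?_⟩
    refine (hη.antisymm (specializes_of_specPrime_le h (hη.trans h) ?_)).eq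
    refine h2 ⟨inferInstance, ?_⟩ (specPrime_mono h hη)
    rw [Ideal.span_singleton_le_iff_mem]
    exact (eq_closedPoint_iff_mem_specPrime hπ (hη.trans h)).1 hfη

end Components


theorem mem_minimalPrimes_span_iff {A : Type*} [CommRing A] {t₁ t₂ c : A}
    (h₁ : Prime t₁) (h₂ : Prime t₂) (h12 : ¬ t₁ ∣ t₂) (h21 : ¬ t₂ ∣ t₁) (hc : IsUnit c)
    {a b : ℕ} {P : Ideal A} :
    P ∈ (Ideal.span {c * (t₁ ^ a * t₂ ^ b)}).minimalPrimes ↔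
      (a ≠ 0 ∧ P = Ideal.span {t₁}) ∨ (b ≠ 0 ∧ P = Ideal.span {t₂}) := by
  have hp₁ := (Ideal.span_singleton_prime h₁.ne_zero).2 h₁
  have hp₂ := (Ideal.span_singleton_prime h₂.ne_zero).2 h₂
  have hmem : ∀ Q : Ideal A, Q.IsPrime → c * (t₁ ^ a * t₂ ^ b) ∈ Q →
      (a ≠ 0 ∧ t₁ ∈ Q) ∨ (b ≠ 0 ∧ t₂ ∈ Q) := by
    intro Q hQ h
    rcases hQ.mem_or_mem h with h | h
    · exact absurd (Ideal.eq_top_of_isUnit_mem _ h hc) hQ.ne_top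
    · rcases hQ.mem_or_mem h with h | h
      · refine Or.inl ⟨?_, hQ.mem_of_pow_mem _ h⟩
        rintro rfl
        exact hQ.ne_top (Ideal.eq_top_of_isUnit_mem _ h (by simp))
      · refine Or.inr ⟨?_, hQ.mem_of_pow_mem _ h⟩
        rintro rfl
        exact hQ.ne_top (Ideal.eq_top_of_isUnit_mem _ h (by simp))
  have hle₁ : a ≠ 0 → Ideal.span {c * (t₁ ^ a * t₂ ^ b)} ≤ Ideal.span {t₁} := fun ha =>
    Ideal.span_singleton_le_span_singleton.2
      (((dvd_pow_self t₁ ha).mul_right _).mul_left _)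
  have hle₂ : b ≠ 0 → Ideal.span {c * (t₁ ^ a * t₂ ^ b)} ≤ Ideal.span {t₂} := fun hb =>
    Ideal.span_singleton_le_span_singleton.2
      (((dvd_pow_self t₂ hb).mul_left _).mul_left _)
  constructor
  · rintro ⟨⟨hP, hle⟩, hmin⟩
    rcases hmem P hP (hle (Ideal.mem_span_singleton_self _)) with ⟨ha, ht⟩ | ⟨hb, ht⟩
    · have h := (Ideal.span_singleton_le_iff_mem P).2 ht
      exact Or.inl ⟨ha, le_antisymm (hmin ⟨hp₁, hle₁ ha⟩ h) h⟩
    · have h := (Ideal.span_singleton_le_iff_mem P).2 ht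
      exact Or.inr ⟨hb, le_antisymm (hmin ⟨hp₂, hle₂ hb⟩ h) h⟩
  · rintro (⟨ha, rfl⟩ | ⟨hb, rfl⟩)
    · refine ⟨⟨hp₁, hle₁ ha⟩, fun Q ⟨hQ, hQle⟩ hle => ?_⟩
      rw [Ideal.span_singleton_le_iff_mem]
      rcases hmem Q hQ (hQle (Ideal.mem_span_singleton_self _)) with ⟨-, ht⟩ | ⟨-, ht⟩
      · exact ht
      · exact absurd (Ideal.mem_span_singleton.1 (hle ht)) h12
    · refine ⟨⟨hp₂, hle₂ hb⟩, fun Q ⟨hQ, hQle⟩ hle => ?_⟩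
      rw [Ideal.span_singleton_le_iff_mem]
      rcases hmem Q hQ (hQle (Ideal.mem_span_singleton_self _)) with ⟨-, ht⟩ | ⟨-, ht⟩
      · exact absurd (Ideal.mem_span_singleton.1 (hle ht)) h21
      · exact ht

theorem length_quotient_span_pow {B : Type*} [CommRing B] [IsDomain B] [IsLocalRing B] {t : B}
    (ht : maximalIdeal B = Ideal.span {t}) (ht0 : t ≠ 0) {v : B} (hv : IsUnit v) (a : ℕ) :
    Module.length B (B ⧸ Ideal.span {v * t ^ a}) = a := by
  change Ring.ord B (v * t ^ a) = a
  rw [Ring.ord_mul_of_isUnit_left hv, Ring.ord_pow (mem_nonZeroDivisors_of_ne_zero ht0)]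
  have h1 : Ring.ord B t = 1 := by
    rw [Ring.ord, ← ht, Module.length_eq_one_iff]
    exact (isSimpleModule_iff_isCoatom).2 (maximalIdeal.isMaximal B).out
  rw [h1, nsmul_one]

section

variable {X : Scheme.{u}} {x ξ : X}

theorem stalkSpecializes_injective [AlgebraicGeometry.IsIntegral X] (h : ξ ⤳ x) :
    Function.Injective (X.presheaf.stalkSpecializes h) := by
  have h1 : Function.Injective (algebraMap (X.presheaf.stalk x) X.functionField) :=
    IsFractionRing.injective _ _
  intro s t hst
  apply h1
  have h2 : ∀ s, algebraMap (X.presheaf.stalk x) X.functionField s =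
      X.presheaf.stalkSpecializes (genericPoint_specializes ξ)
        (X.presheaf.stalkSpecializes h s) := fun s =>
    (TopCat.Presheaf.stalkSpecializes_comp_apply _ (genericPoint_specializes ξ) h s).symm
  rw [h2, h2, hst]

/-- The stalk at ξ is the localization of an affine chart at the prime of ξ, and germs at x factor
the elements of that prime through t. -/
theorem maximalIdeal_eq_of_specPrime_eq (h : ξ ⤳ x) {t : X.presheaf.stalk x}
    (ht : specPrime h = Ideal.span {t}) :
    maximalIdeal (X.presheaf.stalk ξ) = Ideal.span {X.presheaf.stalkSpecializes h t} := by
  apply le_antisymm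
  · obtain ⟨U, hU, hxU, -⟩ := exists_isAffineOpen_mem_and_subset (TopologicalSpace.Opens.mem_top x)
    have hξU := h.mem_open U.2 hxU
    let a1 := (X.presheaf.germ U ξ hξU).hom.toAlgebra
    have i1 := hU.isLocalization_stalk ⟨ξ, hξU⟩
    rw [← IsLocalization.AtPrime.map_eq_maximalIdeal (hU.primeIdealOf ⟨ξ, hξU⟩).asIdeal
      (X.presheaf.stalk ξ), Ideal.map_le_iff_le_comap, ← comap_germ_specPrime hU h hxU hξU, ht]
    intro s hs
    obtain ⟨y, hy⟩ := Ideal.mem_span_singleton.1 (Ideal.mem_comap.1 hs)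
    rw [Ideal.mem_comap, Ideal.mem_span_singleton]
    refine ⟨X.presheaf.stalkSpecializes h y, ?_⟩
    have h1 : X.presheaf.stalkSpecializes h (X.presheaf.germ U x hxU s) =
      X.presheaf.germ U ξ hξU s := TopCat.Presheaf.germ_stalkSpecializes_apply _ _ _ _
    rw [← map_mul]
    exact h1.symm.trans (congrArg _ hy)
  · rw [Ideal.span_singleton_le_iff_mem, ← mem_specPrime_iff, ht]
    exact Ideal.mem_span_singleton_self t

variable {R : Type u} [CommRing R] [IsDomain R] [IsDiscreteValuationRing R]
  {f : X ⟶ Spec (CommRingCat.of R)} {π : R} (hπ : Irreducible π)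

include hπ in
-- In the stalk at ξ the other parameter becomes a unit, so π is a unit times the a-th power of a
-- generator of the maximal ideal.
theorem multiplicity_eq [AlgebraicGeometry.IsIntegral X] (h : ξ ⤳ x) {t₁ t₂ c : X.presheaf.stalk x}
    (h0 : t₁ ≠ 0) (h12 : ¬ t₁ ∣ t₂) (hc : IsUnit c) {a b : ℕ}
    (he : toStalk f x π = c * (t₁ ^ a * t₂ ^ b)) (hP : specPrime h = Ideal.span {t₁}) :
    multiplicity f ξ = a := by
  have hm := maximalIdeal_eq_of_specPrime_eq h hP
  have ht0 : X.presheaf.stalkSpecializes h t₁ ≠ 0 := by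
    rw [← map_zero (X.presheaf.stalkSpecializes h).hom]
    exact fun h' => h0 (stalkSpecializes_injective h h')
  have hu : IsUnit (X.presheaf.stalkSpecializes h t₂) := by
    by_contra h'
    have : t₂ ∈ specPrime h := h'
    rw [hP, Ideal.mem_span_singleton] at this
    exact h12 this
  rw [multiplicity, specialIdeal_eq hπ, ← stalkSpecializes_toStalk h, he]
  have h1 : X.presheaf.stalkSpecializes h (c * (t₁ ^ a * t₂ ^ b)) =
      (X.presheaf.stalkSpecializes h c * X.presheaf.stalkSpecializes h t₂ ^ b) *
        X.presheaf.stalkSpecializes h t₁ ^ a := by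
    simp only [map_mul, map_pow]
    ring
  rw [h1]
  exact length_quotient_span_pow hm ht0
    ((hc.map (X.presheaf.stalkSpecializes h).hom).mul (hu.pow b)) a

end

/-! ### The local structure of X on schemes -/

section Parts

variable {R : Type u} [CommRing R] [IsDomain R] [IsDiscreteValuationRing R]
  [IsAdicComplete (maximalIdeal R) R] [IsAlgClosed (ResidueField R)]
  {X : Scheme.{u}} {f : X ⟶ Spec (CommRingCat.of R)} {π : R} (hπ : Irreducible π)
  (hf : IsSNCModel f) {x : X} (hx : IsClosed {x}) (hxs : f x = closedPoint R)

include hπ hf hx hxs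

theorem IsSNCModel.exists_toStalk_eq :
    ∃ (t₁ t₂ c : X.presheaf.stalk x) (a b : ℕ),
      maximalIdeal (X.presheaf.stalk x) = Ideal.span {t₁, t₂} ∧ IsUnit c ∧
      toStalk f x π = c * (t₁ ^ a * t₂ ^ b) ∧ Prime t₁ ∧ Prime t₂ ∧ ¬ t₁ ∣ t₂ ∧ ¬ t₂ ∣ t₁ := by
  have i1 := hf.isIntegral
  have i3 := hf.flat
  have i5 := hf.regular x
  obtain ⟨-, hdim⟩ := hf.surjective_residue_and_ringKrullDim hx hxs
  have hπ0 : toStalk f x π ≠ 0 := fun h =>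
    hπ.ne_zero (toStalk_injective f x (h.trans (map_zero _).symm))
  obtain ⟨t₁, t₂, c, a, b, hm, hc, he⟩ := (hf.isNormalCrossings hπ hxs).exists_eq hdim hπ0
  have hm' : maximalIdeal (X.presheaf.stalk x) = Ideal.span {t₂, t₁} := by rw [hm, Set.pair_comm]
  have hd := not_dvd_pow_of_ringKrullDim hm hdim.ge
  have hd' := not_dvd_pow_of_ringKrullDim hm' hdim.ge
  refine ⟨t₁, t₂, c, a, b, hm, hc, he,
    prime_of_not_dvd_pow hm (ne_zero_of_ringKrullDim hm' hdim.ge) hd,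
    prime_of_not_dvd_pow hm' (ne_zero_of_ringKrullDim hm hdim.ge) hd', ?_, ?_⟩
  · simpa using hd 1
  · simpa using hd' 1

theorem IsSNCModel.completedStalk_equiv_crossing {t₁ t₂ c : X.presheaf.stalk x} {a b : ℕ}
    (hm : maximalIdeal (X.presheaf.stalk x) = Ideal.span {t₁, t₂}) (hc : IsUnit c)
    (he : toStalk f x π = c * (t₁ ^ a * t₂ ^ b)) (hb : 0 < b)
    (hab : IsUnit (a : R) ∨ IsUnit (b : R)) :
    Nonempty (CompletedStalk f x ≃ₐ[R] PowerSeriesQuotient (crossing π a b)) := by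
  obtain ⟨hres, hdim⟩ := hf.surjective_residue_and_ringKrullDim hx hxs
  have i5 := hf.regular x
  let a3 : Algebra R (X.presheaf.stalk x) := (toStalk f x).toAlgebra
  have i6 : IsLocalHom (algebraMap R (X.presheaf.stalk x)) := ⟨fun r hr => by
    by_contra h
    have h1 : r ∈ (f x).asIdeal := by rw [hxs]; exact h
    exact (mem_asIdeal_iff f x r).1 h1 hr⟩
  obtain ⟨e, he'⟩ := exists_completion_equiv_crossing_of_eq (A := X.presheaf.stalk x)
    ((IsDiscreteValuationRing.irreducible_iff_uniformizer π).1 hπ) hπ.ne_zero hdim hres hm hc hb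
    hab he
  exact (nonempty_completedStalk_equiv_iff f x).2 ⟨e, he'⟩

theorem IsSNCModel.completedStalk_equiv_oneBranch {t₁ t₂ c : X.presheaf.stalk x} {b : ℕ}
    (hm : maximalIdeal (X.presheaf.stalk x) = Ideal.span {t₁, t₂}) (hc : IsUnit c)
    (he : toStalk f x π = c * t₂ ^ b) (hb : 0 < b) :
    ∃ c₀ : MvPowerSeries (Fin 2) R, IsUnit c₀ ∧
      Nonempty (CompletedStalk f x ≃ₐ[R] PowerSeriesQuotient (oneBranch π c₀ b)) := by
  obtain ⟨hres, hdim⟩ := hf.surjective_residue_and_ringKrullDim hx hxs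
  have i5 := hf.regular x
  let a3 : Algebra R (X.presheaf.stalk x) := (toStalk f x).toAlgebra
  obtain ⟨c₀, hc₀, e, he'⟩ := exists_completion_equiv_oneBranch_of_eq (A := X.presheaf.stalk x)
    ((IsDiscreteValuationRing.irreducible_iff_uniformizer π).1 hπ) hπ.ne_zero hdim hres hm hc hb he
  exact ⟨c₀, hc₀, (nonempty_completedStalk_equiv_iff f x).2 ⟨e, he'⟩⟩

theorem completedStalk_equiv_of_isCrossingPoint (p : ℕ) [CharP (ResidueField R) p] {a b : ℕ}
    (h : IsCrossingPoint f x a b) (hab : ¬ p ∣ a ∨ ¬ p ∣ b) :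
    0 < a ∧ 0 < b ∧ Nonempty (CompletedStalk f x ≃ₐ[R] PowerSeriesQuotient (crossing π a b)) := by
  have i1 := hf.isIntegral
  have hab' : IsUnit (a : R) ∨ IsUnit (b : R) :=
    hab.imp (isUnit_natCast_of_not_dvd p) (isUnit_natCast_of_not_dvd p)
  obtain ⟨t₁, t₂, c, α, β, hm, hc, he, h₁, h₂, h12, h21⟩ := hf.exists_toStalk_eq hπ hx hxs
  obtain ⟨ξ₁, ξ₂, hne, hξ₁, hξ₂, hs₁, hs₂, ha, hb⟩ := h
  rw [isComponentPoint_iff hπ hs₁, he, mem_minimalPrimes_span_iff h₁ h₂ h12 h21 hc] at hξ₁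
  rw [isComponentPoint_iff hπ hs₂, he, mem_minimalPrimes_span_iff h₁ h₂ h12 h21 hc] at hξ₂
  have he' : toStalk f x π = c * (t₂ ^ β * t₁ ^ α) := by rw [he]; ring
  have hm' : maximalIdeal (X.presheaf.stalk x) = Ideal.span {t₂, t₁} := by rw [hm, Set.pair_comm]
  rcases hξ₁ with ⟨hα, hP₁⟩ | ⟨hα, hP₁⟩ <;> rcases hξ₂ with ⟨hβ, hP₂⟩ | ⟨hβ, hP₂⟩
  · exact absurd (eq_of_specPrime_eq hs₁ hs₂ (hP₁.trans hP₂.symm)) hne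
  · obtain rfl : α = a := by
      exact_mod_cast (multiplicity_eq hπ hs₁ h₁.ne_zero h12 hc he hP₁).symm.trans ha
    obtain rfl : β = b := by
      exact_mod_cast (multiplicity_eq hπ hs₂ h₂.ne_zero h21 hc he' hP₂).symm.trans hb
    exact ⟨Nat.pos_of_ne_zero hα, Nat.pos_of_ne_zero hβ,
      hf.completedStalk_equiv_crossing hπ hx hxs hm hc he (Nat.pos_of_ne_zero hβ) hab'⟩
  · obtain rfl : β = a := by
      exact_mod_cast (multiplicity_eq hπ hs₁ h₂.ne_zero h21 hc he' hP₁).symm.trans ha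
    obtain rfl : α = b := by
      exact_mod_cast (multiplicity_eq hπ hs₂ h₁.ne_zero h12 hc he hP₂).symm.trans hb
    exact ⟨Nat.pos_of_ne_zero hα, Nat.pos_of_ne_zero hβ,
      hf.completedStalk_equiv_crossing hπ hx hxs hm' hc he' (Nat.pos_of_ne_zero hβ) hab'⟩
  · exact absurd (eq_of_specPrime_eq hs₁ hs₂ (hP₁.trans hP₂.symm)) hne

theorem completedStalk_equiv_of_isOneBranchPoint {b : ℕ} (h : IsOneBranchPoint f x b) :
    0 < b ∧ ∃ c₀ : MvPowerSeries (Fin 2) R, IsUnit c₀ ∧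
      Nonempty (CompletedStalk f x ≃ₐ[R] PowerSeriesQuotient (oneBranch π c₀ b)) := by
  have i1 := hf.isIntegral
  obtain ⟨t₁, t₂, c, α, β, hm, hc, he, h₁, h₂, h12, h21⟩ := hf.exists_toStalk_eq hπ hx hxs
  obtain ⟨ξ, hξ, hs, hb, huniq⟩ := h
  obtain ⟨s₁, s₂, γ, δ, hm', he', hs₁, hs₂, h12', h21', hδ, hP⟩ :
      ∃ (s₁ s₂ : X.presheaf.stalk x) (γ δ : ℕ),
        maximalIdeal (X.presheaf.stalk x) = Ideal.span {s₁, s₂} ∧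
        toStalk f x π = c * (s₁ ^ γ * s₂ ^ δ) ∧ Prime s₁ ∧ Prime s₂ ∧ ¬ s₁ ∣ s₂ ∧ ¬ s₂ ∣ s₁ ∧
        δ ≠ 0 ∧ specPrime hs = Ideal.span {s₂} := by
    rw [isComponentPoint_iff hπ hs, he, mem_minimalPrimes_span_iff h₁ h₂ h12 h21 hc] at hξ
    rcases hξ with ⟨h, hP⟩ | ⟨h, hP⟩
    · exact ⟨t₂, t₁, β, α, by rw [hm, Set.pair_comm], by rw [he]; ring, h₂, h₁, h21, h12, h, hP⟩
    · exact ⟨t₁, t₂, α, β, hm, he, h₁, h₂, h12, h21, h, hP⟩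
  -- A second parameter occurring in π would generate the prime of a second component through x.
  have hγ : γ = 0 := by
    by_contra hγ
    have := (Ideal.span_singleton_prime hs₁.ne_zero).2 hs₁
    obtain ⟨η, hη, hPη⟩ := exists_specPrime_eq (Ideal.span {s₁})
    have hc' : IsComponentPoint f η := by
      rw [isComponentPoint_iff hπ hη, he', mem_minimalPrimes_span_iff hs₁ hs₂ h12' h21' hc]
      exact Or.inl ⟨hγ, hPη⟩
    obtain rfl := huniq η hc' hη
    have h3 : s₂ ∈ Ideal.span {s₁} := by
      rw [← hPη, hP]
      exact Ideal.mem_span_singleton_self s₂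
    exact h12' (Ideal.mem_span_singleton.1 h3)
  obtain rfl : δ = b := by
    have h3 : toStalk f x π = c * (s₂ ^ δ * s₁ ^ γ) := by rw [he']; ring
    exact_mod_cast (multiplicity_eq hπ hs hs₂.ne_zero h21' hc h3 hP).symm.trans hb
  rw [hγ, pow_zero, one_mul] at he'
  exact ⟨Nat.pos_of_ne_zero hδ,
    hf.completedStalk_equiv_oneBranch hπ hx hxs hm' hc he' (Nat.pos_of_ne_zero hδ)⟩

end Parts


/-- Since n'' divides both n₁ and n₂, it is prime to a'' and to b''. The second makes the congruence
solvable and the first makes every solution prime to n''. -/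
theorem exists_coprime_and_dvd {a b n : ℕ} (hn : n ≠ 0) :
    ∃ r : ℕ, r.Coprime (n * (a.gcd b).gcd n / (a.gcd n * b.gcd n)) ∧
      n * (a.gcd b).gcd n / (a.gcd n * b.gcd n) ∣ r * (b / b.gcd n) + a / a.gcd n := by
  rw [← gcd_div_gcd_eq hn]
  have hpos : ∀ m : ℕ, 0 < m.gcd n := fun m =>
    Nat.gcd_pos_of_pos_right _ (Nat.pos_of_ne_zero hn)
  have ha : (a / a.gcd n).Coprime ((n / a.gcd n).gcd (n / b.gcd n)) :=
    (Nat.coprime_div_gcd_div_gcd (hpos a)).coprime_dvd_right (Nat.gcd_dvd_left _ _)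
  have hb : (b / b.gcd n).Coprime ((n / a.gcd n).gcd (n / b.gcd n)) :=
    (Nat.coprime_div_gcd_div_gcd (hpos b)).coprime_dvd_right (Nat.gcd_dvd_right _ _)
  have hd : (n / a.gcd n).gcd (n / b.gcd n) ≠ 0 :=
    (Nat.gcd_pos_of_pos_left _ (Nat.div_pos (Nat.gcd_le_right _ (Nat.pos_of_ne_zero hn))
      (hpos a))).ne'
  obtain ⟨r, hr⟩ := exists_coprime_dvd_mul_add (a := a / a.gcd n) hd hb
  exact ⟨r, coprime_of_dvd_mul_add ha hr, hr⟩

theorem isTameCyclicQuotientSingularity_of_equiv {R : Type u} [CommRing R] [IsDomain R]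
    [IsDiscreteValuationRing R] [IsAdicComplete (maximalIdeal R) R] [IsAlgClosed (ResidueField R)]
    {π : R} (hπ : Irreducible π) {n : ℕ} [NeZero n] (hn : IsUnit (n : R))
    {Y : Scheme.{u}} {g : Y ⟶ Spec (CommRingCat.of (TameRing R π n))} {y : Y} {a b : ℕ} (ha : 0 < a)
    (h1 : 1 < n * (a.gcd b).gcd n / (a.gcd n * b.gcd n))
    (h : ∀ (r : ℕ)
      (hr : n * (a.gcd b).gcd n / (a.gcd n * b.gcd n) ∣ r * (b / b.gcd n) + a / a.gcd n),
      Nonempty (CompletedStalk g y ≃ₐ[TameRing R π n] rootInvariants (tameRoot R π n) hr)) :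
    IsTameCyclicQuotientSingularity g y := by
  have hn0 : n ≠ 0 := NeZero.ne n
  obtain ⟨ζ, hζ⟩ := exists_isPrimitiveRoot hn
  have hD := isDomain_tameRing hπ n
  obtain ⟨r, hrc, hr⟩ := exists_coprime_and_dvd (a := a) (b := b) hn0
  refine ⟨_, r, _, _, tameRoot R π n, hr, h1, ?_, hrc,
    Nat.div_pos (Nat.gcd_le_left _ ha) (Nat.gcd_pos_of_pos_left _ ha),
    (prime_tameRoot hπ n hζ hn).irreducible, h r hr⟩
  have hdvd : n * (a.gcd b).gcd n / (a.gcd n * b.gcd n) ∣ n := by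
    rw [← gcd_div_gcd_eq hn0]
    exact (Nat.gcd_dvd_left _ _).trans (Nat.div_dvd_of_dvd (Nat.gcd_dvd_right a n))
  have hu : IsUnit (n : TameRing R π n) := by
    simpa using hn.map (algebraMap R (TameRing R π n))
  exact isUnit_of_dvd_unit (Nat.cast_dvd_cast hdvd) hu

end TameBaseChange

theorem proposition2p5 {R : Type u} [CommRing R] [IsDomain R] [IsDiscreteValuationRing R]
    [IsAdicComplete (maximalIdeal R) R] [IsAlgClosed (ResidueField R)]
    (p : ℕ) [CharP (ResidueField R) p] (π : R) (hπ : Irreducible π)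
    (n : ℕ) [NeZero n] (hn : ¬ p ∣ n)
    {X : Scheme.{u}} (f : X ⟶ Spec (CommRingCat.of R)) (hf : TameBaseChange.IsSNCModel f)
    {X' : Scheme.{u}} (ν : X' ⟶ TameBaseChange.baseChange f π n)
    (hν : TameBaseChange.IsNormalization ν)
    (f' : X' ⟶ Spec (CommRingCat.of (TameBaseChange.TameRing R π n)))
    (hf' : f' = ν ≫ pullback.snd _ _)
    (x : X) (hx : IsClosed {x}) (hxs : f x = closedPoint R)
    (x' : X') (hx' : (ν ≫ pullback.fst _ _) x' = x) :
    -- two branches: local structure of `X` at `x`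
    (∀ a b : ℕ, TameBaseChange.IsCrossingPoint f x a b → (¬ p ∣ a ∨ ¬ p ∣ b) →
      0 < a ∧ 0 < b ∧ Nonempty (TameBaseChange.CompletedStalk f x ≃ₐ[R]
        TameBaseChange.PowerSeriesQuotient (TameBaseChange.crossing π a b))) ∧
    -- two branches: local structure of `X'` at `x'`
    (∀ a b : ℕ, 0 < a → 0 < b →
      Nonempty (TameBaseChange.CompletedStalk f x ≃ₐ[R]
        TameBaseChange.PowerSeriesQuotient (TameBaseChange.crossing π a b)) →
      ∀ a'' b'' n'' : ℕ, a'' = a / a.gcd n → b'' = b / b.gcd n →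
        n'' = (n * (a.gcd b).gcd n) / (a.gcd n * b.gcd n) →
        (∃ r : ℕ, r.Coprime n'' ∧ n'' ∣ r * b'' + a'') ∧
        (∀ (r : ℕ) (hr : n'' ∣ r * b'' + a''),
          Nonempty (TameBaseChange.CompletedStalk f' x' ≃ₐ[TameBaseChange.TameRing R π n]
            TameBaseChange.rootInvariants (TameBaseChange.tameRoot R π n) hr)) ∧
        (1 < n'' → TameBaseChange.IsTameCyclicQuotientSingularity f' x') ∧
        (n'' = 1 → IsRegularLocalRing (X'.presheaf.stalk x'))) ∧
    -- one branch: local structure of `X` at `x`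
    (∀ b : ℕ, TameBaseChange.IsOneBranchPoint f x b →
      0 < b ∧ ∃ c₀ : MvPowerSeries (Fin 2) R, IsUnit c₀ ∧
        Nonempty (TameBaseChange.CompletedStalk f x ≃ₐ[R]
          TameBaseChange.PowerSeriesQuotient (TameBaseChange.oneBranch π c₀ b))) ∧
    -- one branch: local structure of `X'` at `x'`
    (∀ (b : ℕ) (c₀ : MvPowerSeries (Fin 2) R), 0 < b → IsUnit c₀ →
      Nonempty (TameBaseChange.CompletedStalk f x ≃ₐ[R]
        TameBaseChange.PowerSeriesQuotient (TameBaseChange.oneBranch π c₀ b)) →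
      ∀ b' n' : ℕ, b' = b / b.gcd n → n' = n / b.gcd n →
        ∃ (c : MvPowerSeries (Fin 2) R)
          (c' : MvPowerSeries (Fin 2) (TameBaseChange.TameRing R π n)),
          IsUnit c ∧ c ^ n = c₀ ∧
          -- `c'` is the power series `c(s, t ^ n')`
          c' = MvPowerSeries.subst ![MvPowerSeries.X 0, MvPowerSeries.X 1 ^ n'] c ∧
          IsRegularLocalRing (TameBaseChange.PowerSeriesQuotient
            (TameBaseChange.oneBranch (TameBaseChange.tameRoot R π n) c' b')) ∧
          Nonempty (TameBaseChange.CompletedStalk f' x' ≃ₐ[TameBaseChange.TameRing R π n]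
            TameBaseChange.PowerSeriesQuotient
              (TameBaseChange.oneBranch (TameBaseChange.tameRoot R π n) c' b'))) := by
  have hnu := TameBaseChange.isUnit_natCast_of_not_dvd (R := R) p hn
  subst hf' hx'
  refine ⟨fun a b h hab => ?_, fun a b ha hb h a'' b'' n'' ea eb en => ?_, fun b h => ?_,
    fun b c₀ hb hc₀ h b' n' eb en => ?_⟩
  · exact TameBaseChange.completedStalk_equiv_of_isCrossingPoint hπ hf hx hxs p h hab
  · subst ea eb en
    obtain ⟨h1, h2⟩ := TameBaseChange.completedStalk_equiv_rootInvariants p hπ hn hf hν hxs ha hb h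
    exact ⟨TameBaseChange.exists_coprime_and_dvd (NeZero.ne n), h1,
      fun h3 => TameBaseChange.isTameCyclicQuotientSingularity_of_equiv hπ hnu ha h3 h1, h2⟩
  · exact TameBaseChange.completedStalk_equiv_of_isOneBranchPoint hπ hf hx hxs h
  · subst eb en
    exact TameBaseChange.completedStalk_equiv_oneBranch p hπ hn hf hν hxs hc₀ hb h
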